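/- **Terminology.** Fix $k\ge 0$ constant symbols $c_1,\dots,c_k$. A *tree straight-line program* (TSLP) over the binary symbols $+,\cdot$ and the rank-$0$ symbols $0,1,c_1,\dots,c_k,y_0,y_1,\dots$ consists of finitely many nonterminals, each with a rank, a start nonterminal of rank $0$, and for every nonterminal $A$ of rank $r$ exactly one rule $A(x_1,\dots,x_r)\to t$, where $t$ is a finite ordered tree over these symbols, the nonterminals, and the parameters $x_1,\dots,x_r$, in which each $x_i$ occurs exactly once and $x_1,\dots,x_r$ occur in this order from left to right; the relation "$B$ occurs in the right-hand side of $A$" is required to be acyclic. Using its rules as rewrite rules, a TSLP produces a unique tree without nonterminals and parameters, that is, an arithmetical formula. An *arithmetical circuit* is a finite directed acyclic graph with an output node, whose inner nodes are labelled with $+$ or $\cdot$ (and have two ordered inputs) and whose leaves are labelled with $0,1,c_1,\dots,c_k$ or variables $y_i$. If the symbols $c_j$ are interpreted by fixed elements of a semiring $S$ (with $0$ and $1$, not necessarily commutative), the formula produced by a TSLP, and likewise a circuit, computes a noncommutative polynomial over $S$ (an element of $S\langle y_0,y_1,\dots\rangle$, where coefficients commute with the variables), and for commutative $S$ also an ordinary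 polynomial in $S[y_0,y_1,\dots]$. *Polynomial identity testing* (PIT) is the problem whether the polynomial computed by a given circuit is the zero polynomial. **Theorem.** Let $k\ge 0$. 1. For every semiring $S$ and all fixed $c_1,\dots,c_k\in S$, the question whether the noncommutative polynomial computed by a given TSLP is zero is equivalent, with respect to polynomial time many-one reductions, to PIT for circuits (with noncommutative polynomials over $S$ and the same constants). 2. For every commutative semiring $S$ and all fixed $c_1,\dots,c_k\in S$, the same holds for ordinary (commutative) polynomials. 3. If $S=\mathbb Z$, or $S=\mathbb Z_n=\mathbb Z/n\mathbb Z$ with a fixed $n\ge 2$, and $c_1,\dots,c_k\in S$ are fixed, then the question whether the (commutative) polynomial computed by a given TSLP is the zero polynomial belongs to $\mathbf{coRP}$: there is a randomized polynomial time algorithm that accepts with probability $1$ if the polynomial is zero, and accepts with probability at most $1/2$ otherwise. -/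

import Mathlib

/-! ### Random access machines with logarithmic cost

Machine model: while-programs over a random access memory of natural numbers, with the
operations `+`, `-` (truncated), `*`, `/` (integer division) and indirect addressing. Every
value that is produced during the computation (contents of cells as well as addresses) is charged
with its bit length (logarithmic cost criterion), so that polynomial time on this machine is the
usual polynomial time. -/

namespace RAM

/-- The memory: finitely many arrays are used by a program (their names occur in its text);
`M a i` is the content of cell `i` of the array with name `a`. -/
abbrev Mem : Type := ℕ → ℕ → ℕ

/-- Overwrite cell `i` of array `a` with `v`. -/
def Mem.write (M : Mem) (a i v : ℕ) : Mem :=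
  Function.update M a (Function.update (M a) i v)

/-- Arithmetical expressions; `get a e` reads the cell of array `a` whose address is the value
of `e`. -/
inductive Expr : Type
  | lit (n : ℕ)
  | get (a : ℕ) (e : Expr)
  | add (e₁ e₂ : Expr)
  | sub (e₁ e₂ : Expr)
  | mul (e₁ e₂ : Expr)
  | div (e₁ e₂ : Expr)

/-- The value of an expression. -/
def Expr.eval (M : Mem) : Expr → ℕ
  | lit n => n
  | get a e => M a (e.eval M)
  | add e₁ e₂ => e₁.eval M + e₂.eval M
  | sub e₁ e₂ => e₁.eval M - e₂.eval M
  | mul e₁ e₂ => e₁.eval M * e₂.eval M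
  | div e₁ e₂ => e₁.eval M / e₂.eval M

/-- The logarithmic cost of evaluating an expression: every node of the expression is charged
with one plus the bit length of its value. -/
def Expr.cost (M : Mem) : Expr → ℕ
  | lit n => 1 + Nat.size n
  | get a e => e.cost M + (1 + Nat.size ((get a e).eval M))
  | add e₁ e₂ => e₁.cost M + e₂.cost M + (1 + Nat.size ((add e₁ e₂).eval M))
  | sub e₁ e₂ => e₁.cost M + e₂.cost M + (1 + Nat.size ((sub e₁ e₂).eval M))
  | mul e₁ e₂ => e₁.cost M + e₂.cost M + (1 + Nat.size ((mul e₁ e₂).eval M))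
  | div e₁ e₂ => e₁.cost M + e₂.cost M + (1 + Nat.size ((div e₁ e₂).eval M))

/-- Programs. `set a i e` stores the value of `e` in cell `i` of array `a`; a test succeeds
if its value is not `0`. -/
inductive Prog : Type
  | skip
  | set (a : ℕ) (i e : Expr)
  | seq (p q : Prog)
  | ite (e : Expr) (p q : Prog)
  | loop (e : Expr) (p : Prog)

/-- `Exec p M t M'`: started with memory `M`, the program `p` halts after time `t` with
memory `M'`. -/
inductive Exec : Prog → Mem → ℕ → Mem → Prop
  | skip (M : Mem) : Exec .skip M 1 M
  | set (a : ℕ) (i e : Expr) (M : Mem) :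
      Exec (.set a i e) M (1 + i.cost M + e.cost M) (M.write a (i.eval M) (e.eval M))
  | seq {p q : Prog} {M M' M'' : Mem} {t t' : ℕ} :
      Exec p M t M' → Exec q M' t' M'' → Exec (.seq p q) M (t + t') M''
  | iteTrue {e : Expr} {p q : Prog} {M M' : Mem} {t : ℕ} :
      e.eval M ≠ 0 → Exec p M t M' → Exec (.ite e p q) M (e.cost M + t) M'
  | iteFalse {e : Expr} {p q : Prog} {M M' : Mem} {t : ℕ} :
      e.eval M = 0 → Exec q M t M' → Exec (.ite e p q) M (e.cost M + t) M'
  | loopDone {e : Expr} {p : Prog} {M : Mem} :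
      e.eval M = 0 → Exec (.loop e p) M (e.cost M) M
  | loopStep {e : Expr} {p : Prog} {M M' M'' : Mem} {t t' : ℕ} :
      e.eval M ≠ 0 → Exec p M t M' → Exec (.loop e p) M' t' M'' →
      Exec (.loop e p) M (e.cost M + t + t') M''

/-- The array that stores the list `x`: its length, followed by its entries. -/
def ofList (x : List ℕ) : ℕ → ℕ
  | 0 => x.length
  | i + 1 => x.getD i 0

/-- The list that is stored in an array. -/
def toList (b : ℕ → ℕ) : List ℕ :=
  (List.range (b 0)).map fun i => b (i + 1)

/-- The initial memory: array `0` holds the input, array `1` an auxiliary input (the random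
bits), and all other cells contain `0`. -/
def init (x r : List ℕ) : Mem
  | 0 => ofList x
  | 1 => ofList r
  | _ + 2 => fun _ => 0

/-- The number of bits of a list of numbers (with one extra symbol per entry as a separator). -/
def bitSize (x : List ℕ) : ℕ := (x.map fun n => Nat.size n + 1).sum

/-- A decision problem: a set of instances, their codes, and the set of positive instances.
Input sizes are bit sizes of codes. -/
structure DecisionProblem where
  Inst : Type
  code : Inst → List ℕ
  Yes : Inst → Prop

/-- The function `f` can be computed in polynomial time with respect to the codes of arguments
and values. The output is found in array `2`. The time bound also covers printing the output. -/
def PolyTime {α β : Type} (codeα : α → List ℕ) (codeβ : β → List ℕ) (f : α → β) : Prop :=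
  ∃ (p : Prog) (q : Polynomial ℕ), ∀ a : α, ∃ (t : ℕ) (M : Mem),
    Exec p (init (codeα a) []) t M ∧ toList (M 2) = codeβ (f a) ∧
      t + bitSize (codeβ (f a)) ≤ q.eval (bitSize (codeα a))

/-- Polynomial time many-one reducibility. -/
def DecisionProblem.Reduces (P Q : DecisionProblem) : Prop :=
  ∃ f : P.Inst → Q.Inst, PolyTime P.code Q.code f ∧ ∀ a, P.Yes a ↔ Q.Yes (f a)

/-- Equivalence with respect to polynomial time many-one reductions. -/
def DecisionProblem.Equivalent (P Q : DecisionProblem) : Prop :=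
  P.Reduces Q ∧ Q.Reduces P

/-- The list of numbers in `{0, 1}` that is given by a vector of random bits. -/
def bits {m : ℕ} (r : Fin m → Bool) : List ℕ := List.ofFn fun i => (r i).toNat

/-- The program halts with answer `1` on input `x` with random bits `r`. -/
def Accepts (p : Prog) (x : List ℕ) {m : ℕ} (r : Fin m → Bool) : Prop :=
  ∃ (t : ℕ) (M : Mem), Exec p (init x (bits r)) t M ∧ M 2 0 = 1

/-- The class coRP: there is a program that, given an instance and a uniformly random bit string
of polynomial length, always halts in polynomial time, accepts every positive instance with
probability one, and accepts every negative instance with probability at most one half. -/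
def DecisionProblem.InCoRP (P : DecisionProblem) : Prop :=
  ∃ (p : Prog) (q l : Polynomial ℕ), ∀ a : P.Inst,
    (∀ r : Fin (l.eval (bitSize (P.code a))) → Bool, ∃ (t : ℕ) (M : Mem),
      Exec p (init (P.code a) (bits r)) t M ∧ t ≤ q.eval (bitSize (P.code a))) ∧
    (P.Yes a → ∀ r : Fin (l.eval (bitSize (P.code a))) → Bool, Accepts p (P.code a) r) ∧
    (¬ P.Yes a →
      2 * Nat.card {r : Fin (l.eval (bitSize (P.code a))) → Bool // Accepts p (P.code a) r} ≤
        2 ^ l.eval (bitSize (P.code a)))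

end RAM

/-! ### Formulas, circuits and tree straight-line programs -/

namespace Arith

/-- The terminals of rank `0`: the constants `0` and `1`, symbols for `k` further constants of
the semiring (`k = 0` is allowed), and the variables `y₀, y₁, …`. -/
inductive Leaf (k : ℕ) : Type
  | zero
  | one
  | const (j : Fin k)
  | var (v : ℕ)

/-- The terminals of rank `2`. -/
inductive Op : Type
  | add
  | mul

/-- The value of a leaf under an interpretation of the constant symbols and the variables. -/
def Leaf.eval {R : Type*} [Semiring R] {k : ℕ} (κ : Fin k → R) (χ : ℕ → R) : Leaf k → R
  | zero => 0
  | one => 1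
  | const j => κ j
  | var v => χ v

/-- The semiring operation denoted by a terminal of rank `2`. -/
def Op.eval {R : Type*} [Semiring R] : Op → R → R → R
  | add, a, b => a + b
  | mul, a, b => a * b

/-- Trees over the terminals and the parameters `x₀, x₁, …`. Trees without parameters are the
arithmetical formulas. -/
inductive Formula (k : ℕ) : Type
  | param (i : ℕ)
  | leaf (a : Leaf k)
  | op (f : Op) (s t : Formula k)

/-- Simultaneous replacement of all parameters by trees. -/
def Formula.subst {k : ℕ} (u : ℕ → Formula k) : Formula k → Formula k
  | param i => u i
  | leaf a => leaf a
  | op f s t => op f (s.subst u) (t.subst u)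

/-- The value of a tree under an interpretation of constant symbols, variables and parameters. -/
def Formula.eval {R : Type*} [Semiring R] {k : ℕ} (κ : Fin k → R) (χ ξ : ℕ → R) :
    Formula k → R
  | param i => ξ i
  | leaf a => a.eval κ χ
  | op f s t => f.eval (s.eval κ χ ξ) (t.eval κ χ ξ)

/-- Trees over the terminals, the parameters, and nonterminals `A : N` of rank `rk A`. -/
inductive Tree (k : ℕ) {N : Type} (rk : N → ℕ) : Type
  | param (i : ℕ)
  | leaf (a : Leaf k)
  | op (f : Op) (s t : Tree k rk)
  | nt (A : N) (args : Fin (rk A) → Tree k rk)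

namespace Tree

variable {k : ℕ} {N : Type} {rk : N → ℕ}

/-- The parameters of a tree, listed from left to right. -/
def params : Tree k rk → List ℕ
  | param i => [i]
  | leaf _ => []
  | op _ s t => s.params ++ t.params
  | nt _ args => (List.ofFn fun i => (args i).params).flatten

/-- The nonterminals that occur in a tree. -/
def nonterminals : Tree k rk → Set N
  | param _ => ∅
  | leaf _ => ∅
  | op _ s t => s.nonterminals ∪ t.nonterminals
  | nt A args => {A} ∪ ⋃ i, (args i).nonterminals

/-- Replace every nonterminal `A` by the tree `v A`, whose parameters `x₀, …` are replaced by
the (expanded) arguments of `A`. -/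
def expand (v : N → Formula k) : Tree k rk → Formula k
  | param i => .param i
  | leaf a => .leaf a
  | op f s t => .op f (s.expand v) (t.expand v)
  | nt A args =>
      (v A).subst fun j => if h : j < rk A then (args ⟨j, h⟩).expand v else .param j

end Tree

/-- Codes of leaves. -/
def Leaf.code {k : ℕ} : Leaf k → List ℕ
  | zero => [1]
  | one => [2]
  | const j => [3, j]
  | var v => [4, v]

/-- Codes of operations. -/
def Op.code : Op → List ℕ
  | add => [5]
  | mul => [6]

/-- Codes of trees (prefix notation). -/
def Tree.code {k n : ℕ} {rk : Fin n → ℕ} : Tree k rk → List ℕ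
  | param i => [0, i]
  | leaf a => a.code
  | op f s t => f.code ++ s.code ++ t.code
  | nt A args => [7, (A : ℕ)] ++ (List.ofFn fun i => (args i).code).flatten

/-- Tree straight-line programs over the terminals `+`, `·` (rank `2`) and constants and
variables (rank `0`). The nonterminals are numbered; for each of them there is exactly one rule
`A(x₀, …, x_{rk A - 1}) → rhs A`. -/
structure TSLP (k : ℕ) where
  /-- the number of nonterminals -/
  n : ℕ
  /-- the ranks of the nonterminals -/
  rk : Fin n → ℕ
  /-- the start nonterminal -/
  start : Fin n
  /-- the right-hand sides of the rules -/
  rhs : Fin n → Tree k rk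
  rk_start : rk start = 0
  /-- The right-hand side of `A` is a valid pattern of rank `rk A`: each of the parameters
  `x₀, …, x_{rk A - 1}` occurs exactly once, in this order, and no other parameter occurs. -/
  valid : ∀ A, (rhs A).params = List.range (rk A)
  /-- The relation "`B` occurs in the right-hand side of `A`" is acyclic (for a relation on a
  finite set, this is the same as well-foundedness). -/
  acyclic : WellFounded fun B A => B ∈ (rhs A).nonterminals

namespace TSLP

variable {k : ℕ}

open Classical in
/-- The tree `val A` derived from the nonterminal `A`, by recursion along the acyclic relation:
all nonterminals `B` in the right-hand side of `A` are replaced by `val B`. (The value in the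
`else` branch is irrelevant, since `expand` uses only nonterminals of the right-hand side.) -/
noncomputable def val (G : TSLP k) : Fin G.n → Formula k :=
  G.acyclic.fix fun A ih =>
    (G.rhs A).expand fun B =>
      if h : B ∈ (G.rhs A).nonterminals then ih B h else .leaf .zero

/-- The value of the formula `val start` under an interpretation of constant symbols and
variables. (No parameters occur in this formula, their interpretation as `0` is irrelevant.) -/
noncomputable def eval {R : Type*} [Semiring R] (κ : Fin k → R) (χ : ℕ → R) (G : TSLP k) : R :=
  (G.val G.start).eval κ χ fun _ => 0

/-- The code of a tree straight-line program: the number of nonterminals, the start nonterminal,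
the ranks, and the right-hand sides. -/
def code (G : TSLP k) : List ℕ :=
  [G.n, (G.start : ℕ)] ++ List.ofFn G.rk ++ (List.ofFn fun A => (G.rhs A).code).flatten

end TSLP

/-- The gates of a circuit with `n` gates. -/
inductive Gate (k n : ℕ) : Type
  | leaf (a : Leaf k)
  | op (f : Op) (i j : Fin n)

/-- The inputs of a gate. -/
def Gate.inputs {k n : ℕ} : Gate k n → Set (Fin n)
  | leaf _ => ∅
  | op _ i j => {i, j}

/-- Codes of gates. -/
def Gate.code {k n : ℕ} : Gate k n → List ℕ
  | leaf a => a.code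
  | op f i j => f.code ++ [(i : ℕ), (j : ℕ)]

/-- Arithmetical circuits: node-labelled directed acyclic graphs. -/
structure Circuit (k : ℕ) where
  /-- the number of gates -/
  n : ℕ
  gate : Fin n → Gate k n
  /-- the output gate -/
  out : Fin n
  /-- The graph is acyclic (for a finite graph, this is the same as well-foundedness). -/
  acyclic : WellFounded fun j i => j ∈ (gate i).inputs

namespace Circuit

variable {k : ℕ}

/-- The value of one gate, given the values of its inputs. -/
def evalGate {R : Type*} [Semiring R] (κ : Fin k → R) (χ : ℕ → R) {n : ℕ} (g : Gate k n)
    (v : (j : Fin n) → j ∈ g.inputs → R) : R :=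
  match g, v with
  | .leaf a, _ => a.eval κ χ
  | .op f i j, v => f.eval (v i (Or.inl rfl)) (v j (Or.inr rfl))

/-- The values of the gates. -/
noncomputable def val {R : Type*} [Semiring R] (κ : Fin k → R) (χ : ℕ → R) (C : Circuit k) :
    Fin C.n → R :=
  C.acyclic.fix fun i ih => evalGate κ χ (C.gate i) ih

/-- The value of the output gate. -/
noncomputable def eval {R : Type*} [Semiring R] (κ : Fin k → R) (χ : ℕ → R) (C : Circuit k) : R :=
  C.val κ χ C.out

/-- The code of a circuit: the number of gates, the output gate, and the list of gates. -/
def code (C : Circuit k) : List ℕ :=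
  [C.n, (C.out : ℕ)] ++ (List.ofFn fun i => (C.gate i).code).flatten

end Circuit

/-! ### The polynomials computed by circuits and tree straight-line programs, and zero testing

`c` assigns elements of the semiring to the constant symbols. Noncommutative polynomials over a
semiring `S` are elements of the monoid semiring over `S` of the free monoid of words over the
variables. -/

/-- The noncommutative polynomial computed by a circuit. -/
noncomputable def Circuit.ncPoly {S : Type*} [Semiring S] {k : ℕ} (c : Fin k → S)
    (C : Circuit k) : MonoidAlgebra S (FreeMonoid ℕ) :=
  C.eval (fun j => MonoidAlgebra.single 1 (c j)) fun v => MonoidAlgebra.single (FreeMonoid.of v) 1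

/-- The noncommutative polynomial computed by a tree straight-line program. -/
noncomputable def TSLP.ncPoly {S : Type*} [Semiring S] {k : ℕ} (c : Fin k → S)
    (G : TSLP k) : MonoidAlgebra S (FreeMonoid ℕ) :=
  G.eval (fun j => MonoidAlgebra.single 1 (c j)) fun v => MonoidAlgebra.single (FreeMonoid.of v) 1

/-- The (commutative) polynomial computed by a circuit. -/
noncomputable def Circuit.poly {S : Type*} [CommSemiring S] {k : ℕ} (c : Fin k → S)
    (C : Circuit k) : MvPolynomial ℕ S :=
  C.eval (fun j => MvPolynomial.C (c j)) MvPolynomial.X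

/-- The (commutative) polynomial computed by a tree straight-line program. -/
noncomputable def TSLP.poly {S : Type*} [CommSemiring S] {k : ℕ} (c : Fin k → S)
    (G : TSLP k) : MvPolynomial ℕ S :=
  G.eval (fun j => MvPolynomial.C (c j)) MvPolynomial.X

/-- Polynomial identity testing for circuits, noncommutative polynomials. -/
def ncPIT {S : Type*} [Semiring S] {k : ℕ} (c : Fin k → S) : RAM.DecisionProblem where
  Inst := Circuit k
  code := Circuit.code
  Yes C := C.ncPoly c = 0

/-- Zero testing for tree straight-line programs, noncommutative polynomials. -/
def ncZeroTSLP {S : Type*} [Semiring S] {k : ℕ} (c : Fin k → S) : RAM.DecisionProblem where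
  Inst := TSLP k
  code := TSLP.code
  Yes G := G.ncPoly c = 0

/-- Polynomial identity testing for circuits. -/
def PIT {S : Type*} [CommSemiring S] {k : ℕ} (c : Fin k → S) : RAM.DecisionProblem where
  Inst := Circuit k
  code := Circuit.code
  Yes C := C.poly c = 0

/-- Zero testing for tree straight-line programs. -/
def zeroTSLP {S : Type*} [CommSemiring S] {k : ℕ} (c : Fin k → S) : RAM.DecisionProblem where
  Inst := TSLP k
  code := TSLP.code
  Yes G := G.poly c = 0

end Arith

/-! ### A loop language with automatic polynomial time bounds -/

/-! From circuits to tree straight-line programs there is little to do: every gate becomes a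
nonterminal of rank 0.

For the converse, consider a nonterminal of rank r. Its tree, read in a semiring, is a function of r
arguments in which every argument occurs once. Collapse all subtrees without parameters to elements
of the semiring. Adding an element, or multiplying by one from either side, is a map x ↦ a·x·b + c,
and such maps are closed under composition by distributivity alone, without commutativity of the
product. What remains is a binary tree whose leaves are the r parameters, with one affine map on
every edge. In postfix form this is a list of O(r) stack instructions, a skeleton, whose
coefficients are gates of a growing circuit. A right-hand side is translated by executing the
skeletons of its symbols on a stack with two kinds of entries: gates, and symbolic values that
depend on parameters (`Sem`, `Conf.run_string`, `reads`). Since parameters occur in their natural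
order, a skeleton can take its arguments from a queue. An affine map that hits a symbolic value is
merged into the last emitted instruction, which keeps skeletons short. The start nonterminal has
rank 0, so its skeleton is a single gate, the output of the circuit. Topological sorting is avoided:
all nonterminals receive a default skeleton of the right rank, and all rules are translated again
and again; after l rounds all nonterminals of height less than l are correct (`Level`,
`run_tslpToCircuit`). One program serves all semirings.

For the randomized test, let the circuit have n gates, hence degree at most 2^n and possibly doubly
exponential coefficients. It is evaluated in the group ring of a cyclic group of order r = q^j over
ℤ/μ, where μ = n' for the semiring ℤ/n'ℤ and μ is random for ℤ. A variable receives the value ∑ s_l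
ξ^l for l < L = n + 2, with random bits s_l and the generator ξ of the group. A zero polynomial
always evaluates to zero. Otherwise write the integer polynomial as d·P₀ with P₀ primitive, and let
p ≠ q be a prime. Sending ξ to a primitive r-th root of unity ζ in the algebraic closure of the
field with p elements makes the 2^L random values pairwise distinct: lifting the exponent shows that
ζ has degree at least L over the prime field if r ≥ p^(q-1)·L (`injective_sum_pow`). By
Schwartz–Zippel, P₀ vanishes there with probability at most 2^n / 2^L = 1/4. For ℤ/n'ℤ a suitable p
divides n', which settles this case. For ℤ the choice p = 2 shows that the value in the integral
group ring is nonzero with probability at least 3/4. A nonzero coefficient of it has less than 2^E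
bits for some E of polynomial size up to relabelling, that is, its bit length is at most
exponential, and μ is a product of random numbers up to 2^ℓ; the bound lcm(1, …, M) ≥ 2^M / (M + 1)
yields so many nondivisors that μ divides the coefficient with probability at most 1/4
(`card_modulus_dvd_le`).

Running times come from a loop language in which every loop makes the same number N of rounds, N
being polynomial in the input length, and in which one assignment lengthens numbers by a constant
number of bits only. Every such program takes polynomial time (`exec_compile`), so that only
correctness is left to be proved about the concrete programs. -/

theorem Polynomial.eval_nat_mono (p : Polynomial ℕ) : Monotone fun x => p.eval x := by
  intro a b h
  induction p using Polynomial.induction_on' with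
  | add p q hp hq => simpa using Nat.add_le_add hp hq
  | monomial n c => simpa using Nat.mul_le_mul_left c (Nat.pow_le_pow_left h n)

open Polynomial (X)

namespace RAM

/-- Expressions of linear growth. `mulmod e₁ e₂ m` is the remainder of `e₁ * e₂` modulo `m + 1`. -/
inductive Ex : Type
  | lit (n : ℕ)
  | get (a : ℕ) (e : Ex)
  | add (e₁ e₂ : Ex)
  | sub (e₁ e₂ : Ex)
  | mulmod (e₁ e₂ m : Ex)

namespace Ex

def toExpr : Ex → Expr
  | lit n => .lit n
  | get a e => .get a e.toExpr
  | add e₁ e₂ => .add e₁.toExpr e₂.toExpr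
  | sub e₁ e₂ => .sub e₁.toExpr e₂.toExpr
  | mulmod e₁ e₂ m =>
      .sub (.mul e₁.toExpr e₂.toExpr)
        (.mul (.div (.mul e₁.toExpr e₂.toExpr) (.add m.toExpr (.lit 1)))
          (.add m.toExpr (.lit 1)))

@[simp] def eval (M : Mem) : Ex → ℕ
  | lit n => n
  | get a e => M a (e.eval M)
  | add e₁ e₂ => e₁.eval M + e₂.eval M
  | sub e₁ e₂ => e₁.eval M - e₂.eval M
  | mulmod e₁ e₂ m => (e₁.eval M * e₂.eval M) % (m.eval M + 1)

/-- The expression does not read the array with name `a`. -/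
@[simp] def Avoids (x : ℕ) : Ex → Bool
  | lit _ => true
  | get a e => a != x && e.Avoids x
  | add e₁ e₂ => e₁.Avoids x && e₂.Avoids x
  | sub e₁ e₂ => e₁.Avoids x && e₂.Avoids x
  | mulmod e₁ e₂ m => e₁.Avoids x && e₂.Avoids x && m.Avoids x

theorem eval_toExpr (M : Mem) (e : Ex) : e.toExpr.eval M = e.eval M := by
  induction e with
  | lit n => rfl
  | get a e ih => simp [toExpr, Expr.eval, ih]
  | add e₁ e₂ h₁ h₂ => simp [toExpr, Expr.eval, h₁, h₂]
  | sub e₁ e₂ h₁ h₂ => simp [toExpr, Expr.eval, h₁, h₂]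
  | mulmod e₁ e₂ m h₁ h₂ hm =>
    simp only [toExpr, Expr.eval, h₁, h₂, hm, eval]
    rw [mul_comm (_ / _), Nat.mod_eq_sub]

end Ex

/-- Two memories that differ in the loop counters only. -/
def Agree (M M' : Mem) : Prop := ∀ a, a ≠ 4 → M a = M' a

theorem Ex.eval_congr {M M' : Mem} (h : Agree M M') (e : Ex) (he : e.Avoids 4) :
    e.eval M = e.eval M' := by
  induction e with
  | lit n => rfl
  | get a e ih =>
    simp only [Avoids, Bool.and_eq_true, bne_iff_ne] at he
    simp [ih he.2, h a he.1]
  | add e₁ e₂ h₁ h₂ => simp at he; simp [h₁ he.1, h₂ he.2]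
  | sub e₁ e₂ h₁ h₂ => simp at he; simp [h₁ he.1, h₂ he.2]
  | mulmod e₁ e₂ m h₁ h₂ hm => simp at he; simp [h₁ he.1.1, h₂ he.1.2, hm he.2]

/-- All cells contain numbers with at most `b` bits. -/
def Mem.Bounded (M : Mem) (b : ℕ) : Prop := ∀ a i, M a i < 2 ^ b

theorem Mem.Bounded.mono {M : Mem} {b b' : ℕ} (h : M.Bounded b) (hb : b ≤ b') : M.Bounded b' :=
  fun a i => (h a i).trans_le (Nat.pow_le_pow_right two_pos hb)

theorem Mem.Bounded.write {M : Mem} {b : ℕ} (h : M.Bounded b) (a i v : ℕ) (hv : v < 2 ^ b) :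
    (M.write a i v).Bounded b := by
  intro a' i'
  unfold Mem.write
  by_cases h1 : a' = a
  · subst h1
    by_cases h2 : i' = i
    · subst h2; simpa using hv
    · simpa [h2] using h a' i'
  · simpa [h1] using h a' i'

/-- The growth is additive in the number of bits: a sum has one carry bit, and a remainder is
smaller than its modulus. An unrestricted product would double the bit length, and repeated squaring
in a loop would make it exponential; this is why the language multiplies only modulo another
expression. -/
theorem Ex.eval_lt (e : Ex) : ∃ C : ℕ, ∀ (M : Mem) (b : ℕ), M.Bounded b → e.eval M < 2 ^ (b + C) := by
  induction e with
  | lit n =>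
    refine ⟨n, fun M b _ => ?_⟩
    exact lt_of_lt_of_le (Nat.lt_two_pow_self (n := n)) (Nat.pow_le_pow_right two_pos (by omega))
  | get a e _ => exact ⟨0, fun M b h => h _ _⟩
  | add e₁ e₂ h₁ h₂ =>
    obtain ⟨C₁, h₁⟩ := h₁
    obtain ⟨C₂, h₂⟩ := h₂
    refine ⟨C₁ + C₂ + 1, fun M b h => ?_⟩
    have a1 := lt_of_lt_of_le (h₁ M b h)
      (Nat.pow_le_pow_right two_pos (show b + C₁ ≤ b + C₁ + C₂ by omega))
    have a2 := lt_of_lt_of_le (h₂ M b h)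
      (Nat.pow_le_pow_right two_pos (show b + C₂ ≤ b + C₁ + C₂ by omega))
    have : 2 ^ (b + (C₁ + C₂ + 1)) = 2 * 2 ^ (b + C₁ + C₂) := by ring
    simp only [eval]
    omega
  | sub e₁ e₂ h₁ h₂ =>
    obtain ⟨C₁, h₁⟩ := h₁
    exact ⟨C₁, fun M b h => lt_of_le_of_lt (Nat.sub_le _ _) (h₁ M b h)⟩
  | mulmod e₁ e₂ m _ _ hm =>
    obtain ⟨C, hm⟩ := hm
    refine ⟨C, fun M b h => lt_of_lt_of_le (Nat.mod_lt _ (Nat.succ_pos _)) (hm M b h)⟩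

/-- The compiled form of `mulmod` contains full products as intermediate values, but these have
about 2b bits, so the cost remains linear in b. -/
theorem Ex.cost_le (e : Ex) :
    ∃ C : ℕ, ∀ (M : Mem) (b : ℕ), M.Bounded b → e.toExpr.cost M ≤ C * (b + 1) := by
  have key : ∀ {v b C : ℕ}, v < 2 ^ (b + C) → 1 + Nat.size v ≤ (C + 1) * (b + 1) := by
    intro v b C h
    have := Nat.size_le.2 h
    nlinarith
  induction e with
  | lit n =>
    refine ⟨1 + Nat.size n, fun M b _ => ?_⟩
    simp only [toExpr, Expr.cost]
    nlinarith
  | get a e ih =>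
    obtain ⟨C, hC⟩ := ih
    obtain ⟨D, hD⟩ := (Ex.get a e).eval_lt
    refine ⟨C + (D + 1), fun M b h => ?_⟩
    have h1 := hC M b h
    have h2 := key (hD M b h)
    rw [← eval_toExpr] at h2
    simp only [toExpr, Expr.cost] at h2 ⊢
    linarith
  | add e₁ e₂ h₁ h₂ =>
    obtain ⟨C₁, h₁⟩ := h₁
    obtain ⟨C₂, h₂⟩ := h₂
    obtain ⟨D, hD⟩ := (Ex.add e₁ e₂).eval_lt
    refine ⟨C₁ + C₂ + (D + 1), fun M b h => ?_⟩
    have a1 := h₁ M b h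
    have a2 := h₂ M b h
    have h2 := key (hD M b h)
    rw [← eval_toExpr] at h2
    simp only [toExpr, Expr.cost] at h2 ⊢
    linarith
  | sub e₁ e₂ h₁ h₂ =>
    obtain ⟨C₁, h₁⟩ := h₁
    obtain ⟨C₂, h₂⟩ := h₂
    obtain ⟨D, hD⟩ := (Ex.sub e₁ e₂).eval_lt
    refine ⟨C₁ + C₂ + (D + 1), fun M b h => ?_⟩
    have a1 := h₁ M b h
    have a2 := h₂ M b h
    have h2 := key (hD M b h)
    rw [← eval_toExpr] at h2
    simp only [toExpr, Expr.cost] at h2 ⊢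
    linarith
  | mulmod e₁ e₂ m h₁ h₂ hm =>
    obtain ⟨C₁, h₁⟩ := h₁
    obtain ⟨C₂, h₂⟩ := h₂
    obtain ⟨C, hm⟩ := hm
    obtain ⟨D₁, d₁⟩ := e₁.eval_lt
    obtain ⟨D₂, d₂⟩ := e₂.eval_lt
    obtain ⟨D, dm⟩ := (Ex.add m (.lit 1)).eval_lt
    refine ⟨2 * (C₁ + C₂) + 2 * C + (1 + Nat.size 1) * 2 + 3 * (D₁ + D₂ + 2) + 2 * (D + 1) +
      2 * (D₁ + D₂ + 2), fun M b h => ?_⟩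
    have a1 := h₁ M b h
    have a2 := h₂ M b h
    have a3 := hm M b h
    have hp : e₁.eval M * e₂.eval M < 2 ^ (b + (b + D₁ + D₂)) := by
      have := Nat.mul_lt_mul'' (d₁ M b h) (d₂ M b h)
      rw [← pow_add] at this
      convert this using 2
      ring
    have hs : ∀ v, v ≤ e₁.eval M * e₂.eval M → 1 + Nat.size v ≤ (D₁ + D₂ + 2) * (b + 1) := by
      intro v hv
      have := Nat.size_le.2 (lt_of_le_of_lt hv hp)
      nlinarith
    have b1 := hs _ le_rfl
    have b2 := hs (e₁.eval M * e₂.eval M / (m.eval M + 1)) (Nat.div_le_self _ _)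
    have b3 := hs (e₁.eval M * e₂.eval M / (m.eval M + 1) * (m.eval M + 1))
      (Nat.div_mul_le_self _ _)
    have b4 := hs (e₁.eval M * e₂.eval M -
      e₁.eval M * e₂.eval M / (m.eval M + 1) * (m.eval M + 1)) (Nat.sub_le _ _)
    have b5 := key (dm M b h)
    simp only [eval] at b5
    simp only [toExpr, Expr.cost, Expr.eval, eval_toExpr]
    have b6 : 1 + Nat.size 1 ≤ (1 + Nat.size 1) * (b + 1) := Nat.le_mul_of_pos_right _ (by omega)
    have e1 : (2 * (C₁ + C₂) + 2 * C + (1 + Nat.size 1) * 2 + 3 * (D₁ + D₂ + 2) + 2 * (D + 1) +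
      2 * (D₁ + D₂ + 2)) * (b + 1) = 2 * (C₁ * (b + 1)) + 2 * (C₂ * (b + 1)) + 2 * (C * (b + 1)) +
      2 * ((1 + Nat.size 1) * (b + 1)) + 5 * ((D₁ + D₂ + 2) * (b + 1)) +
      2 * ((D + 1) * (b + 1)) := by ring
    rw [e1]
    omega

/-- Loop programs. `rep p` repeats `p` as often as cell `0` of array `3` says. -/
inductive Cmd : Type
  | skip
  | set (a : ℕ) (i e : Ex)
  | seq (p q : Cmd)
  | ite (e : Ex) (p q : Cmd)
  | rep (p : Cmd)

namespace Cmd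

/-- The effect of a program on the memory. -/
def run : Cmd → Mem → Mem
  | skip, M => M
  | set a i e, M => M.write a (i.eval M) (e.eval M)
  | seq p q, M => q.run (p.run M)
  | ite e p q, M => if e.eval M = 0 then q.run M else p.run M
  | rep p, M => p.run^[M 3 0] M

/-- The array with name `x` is not overwritten. -/
def Keeps (x : ℕ) : Cmd → Bool
  | skip => true
  | set a _ _ => a != x
  | seq p q => p.Keeps x && q.Keeps x
  | ite _ p q => p.Keeps x && q.Keeps x
  | rep p => p.Keeps x

/-- Loop counters are not used. -/
def WF : Cmd → Bool
  | skip => true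
  | set a i e => a != 3 && a != 4 && i.Avoids 4 && e.Avoids 4
  | seq p q => p.WF && q.WF
  | ite e p q => e.Avoids 4 && p.WF && q.WF
  | rep p => p.WF

/-- Translation into programs; the counter of a loop of nesting depth `d` is cell `d` of
array `4`. -/
def compile : Cmd → ℕ → Prog
  | skip, _ => .skip
  | set a i e, _ => .set a i.toExpr e.toExpr
  | seq p q, d => .seq (p.compile d) (q.compile d)
  | ite e p q, d => .ite e.toExpr (p.compile d) (q.compile d)
  | rep p, d =>
      .seq (.set 4 (.lit d) (.get 3 (.lit 0)))
        (.loop (.get 4 (.lit d))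
          (.seq (p.compile (d + 1)) (.set 4 (.lit d) (.sub (.get 4 (.lit d)) (.lit 1)))))

theorem run_of_keeps {x : ℕ} (c : Cmd) (h : c.Keeps x) (M : Mem) : c.run M x = M x := by
  induction c generalizing M with
  | skip => rfl
  | set a i e =>
    simp only [Keeps, bne_iff_ne] at h
    simp [run, Mem.write, Function.update_of_ne (Ne.symm h)]
  | seq p q hp hq =>
    simp only [Keeps, Bool.and_eq_true] at h
    simp [run, hq h.2, hp h.1]
  | ite e p q hp hq =>
    simp only [Keeps, Bool.and_eq_true] at h
    simp only [run]
    split_ifs <;> simp [hp h.1, hq h.2]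
  | rep p hp =>
    simp only [run]
    generalize M 3 0 = n
    induction n with
    | zero => rfl
    | succ n ih => rw [Function.iterate_succ_apply', hp h, ih]

theorem keeps_of_wf {c : Cmd} (h : c.WF) : c.Keeps 3 := by
  induction c with
  | skip => rfl
  | set a i e => simp only [WF, Bool.and_eq_true] at h; exact h.1.1.1
  | seq p q hp hq =>
    simp only [WF, Bool.and_eq_true] at h; simp [Keeps, hp h.1, hq h.2]
  | ite e p q hp hq =>
    simp only [WF, Bool.and_eq_true] at h; simp [Keeps, hp h.1.2, hq h.2]
  | rep p hp => exact hp h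

/-- Array `3` is never written, so every loop makes exactly N rounds. The polynomial g bounds the
gain in bit length and h the time per unit of b + 1. It is essential that neither depends on b: a
sequence then adds the gains and a loop multiplies them by N, whereas a gain proportional to b would
be compounded in every round. -/
theorem exec_compile (c : Cmd) (hc : c.WF) (d : ℕ) :
    ∃ g h : Polynomial ℕ, ∀ (b N : ℕ) (M M₀ : Mem), Agree M M₀ → M.Bounded b → M 3 0 = N →
      ∃ (t : ℕ) (M' : Mem), Exec (c.compile d) M t M' ∧ Agree M' (c.run M₀) ∧
        (∀ i < d, M' 4 i = M 4 i) ∧ M'.Bounded (b + g.eval N) ∧ t ≤ h.eval N * (b + 1) := by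
  induction c generalizing d with
  | skip =>
    refine ⟨0, 1, fun b N M M₀ ha hb _ => ⟨1, M, .skip M, ha, fun _ _ => rfl, ?_, by simp⟩⟩
    simpa using hb
  | set a i e =>
    simp only [WF, Bool.and_eq_true, bne_iff_ne] at hc
    obtain ⟨⟨⟨h3, h4⟩, hi⟩, he⟩ := hc
    obtain ⟨C, hC⟩ := e.eval_lt
    obtain ⟨C₁, hC₁⟩ := i.cost_le
    obtain ⟨C₂, hC₂⟩ := e.cost_le
    refine ⟨.C C, .C (1 + C₁ + C₂), fun b N M M₀ ha hb _ =>
      ⟨_, _, .set a i.toExpr e.toExpr M, ?_, ?_, ?_, ?_⟩⟩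
    · intro x hx
      simp only [run, Ex.eval_toExpr, Mem.write, i.eval_congr ha hi, e.eval_congr ha he]
      by_cases hxa : x = a
      · subst hxa; simp [ha x hx]
      · simp [hxa, ha x hx]
    · intro j _
      simp [Mem.write, Function.update_of_ne (Ne.symm h4)]
    · rw [Polynomial.eval_C]
      refine (hb.mono (Nat.le_add_right _ _)).write _ _ _ ?_
      rw [Ex.eval_toExpr]
      exact hC M b hb
    · have := hC₁ M b hb
      have := hC₂ M b hb
      rw [Polynomial.eval_C]
      nlinarith
  | seq p q hp hq =>
    simp only [WF, Bool.and_eq_true] at hc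
    obtain ⟨g₁, h₁, H₁⟩ := hp hc.1 d
    obtain ⟨g₂, h₂, H₂⟩ := hq hc.2 d
    -- The second command starts with b + g₁(N) bits, and b + g₁(N) + 1 ≤ (g₁(N) + 1)(b + 1).
    refine ⟨g₁ + g₂, h₁ + h₂ * (g₁ + 1), fun b N M M₀ ha hb hN => ?_⟩
    obtain ⟨t, M', e1, a1, c1, b1, l1⟩ := H₁ b N M M₀ ha hb hN
    have hN' : M' 3 0 = N := by
      rw [a1 3 (by decide), run_of_keeps p (keeps_of_wf hc.1), ← ha 3 (by decide), hN]
    obtain ⟨t', M'', e2, a2, c2, b2, l2⟩ := H₂ _ N M' _ a1 b1 hN'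
    refine ⟨_, _, .seq e1 e2, a2, fun i hi => by rw [c2 i hi, c1 i hi], ?_, ?_⟩
    · simpa [add_assoc] using b2
    · simp only [Polynomial.eval_add, Polynomial.eval_mul, Polynomial.eval_one]
      have : h₂.eval N * (b + g₁.eval N + 1) ≤ h₂.eval N * ((g₁.eval N + 1) * (b + 1)) :=
        Nat.mul_le_mul_left _ (by nlinarith)
      nlinarith
  | ite e p q hp hq =>
    simp only [WF, Bool.and_eq_true] at hc
    obtain ⟨⟨he, hcp⟩, hcq⟩ := hc
    obtain ⟨g₁, h₁, H₁⟩ := hp hcp d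
    obtain ⟨g₂, h₂, H₂⟩ := hq hcq d
    obtain ⟨C, hC⟩ := e.cost_le
    refine ⟨g₁ + g₂, h₁ + h₂ + .C C, fun b N M M₀ ha hb hN => ?_⟩
    have hcost := hC M b hb
    simp only [Polynomial.eval_add, Polynomial.eval_C, add_mul]
    by_cases h0 : e.eval M = 0
    · obtain ⟨t, M', e1, a1, c1, b1, l1⟩ := H₂ b N M M₀ ha hb hN
      refine ⟨_, _, .iteFalse (by rw [Ex.eval_toExpr, h0]) e1, ?_, c1, b1.mono (by omega), by omega⟩
      rw [run, if_pos (by rw [← e.eval_congr ha he, h0])]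
      exact a1
    · obtain ⟨t, M', e1, a1, c1, b1, l1⟩ := H₁ b N M M₀ ha hb hN
      refine ⟨_, _, .iteTrue (by rwa [Ex.eval_toExpr]) e1, ?_, c1, b1.mono (by omega), by omega⟩
      rw [run, if_neg (by rwa [← e.eval_congr ha he])]
      exact a1
  | rep p hp =>
    obtain ⟨g, h, H⟩ := hp hc (d + 1)
    obtain ⟨C₁, hC₁⟩ := (Ex.get 4 (.lit d)).cost_le
    obtain ⟨C₂, hC₂⟩ := (Ex.sub (.get 4 (.lit d)) (.lit 1)).cost_le
    obtain ⟨C₃, hC₃⟩ := (Ex.lit d).cost_le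
    obtain ⟨C₄, hC₄⟩ := (Ex.get 3 (.lit 0)).cost_le
    have hp3 : ∀ M, p.run M 3 = M 3 := run_of_keeps p (keeps_of_wf hc)
    set K := C₁ + C₂ + C₃ + C₄ + 1 with hK
    set L : Prog := .loop (.get 4 (.lit d))
      (.seq (p.compile (d + 1)) (.set 4 (.lit d) (.sub (.get 4 (.lit d)) (.lit 1)))) with hL
    -- Here n is the number of remaining rounds, the current value of the counter, while the bounds
    -- for one round keep referring to the fixed number N.
    have key : ∀ (n b N : ℕ) (M M₀ : Mem), Agree M M₀ → M.Bounded b → M 3 0 = N → M 4 d = n →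
        ∃ (t : ℕ) (M' : Mem), Exec L M t M' ∧ Agree M' (p.run^[n] M₀) ∧
          (∀ i < d, M' 4 i = M 4 i) ∧ M'.Bounded (b + n * g.eval N) ∧
          t ≤ (n * (h.eval N + 2 * K) + K) * (b + n * g.eval N + 1) := by
      intro n
      induction n with
      | zero =>
        intro b N M M₀ ha hb hN hn
        refine ⟨_, _, .loopDone (by simpa [Expr.eval] using hn), ha, fun _ _ => rfl,
          by simpa using hb, ?_⟩
        have := hC₁ M b hb
        simp only [Ex.toExpr] at this
        simp only [zero_mul, zero_add, add_zero]
        exact this.trans (Nat.mul_le_mul_right _ (by omega))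
      | succ n ih =>
        intro b N M M₀ ha hb hN hn
        obtain ⟨t, M₁, e1, a1, c1, b1, l1⟩ := H b N M M₀ ha hb hN
        have hcnt : M₁ 4 d = n + 1 := by rw [c1 d (Nat.lt_succ_self d), hn]
        obtain ⟨t', M', e2, a2, c2, b2, l2⟩ := ih (b + g.eval N) N (M₁.write 4 d n) (p.run M₀)
          (fun a h4 => by rw [← a1 a h4]; simp [Mem.write, h4])
          (b1.write _ _ _ (lt_of_le_of_lt (by omega) (b1 4 d)))
          (by
            have h3 := a1 3 (by decide)
            rw [hp3, ← ha 3 (by decide)] at h3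
            rw [Mem.write, Function.update_of_ne (by decide), h3, hN])
          (by simp [Mem.write])
        have e3 := Exec.set 4 (.lit d) (.sub (.get 4 (.lit d)) (.lit 1)) M₁
        simp only [Expr.eval, hcnt, Nat.add_sub_cancel] at e3
        refine ⟨_, M', .loopStep (by simp [Expr.eval, hn]) (.seq e1 e3) e2, ?_, ?_, ?_, ?_⟩
        · rwa [Function.iterate_succ_apply]
        · intro i hi
          rw [c2 i hi, ← c1 i (by omega)]
          simp [Mem.write, Function.update_of_ne (Nat.ne_of_lt hi)]
        · convert b2 using 1
          ring
        · have i1 := hC₁ M b hb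
          have i2 := hC₂ M₁ _ b1
          have i3 := hC₃ M₁ _ b1
          simp only [Ex.toExpr] at i1 i2 i3
          have hB : b + (n + 1) * g.eval N = b + g.eval N + n * g.eval N := by ring
          rw [hB]
          generalize b + g.eval N + n * g.eval N = B at *
          have j0 : b + 1 ≤ b + (n + 1) * g.eval N + 1 := by omega
          have j1 : b + g.eval N + 1 ≤ b + (n + 1) * g.eval N + 1 := by nlinarith
          rw [hB] at j0 j1
          have k1 := i1.trans (Nat.mul_le_mul_left C₁ j0)
          have k2 := i2.trans (Nat.mul_le_mul_left C₂ j1)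
          have k3 := i3.trans (Nat.mul_le_mul_left C₃ j1)
          have k4 := l1.trans (Nat.mul_le_mul_left _ j0)
          rw [hK] at l2 ⊢
          nlinarith
    refine ⟨X * g, X * (h + .C (2 * K)) * (X * g + 1) + .C K * (X * g + 1) + .C K,
      fun b N M M₀ ha hb hN => ?_⟩
    obtain ⟨t, M', e1, a1, c1, b1, l1⟩ := key N b N (M.write 4 d N) M₀
      (fun a h4 => by rw [← ha a h4]; simp [Mem.write, h4])
      (hb.write _ _ _ (hN ▸ hb 3 0)) (by simpa [Mem.write] using hN) (by simp [Mem.write])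
    have e0 := Exec.set 4 (.lit d) (.get 3 (.lit 0)) M
    simp only [Expr.eval, hN] at e0
    refine ⟨_, M', .seq e0 e1, ?_, ?_, ?_, ?_⟩
    · rwa [run, ← ha 3 (by decide), hN]
    · intro i hi
      rw [c1 i hi]
      simp [Mem.write, Function.update_of_ne (Nat.ne_of_lt hi)]
    · simpa using b1
    · have i3 := hC₃ M _ hb
      have i4 := hC₄ M _ hb
      simp only [Ex.toExpr] at i3 i4
      simp only [Polynomial.eval_add, Polynomial.eval_mul, Polynomial.eval_C, Polynomial.eval_X,
        Polynomial.eval_one]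
      have hB : b + N * g.eval N + 1 ≤ (N * g.eval N + 1) * (b + 1) := by
        have := Nat.zero_le (N * g.eval N * b)
        linarith
      have l3 := l1.trans (Nat.mul_le_mul_left _ hB)
      have hk : 1 + C₃ * (b + 1) + C₄ * (b + 1) ≤ K * (b + 1) := by rw [hK]; nlinarith
      nlinarith

/-- Cell `0` of the array with name `x` is only changed by adding constants, and no other cell of
this array is changed. -/
def Counts (x : ℕ) : Cmd → Bool
  | skip => true
  | set a i e =>
      a != x || (match i, e with
        | .lit 0, .add (.get a' (.lit 0)) (.lit _) => a' == x
        | _, _ => false)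
  | seq p q => p.Counts x && q.Counts x
  | ite _ p q => p.Counts x && q.Counts x
  | rep p => p.Counts x

/-- The running time alone does not bound the length of the output, because the length is a number
stored in a cell and may be exponential in its bit length. A cell that only increases by constants
is bounded by a polynomial in N, and output lengths are compared with such a cell. -/
theorem run_counts_le {x : ℕ} (c : Cmd) (hc : c.Counts x) (hw : c.WF) :
    ∃ g : Polynomial ℕ, ∀ M : Mem, c.run M x 0 ≤ M x 0 + g.eval (M 3 0) := by
  induction c with
  | skip => exact ⟨0, fun M => by simp [run]⟩
  | set a i e =>
    by_cases hax : a = x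
    · subst hax
      simp only [Counts, bne_self_eq_false, Bool.false_or] at hc
      split at hc
      · rename_i a' n
        simp only [beq_iff_eq] at hc
        subst hc
        exact ⟨.C n, fun M => by simp [run, Mem.write]⟩
      · simp at hc
    · refine ⟨0, fun M => ?_⟩
      simp [run, Mem.write, Function.update_of_ne (Ne.symm hax)]
  | seq p q hp hq =>
    simp only [WF, Counts, Bool.and_eq_true] at hc hw
    obtain ⟨g₁, h₁⟩ := hp hc.1 hw.1
    obtain ⟨g₂, h₂⟩ := hq hc.2 hw.2
    refine ⟨g₁ + g₂, fun M => ?_⟩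
    have a1 := h₁ M
    have a2 := h₂ (p.run M)
    rw [run_of_keeps p (keeps_of_wf hw.1)] at a2
    simp only [run, Polynomial.eval_add]
    omega
  | ite e p q hp hq =>
    simp only [WF, Counts, Bool.and_eq_true] at hc hw
    obtain ⟨g₁, h₁⟩ := hp hc.1 hw.1.2
    obtain ⟨g₂, h₂⟩ := hq hc.2 hw.2
    refine ⟨g₁ + g₂, fun M => ?_⟩
    have a1 := h₁ M
    have a2 := h₂ M
    simp only [run, Polynomial.eval_add]
    split_ifs <;> omega
  | rep p hp =>
    obtain ⟨g, h⟩ := hp hc hw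
    refine ⟨X * g, fun M => ?_⟩
    have key : ∀ n, p.run^[n] M 3 = M 3 ∧ p.run^[n] M x 0 ≤ M x 0 + n * g.eval (M 3 0) := by
      intro n
      induction n with
      | zero => simp
      | succ n ih =>
        rw [Function.iterate_succ_apply']
        refine ⟨by rw [run_of_keeps p (keeps_of_wf hw), ih.1], ?_⟩
        have := h (p.run^[n] M)
        rw [ih.1] at this
        have e : (n + 1) * g.eval (M 3 0) = n * g.eval (M 3 0) + g.eval (M 3 0) := by ring
        omega
    simpa [run] using (key (M 3 0)).2

end Cmd

/-- The expression with value `(M 0 0 + c) ^ d`. -/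
def powExpr (c : ℕ) : ℕ → Expr
  | 0 => .lit 1
  | d + 1 => .mul (powExpr c d) (.add (.get 0 (.lit 0)) (.lit c))

theorem eval_powExpr (c d : ℕ) (M : Mem) : (powExpr c d).eval M = (M 0 0 + c) ^ d := by
  induction d with
  | zero => rfl
  | succ d ih => simp [powExpr, Expr.eval, ih, pow_succ]

theorem cost_powExpr_le (c d : ℕ) :
    ∃ q : Polynomial ℕ, ∀ M, (powExpr c d).cost M ≤ q.eval (M 0 0) := by
  have size_le : ∀ n : ℕ, Nat.size n ≤ n := fun n => Nat.size_le.2 Nat.lt_two_pow_self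
  induction d with
  | zero => exact ⟨.C 2, fun M => by simp [powExpr, Expr.cost]⟩
  | succ d ih =>
    obtain ⟨q, hq⟩ := ih
    refine ⟨q + (X + .C (c + 2) + .C (1 + c) + (X + .C (c + 1))) + (1 + (X + .C c) ^ (d + 1)),
      fun M => ?_⟩
    have h1 := hq M
    have h2 := size_le ((powExpr c (d + 1)).eval M)
    have h3 := size_le (M 0 0 + c)
    have h4 := size_le c
    have h5 := size_le (M 0 0)
    rw [eval_powExpr] at h2
    have e : (powExpr c (d + 1)).cost M = (powExpr c d).cost M + ((1 + Nat.size 0) +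
        (1 + Nat.size (M 0 0)) + (1 + Nat.size c) + (1 + Nat.size (M 0 0 + c))) +
        (1 + Nat.size ((powExpr c (d + 1)).eval M)) := rfl
    rw [e, eval_powExpr]
    simp only [Polynomial.eval_add, Polynomial.eval_pow, Polynomial.eval_C, Polynomial.eval_X,
      Polynomial.eval_one, Nat.size_zero]
    omega

/-- The program that first stores `(n + c) ^ d`, where `n` is the length of the input, as
the number of repetitions of loops. -/
def program (c d : ℕ) (p : Cmd) : Prog := .seq (.set 3 (.lit 0) (powExpr c d)) (p.compile 0)

/-- The memory after the first instruction of `program`. -/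
def start (c d : ℕ) (x r : List ℕ) : Mem := (init x r).write 3 0 ((x.length + c) ^ d)

theorem size_le_bitSize {x : List ℕ} {n : ℕ} (h : n ∈ x) : Nat.size n ≤ bitSize x := by
  induction x with
  | nil => simp at h
  | cons a x ih =>
    simp only [bitSize, List.map_cons, List.sum_cons] at ih ⊢
    rcases List.mem_cons.1 h with rfl | h
    · omega
    · have := ih h; omega

theorem length_le_bitSize (x : List ℕ) : x.length ≤ bitSize x := by
  induction x with
  | nil => simp
  | cons a x ih => simp only [bitSize, List.map_cons, List.sum_cons, List.length_cons] at ih ⊢; omega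

theorem bitSize_le {x : List ℕ} {b : ℕ} (h : ∀ n ∈ x, n < 2 ^ b) :
    bitSize x ≤ x.length * (b + 1) := by
  induction x with
  | nil => simp [bitSize]
  | cons a x ih =>
    have h1 := ih fun n hn => h n (List.mem_cons_of_mem _ hn)
    have h2 := Nat.size_le.2 (h a List.mem_cons_self)
    simp only [bitSize, List.map_cons, List.sum_cons, List.length_cons] at h1 ⊢
    rw [add_mul]
    omega

theorem exec_program (c d : ℕ) (p : Cmd) (hp : p.WF) (l : Polynomial ℕ) :
    ∃ q : Polynomial ℕ, ∀ x r : List ℕ, r.length ≤ l.eval (bitSize x) → (∀ y ∈ r, y ≤ 1) →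
      ∃ (t : ℕ) (M : Mem), Exec (program c d p) (init x r) t M ∧
        Agree M (p.run (start c d x r)) ∧ M.Bounded (q.eval (bitSize x)) ∧
        t ≤ q.eval (bitSize x) := by
  obtain ⟨g, h, H⟩ := p.exec_compile hp 0
  obtain ⟨q₀, hq₀⟩ := cost_powExpr_le c d
  set N : Polynomial ℕ := (X + .C c) ^ d with hN
  -- Bounds the bit length of all initial cells: `X` accounts for the input and its length, `l` for
  -- the number of random bits, `N` for the number of rounds, and 1 for the random bits themselves.
  set b : Polynomial ℕ := X + l + N + 1 with hb
  refine ⟨q₀ + 2 + b + g.comp N + h.comp N * (b + 1), fun x r hr hr1 => ?_⟩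
  have hx := length_le_bitSize x
  have hNx : (x.length + c) ^ d ≤ N.eval (bitSize x) := by
    simp only [hN, Polynomial.eval_pow, Polynomial.eval_add, Polynomial.eval_X, Polynomial.eval_C]
    exact Nat.pow_le_pow_left (by omega) d
  have hbx : b.eval (bitSize x) = bitSize x + l.eval (bitSize x) + N.eval (bitSize x) + 1 := by
    simp [hb]
  have self : ∀ {v w : ℕ}, v ≤ w → v < 2 ^ w := fun {v w} hv =>
    hv.trans_lt Nat.lt_two_pow_self
  have hget : ∀ (y : List ℕ) (i B : ℕ), (∀ n ∈ y, n < 2 ^ B) → y.getD i 0 < 2 ^ B := by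
    intro y i B hy
    by_cases hi : i < y.length
    · rw [List.getD_eq_getElem _ _ hi]; exact hy _ (List.getElem_mem hi)
    · rw [List.getD_eq_default _ _ (by omega)]; positivity
  have bound : (start c d x r).Bounded (b.eval (bitSize x)) := by
    refine Mem.Bounded.write ?_ _ _ _ (self (by omega))
    intro a i
    match a with
    | 0 =>
      cases i with
      | zero => exact self (by change x.length ≤ _; omega)
      | succ i =>
        refine hget x i _ fun n hn => ?_
        refine lt_of_lt_of_le (Nat.lt_size_self n) (Nat.pow_le_pow_right two_pos ?_)
        have := size_le_bitSize hn
        omega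
    | 1 =>
      cases i with
      | zero => exact self (by change r.length ≤ _; omega)
      | succ i =>
        refine hget r i _ fun n hn => self ?_
        have := hr1 n hn
        omega
    | a + 2 => exact self (Nat.zero_le _)
  obtain ⟨t, M, e, ha, -, hM, ht⟩ := H _ _ (start c d x r) (start c d x r) (fun _ _ => rfl) bound rfl
  have hs : start c d x r 3 0 = (x.length + c) ^ d := by simp [start, Mem.write]
  rw [hs] at hM ht
  have e0 := Exec.set 3 (.lit 0) (powExpr c d) (init x r)
  have h00 : init x r 0 0 = x.length := rfl
  rw [eval_powExpr, h00] at e0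
  have m1 := (Polynomial.eval_nat_mono g) hNx
  have m2 := (Polynomial.eval_nat_mono h) hNx
  have m3 := (hq₀ (init x r)).trans ((Polynomial.eval_nat_mono q₀) (h00 ▸ hx))
  simp only at m1 m2 m3
  have hq : (q₀ + 2 + b + g.comp N + h.comp N * (b + 1)).eval (bitSize x) =
      q₀.eval (bitSize x) + 2 + b.eval (bitSize x) + g.eval (N.eval (bitSize x)) +
        h.eval (N.eval (bitSize x)) * (b.eval (bitSize x) + 1) := by
    simp [Polynomial.eval_comp]
  refine ⟨_, M, .seq e0 e, ha, hM.mono ?_, ?_⟩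
  · omega
  · have := Nat.mul_le_mul_right (b.eval (bitSize x) + 1) m2
    have e1 : (Expr.lit 0).cost (init x r) = 1 := by simp [Expr.cost]
    omega

theorem ofList_toList (b : ℕ → ℕ) (l : List ℕ) (h0 : b 0 = l.length)
    (h : ∀ i (hi : i < l.length), b (i + 1) = l[i]) : toList b = l := by
  apply List.ext_getElem
  · simp [toList, h0]
  · intro i h1 h2
    simp [toList, h i h2]

/-- A loop program that leaves the code of the result in array `2` and maintains the length of
this code in cell `0` of the array with name `x` computes a polynomial time function. -/
theorem polyTime_of_run {α β : Type} {codeα : α → List ℕ} {codeβ : β → List ℕ} {f : α → β}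
    (c d x : ℕ) (p : Cmd) (hp : p.WF) (hx : p.Counts x) (hx4 : x ≠ 4) (hx3 : 2 ≤ x)
    (H : ∀ a, toList (p.run (start c d (codeα a) []) 2) = codeβ (f a) ∧
      p.run (start c d (codeα a) []) 2 0 ≤ p.run (start c d (codeα a) []) x 0) :
    PolyTime codeα codeβ f := by
  obtain ⟨q, hq⟩ := exec_program c d p hp 0
  obtain ⟨g, hg⟩ := p.run_counts_le hx hp
  set N : Polynomial ℕ := (X + .C c) ^ d with hN
  refine ⟨program c d p, q + (N + g.comp N) * (q + 1), fun a => ?_⟩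
  obtain ⟨t, M, e, hM, hb, ht⟩ := hq (codeα a) [] (by simp) (by simp)
  obtain ⟨h1, h2⟩ := H a
  have hM2 := hM 2 (by decide)
  refine ⟨t, M, e, by rw [hM2, h1], ?_⟩
  have hlen : (codeβ (f a)).length = M 2 0 := by rw [← h1, hM2]; simp [toList]
  have hb1 : ∀ n ∈ codeβ (f a), n < 2 ^ q.eval (bitSize (codeα a)) := by
    intro n hn
    rw [← h1, ← hM2, toList] at hn
    obtain ⟨i, -, rfl⟩ := List.mem_map.1 hn
    exact hb _ _
  have hNx : ((codeα a).length + c) ^ d ≤ N.eval (bitSize (codeα a)) := by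
    simp only [hN, Polynomial.eval_pow, Polynomial.eval_add, Polynomial.eval_X, Polynomial.eval_C]
    exact Nat.pow_le_pow_left (Nat.add_le_add_right (length_le_bitSize _) _) d
  have hs : start c d (codeα a) [] 3 0 = ((codeα a).length + c) ^ d := by simp [start, Mem.write]
  have hsx : start c d (codeα a) [] x 0 ≤ ((codeα a).length + c) ^ d := by
    by_cases h : x = 3
    · rw [h, hs]
    · obtain ⟨x, rfl⟩ := Nat.exists_eq_add_of_le' hx3
      simp [start, Mem.write, Function.update_of_ne h, init]
  have h3 := hg (start c d (codeα a) [])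
  rw [hs] at h3
  have h4 := (Polynomial.eval_nat_mono g) hNx
  simp only at h4
  have h5 := (bitSize_le hb1).trans (Nat.mul_le_mul_right _
    (show _ ≤ N.eval (bitSize (codeα a)) + g.eval (N.eval (bitSize (codeα a))) by
      rw [hlen, hM2]; omega))
  simp only [Polynomial.eval_add, Polynomial.eval_mul, Polynomial.eval_comp, Polynomial.eval_one]
  omega

end RAM

namespace RAM

/-! ### Reasoning about memories -/

theorem Mem.write_self (M : Mem) (a i v : ℕ) : (M.write a i v) a = Function.update (M a) i v := by
  simp [Mem.write]

theorem Mem.write_ne (M : Mem) {a b : ℕ} (i v : ℕ) (h : b ≠ a) : (M.write a i v) b = M b := by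
  simp [Mem.write, h]

/-- The list `l` is stored in the cells `p, p + 1, …`. -/
def Seg (f : ℕ → ℕ) : ℕ → List ℕ → Prop
  | _, [] => True
  | p, x :: l => f p = x ∧ Seg f (p + 1) l

@[simp] theorem seg_nil (f : ℕ → ℕ) (p : ℕ) : Seg f p [] := trivial

@[simp] theorem seg_cons (f : ℕ → ℕ) (p x : ℕ) (l : List ℕ) :
    Seg f p (x :: l) ↔ f p = x ∧ Seg f (p + 1) l := Iff.rfl

theorem seg_append (f : ℕ → ℕ) (p : ℕ) (l l' : List ℕ) :
    Seg f p (l ++ l') ↔ Seg f p l ∧ Seg f (p + l.length) l' := by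
  induction l generalizing p with
  | nil => simp
  | cons x l ih => simp [ih, and_assoc, add_assoc, add_comm 1]

theorem Seg.congr {f g : ℕ → ℕ} {p : ℕ} {l : List ℕ} (h : Seg f p l)
    (hfg : ∀ i, p ≤ i → i < p + l.length → f i = g i) : Seg g p l := by
  induction l generalizing p with
  | nil => trivial
  | cons x l ih =>
    simp only [List.length_cons] at hfg
    refine ⟨by rw [← hfg p le_rfl (by omega), h.1], ih h.2 fun i h1 h2 => hfg i (by omega) (by omega)⟩

theorem Seg.update {f : ℕ → ℕ} {p q v : ℕ} {l : List ℕ} (h : Seg f p l)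
    (hq : q < p ∨ p + l.length ≤ q) : Seg (Function.update f q v) p l :=
  h.congr fun i h1 h2 => by rw [Function.update_of_ne (by omega)]

theorem seg_iff_getElem (f : ℕ → ℕ) (p : ℕ) (l : List ℕ) :
    Seg f p l ↔ ∀ i (hi : i < l.length), f (p + i) = l[i] := by
  induction l generalizing p with
  | nil => simp
  | cons x l ih =>
    rw [seg_cons, ih]
    constructor
    · rintro ⟨h1, h2⟩ i hi
      cases i with
      | zero => simpa using h1
      | succ i => simpa [add_assoc, add_comm 1] using h2 i (by simpa using hi)
    · intro h
      refine ⟨h 0 (by simp), fun i hi => ?_⟩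
      rw [add_assoc, add_comm 1]
      exact h (i + 1) (by simpa using hi)

theorem seg_ofList (x : List ℕ) : Seg (ofList x) 1 x := by
  rw [seg_iff_getElem]
  intro i hi
  rw [add_comm]
  simp [ofList, hi]

theorem toList_of_seg {b : ℕ → ℕ} {l : List ℕ} (h0 : b 0 = l.length) (h : Seg b 1 l) :
    toList b = l :=
  ofList_toList b l h0 fun i hi => by
    rw [seg_iff_getElem] at h
    rw [add_comm, h i hi]

/-- The cell `0` of an array. -/
abbrev Ex.var (a : ℕ) : Ex := .get a (.lit 0)

/-- Assignment to the cell `0` of an array. -/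
abbrev Cmd.asg (a : ℕ) (e : Ex) : Cmd := .set a (.lit 0) e

/-- Add a constant to the cell `0` of an array. -/
abbrev Cmd.inc (a c : ℕ) : Cmd := .set a (.lit 0) (.add (.get a (.lit 0)) (.lit c))

scoped infixr:60 " ;; " => Cmd.seq

theorem Cmd.run_seq (p q : Cmd) (M : Mem) : (p ;; q).run M = q.run (p.run M) := rfl

theorem Cmd.run_set (a : ℕ) (i e : Ex) (M : Mem) :
    (Cmd.set a i e).run M = M.write a (i.eval M) (e.eval M) := rfl

theorem Cmd.run_ite (e : Ex) (p q : Cmd) (M : Mem) :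
    (Cmd.ite e p q).run M = if e.eval M = 0 then q.run M else p.run M := rfl

theorem Cmd.run_skip (M : Mem) : Cmd.skip.run M = M := rfl

theorem Cmd.run_rep (p : Cmd) (M : Mem) : (Cmd.rep p).run M = p.run^[M 3 0] M := rfl

/-- Iteration with an invariant. -/
theorem iterate_inv {α : Type*} (f : α → α) (I : ℕ → α → Prop) (n : ℕ) {a : α} (h0 : I 0 a)
    (h : ∀ i < n, ∀ b, I i b → I (i + 1) (f b)) : I n (f^[n] a) := by
  induction n with
  | zero => exact h0
  | succ n ih =>
    rw [Function.iterate_succ_apply']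
    exact h n (Nat.lt_succ_self n) _ (ih fun i hi => h i (by omega))

/-! ### Translation of circuits into tree straight-line programs -/

/-- One step of the translation: `5` is the input position, `6` the output length. -/
def gateStep : Cmd :=
  .ite (.sub (.add (.var 0) (.lit 1)) (.var 5))
    (.ite (.sub (.get 0 (.var 5)) (.lit 2))
      (.ite (.sub (.get 0 (.var 5)) (.lit 4))
        (.set 2 (.add (.var 6) (.lit 1)) (.get 0 (.var 5)) ;;
          .set 2 (.add (.var 6) (.lit 2)) (.lit 7) ;;
          .set 2 (.add (.var 6) (.lit 3)) (.get 0 (.add (.var 5) (.lit 1))) ;;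
          .set 2 (.add (.var 6) (.lit 4)) (.lit 7) ;;
          .set 2 (.add (.var 6) (.lit 5)) (.get 0 (.add (.var 5) (.lit 2))) ;;
          .inc 6 5 ;; .inc 5 3)
        (.set 2 (.add (.var 6) (.lit 1)) (.get 0 (.var 5)) ;;
          .set 2 (.add (.var 6) (.lit 2)) (.get 0 (.add (.var 5) (.lit 1))) ;;
          .inc 6 2 ;; .inc 5 2))
      (.set 2 (.add (.var 6) (.lit 1)) (.get 0 (.var 5)) ;; .inc 6 1 ;; .inc 5 1))
    .skip

/-- The codes of leaves agree in both formats, and a gate `f i j` becomes `f 7 i 7 j`. All ranks are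
zero and unused cells contain zero already, so the first loop writes no ranks; it only moves the
output length past them. -/
def circuitToTSLP : Cmd :=
  .inc 6 2 ;;
  .rep (.ite (.sub (.get 0 (.lit 1)) (.var 7)) (.inc 7 1 ;; .inc 6 1) .skip) ;;
  .set 2 (.lit 1) (.get 0 (.lit 1)) ;;
  .set 2 (.lit 2) (.get 0 (.lit 2)) ;;
  .asg 5 (.lit 3) ;;
  .rep gateStep ;;
  .set 2 (.lit 0) (.var 6)

end RAM

namespace Arith

open RAM

/-- The code of the right-hand side that corresponds to a gate. -/
def Gate.toTree {k n : ℕ} : Gate k n → Tree k (fun _ : Fin n => 0)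
  | leaf a => .leaf a
  | op f i j => .op f (.nt i Fin.elim0) (.nt j Fin.elim0)

/-- The circuit as a tree straight-line program without parameters. -/
def Circuit.toTSLP {k : ℕ} (C : Circuit k) : TSLP k where
  n := C.n
  rk _ := 0
  start := C.out
  rhs i := (C.gate i).toTree
  rk_start := rfl
  valid i := by cases C.gate i <;> simp [Gate.toTree, Tree.params]
  acyclic := by
    convert C.acyclic using 3 with j i
    cases C.gate i <;> simp [Gate.toTree, Tree.nonterminals, Gate.inputs, or_comm]

theorem Formula.eval_subst {R : Type*} [Semiring R] {k : ℕ} (κ : Fin k → R) (χ ξ : ℕ → R)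
    (u : ℕ → Formula k) (t : Formula k) :
    (t.subst u).eval κ χ ξ = t.eval κ χ fun i => (u i).eval κ χ ξ := by
  induction t with
  | param i => rfl
  | leaf a => rfl
  | op f s t hs ht => simp [Formula.subst, Formula.eval, hs, ht]

theorem TSLP.val_eq {k : ℕ} (G : TSLP k) (A : Fin G.n) :
    G.val A = (G.rhs A).expand fun B =>
      open Classical in if B ∈ (G.rhs A).nonterminals then G.val B else .leaf .zero := by
  rw [TSLP.val, WellFounded.fix_eq]
  congr 1

theorem Circuit.val_eq {R : Type*} [Semiring R] {k : ℕ} (κ : Fin k → R) (χ : ℕ → R)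
    (C : Circuit k) (i : Fin C.n) :
    C.val κ χ i = evalGate κ χ (C.gate i) fun j _ => C.val κ χ j := by
  rw [Circuit.val, WellFounded.fix_eq]

open Classical in
theorem Circuit.eval_toTSLP {R : Type*} [Semiring R] {k : ℕ} (κ : Fin k → R) (χ : ℕ → R)
    (C : Circuit k) : C.toTSLP.eval κ χ = C.eval κ χ := by
  have key : ∀ (i : Fin C.n) (ξ : ℕ → R), (C.toTSLP.val i).eval κ χ ξ = C.val κ χ i := by
    intro i
    induction i using C.acyclic.induction with
    | h i ih =>
      intro ξ
      rw [Circuit.val_eq]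
      refine (congrArg (Formula.eval κ χ ξ) (TSLP.val_eq C.toTSLP i)).trans ?_
      change (Tree.expand (fun B => if B ∈ (C.gate i).toTree.nonterminals then C.toTSLP.val B
        else .leaf .zero) (C.gate i).toTree).eval κ χ ξ = _
      generalize C.gate i = g at ih
      cases g with
      | leaf a => rfl
      | op f j l =>
        simp only [Gate.toTree, Tree.expand, Tree.nonterminals, Formula.eval, Formula.eval_subst,
          evalGate]
        rw [if_pos (by simp), if_pos (by simp), ih j (by simp [Gate.inputs]),
          ih l (by simp [Gate.inputs])]
  exact key _ _

theorem gateStep_run {k n : ℕ} (g : Gate k n) (M : Mem) (l : List ℕ)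
    (h : Seg (M 0) (M 5 0) g.code) (hle : M 5 0 + g.code.length ≤ M 0 0 + 1)
    (hl : Seg (M 2) 1 l) (h6 : M 6 0 = l.length) :
    gateStep.run M 0 = M 0 ∧ gateStep.run M 5 0 = M 5 0 + g.code.length ∧
      Seg (gateStep.run M 2) 1 (l ++ g.toTree.code) ∧
      gateStep.run M 6 0 = (l ++ g.toTree.code).length := by
  have hg : M 0 0 + 1 - M 5 0 ≠ 0 := by
    have : 0 < g.code.length := by
      rcases g with a | f
      · cases a <;> simp [Gate.code, Leaf.code]
      · cases f <;> simp [Gate.code, Op.code]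
    omega
  clear hle
  rw [gateStep, Cmd.run_ite, if_neg (by simpa using hg)]
  cases g with
  | leaf a =>
    cases a <;>
    simp_all [Gate.code, Gate.toTree, Tree.code, Leaf.code, Cmd.run_seq, Cmd.run_set, Cmd.run_ite,
      Mem.write_self, Mem.write_ne, seg_append, Seg.update, add_comm 1]
  | op f i j =>
    cases f <;>
    simp_all [Gate.code, Gate.toTree, Tree.code, Op.code, Cmd.run_seq, Cmd.run_set, Cmd.run_ite,
      Mem.write_self, Mem.write_ne, seg_append, add_comm 1] <;>
    repeat refine Seg.update ?_ (Or.inr (by omega))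
    all_goals assumption

theorem Gate.code_length_pos {k n : ℕ} (g : Gate k n) : 0 < g.code.length := by
  rcases g with a | f
  · cases a <;> simp [Gate.code, Leaf.code]
  · cases f <;> simp [Gate.code, Op.code]

/-- The number of rounds may exceed the number of gates, since the step is the identity once the
input is used up. Loops with a fixed number of rounds are always handled like this. -/
theorem gateStep_iterate {k n : ℕ} (gs : List (Gate k n)) (M : Mem) (l : List ℕ)
    (h : Seg (M 0) (M 5 0) (gs.flatMap Gate.code))
    (hle : M 5 0 + (gs.flatMap Gate.code).length = M 0 0 + 1)
    (hl : Seg (M 2) 1 l) (h6 : M 6 0 = l.length) (i : ℕ) (hi : gs.length ≤ i) :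
    Seg (gateStep.run^[i] M 2) 1 (l ++ gs.flatMap fun g => g.toTree.code) ∧
      gateStep.run^[i] M 6 0 = (l ++ gs.flatMap fun g => g.toTree.code).length := by
  induction gs generalizing M l i with
  | nil =>
    have hfix : gateStep.run M = M := by
      rw [gateStep, Cmd.run_ite, if_pos, Cmd.run_skip]
      simp only [List.flatMap_nil, List.length_nil] at hle
      simp only [Ex.eval]
      omega
    rw [Function.iterate_fixed hfix]
    simpa using ⟨hl, h6⟩
  | cons g gs ih =>
    obtain ⟨i, rfl⟩ := Nat.exists_eq_add_of_le' (show 1 ≤ i by simp at hi; omega)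
    rw [List.flatMap_cons, seg_append] at h
    rw [List.flatMap_cons, List.length_append] at hle
    obtain ⟨a1, a2, a3, a4⟩ := gateStep_run g M l h.1 (by omega) hl h6
    rw [Function.iterate_succ_apply]
    have := ih (gateStep.run M) (l ++ g.toTree.code) (by rw [a1, a2]; exact h.2)
      (by rw [a1, a2]; omega) a3 a4 i (by simpa using hi)
    simpa [List.append_assoc] using this

theorem length_le_length_flatten {α : Type*} {L : List (List α)} (h : ∀ l ∈ L, 0 < l.length) :
    L.length ≤ L.flatten.length := by
  induction L with
  | nil => simp
  | cons a L ih =>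
    have h1 := ih fun l hl => h l (List.mem_cons_of_mem _ hl)
    have h2 := h a List.mem_cons_self
    simp only [List.length_cons, List.flatten_cons, List.length_append]
    omega

theorem circuitToTSLP_run {k : ℕ} (C : Circuit k) :
    toList (circuitToTSLP.run (start 1 1 C.code []) 2) = C.toTSLP.code ∧
      circuitToTSLP.run (start 1 1 C.code []) 2 0 ≤
        circuitToTSLP.run (start 1 1 C.code []) 6 0 := by
  have hflat : (List.ofFn fun i => (C.gate i).code).flatten =
      (List.ofFn C.gate).flatMap Gate.code := by
    rw [List.flatMap, List.map_ofFn]; rfl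
  have hcode : C.code = [C.n, (C.out : ℕ)] ++ (List.ofFn C.gate).flatMap Gate.code := by
    rw [Circuit.code, hflat]
  have hcode' : C.toTSLP.code = ([C.n, (C.out : ℕ)] ++ List.replicate C.n 0) ++
      (List.ofFn C.gate).flatMap fun g => g.toTree.code := by
    rw [TSLP.code, List.flatMap, List.map_ofFn]
    congr 2
    exact List.ofFn_const C.n 0
  have hn : C.n ≤ ((List.ofFn C.gate).flatMap Gate.code).length := by
    have := length_le_length_flatten (L := List.ofFn fun i => (C.gate i).code) (by
      intro l hl
      obtain ⟨i, rfl⟩ := List.mem_ofFn.1 hl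
      exact (C.gate i).code_length_pos)
    rwa [hflat, List.length_ofFn] at this
  set M₀ := start 1 1 C.code [] with hM₀
  have h00 : M₀ 0 = ofList C.code := by simp [hM₀, start, Mem.write, init]
  have h03 : M₀ 3 0 = C.code.length + 1 := by simp [hM₀, start, Mem.write]
  have h0 : ∀ a, 4 ≤ a → M₀ a = fun _ => 0 := by
    intro a ha
    obtain ⟨a, rfl⟩ := Nat.exists_eq_add_of_le' (show 2 ≤ a by omega)
    rw [hM₀, start, Mem.write_ne _ _ _ (by omega)]
    rfl
  have h02 : M₀ 2 = fun _ => 0 := by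
    rw [hM₀, start, Mem.write_ne _ _ _ (by omega)]
    rfl
  have hlen : C.code.length = 2 + ((List.ofFn C.gate).flatMap Gate.code).length := by
    rw [hcode, List.length_append]; rfl
  have hin : Seg (ofList C.code) 1 C.code := seg_ofList _
  nth_rw 2 [hcode] at hin
  simp only [List.cons_append, List.nil_append, seg_cons] at hin
  obtain ⟨hi1, hi2, hi3⟩ := hin
  simp only [circuitToTSLP, Cmd.run_seq]
  set M₁ := (Cmd.inc 6 2).run M₀ with hM₁
  set p₁ : Cmd := .rep (.ite (.sub (.get 0 (.lit 1)) (.var 7)) (.inc 7 1 ;; .inc 6 1) .skip)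
  obtain ⟨b0, b2, b3, b7, b6⟩ : p₁.run M₁ 0 = M₀ 0 ∧ p₁.run M₁ 2 = M₀ 2 ∧ p₁.run M₁ 3 = M₀ 3 ∧
      p₁.run M₁ 7 0 = C.n ∧ p₁.run M₁ 6 0 = 2 + C.n := by
    have := iterate_inv
      (Cmd.ite (.sub (.get 0 (.lit 1)) (.var 7)) (.inc 7 1 ;; .inc 6 1) .skip).run
      (fun i M => M 0 = M₀ 0 ∧ M 2 = M₀ 2 ∧ M 3 = M₀ 3 ∧ M 7 0 = min i C.n ∧
        M 6 0 = 2 + min i C.n) (M₁ 3 0) (a := M₁)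
      (by simp [hM₁, Cmd.run_set, Mem.write_self, Mem.write_ne, h0]) (by
        rintro i - M ⟨a0, a2, a3, a7, a6⟩
        rw [Cmd.run_ite]
        simp only [Ex.eval, a0, a7, h00, hi1]
        split_ifs with h
        · exact ⟨a0, a2, a3, by rw [Cmd.run_skip]; omega, by rw [Cmd.run_skip]; omega⟩
        · refine ⟨?_, ?_, ?_, ?_, ?_⟩ <;>
            simp [Cmd.run_seq, Cmd.run_set, Mem.write_self, Mem.write_ne, a0, a2, a3, a7, a6] <;>
            omega)
    have e3 : M₁ 3 0 = C.code.length + 1 := by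
      rw [hM₁, Cmd.run_set, Mem.write_ne _ _ _ (by decide), h03]
    obtain ⟨a0, a2, a3, a7, a6⟩ := this
    refine ⟨a0, a2, a3, a7.trans ?_, a6.trans ?_⟩ <;> omega
  set M₂ := p₁.run M₁
  set M₃ := (Cmd.asg 5 (.lit 3)).run ((Cmd.set 2 (.lit 2) (.get 0 (.lit 2))).run
    ((Cmd.set 2 (.lit 1) (.get 0 (.lit 1))).run M₂)) with hM₃
  have c0 : M₃ 0 = ofList C.code := by
    simp [hM₃, Cmd.run_set, Mem.write_ne, b0, h00]
  have c3 : M₃ 3 0 = C.code.length + 1 := by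
    simp [hM₃, Cmd.run_set, Mem.write_ne, b3, h03]
  have c5 : M₃ 5 0 = 3 := by simp [hM₃, Cmd.run_set, Mem.write_self]
  have c6 : M₃ 6 0 = 2 + C.n := by simp [hM₃, Cmd.run_set, Mem.write_ne, b6]
  have c2 : Seg (M₃ 2) 1 ([C.n, (C.out : ℕ)] ++ List.replicate C.n 0) := by
    have : M₃ 2 = Function.update (Function.update (fun _ => 0) 1 C.n) 2 C.out := by
      simp [hM₃, Cmd.run_set, Mem.write_self, Mem.write_ne, b0, b2, h00, h02, hi1, hi2]
    rw [this]
    refine ⟨by simp, by simp, ?_⟩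
    refine (seg_iff_getElem _ _ (List.replicate C.n 0)).2 fun i hi => ?_
    rw [List.getElem_replicate, Function.update_of_ne (by omega), Function.update_of_ne (by omega)]
  obtain ⟨d2, d6⟩ := gateStep_iterate (List.ofFn C.gate) M₃ _ (by rw [c0, c5]; exact hi3)
    (by rw [c0, c5]; change _ = C.code.length + 1; omega) c2 (by rw [c6]; simp; omega)
    (M₃ 3 0) (by rw [c3, List.length_ofFn]; omega)
  rw [← hcode'] at d2 d6
  rw [Cmd.run_rep]
  generalize gateStep.run^[M₃ 3 0] M₃ = M₄ at *
  simp only [Cmd.run_set, Mem.write_self, Ex.eval, d6]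
  refine ⟨toList_of_seg (by simp) (d2.update (by simp)), ?_⟩
  rw [Mem.write_ne _ _ _ (by decide), d6]
  simp

theorem Circuit.ncPoly_toTSLP {S : Type*} [Semiring S] {k : ℕ} (c : Fin k → S) (C : Circuit k) :
    C.toTSLP.ncPoly c = C.ncPoly c :=
  C.eval_toTSLP _ _

theorem Circuit.poly_toTSLP {S : Type*} [CommSemiring S] {k : ℕ} (c : Fin k → S) (C : Circuit k) :
    C.toTSLP.poly c = C.poly c :=
  C.eval_toTSLP _ _

theorem ncPIT_reduces {S : Type*} [Semiring S] {k : ℕ} (c : Fin k → S) :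
    (ncPIT c).Reduces (ncZeroTSLP c) :=
  ⟨Circuit.toTSLP, polyTime_of_run 1 1 6 circuitToTSLP (by decide) (by decide)
    (by decide) (by decide) circuitToTSLP_run, fun C =>
      Iff.of_eq (congrArg (· = 0) (Circuit.ncPoly_toTSLP c C).symm)⟩

theorem PIT_reduces {S : Type*} [CommSemiring S] {k : ℕ} (c : Fin k → S) :
    (PIT c).Reduces (zeroTSLP c) :=
  ⟨Circuit.toTSLP, polyTime_of_run 1 1 6 circuitToTSLP (by decide) (by decide)
    (by decide) (by decide) circuitToTSLP_run, fun C =>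
      Iff.of_eq (congrArg (· = 0) (Circuit.poly_toTSLP c C).symm)⟩

end Arith

namespace Arith

open RAM

/-! ### Lists of gates -/

/-- A gate whose inputs are given by arbitrary numbers. -/
inductive PreGate (k : ℕ) : Type
  | leaf (a : Leaf k)
  | op (f : Op) (i j : ℕ)

def PreGate.code {k : ℕ} : PreGate k → List ℕ
  | leaf a => a.code
  | op f i j => f.code ++ [i, j]

def PreGate.eval {R : Type*} [Semiring R] {k : ℕ} (κ : Fin k → R) (χ v : ℕ → R) : PreGate k → R
  | leaf a => a.eval κ χ
  | op f i j => f.eval (v i) (v j)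

/-- All inputs of the gate are smaller than `n`. -/
def PreGate.Lt {k : ℕ} (n : ℕ) : PreGate k → Prop
  | leaf _ => True
  | op _ i j => i < n ∧ j < n

/-- The values of a list of gates; the first element of the list is the gate with the largest
number. -/
def gval {R : Type*} [Semiring R] {k : ℕ} (κ : Fin k → R) (χ : ℕ → R) :
    List (PreGate k) → ℕ → R
  | [], _ => 0
  | g :: gs, i => if i = gs.length then g.eval κ χ (gval κ χ gs) else gval κ χ gs i

/-- The inputs of every gate have smaller numbers. -/
def Ordered {k : ℕ} : List (PreGate k) → Prop
  | [] => True
  | g :: gs => g.Lt gs.length ∧ Ordered gs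

/-- The codes of the gates in the order of their numbers. -/
def gcode {k : ℕ} : List (PreGate k) → List ℕ
  | [] => []
  | g :: gs => gcode gs ++ g.code

section gval

variable {R : Type*} [Semiring R] {k : ℕ} (κ : Fin k → R) (χ : ℕ → R)

/-- Lists grow at the head while gates are numbered from the tail, so a number that was once
assigned keeps its gate and its value under all extensions. -/
theorem gval_suffix {gs gs' : List (PreGate k)} (h : gs <:+ gs') {i : ℕ} (hi : i < gs.length) :
    gval κ χ gs' i = gval κ χ gs i := by
  obtain ⟨l, rfl⟩ := h
  induction l with
  | nil => rfl
  | cons g l ih => rw [List.cons_append, gval, if_neg (by simp; omega), ih]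

theorem gval_cons_self (g : PreGate k) (gs : List (PreGate k)) :
    gval κ χ (g :: gs) gs.length = g.eval κ χ (gval κ χ gs) := by
  simp [gval]

theorem gval_cons_of_lt (g : PreGate k) (gs : List (PreGate k)) {i : ℕ} (hi : i < gs.length) :
    gval κ χ (g :: gs) i = gval κ χ gs i := by
  simp [gval, hi.ne]

end gval

/-! ### Skeletons -/

/-- Instructions of a stack machine: push the next argument, apply the affine map `a * x * b + c`
to the top element, apply an operation to the two top elements, push a constant; constants are
given by gates. -/
inductive Ins : Type
  | arg
  | aff (a b c : ℕ)
  | op (f : Op)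
  | con (g : ℕ)

def Ins.Lt (n : ℕ) : Ins → Prop
  | arg => True
  | aff a b c => a < n ∧ b < n ∧ c < n
  | op _ => True
  | con g => g < n

/-- Execution of a list of instructions with a list of arguments and a stack. -/
def exec {R : Type*} [Semiring R] (v : ℕ → R) : List Ins → List R → List R →
    Option (List R × List R)
  | [], q, s => some (q, s)
  | .arg :: w, x :: q, s => exec v w q (x :: s)
  | .aff a b c :: w, q, x :: s => exec v w q ((v a * x * v b + v c) :: s)
  | .op f :: w, q, y :: x :: s => exec v w q (f.eval x y :: s)
  | .con g :: w, q, s => exec v w q (v g :: s)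
  | _, _, _ => none

section exec

variable {R : Type*} [Semiring R] {v v' : ℕ → R}

theorem exec_append (w w' : List Ins) (q s : List R) :
    exec v (w ++ w') q s = (exec v w q s).bind fun r => exec v w' r.1 r.2 := by
  induction w generalizing q s with
  | nil => rfl
  | cons i w ih =>
    cases i with
    | arg => cases q <;> simp [exec, ih]
    | aff a b c => cases s <;> simp [exec, ih]
    | op f => rcases s with _ | ⟨y, _ | ⟨x, s⟩⟩ <;> simp [exec, ih]
    | con g => simp [exec, ih]

theorem exec_congr {n : ℕ} (hv : ∀ i < n, v i = v' i) (w : List Ins) (hw : ∀ i ∈ w, i.Lt n)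
    (q s : List R) : exec v w q s = exec v' w q s := by
  induction w generalizing q s with
  | nil => rfl
  | cons i w ih =>
    have ih := fun q s => ih (fun j hj => hw j (List.mem_cons_of_mem _ hj)) q s
    have hi := hw i List.mem_cons_self
    cases i with
    | arg => cases q <;> simp [exec, ih]
    | aff a b c =>
      obtain ⟨h1, h2, h3⟩ := hi
      cases s <;> simp [exec, ih, hv a h1, hv b h2, hv c h3]
    | op f => rcases s with _ | ⟨y, _ | ⟨x, s⟩⟩ <;> simp [exec, ih]
    | con g => simp [exec, ih, hv g hi]

/-- `Merge v V c s`: the stack `s` consists of the elements of `c` at the positions where `V` has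
no entry, and of the values of the gates given by `V` otherwise. -/
inductive Merge (v : ℕ → R) : List (Option ℕ) → List R → List R → Prop
  | nil : Merge v [] [] []
  | con {V : List (Option ℕ)} {c s : List R} (g : ℕ) :
      Merge v V c s → Merge v (some g :: V) c (v g :: s)
  | var {V : List (Option ℕ)} {c s : List R} (x : R) :
      Merge v V c s → Merge v (none :: V) (x :: c) (x :: s)

theorem Merge.congr {V : List (Option ℕ)} {c s : List R} (h : Merge v V c s)
    {n : ℕ} (hv : ∀ i < n, v i = v' i) (hV : ∀ g, some g ∈ V → g < n) : Merge v' V c s := by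
  induction h with
  | nil => exact .nil
  | con g _ ih =>
    rw [hv g (hV g List.mem_cons_self)]
    exact .con g (ih fun g hg => hV g (List.mem_cons_of_mem _ hg))
  | var x _ ih => exact .var x (ih fun g hg => hV g (List.mem_cons_of_mem _ hg))

end exec

/-! ### Skeletons and stacks in the memory -/

def Op.num : Op → ℕ
  | add => 5
  | mul => 6

/-- The instruction `i` is stored at position `p`. -/
def InsAt (M : Mem) (p : ℕ) : Ins → Prop
  | .arg => M 10 p = 1
  | .aff a b c => M 10 p = 2 ∧ M 11 p = a ∧ M 12 p = b ∧ M 13 p = c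
  | .op f => M 10 p = f.num
  | .con g => M 10 p = 3 ∧ M 13 p = g

def StrAt (M : Mem) : ℕ → List Ins → Prop
  | _, [] => True
  | p, i :: w => InsAt M p i ∧ StrAt M (p + 1) w

/-- Two memories have the same instructions at position `p`. -/
def SameIns (M M' : Mem) (p : ℕ) : Prop :=
  M 10 p = M' 10 p ∧ M 11 p = M' 11 p ∧ M 12 p = M' 12 p ∧ M 13 p = M' 13 p

theorem InsAt.congr {M M' : Mem} {p : ℕ} {i : Ins} (h : InsAt M p i) (hs : SameIns M M' p) :
    InsAt M' p i := by
  obtain ⟨h0, h1, h2, h3⟩ := hs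
  cases i <;> simp_all [InsAt]

theorem StrAt.congr {M M' : Mem} {p : ℕ} {w : List Ins} (h : StrAt M p w)
    (hs : ∀ q, p ≤ q → q < p + w.length → SameIns M M' q) : StrAt M' p w := by
  induction w generalizing p with
  | nil => trivial
  | cons i w ih =>
    simp only [List.length_cons] at hs
    exact ⟨h.1.congr (hs p le_rfl (by omega)), ih h.2 fun q h1 h2 => hs q (by omega) (by omega)⟩

theorem strAt_append (M : Mem) (p : ℕ) (w w' : List Ins) :
    StrAt M p (w ++ w') ↔ StrAt M p w ∧ StrAt M (p + w.length) w' := by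
  induction w generalizing p with
  | nil => simp [StrAt]
  | cons i w ih => simp [StrAt, ih, and_assoc, add_assoc, add_comm 1]

/-- A stack of numbers; its top element is the last one in the array. -/
def KAt (f : ℕ → ℕ) : List ℕ → Prop
  | [] => True
  | x :: l => f (l.length + 1) = x ∧ KAt f l

theorem KAt.update {f : ℕ → ℕ} {l : List ℕ} (h : KAt f l) {i : ℕ} (hi : l.length < i) (v : ℕ) :
    KAt (Function.update f i v) l := by
  induction l with
  | nil => trivial
  | cons x l ih =>
    simp only [List.length_cons] at hi
    exact ⟨by rw [Function.update_of_ne (by omega), h.1], ih h.2 (by omega)⟩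

/-- A stack of optional gates. -/
def VAt (f g : ℕ → ℕ) : List (Option ℕ) → Prop
  | [] => True
  | none :: l => f (l.length + 1) = 1 ∧ VAt f g l
  | some x :: l => f (l.length + 1) = 0 ∧ g (l.length + 1) = x ∧ VAt f g l

theorem VAt.update_left {f g : ℕ → ℕ} {l : List (Option ℕ)} (h : VAt f g l) {i : ℕ}
    (hi : l.length < i) (v : ℕ) : VAt (Function.update f i v) g l := by
  induction l with
  | nil => trivial
  | cons x l ih =>
    simp only [List.length_cons] at hi
    cases x with
    | none => exact ⟨by rw [Function.update_of_ne (by omega), h.1], ih h.2 (by omega)⟩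
    | some x =>
      exact ⟨by rw [Function.update_of_ne (by omega), h.1], h.2.1, ih h.2.2 (by omega)⟩

theorem VAt.update_right {f g : ℕ → ℕ} {l : List (Option ℕ)} (h : VAt f g l) {i : ℕ}
    (hi : l.length < i) (v : ℕ) : VAt f (Function.update g i v) l := by
  induction l with
  | nil => trivial
  | cons x l ih =>
    simp only [List.length_cons] at hi
    cases x with
    | none => exact ⟨h.1, ih h.2 (by omega)⟩
    | some x =>
      exact ⟨h.1, by rw [Function.update_of_ne (by omega), h.2.1], ih h.2.2 (by omega)⟩

/-- The memory during the processing of a right-hand side: the list of gates, the emitted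
instructions, the stack of values, the stack of positions in skeletons, and the position in the
input. -/
structure St {k : ℕ} (M₀ : Mem) (o₀ : ℕ) (M : Mem) (gs : List (PreGate k)) (out : List Ins)
    (V : List (Option ℕ)) (K : List ℕ) (tp : ℕ) : Prop where
  fr0 : M 0 = M₀ 0
  fr25 : M 25 = M₀ 25
  low : ∀ p < o₀, SameIns M₀ M p
  len : M 6 0 = 2 + (gcode gs).length
  code : Seg (M 2) 3 (gcode gs)
  cnt : M 7 0 = gs.length
  str : StrAt M o₀ out
  o : M 14 0 = o₀ + out.length
  vsp : M 15 0 = V.length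
  vst : VAt (M 16) (M 17) V
  ksp : M 18 0 = K.length
  kst : KAt (M 19) K
  tp : M 20 0 = tp

end Arith

/-! ### Commands for the symbolic execution of right-hand sides -/

namespace RAM

/-- Append a gate with an operation to the output. -/
def mkOp (f i j : Ex) : Cmd :=
  .set 2 (.add (.var 6) (.lit 1)) f ;;
  .set 2 (.add (.var 6) (.lit 2)) i ;;
  .set 2 (.add (.var 6) (.lit 3)) j ;;
  .inc 6 3 ;; .inc 7 1

/-- Append a leaf with an argument to the output. -/
def mkLeaf (t a : Ex) : Cmd :=
  .set 2 (.add (.var 6) (.lit 1)) t ;;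
  .set 2 (.add (.var 6) (.lit 2)) a ;;
  .inc 6 2 ;; .inc 7 1

/-- The number of the last gate. -/
abbrev lastGate : Ex := .sub (.var 7) (.lit 1)

/-- The position of the last emitted instruction. -/
abbrev lastIns : Ex := .sub (.var 14) (.lit 1)

/-- Apply the affine map given by the cells `22`, `23`, `24` to the top of the stack of values. -/
def applyAff : Cmd :=
  .ite (.get 16 (.var 15))
    (mkOp (.lit 6) (.var 22) (.get 11 lastIns) ;;
      .set 11 lastIns lastGate ;;
      mkOp (.lit 6) (.get 12 lastIns) (.var 23) ;;
      .set 12 lastIns lastGate ;;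
      mkOp (.lit 6) (.var 22) (.get 13 lastIns) ;;
      mkOp (.lit 6) lastGate (.var 23) ;;
      mkOp (.lit 5) lastGate (.var 24) ;;
      .set 13 lastIns lastGate)
    (mkOp (.lit 6) (.var 22) (.get 17 (.var 15)) ;;
      mkOp (.lit 6) lastGate (.var 23) ;;
      mkOp (.lit 5) lastGate (.var 24) ;;
      .set 17 (.var 15) lastGate)

def setABC (a b c : Ex) : Cmd := .asg 22 a ;; .asg 23 b ;; .asg 24 c

/-- Push a gate on the stack of values. -/
def pushCon (g : Ex) : Cmd :=
  .inc 15 1 ;; .set 16 (.var 15) (.lit 0) ;; .set 17 (.var 15) g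

/-- Emit the instruction `e` and an identity map. -/
def emit (e : Ex) : Cmd :=
  .set 10 (.var 14) e ;;
  .set 10 (.add (.var 14) (.lit 1)) (.lit 2) ;;
  .set 11 (.add (.var 14) (.lit 1)) (.lit 1) ;;
  .set 12 (.add (.var 14) (.lit 1)) (.lit 1) ;;
  .set 13 (.add (.var 14) (.lit 1)) (.lit 0) ;;
  .inc 14 2

/-- Array `19` is a stack of return positions: each entry is the next instruction of a skeleton
under execution. An instruction `arg` calls `fetch`, which reads the next symbol of the right-hand
side; for an operation or a nonterminal, its skeleton is pushed here, so that nested skeletons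
follow the structure of the tree. -/
def pushFrame (e : Ex) : Cmd := .inc 18 1 ;; .set 19 (.var 18) e

abbrev token : Ex := .get 0 (.var 20)
abbrev tokenArg : Ex := .get 0 (.add (.var 20) (.lit 1))

/-- Process the next symbol of the right-hand side. -/
def fetch : Cmd :=
  .ite token
    (.ite (.sub token (.lit 2))
      (.ite (.sub token (.lit 4))
        (.ite (.sub token (.lit 6))
          (pushFrame (.get 25 tokenArg) ;; .inc 20 2)
          (.ite (.sub token (.lit 5)) (pushFrame (.lit 4)) (pushFrame (.lit 0)) ;; .inc 20 1))
        (mkLeaf token tokenArg ;; pushCon lastGate ;; .inc 20 2))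
      (pushCon (.sub token (.lit 1)) ;; .inc 20 1))
    (emit (.lit 1) ;; .inc 15 1 ;; .set 16 (.var 15) (.lit 1) ;; .inc 20 2)

abbrev opcode : Ex := .get 10 (.var 21)

/-- The instruction for an operation. -/
def opStep : Cmd :=
  .ite (.get 16 (.var 15))
    (.ite (.get 16 (.sub (.var 15) (.lit 1)))
      (emit opcode ;; .asg 15 (.sub (.var 15) (.lit 1)))
      (.ite (.sub opcode (.lit 5))
          (setABC (.get 17 (.sub (.var 15) (.lit 1))) (.lit 1) (.lit 0))
          (setABC (.lit 1) (.lit 1) (.get 17 (.sub (.var 15) (.lit 1)))) ;;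
        .asg 15 (.sub (.var 15) (.lit 1)) ;; .set 16 (.var 15) (.lit 1) ;; applyAff))
    (.ite (.sub opcode (.lit 5))
        (setABC (.lit 1) (.get 17 (.var 15)) (.lit 0))
        (setABC (.lit 1) (.lit 1) (.get 17 (.var 15))) ;;
      .asg 15 (.sub (.var 15) (.lit 1)) ;; applyAff)

/-- Execute the instruction whose position is in cell `21`. -/
def vmBody : Cmd :=
  .ite opcode
    (.ite (.sub opcode (.lit 1))
      (.ite (.sub opcode (.lit 2))
        (.ite (.sub opcode (.lit 3))
          opStep
          (pushCon (.get 13 (.var 21))))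
        (setABC (.get 11 (.var 21)) (.get 12 (.var 21)) (.get 13 (.var 21)) ;; applyAff))
      fetch)
    (.asg 18 (.sub (.var 18) (.lit 1)))

/-- One step of the machine that processes a right-hand side. -/
def vmStep : Cmd :=
  .ite (.var 18)
    (.asg 21 (.get 19 (.var 18)) ;; .set 19 (.var 18) (.add (.var 21) (.lit 1)) ;; vmBody)
    .skip

end RAM

/-! ### Effect of the commands on the memory -/

namespace Arith

open RAM

theorem Seg.snoc_update {f : ℕ → ℕ} {p q v : ℕ} {l : List ℕ} (h : Seg f p l) (hq : p + l.length ≤ q) :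
    Seg (Function.update f q v) p l := h.update (Or.inr hq)

theorem StrAt.of_arrays {M M' : Mem} {p : ℕ} {w : List Ins} (h : StrAt M p w)
    (h0 : M' 10 = M 10) (h1 : M' 11 = M 11) (h2 : M' 12 = M 12) (h3 : M' 13 = M 13) :
    StrAt M' p w :=
  h.congr fun q _ _ => by simp [SameIns, h0, h1, h2, h3]

section memory

variable {k : ℕ} {M₀ M : Mem} {o₀ : ℕ} {gs : List (PreGate k)} {out : List Ins}
  {V : List (Option ℕ)} {K : List ℕ} {tp : ℕ}

/-- The operands are evaluated after the preceding cells of the new gate have been written to array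
`2`; the hypotheses with arbitrary x and y say that these writes do not disturb them. -/
theorem St.run_mkOp (h : St M₀ o₀ M gs out V K tp) (f : Op) (ef ei ej : Ex) {i j : ℕ}
    (hf : ef.eval M = f.num) (hei : ∀ x, ei.eval (M.write 2 (M 6 0 + 1) x) = i)
    (hej : ∀ x y, ej.eval ((M.write 2 (M 6 0 + 1) x).write 2 (M 6 0 + 2) y) = j) :
    St M₀ o₀ ((mkOp ef ei ej).run M) (.op f i j :: gs) out V K tp := by
  have hcode : PreGate.code (.op f i j : PreGate k) = [f.num, i, j] := by cases f <;> rfl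
  have e1 : (mkOp ef ei ej).run M 2 = Function.update (Function.update (Function.update (M 2)
      (M 6 0 + 1) f.num) (M 6 0 + 2) i) (M 6 0 + 3) j := by
    simp [mkOp, Cmd.run_seq, Cmd.run_set, Mem.write_self, Mem.write_ne, hf, hei, hej]
  have e2 : ∀ a, a ≠ 2 → a ≠ 6 → a ≠ 7 → (mkOp ef ei ej).run M a = M a := by
    intro a h2 h6 h7
    simp [mkOp, Cmd.run_seq, Cmd.run_set, Mem.write_ne, h2, h6, h7]
  have e6 : (mkOp ef ei ej).run M 6 0 = M 6 0 + 3 := by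
    simp [mkOp, Cmd.run_seq, Cmd.run_set, Mem.write_self, Mem.write_ne]
  have e7 : (mkOp ef ei ej).run M 7 0 = M 7 0 + 1 := by
    simp [mkOp, Cmd.run_seq, Cmd.run_set, Mem.write_self, Mem.write_ne]
  have hseg := h.code
  have hlen := h.len
  constructor
  · rw [e2 _ (by decide) (by decide) (by decide), h.fr0]
  · rw [e2 _ (by decide) (by decide) (by decide), h.fr25]
  · intro p hp
    simpa [SameIns, e2] using h.low p hp
  · rw [e6, h.len, gcode, hcode]; simp [add_assoc]
  · rw [e1, gcode, hcode, seg_append, hlen]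
    refine ⟨?_, ?_⟩
    · repeat refine Seg.snoc_update ?_ (by omega)
      exact hseg
    · simp [show 3 + (gcode gs).length = 2 + (gcode gs).length + 1 by omega]
  · rw [e7, h.cnt]; rfl
  · exact h.str.of_arrays (by simp [e2]) (by simp [e2]) (by simp [e2]) (by simp [e2])
  · simpa [e2] using h.o
  · simpa [e2] using h.vsp
  · simpa [e2] using h.vst
  · simpa [e2] using h.ksp
  · simpa [e2] using h.kst
  · simpa [e2] using h.tp

theorem St.of_arrays {M' : Mem} {K' : List ℕ} {tp' : ℕ} (h : St M₀ o₀ M gs out V K tp)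
    (he : ∀ a ∈ [0, 2, 6, 7, 10, 11, 12, 13, 14, 15, 16, 17, 25], M' a = M a)
    (hk : M' 18 0 = K'.length) (hk' : KAt (M' 19) K') (ht : M' 20 0 = tp') :
    St M₀ o₀ M' gs out V K' tp' := by
  simp only [List.mem_cons, List.not_mem_nil, or_false, forall_eq_or_imp, forall_eq] at he
  obtain ⟨e0, e2, e6, e7, e10, e11, e12, e13, e14, e15, e16, e17, e25⟩ := he
  exact ⟨e0 ▸ h.fr0, e25 ▸ h.fr25, fun p hp => by simpa [SameIns, e10, e11, e12, e13] using h.low p hp,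
    e6 ▸ h.len, e2 ▸ h.code, e7 ▸ h.cnt, h.str.of_arrays e10 e11 e12 e13, e14 ▸ h.o, e15 ▸ h.vsp,
    e16 ▸ e17 ▸ h.vst, hk, hk', ht⟩

theorem St.last {a b c : ℕ} (h : St M₀ o₀ M gs (out ++ [.aff a b c]) V K tp) :
    M 14 0 - 1 = o₀ + out.length ∧ M 11 (M 14 0 - 1) = a ∧ M 12 (M 14 0 - 1) = b ∧
      M 13 (M 14 0 - 1) = c := by
  have h1 := h.o
  have h2 := (strAt_append _ _ _ _).1 h.str
  have h3 : M 14 0 - 1 = o₀ + out.length := by rw [h1, List.length_append]; simp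
  rw [h3]
  exact ⟨rfl, h2.2.1.2⟩

theorem St.set_last {a b c r x a' b' c' : ℕ} (h : St M₀ o₀ M gs (out ++ [.aff a b c]) V K tp)
    (hr : r = 11 ∧ (a', b', c') = (x, b, c) ∨ r = 12 ∧ (a', b', c') = (a, x, c) ∨
      r = 13 ∧ (a', b', c') = (a, b, x)) :
    St M₀ o₀ (M.write r (M 14 0 - 1) x) gs (out ++ [.aff a' b' c']) V K tp := by
  obtain ⟨l1, l2, l3, l4⟩ := h.last
  obtain ⟨s1, s2, -⟩ := (strAt_append _ _ _ _).1 h.str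
  have hs : ∀ q, q ≠ M 14 0 - 1 → SameIns M (M.write r (M 14 0 - 1) x) q := by
    intro q hq
    rcases hr with ⟨rfl, -⟩ | ⟨rfl, -⟩ | ⟨rfl, -⟩ <;>
    simp [SameIns, Mem.write_self, Mem.write_ne, Function.update_of_ne hq]
  have hne : ∀ b, b ≠ 11 → b ≠ 12 → b ≠ 13 → M.write r (M 14 0 - 1) x b = M b := by
    intro b h1 h2 h3
    rcases hr with ⟨rfl, -⟩ | ⟨rfl, -⟩ | ⟨rfl, -⟩ <;> rw [Mem.write_ne] <;> assumption
  constructor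
  · simpa [hne] using h.fr0
  · simpa [hne] using h.fr25
  · intro p hp
    obtain ⟨a1, a2, a3, a4⟩ := h.low p hp
    obtain ⟨b1, b2, b3, b4⟩ := hs p (by omega)
    exact ⟨a1.trans b1, a2.trans b2, a3.trans b3, a4.trans b4⟩
  · simpa [hne] using h.len
  · simpa [hne] using h.code
  · simpa [hne] using h.cnt
  · rw [strAt_append]
    refine ⟨s1.congr fun q _ hq => hs q (by omega), ?_, trivial⟩
    rw [← l1] at s2 ⊢
    obtain ⟨t1, t2, t3, t4⟩ := s2
    rcases hr with ⟨rfl, hr⟩ | ⟨rfl, hr⟩ | ⟨rfl, hr⟩ <;> obtain ⟨rfl, rfl, rfl⟩ := Prod.ext_iff.1 hr |>.imp id Prod.ext_iff.1 <;>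
    simp_all [InsAt, Mem.write_self, Mem.write_ne]
  · simpa [hne] using h.o
  · simpa [hne] using h.vsp
  · simpa [hne] using h.vst
  · simpa [hne] using h.ksp
  · simpa [hne] using h.kst
  · simpa [hne] using h.tp

theorem keeps_mkOp {a : ℕ} (f i j : Ex) (M : Mem) (h2 : a ≠ 2 := by decide) (h6 : a ≠ 6 := by decide)
    (h7 : a ≠ 7 := by decide) : (mkOp f i j).run M a = M a :=
  Cmd.run_of_keeps _ (by simp [mkOp, Cmd.Keeps, h2.symm, h6.symm, h7.symm]) M

/-- The state of the memory together with the three coefficients of an affine map. -/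
def StC (M₀ : Mem) (o₀ : ℕ) (M : Mem) (gs : List (PreGate k)) (out : List Ins)
    (V : List (Option ℕ)) (K : List ℕ) (tp a b c : ℕ) : Prop :=
  St M₀ o₀ M gs out V K tp ∧ M 22 0 = a ∧ M 23 0 = b ∧ M 24 0 = c

variable {a b c : ℕ}

theorem StC.run_mkOp (h : StC M₀ o₀ M gs out V K tp a b c) (f : Op) (ei ej : Ex) {i j : ℕ}
    (hei : ei.eval M = i) (hej : ej.eval M = j) (hi2 : ei.Avoids 2) (hj2 : ej.Avoids 2) :
    StC M₀ o₀ ((mkOp (.lit f.num) ei ej).run M) (.op f i j :: gs) out V K tp a b c := by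
  have hw : ∀ (e : Ex) (N : Mem) (x y : ℕ), e.Avoids 2 → e.eval (N.write 2 x y) = e.eval N := by
    intro e N x y he
    induction e with
    | lit n => rfl
    | get a e ih =>
      simp only [Ex.Avoids, Bool.and_eq_true, bne_iff_ne] at he
      simp [ih he.2, Mem.write_ne _ _ _ he.1]
    | add e₁ e₂ h₁ h₂ => simp at he; simp [h₁ he.1, h₂ he.2]
    | sub e₁ e₂ h₁ h₂ => simp at he; simp [h₁ he.1, h₂ he.2]
    | mulmod e₁ e₂ m h₁ h₂ hm => simp at he; simp [h₁ he.1.1, h₂ he.1.2, hm he.2]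
  refine ⟨h.1.run_mkOp f _ _ _ rfl (fun x => by rw [hw _ _ _ _ hi2, hei])
    (fun x y => by rw [hw _ _ _ _ hj2, hw _ _ _ _ hj2, hej]), ?_, ?_, ?_⟩
  · rw [keeps_mkOp]; exact h.2.1
  · rw [keeps_mkOp]; exact h.2.2.1
  · rw [keeps_mkOp]; exact h.2.2.2

theorem StC.set_last {g : PreGate k} {r x y z x' y' z' : ℕ}
    (h : StC M₀ o₀ M (g :: gs) (out ++ [.aff x y z]) V K tp a b c)
    (hr : r = 11 ∧ (x', y', z') = (gs.length, y, z) ∨ r = 12 ∧ (x', y', z') = (x, gs.length, z) ∨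
      r = 13 ∧ (x', y', z') = (x, y, gs.length)) :
    StC M₀ o₀ ((Cmd.set r lastIns lastGate).run M) (g :: gs) (out ++ [.aff x' y' z']) V K tp
      a b c := by
  have hc := h.1.cnt
  have e : (Cmd.set r lastIns lastGate).run M = M.write r (M 14 0 - 1) gs.length := by
    simp [Cmd.run_set, hc]
  rw [e]
  refine ⟨h.1.set_last hr, ?_⟩
  rcases hr with ⟨rfl, -⟩ | ⟨rfl, -⟩ | ⟨rfl, -⟩ <;> simpa [Mem.write_ne] using h.2

/-- The composition is a·(x·X·y + z)·b + c = (a·x)·X·(y·b) + (a·z·b + c); the five new gates compute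
its three coefficients. The last instruction is overwritten instead of appending a new one, which
keeps the length of a skeleton independent of the number of affine maps that are met. -/
theorem St.run_applyAff_var {x y z : ℕ}
    (h : StC M₀ o₀ M gs (out ++ [.aff x y z]) (none :: V) K tp a b c) :
    St M₀ o₀ (applyAff.run M)
      (.op .add (gs.length + 3) c :: .op .mul (gs.length + 2) b :: .op .mul a z :: .op .mul y b ::
        .op .mul a x :: gs)
      (out ++ [.aff gs.length (gs.length + 1) (gs.length + 4)]) (none :: V) K tp := by
  have hv : M 16 (M 15 0) = 1 := by rw [h.1.vsp]; exact h.1.vst.1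
  rw [applyAff, Cmd.run_ite, if_neg (by simp [hv])]
  simp only [Cmd.run_seq]
  have h1 := h.run_mkOp .mul (.var 22) (.get 11 lastIns) h.2.1 h.1.last.2.1 rfl rfl
  have h2 := h1.set_last (Or.inl ⟨rfl, rfl⟩)
  have h3 := h2.run_mkOp .mul (.get 12 lastIns) (.var 23) h2.1.last.2.2.1 h2.2.2.1 rfl rfl
  have h4 := h3.set_last (Or.inr (Or.inl ⟨rfl, rfl⟩))
  have h5 := h4.run_mkOp .mul (.var 22) (.get 13 lastIns) h4.2.1 h4.1.last.2.2.2 rfl rfl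
  have h6 := h5.run_mkOp .mul lastGate (.var 23) (i := gs.length + 2) (by simp [h5.1.cnt]) h5.2.2.1
    rfl rfl
  have h7 := h6.run_mkOp .add lastGate (.var 24) (i := gs.length + 3) (by simp [h6.1.cnt]) h6.2.2.2
    rfl rfl
  exact (h7.set_last (Or.inr (Or.inr ⟨rfl, rfl⟩))).1

theorem St.set_top {g x : ℕ} (h : St M₀ o₀ M gs out (some g :: V) K tp) :
    St M₀ o₀ (M.write 17 (M 15 0) x) gs out (some x :: V) K tp := by
  have hv := h.vsp
  obtain ⟨v1, v2, v3⟩ := h.vst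
  have hne : ∀ b, b ≠ 17 → M.write 17 (M 15 0) x b = M b := fun b hb => Mem.write_ne _ _ _ hb
  refine ⟨by simpa [hne] using h.fr0, by simpa [hne] using h.fr25,
    fun p hp => by simpa [SameIns, hne] using h.low p hp, by simpa [hne] using h.len,
    by simpa [hne] using h.code, by simpa [hne] using h.cnt,
    h.str.of_arrays (by simp [hne]) (by simp [hne]) (by simp [hne]) (by simp [hne]),
    by simpa [hne] using h.o, by simpa [hne] using hv, ?_, by simpa [hne] using h.ksp,
    by simpa [hne] using h.kst, by simpa [hne] using h.tp⟩
  rw [hne 16 (by decide), Mem.write_self, hv]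
  exact ⟨v1, by simp, v3.update_right (by simp) x⟩

/-- On a constant entry the affine map is computed by three gates, and no instruction is emitted. -/
theorem St.run_applyAff_con {g : ℕ}
    (h : StC M₀ o₀ M gs out (some g :: V) K tp a b c) :
    St M₀ o₀ (applyAff.run M)
      (.op .add (gs.length + 1) c :: .op .mul gs.length b :: .op .mul a g :: gs)
      out (some (gs.length + 2) :: V) K tp := by
  have hv : M 16 (M 15 0) = 0 := by rw [h.1.vsp]; exact h.1.vst.1
  have hg : M 17 (M 15 0) = g := by rw [h.1.vsp]; exact h.1.vst.2.1
  rw [applyAff, Cmd.run_ite, if_pos (by simp [hv])]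
  simp only [Cmd.run_seq]
  have h5 := h.run_mkOp .mul (.var 22) (.get 17 (.var 15)) h.2.1 hg rfl rfl
  have h6 := h5.run_mkOp .mul lastGate (.var 23) (i := gs.length) (by simp [h5.1.cnt]) h5.2.2.1
    rfl rfl
  have h7 := h6.run_mkOp .add lastGate (.var 24) (i := gs.length + 1) (by simp [h6.1.cnt]) h6.2.2.2
    rfl rfl
  have key : ∀ N : Mem, N 7 0 = gs.length + 3 →
      (Cmd.set 17 (.var 15) lastGate).run N = N.write 17 (N 15 0) (gs.length + 2) := by
    intro N hN
    simp [Cmd.run_set, hN]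
  refine (key _ ?_).symm ▸ h7.1.set_top
  exact h7.1.cnt

theorem St.run_pushCon {e : Ex} {g : ℕ} (h : St M₀ o₀ M gs out V K tp)
    (he : e.eval ((M.write 15 0 (M 15 0 + 1)).write 16 (M 15 0 + 1) 0) = g) :
    St M₀ o₀ ((pushCon e).run M) gs out (some g :: V) K tp := by
  have hv := h.vsp
  have e1 : (pushCon e).run M =
      ((M.write 15 0 (M 15 0 + 1)).write 16 (M 15 0 + 1) 0).write 17 (M 15 0 + 1) g := by
    simp [pushCon, Cmd.run_seq, Cmd.run_set, Mem.write_self, Mem.write_ne, he]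
  rw [e1]
  have hne : ∀ b, b ≠ 15 → b ≠ 16 → b ≠ 17 →
      ((M.write 15 0 (M 15 0 + 1)).write 16 (M 15 0 + 1) 0).write 17 (M 15 0 + 1) g b = M b :=
    fun b h1 h2 h3 => by rw [Mem.write_ne _ _ _ h3, Mem.write_ne _ _ _ h2, Mem.write_ne _ _ _ h1]
  refine ⟨by simpa [hne] using h.fr0, by simpa [hne] using h.fr25,
    fun p hp => by simpa [SameIns, hne] using h.low p hp, by simpa [hne] using h.len,
    by simpa [hne] using h.code, by simpa [hne] using h.cnt,
    h.str.of_arrays (by simp [hne]) (by simp [hne]) (by simp [hne]) (by simp [hne]),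
    by simpa [hne] using h.o, by simp [Mem.write_self, Mem.write_ne, hv], ?_,
    by simpa [hne] using h.ksp, by simpa [hne] using h.kst, by simpa [hne] using h.tp⟩
  simp only [Mem.write_self, ne_eq, Nat.reduceEqDiff, not_false_eq_true, Mem.write_ne, hv]
  exact ⟨by simp, by simp, (h.vst.update_left (by simp) 0).update_right (by simp) g⟩

theorem St.run_mkLeaf {et ea : Ex} {t : ℕ} {l : Leaf k} (h : St M₀ o₀ M gs out V K tp)
    (hl : l.code = [t, a]) (ht : et.eval M = t) (ha : ∀ x, ea.eval (M.write 2 (M 6 0 + 1) x) = a) :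
    St M₀ o₀ ((mkLeaf et ea).run M) (.leaf l :: gs) out V K tp := by
  have e1 : (mkLeaf et ea).run M 2 = Function.update (Function.update (M 2)
      (M 6 0 + 1) t) (M 6 0 + 2) a := by
    simp [mkLeaf, Cmd.run_seq, Cmd.run_set, Mem.write_self, Mem.write_ne, ht, ha]
  have e2 : ∀ a, a ≠ 2 → a ≠ 6 → a ≠ 7 → (mkLeaf et ea).run M a = M a := by
    intro a h2 h6 h7
    simp [mkLeaf, Cmd.run_seq, Cmd.run_set, Mem.write_ne, h2, h6, h7]
  have e6 : (mkLeaf et ea).run M 6 0 = M 6 0 + 2 := by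
    simp [mkLeaf, Cmd.run_seq, Cmd.run_set, Mem.write_self, Mem.write_ne]
  have e7 : (mkLeaf et ea).run M 7 0 = M 7 0 + 1 := by
    simp [mkLeaf, Cmd.run_seq, Cmd.run_set, Mem.write_self, Mem.write_ne]
  have hlen := h.len
  refine ⟨by simpa [e2] using h.fr0, by simpa [e2] using h.fr25,
    fun p hp => by simpa [SameIns, e2] using h.low p hp, ?_, ?_, by rw [e7, h.cnt]; rfl,
    h.str.of_arrays (by simp [e2]) (by simp [e2]) (by simp [e2]) (by simp [e2]),
    by simpa [e2] using h.o, by simpa [e2] using h.vsp, by simpa [e2] using h.vst,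
    by simpa [e2] using h.ksp, by simpa [e2] using h.kst, by simpa [e2] using h.tp⟩
  · rw [e6, hlen, gcode, PreGate.code, hl]; simp [add_assoc]
  · rw [e1, gcode, PreGate.code, hl, seg_append, hlen]
    refine ⟨?_, ?_⟩
    · repeat refine Seg.snoc_update ?_ (by omega)
      exact h.code
    · simp [show 3 + (gcode gs).length = 2 + (gcode gs).length + 1 by omega]

theorem St.run_emit {e : Ex} {i : Ins} {n : ℕ} (h : St M₀ o₀ M gs out V K tp)
    (he : e.eval M = n) (hi : i = .arg ∧ n = 1 ∨ ∃ f, i = .op f ∧ n = f.num) :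
    St M₀ o₀ ((emit e).run M) gs (out ++ [i, .aff 1 1 0]) V K tp := by
  have ho := h.o
  have e2 : ∀ a, a ≠ 10 → a ≠ 11 → a ≠ 12 → a ≠ 13 → a ≠ 14 → (emit e).run M a = M a := by
    intro a h0 h1 h2 h3 h4
    simp [emit, Cmd.run_seq, Cmd.run_set, Mem.write_ne, h0, h1, h2, h3, h4]
  have hs : ∀ q < M 14 0, SameIns M ((emit e).run M) q := by
    intro q hq
    have h1 : q ≠ M 14 0 := hq.ne
    have h2 : q ≠ M 14 0 + 1 := by omega
    simp [SameIns, emit, Cmd.run_seq, Cmd.run_set, Mem.write_self, Mem.write_ne,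
      Function.update_of_ne h1, Function.update_of_ne h2]
  refine ⟨by simpa [e2] using h.fr0, by simpa [e2] using h.fr25, ?_, by simpa [e2] using h.len,
    by simpa [e2] using h.code, by simpa [e2] using h.cnt, ?_, ?_, by simpa [e2] using h.vsp,
    by simpa [e2] using h.vst, by simpa [e2] using h.ksp, by simpa [e2] using h.kst,
    by simpa [e2] using h.tp⟩
  · intro p hp
    obtain ⟨a1, a2, a3, a4⟩ := h.low p hp
    obtain ⟨b1, b2, b3, b4⟩ := hs p (by omega)
    exact ⟨a1.trans b1, a2.trans b2, a3.trans b3, a4.trans b4⟩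
  · rw [strAt_append, ← ho]
    refine ⟨h.str.congr fun q _ hq => hs q (by omega), ?_, ?_, trivial⟩
    · have : (emit e).run M 10 (M 14 0) = n := by
        simp [emit, Cmd.run_seq, Cmd.run_set, Mem.write_self, Mem.write_ne, he]
      rcases hi with ⟨rfl, rfl⟩ | ⟨f, rfl, rfl⟩ <;> exact this
    · simp [InsAt, emit, Cmd.run_seq, Cmd.run_set, Mem.write_self, Mem.write_ne]
  · simp [emit, Cmd.run_seq, Cmd.run_set, Mem.write_self, Mem.write_ne, ho, add_assoc]

theorem St.run_pushVar (h : St M₀ o₀ M gs out V K tp) :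
    St M₀ o₀ ((Cmd.inc 15 1 ;; .set 16 (.var 15) (.lit 1)).run M) gs out (none :: V) K tp := by
  have hv := h.vsp
  have e1 : (Cmd.inc 15 1 ;; .set 16 (.var 15) (.lit 1)).run M =
      (M.write 15 0 (M 15 0 + 1)).write 16 (M 15 0 + 1) 1 := by
    simp [Cmd.run_seq, Cmd.run_set, Mem.write_self]
  rw [e1]
  have hne : ∀ b, b ≠ 15 → b ≠ 16 →
      (M.write 15 0 (M 15 0 + 1)).write 16 (M 15 0 + 1) 1 b = M b :=
    fun b h1 h2 => by rw [Mem.write_ne _ _ _ h2, Mem.write_ne _ _ _ h1]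
  refine ⟨by simpa [hne] using h.fr0, by simpa [hne] using h.fr25,
    fun p hp => by simpa [SameIns, hne] using h.low p hp, by simpa [hne] using h.len,
    by simpa [hne] using h.code, by simpa [hne] using h.cnt,
    h.str.of_arrays (by simp [hne]) (by simp [hne]) (by simp [hne]) (by simp [hne]),
    by simpa [hne] using h.o, by simp [Mem.write_self, Mem.write_ne, hv], ?_,
    by simpa [hne] using h.ksp, by simpa [hne] using h.kst, by simpa [hne] using h.tp⟩
  simp only [Mem.write_self, ne_eq, Nat.reduceEqDiff, not_false_eq_true, Mem.write_ne, hv]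
  exact ⟨by simp, h.vst.update_left (by simp) 1⟩

theorem St.pop {v : Option ℕ} (h : St M₀ o₀ M gs out (v :: V) K tp) :
    St M₀ o₀ (M.write 15 0 (M 15 0 - 1)) gs out V K tp := by
  have hv := h.vsp
  have hne : ∀ b, b ≠ 15 → (M.write 15 0 (M 15 0 - 1)) b = M b :=
    fun b h1 => by rw [Mem.write_ne _ _ _ h1]
  refine ⟨by simpa [hne] using h.fr0, by simpa [hne] using h.fr25,
    fun p hp => by simpa [SameIns, hne] using h.low p hp, by simpa [hne] using h.len,
    by simpa [hne] using h.code, by simpa [hne] using h.cnt,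
    h.str.of_arrays (by simp [hne]) (by simp [hne]) (by simp [hne]) (by simp [hne]),
    by simpa [hne] using h.o, by simp [Mem.write_self, hv], ?_,
    by simpa [hne] using h.ksp, by simpa [hne] using h.kst, by simpa [hne] using h.tp⟩
  rw [hne 16 (by decide), hne 17 (by decide)]
  cases v with
  | none => exact h.vst.2
  | some g => exact h.vst.2.2

theorem St.top_to_var {v : Option ℕ} (h : St M₀ o₀ M gs out (v :: V) K tp) :
    St M₀ o₀ (M.write 16 (M 15 0) 1) gs out (none :: V) K tp := by
  have hv := h.vsp
  have hne : ∀ b, b ≠ 16 → (M.write 16 (M 15 0) 1) b = M b :=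
    fun b h1 => by rw [Mem.write_ne _ _ _ h1]
  refine ⟨by simpa [hne] using h.fr0, by simpa [hne] using h.fr25,
    fun p hp => by simpa [SameIns, hne] using h.low p hp, by simpa [hne] using h.len,
    by simpa [hne] using h.code, by simpa [hne] using h.cnt,
    h.str.of_arrays (by simp [hne]) (by simp [hne]) (by simp [hne]) (by simp [hne]),
    by simpa [hne] using h.o, by simpa [hne] using hv, ?_,
    by simpa [hne] using h.ksp, by simpa [hne] using h.kst, by simpa [hne] using h.tp⟩
  rw [hne 17 (by decide), Mem.write_self, hv]
  have hV : VAt (M 16) (M 17) V := by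
    cases v with
    | none => exact h.vst.2
    | some g => exact h.vst.2.2
  exact ⟨by simp, hV.update_left (by simp) 1⟩

theorem St.top_kind {v : Option ℕ} (h : St M₀ o₀ M gs out (v :: V) K tp) :
    (v = none → M 16 (M 15 0) = 1) ∧
      ∀ g, v = some g → M 16 (M 15 0) = 0 ∧ M 17 (M 15 0) = g := by
  rw [h.vsp]
  refine ⟨?_, ?_⟩
  · rintro rfl; exact h.vst.1
  · rintro g rfl; exact ⟨h.vst.1, h.vst.2.1⟩

theorem St.snd_kind {u v : Option ℕ} (h : St M₀ o₀ M gs out (u :: v :: V) K tp) :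
    (v = none → M 16 (M 15 0 - 1) = 1) ∧
      ∀ g, v = some g → M 16 (M 15 0 - 1) = 0 ∧ M 17 (M 15 0 - 1) = g := by
  have := h.pop.top_kind
  simpa [Mem.write_self, Mem.write_ne] using this

theorem St.run_setABC (h : St M₀ o₀ M gs out V K tp) {ea eb ec : Ex} (ha : ea.eval M = a)
    (hb : ∀ x, eb.eval (M.write 22 0 x) = b)
    (hc : ∀ x y, ec.eval ((M.write 22 0 x).write 23 0 y) = c) :
    StC M₀ o₀ ((setABC ea eb ec).run M) gs out V K tp a b c := by
  have e : (setABC ea eb ec).run M = ((M.write 22 0 a).write 23 0 b).write 24 0 c := by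
    simp [setABC, Cmd.run_seq, Cmd.run_set, ha, hb, hc]
  rw [e]
  refine ⟨h.of_arrays ?_ ?_ ?_ ?_, ?_, ?_, ?_⟩
  · simp [Mem.write_ne]
  · simpa [Mem.write_ne] using h.ksp
  · simpa [Mem.write_ne] using h.kst
  · simpa [Mem.write_ne] using h.tp
  · simp [Mem.write_self, Mem.write_ne]
  · simp [Mem.write_self, Mem.write_ne]
  · simp [Mem.write_self]

theorem St.run_pushFrame {e : Ex} {x : ℕ} (h : St M₀ o₀ M gs out V K tp)
    (he : e.eval (M.write 18 0 (M 18 0 + 1)) = x) :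
    St M₀ o₀ ((pushFrame e).run M) gs out V (x :: K) tp := by
  have e1 : (pushFrame e).run M = (M.write 18 0 (M 18 0 + 1)).write 19 (M 18 0 + 1) x := by
    simp [pushFrame, Cmd.run_seq, Cmd.run_set, Mem.write_self, he]
  rw [e1]
  refine h.of_arrays (by simp [Mem.write_ne]) ?_ ?_ ?_
  · simp [Mem.write_ne, Mem.write_self, h.ksp]
  · rw [Mem.write_self, Mem.write_ne _ _ _ (by decide), h.ksp]
    exact ⟨by simp, h.kst.update (by simp) x⟩
  · simpa [Mem.write_ne] using h.tp

theorem St.run_next (h : St M₀ o₀ M gs out V K tp) (n : ℕ) :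
    St M₀ o₀ ((Cmd.inc 20 n).run M) gs out V K (tp + n) := by
  rw [Cmd.run_set]
  refine h.of_arrays (by simp [Mem.write_ne]) ?_ ?_ ?_
  · simpa [Mem.write_ne] using h.ksp
  · simpa [Mem.write_ne] using h.kst
  · simp [Mem.write_self, h.tp]

end memory

end Arith

/-! ### Meaning of the symbolic stack and of the emitted instructions -/

namespace Arith

open RAM

section semantics

variable {R : Type*} [Semiring R] {k : ℕ} (κ : Fin k → R) (χ : ℕ → R)

/-- The emitted instructions and the stack of values represent the values `vs`, for all values of
the parameters; `p` parameters have been read. -/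
structure Sem {ρ : ℕ} (gs₀ gs : List (PreGate k)) (out : List Ins) (V : List (Option ℕ)) (p : ℕ)
    (vs : (Fin ρ → R) → List R) : Prop where
  base : [.leaf .one, .leaf .zero] <:+ gs₀
  suf : gs₀ <:+ gs
  ord : Ordered gs
  idsV : ∀ g, some g ∈ V → g < gs.length
  idsOut : ∀ i ∈ out, i.Lt gs.length
  shape : out = [] ∨ ∃ out' a b c, out = out' ++ [.aff a b c]
  pot : out.length + 2 * V.count none = 4 * p
  sim : ∀ xs, ∃ cs, exec (gval κ χ gs) out (List.ofFn xs) [] = some ((List.ofFn xs).drop p, cs) ∧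
    Merge (gval κ χ gs) V cs (vs xs)

variable {κ χ} {ρ : ℕ} {gs₀ gs gs' : List (PreGate k)} {out : List Ins} {V : List (Option ℕ)} {p : ℕ}
  {vs : (Fin ρ → R) → List R} {x y : (Fin ρ → R) → R} {rest : (Fin ρ → R) → List R}
  {a b c g : ℕ} {v : Option ℕ}

theorem Sem.two_le (h : Sem κ χ gs₀ gs out V p vs) : 2 ≤ gs.length :=
  (h.base.trans h.suf).length_le

theorem Sem.gval_zero (h : Sem κ χ gs₀ gs out V p vs) : gval κ χ gs 0 = 0 := by
  rw [gval_suffix κ χ (h.base.trans h.suf) (by simp)]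
  rfl

theorem Sem.gval_one (h : Sem κ χ gs₀ gs out V p vs) : gval κ χ gs 1 = 1 := by
  rw [gval_suffix κ χ (h.base.trans h.suf) (by simp)]
  rfl

theorem Ins.Lt.mono {m n : ℕ} {i : Ins} (h : i.Lt m) (hmn : m ≤ n) : i.Lt n := by
  cases i with
  | arg => trivial
  | aff a b c => exact ⟨h.1.trans_le hmn, h.2.1.trans_le hmn, h.2.2.trans_le hmn⟩
  | op f => trivial
  | con g => exact Nat.lt_of_lt_of_le h hmn

theorem Sem.extend (h : Sem κ χ gs₀ gs out V p vs) (hs : gs <:+ gs') (ho : Ordered gs') :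
    Sem κ χ gs₀ gs' out V p vs := by
  refine ⟨h.base, h.suf.trans hs, ho, fun g hg => (h.idsV g hg).trans_le hs.length_le,
    fun i hi => (h.idsOut i hi).mono hs.length_le, h.shape, h.pot, fun xs => ?_⟩
  obtain ⟨cs, h1, h2⟩ := h.sim xs
  have hv : ∀ i < gs.length, gval κ χ gs i = gval κ χ gs' i := fun i hi =>
    (gval_suffix κ χ hs hi).symm
  exact ⟨cs, by rw [← exec_congr hv out h.idsOut, h1], h2.congr hv h.idsV⟩

theorem Sem.push_con (h : Sem κ χ gs₀ gs out V p vs) (hg : g < gs.length) :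
    Sem κ χ gs₀ gs out (some g :: V) p fun xs => gval κ χ gs g :: vs xs := by
  refine ⟨h.base, h.suf, h.ord, ?_, h.idsOut, h.shape, by simpa using h.pot, fun xs => ?_⟩
  · intro g' hg'
    rcases List.mem_cons.1 hg' with e | e
    · cases e; exact hg
    · exact h.idsV _ e
  · obtain ⟨cs, h1, h2⟩ := h.sim xs
    exact ⟨cs, h1, .con g h2⟩

theorem Merge.inv_some {v : ℕ → R} {c s : List R} (h : Merge v (some g :: V) c s) :
    ∃ s', s = v g :: s' ∧ Merge v V c s' := by
  cases h with
  | con _ h => exact ⟨_, rfl, h⟩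

theorem Merge.inv_none {v : ℕ → R} {c s : List R} (h : Merge v (none :: V) c s) :
    ∃ x c' s', s = x :: s' ∧ c = x :: c' ∧ Merge v V c' s' := by
  cases h with
  | var _ h => exact ⟨_, _, _, rfl, rfl, h⟩

theorem Sem.pop (h : Sem κ χ gs₀ gs out (some g :: V) p fun xs => y xs :: rest xs) :
    Sem κ χ gs₀ gs out V p rest ∧ (∀ xs, y xs = gval κ χ gs g) ∧ g < gs.length := by
  refine ⟨⟨h.base, h.suf, h.ord, fun g' hg' => h.idsV _ (List.mem_cons_of_mem _ hg'), h.idsOut,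
    h.shape, by simpa using h.pot, fun xs => ?_⟩, fun xs => ?_, h.idsV _ List.mem_cons_self⟩
  · obtain ⟨cs, h1, h2⟩ := h.sim xs
    obtain ⟨s', e, h3⟩ := h2.inv_some
    obtain rfl := (List.cons.inj e).2
    exact ⟨cs, h1, h3⟩
  · obtain ⟨cs, h1, h2⟩ := h.sim xs
    obtain ⟨s', e, -⟩ := h2.inv_some
    exact (List.cons.inj e).1

theorem Sem.pop_snd
    (h : Sem κ χ gs₀ gs out (none :: some g :: V) p fun xs => y xs :: x xs :: rest xs) :
    Sem κ χ gs₀ gs out (none :: V) p (fun xs => y xs :: rest xs) ∧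
      (∀ xs, x xs = gval κ χ gs g) ∧ g < gs.length := by
  refine ⟨⟨h.base, h.suf, h.ord, fun g' hg' => h.idsV _ ?_, h.idsOut,
    h.shape, by simpa using h.pot, fun xs => ?_⟩, fun xs => ?_,
    h.idsV _ (List.mem_cons_of_mem _ List.mem_cons_self)⟩
  · rcases List.mem_cons.1 hg' with e | e
    · cases e
    · exact List.mem_cons_of_mem _ (List.mem_cons_of_mem _ e)
  · obtain ⟨cs, h1, h2⟩ := h.sim xs
    obtain ⟨z, c', s', e, rfl, h3⟩ := h2.inv_none
    obtain ⟨s'', e', h4⟩ := h3.inv_some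
    obtain ⟨rfl, rfl⟩ := List.cons.inj e
    obtain rfl := (List.cons.inj e').2
    exact ⟨_, h1, .var _ h4⟩
  · obtain ⟨cs, h1, h2⟩ := h.sim xs
    obtain ⟨z, c', s', e, -, h3⟩ := h2.inv_none
    obtain ⟨s'', e', -⟩ := h3.inv_some
    rw [← (List.cons.inj e).2] at e'
    exact (List.cons.inj e').1

/-- The potential in `pot` is unchanged: two instructions are added and two symbolic entries merge
into one. Only reading a parameter increases it, by 4 = 2 + 2 for two instructions and one symbolic
entry. This is the source of the bound on the length of skeletons. The identity map emitted after
the operation is the instruction into which later affine maps are merged. -/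
theorem Sem.emit_op {f : Op}
    (h : Sem κ χ gs₀ gs out (none :: none :: V) p fun xs => y xs :: x xs :: rest xs) :
    Sem κ χ gs₀ gs (out ++ [.op f, .aff 1 1 0]) (none :: V) p
      fun xs => f.eval (x xs) (y xs) :: rest xs := by
  have h2 := h.two_le
  refine ⟨h.base, h.suf, h.ord, fun g' hg' => h.idsV _ (List.mem_cons_of_mem _ hg'), ?_,
    Or.inr ⟨out ++ [.op f], 1, 1, 0, by simp⟩, ?_, fun xs => ?_⟩
  · intro i hi
    rcases List.mem_append.1 hi with e | e
    · exact h.idsOut i e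
    · simp only [List.mem_cons, List.not_mem_nil, or_false] at e
      rcases e with rfl | rfl
      · trivial
      · exact ⟨by omega, by omega, by omega⟩
  · have := h.pot
    simp only [List.count_cons_self, List.length_append, List.length_cons, List.length_nil] at this ⊢
    omega
  · obtain ⟨cs, h1, h2⟩ := h.sim xs
    obtain ⟨z, c', s', e, rfl, h3⟩ := h2.inv_none
    obtain ⟨w, c', s'', e', rfl, h4⟩ := h3.inv_none
    obtain ⟨rfl, rfl⟩ := List.cons.inj e
    obtain ⟨rfl, rfl⟩ := List.cons.inj e'
    refine ⟨_, ?_, .var _ h4⟩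
    rw [exec_append, h1]
    simp [exec, h.gval_zero, h.gval_one]

theorem Sem.push_param (h : Sem κ χ gs₀ gs out V p vs) (hp : p < ρ) :
    Sem κ χ gs₀ gs (out ++ [.arg, .aff 1 1 0]) (none :: V) (p + 1)
      fun xs => xs ⟨p, hp⟩ :: vs xs := by
  have h2 := h.two_le
  refine ⟨h.base, h.suf, h.ord, fun g' hg' => h.idsV _ ?_, ?_,
    Or.inr ⟨out ++ [.arg], 1, 1, 0, by simp⟩, ?_, fun xs => ?_⟩
  · rcases List.mem_cons.1 hg' with e | e
    · cases e
    · exact e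
  · intro i hi
    rcases List.mem_append.1 hi with e | e
    · exact h.idsOut i e
    · simp only [List.mem_cons, List.not_mem_nil, or_false] at e
      rcases e with rfl | rfl
      · trivial
      · exact ⟨by omega, by omega, by omega⟩
  · have := h.pot
    simp only [List.count_cons_self, List.length_append, List.length_cons, List.length_nil] at this ⊢
    omega
  · obtain ⟨cs, h1, h2⟩ := h.sim xs
    refine ⟨_, ?_, .var _ h2⟩
    rw [exec_append, h1, List.drop_eq_getElem_cons (by simpa using hp)]
    simp [exec, h.gval_zero, h.gval_one]

theorem Sem.aff_con (h : Sem κ χ gs₀ gs out (some g :: V) p fun xs => x xs :: rest xs)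
    (ha : a < gs.length) (hb : b < gs.length) (hc : c < gs.length) :
    Sem κ χ gs₀ (.op .add (gs.length + 1) c :: .op .mul gs.length b :: .op .mul a g :: gs)
      out (some (gs.length + 2) :: V) p
      fun xs => (gval κ χ gs a * x xs * gval κ χ gs b + gval κ χ gs c) :: rest xs := by
  obtain ⟨h1, h2, h3⟩ := h.pop
  have ho : Ordered (.op .add (gs.length + 1) c :: .op .mul gs.length b :: .op .mul a g :: gs) := by
    refine ⟨⟨?_, ?_⟩, ⟨?_, ?_⟩, ⟨?_, ?_⟩, h.ord⟩ <;> (try simp only [List.length_cons]) <;> omega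
  have h4 := (h1.extend (gs' := .op .add (gs.length + 1) c :: .op .mul gs.length b ::
    .op .mul a g :: gs) ⟨[_, _, _], rfl⟩ ho).push_con (g := gs.length + 2) (by simp)
  convert h4 using 3 with xs
  rw [h2]
  have s1 : gs <:+ .op .mul a g :: gs := List.suffix_cons _ _
  have s2 : gs <:+ .op .mul gs.length b :: .op .mul a g :: gs := s1.trans (List.suffix_cons _ _)
  refine Eq.symm ((gval_cons_self κ χ (.op .add (gs.length + 1) c)
    (.op .mul gs.length b :: .op .mul a g :: gs)).trans ?_)
  change gval κ χ (.op .mul gs.length b :: .op .mul a g :: gs)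
    (.op .mul a g :: gs : List (PreGate k)).length + gval κ χ _ c = _
  rw [gval_suffix κ χ s2 hc, gval_cons_self]
  change gval κ χ (.op .mul a g :: gs) gs.length * gval κ χ _ b + _ = _
  rw [gval_suffix κ χ s1 hb, gval_cons_self]
  rfl

/-- The last instruction acts on the topmost value that the emitted instructions leave on their
stack, and this is the topmost symbolic entry, because constants are not part of that stack.
Changing its coefficients therefore changes exactly this entry. The identity behind it needs both
distributive laws and associativity, but no commutativity of multiplication. -/
theorem Sem.aff_var {s t u : ℕ}
    (h : Sem κ χ gs₀ gs (out ++ [.aff s t u]) (none :: V) p fun xs => x xs :: rest xs)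
    (ha : a < gs.length) (hb : b < gs.length) (hc : c < gs.length) :
    Sem κ χ gs₀ (.op .add (gs.length + 3) c :: .op .mul (gs.length + 2) b :: .op .mul a u ::
        .op .mul t b :: .op .mul a s :: gs)
      (out ++ [.aff gs.length (gs.length + 1) (gs.length + 4)]) (none :: V) p
      fun xs => (gval κ χ gs a * x xs * gval κ χ gs b + gval κ χ gs c) :: rest xs := by
  have hstu : s < gs.length ∧ t < gs.length ∧ u < gs.length := h.idsOut (.aff s t u) (by simp)
  obtain ⟨hs, ht, hu⟩ := hstu
  set gs' : List (PreGate k) := .op .add (gs.length + 3) c :: .op .mul (gs.length + 2) b ::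
    .op .mul a u :: .op .mul t b :: .op .mul a s :: gs with hgs'
  have ho : Ordered gs' := by
    refine ⟨⟨?_, ?_⟩, ⟨?_, ?_⟩, ⟨?_, ?_⟩, ⟨?_, ?_⟩, ⟨?_, ?_⟩, h.ord⟩ <;>
    (try simp only [List.length_cons]) <;> omega
  have hsuf : gs <:+ gs' := ⟨[_, _, _, _, _], rfl⟩
  have h4 := h.extend hsuf ho
  have hl : gs'.length = gs.length + 5 := rfl
  refine ⟨h4.base, h4.suf, ho, h4.idsV, ?_, Or.inr ⟨out, _, _, _, rfl⟩, ?_, fun xs => ?_⟩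
  · intro i hi
    rcases List.mem_append.1 hi with e | e
    · exact h4.idsOut i (List.mem_append_left _ e)
    · simp only [List.mem_cons, List.not_mem_nil, or_false] at e
      subst e
      exact ⟨by omega, by omega, by omega⟩
  · have := h.pot
    simp only [List.length_append, List.length_cons, List.length_nil] at this ⊢
    exact this
  · obtain ⟨cs, h1, h2⟩ := h4.sim xs
    obtain ⟨z, c', s', e, rfl, h3⟩ := h2.inv_none
    obtain ⟨rfl, rfl⟩ := List.cons.inj e
    · refine ⟨_, ?_, .var _ h3⟩
      rw [exec_append, Option.bind_eq_some_iff] at h1 ⊢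
      obtain ⟨⟨q, st⟩, e1, e2⟩ := h1
      refine ⟨(q, st), e1, ?_⟩
      cases st with
      | nil => simp [exec] at e2
      | cons w st =>
        simp only [exec, Option.some.injEq, Prod.mk.injEq, List.cons.injEq] at e2 ⊢
        obtain ⟨e2, e3, e4⟩ := e2
        refine ⟨e2, ?_, e4⟩
        rw [← e3, gval_suffix κ χ hsuf hs, gval_suffix κ χ hsuf ht, gval_suffix κ χ hsuf hu]
        set L₁ : List (PreGate k) := .op .mul a s :: gs with hL₁
        set L₂ : List (PreGate k) := .op .mul t b :: L₁ with hL₂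
        set L₃ : List (PreGate k) := .op .mul a u :: L₂ with hL₃
        set L₄ : List (PreGate k) := .op .mul (gs.length + 2) b :: L₃ with hL₄
        have s1 : gs <:+ L₁ := List.suffix_cons _ _
        have s2 : gs <:+ L₂ := s1.trans (List.suffix_cons _ _)
        have s3 : gs <:+ L₃ := s2.trans (List.suffix_cons _ _)
        have s4 : gs <:+ L₄ := s3.trans (List.suffix_cons _ _)
        have g0 : gval κ χ gs' gs.length = gval κ χ gs a * gval κ χ gs s := by
          have t1 : L₁ <:+ gs' := ⟨[_, _, _, _], rfl⟩
          rw [gval_suffix κ χ t1 (by simp [hL₁])]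
          exact gval_cons_self κ χ _ gs
        have g1 : gval κ χ gs' (gs.length + 1) = gval κ χ gs t * gval κ χ gs b := by
          have t2 : L₂ <:+ gs' := ⟨[_, _, _], rfl⟩
          rw [gval_suffix κ χ t2 (by simp [hL₁, hL₂])]
          refine (gval_cons_self κ χ _ L₁).trans ?_
          change gval κ χ L₁ t * gval κ χ L₁ b = _
          rw [gval_suffix κ χ s1 ht, gval_suffix κ χ s1 hb]
        have g4 : gval κ χ gs' (gs.length + 4) =
            gval κ χ gs a * gval κ χ gs u * gval κ χ gs b + gval κ χ gs c := by
          refine (gval_cons_self κ χ _ L₄).trans ?_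
          change gval κ χ L₄ L₃.length + gval κ χ L₄ c = _
          rw [gval_suffix κ χ s4 hc, gval_cons_self]
          change gval κ χ L₃ L₂.length * gval κ χ L₃ b + _ = _
          rw [gval_suffix κ χ s3 hb, gval_cons_self]
          change gval κ χ L₂ a * gval κ χ L₂ u * _ + _ = _
          rw [gval_suffix κ χ s2 ha, gval_suffix κ χ s2 hu]
        rw [g0, g1, g4]
        simp only [mul_add, add_mul, mul_assoc, add_assoc]

/-- The state of the machine during the processing of a right-hand side. -/
def Conf (κ : Fin k → R) (χ : ℕ → R) (M₀ : Mem) (o₀ : ℕ) (gs₀ : List (PreGate k)) (M : Mem)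
    (K : List ℕ) (tp p : ℕ) (vs : (Fin ρ → R) → List R) : Prop :=
  ∃ gs out V, St M₀ o₀ M gs out V K tp ∧ Sem κ χ gs₀ gs out V p vs

variable {M₀ M : Mem} {o₀ : ℕ} {K : List ℕ} {tp : ℕ}

theorem conf_applyAff (hM : StC M₀ o₀ M gs out (v :: V) K tp a b c)
    (h : Sem κ χ gs₀ gs out (v :: V) p fun xs => x xs :: rest xs)
    (ha : a < gs.length) (hb : b < gs.length) (hc : c < gs.length) :
    Conf κ χ M₀ o₀ gs₀ (applyAff.run M) K tp p
      fun xs => (gval κ χ gs a * x xs * gval κ χ gs b + gval κ χ gs c) :: rest xs := by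
  cases v with
  | some g => exact ⟨_, _, _, St.run_applyAff_con hM, h.aff_con ha hb hc⟩
  | none =>
    rcases h.shape with rfl | ⟨out', s, t, u, rfl⟩
    -- Without emitted instructions no value has been produced, so a symbolic entry cannot exist.
    · exfalso
      obtain ⟨cs, h1, h2⟩ := h.sim fun _ => 0
      simp only [exec, Option.some.injEq, Prod.mk.injEq] at h1
      rw [← h1.2] at h2
      cases h2
    · exact ⟨_, _, _, St.run_applyAff_var hM, h.aff_var ha hb hc⟩

end semantics

end Arith

/-! ### Single steps of the machine -/

namespace Arith

open RAM

section steps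

variable {R : Type*} [Semiring R] {k : ℕ} {κ : Fin k → R} {χ : ℕ → R} {ρ : ℕ}
  {gs₀ gs : List (PreGate k)} {out : List Ins} {V : List (Option ℕ)} {p : ℕ}
  {vs : (Fin ρ → R) → List R} {x y : (Fin ρ → R) → R} {rest : (Fin ρ → R) → List R}
  {a b c g pc : ℕ} {M₀ M : Mem} {o₀ : ℕ} {K : List ℕ} {tp : ℕ}

/-- The return position is advanced before the instruction is executed, so an instruction may push a
frame of its own. The skeletons that are executed lie below o₀, and new instructions are written
from o₀ on; hence the code under execution is not modified. -/
theorem St.run_vmStep (h : St M₀ o₀ M gs out V (pc :: K) tp) (hpc : pc < o₀) :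
    ∃ M', vmStep.run M = vmBody.run M' ∧ St M₀ o₀ M' gs out V ((pc + 1) :: K) tp ∧
      M' 21 0 = pc ∧ SameIns M₀ M' pc := by
  have h1 := h.ksp
  have h2 := h.kst.1
  simp only [List.length_cons] at h1
  have e1 : M 19 (M 18 0) = pc := by rw [h1, h2]
  have hS : St M₀ o₀ ((M.write 21 0 pc).write 19 (M 18 0) (pc + 1)) gs out V ((pc + 1) :: K) tp := by
    refine h.of_arrays (by simp [Mem.write_ne]) ?_ ?_ ?_
    · simp [Mem.write_ne, h1]
    · rw [Mem.write_self, Mem.write_ne _ _ _ (by decide), h1]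
      exact ⟨by simp, h.kst.2.update (by simp) _⟩
    · simpa [Mem.write_ne] using h.tp
  refine ⟨_, ?_, hS, ?_, hS.low pc hpc⟩
  · rw [vmStep, Cmd.run_ite, if_neg (by simp [h1])]
    simp [Cmd.run_seq, Cmd.run_set, Mem.write_ne, Mem.write_self, e1]
  · simp [Mem.write_ne, Mem.write_self]

theorem St.run_vmStep_halt (h : St M₀ o₀ M gs out V [] tp) : vmStep.run M = M := by
  rw [vmStep, Cmd.run_ite, if_pos (by simpa using h.ksp), Cmd.run_skip]

theorem Conf.run_end (h : Conf κ χ M₀ o₀ gs₀ M (pc :: K) tp p vs) (hpc : pc < o₀)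
    (hi : M₀ 10 pc = 0) : Conf κ χ M₀ o₀ gs₀ (vmStep.run M) K tp p vs := by
  obtain ⟨gs, out, V, hS, hV⟩ := h
  obtain ⟨M', e, hS, e21, hi'⟩ := hS.run_vmStep hpc
  have e10 := hi'.1
  refine ⟨gs, out, V, ?_, hV⟩
  rw [e, vmBody, Cmd.run_ite, if_pos (by simp [e21, ← e10, hi]), Cmd.run_set]
  refine hS.of_arrays (by simp [Mem.write_ne]) ?_ ?_ ?_
  · simp [Mem.write_self, hS.ksp]
  · rw [Mem.write_ne _ _ _ (by decide)]
    exact hS.kst.2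
  · simpa [Mem.write_ne] using hS.tp

theorem Conf.run_aff (h : Conf κ χ M₀ o₀ gs₀ M (pc :: K) tp p fun xs => x xs :: rest xs)
    (hpc : pc < o₀) (hi : InsAt M₀ pc (.aff a b c)) (hl : (Ins.aff a b c).Lt gs₀.length) :
    Conf κ χ M₀ o₀ gs₀ (vmStep.run M) ((pc + 1) :: K) tp p
      fun xs => (gval κ χ gs₀ a * x xs * gval κ χ gs₀ b + gval κ χ gs₀ c) :: rest xs := by
  obtain ⟨gs, out, V, hS, hV⟩ := h
  obtain ⟨M', e, hS, e21, hi'⟩ := hS.run_vmStep hpc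
  obtain ⟨i0, i1, i2, i3⟩ := hi.congr hi'
  obtain ⟨l1, l2, l3⟩ := hl
  have hle := hV.suf.length_le
  rw [e, vmBody, Cmd.run_ite, if_neg (by simp [e21, i0]), Cmd.run_ite, if_neg (by simp [e21, i0]),
    Cmd.run_ite, if_pos (by simp [e21, i0]), Cmd.run_seq]
  rw [← gval_suffix κ χ hV.suf l1, ← gval_suffix κ χ hV.suf l2, ← gval_suffix κ χ hV.suf l3]
  have hC : StC M₀ o₀ _ gs out V ((pc + 1) :: K) tp a b c :=
    hS.run_setABC (ea := .get 11 (.var 21)) (eb := .get 12 (.var 21)) (ec := .get 13 (.var 21))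
    (by simp [e21, i1]) (fun x => by simp [Mem.write_ne, e21, i2])
    (fun x y => by simp [Mem.write_ne, e21, i3])
  cases V with
  | nil =>
    exfalso
    obtain ⟨cs, -, h2⟩ := hV.sim fun _ => 0
    cases h2
  | cons v V => exact conf_applyAff hC hV (by omega) (by omega) (by omega)

theorem Conf.run_con (h : Conf κ χ M₀ o₀ gs₀ M (pc :: K) tp p vs)
    (hpc : pc < o₀) (hi : InsAt M₀ pc (.con g)) (hl : g < gs₀.length) :
    Conf κ χ M₀ o₀ gs₀ (vmStep.run M) ((pc + 1) :: K) tp p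
      fun xs => gval κ χ gs₀ g :: vs xs := by
  obtain ⟨gs, out, V, hS, hV⟩ := h
  obtain ⟨M', e, hS, e21, hi'⟩ := hS.run_vmStep hpc
  obtain ⟨i0, i3⟩ := hi.congr hi'
  have hle := hV.suf.length_le
  rw [e, vmBody, Cmd.run_ite, if_neg (by simp [e21, i0]), Cmd.run_ite, if_neg (by simp [e21, i0]),
    Cmd.run_ite, if_neg (by simp [e21, i0]), Cmd.run_ite, if_pos (by simp [e21, i0])]
  rw [← gval_suffix κ χ hV.suf hl]
  exact ⟨_, _, _, hS.run_pushCon (by simp [Mem.write_ne, e21, i3]), hV.push_con (by omega)⟩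

/-- An operation is emitted only if both operands are symbolic. A constant second operand g turns it
into x ↦ 1·x·1 + g or x ↦ 1·x·g + 0, applied to the first operand of either kind; a constant first
operand is treated alike, with the factor on the left. Gates 0 and 1 supply the coefficients 0 and
1. -/
theorem Conf.run_opStep {f : Op}
    (h : Conf κ χ M₀ o₀ gs₀ M K tp p fun xs => y xs :: x xs :: rest xs)
    (hf : M 10 (M 21 0) = f.num) :
    Conf κ χ M₀ o₀ gs₀ (opStep.run M) K tp p fun xs => f.eval (x xs) (y xs) :: rest xs := by
  obtain ⟨gs, out, V, hS, hV⟩ := h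
  have h2 := hV.two_le
  rw [opStep]
  obtain ⟨u, v, V, rfl⟩ : ∃ u v V', V = u :: v :: V' := by
    obtain ⟨cs, -, h2⟩ := hV.sim fun _ => 0
    rcases V with _ | ⟨u, _ | ⟨v, V⟩⟩
    · cases h2
    · cases u with
      | none => obtain ⟨_, _, _, e1, -, h3⟩ := h2.inv_none; rw [← (List.cons.inj e1).2] at h3; cases h3
      | some g => obtain ⟨_, e1, h3⟩ := h2.inv_some; rw [← (List.cons.inj e1).2] at h3; cases h3
    · exact ⟨u, v, V, rfl⟩
  cases u with
  | some g =>
    obtain ⟨k1, k2⟩ := hS.top_kind.2 g rfl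
    rw [Cmd.run_ite, if_pos (by simp [k1]), Cmd.run_seq, Cmd.run_seq]
    obtain ⟨hV', hy, hg⟩ := hV.pop
    cases f with
    | add =>
      rw [Cmd.run_ite, if_pos (by simp [hf, Op.num])]
      have hC := hS.run_setABC (ea := .lit 1) (eb := .lit 1) (ec := .get 17 (.var 15)) (a := 1)
        (b := 1) (c := g) rfl (fun _ => rfl) (fun _ _ => by simp [Mem.write_ne, k2])
      have hC' := hC.1.pop
      have := conf_applyAff ⟨hC', by simpa [Mem.write_ne] using hC.2⟩ hV' (by omega) (by omega) hg
      simp only [hV.gval_one, one_mul, mul_one] at this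
      simp only [Op.eval, hy]
      exact this
    | mul =>
      rw [Cmd.run_ite, if_neg (by simp [hf, Op.num])]
      have hC := hS.run_setABC (ea := .lit 1) (eb := .get 17 (.var 15)) (ec := .lit 0) (a := 1)
        (b := g) (c := 0) rfl (fun _ => by simp [Mem.write_ne, k2]) (fun _ _ => rfl)
      have hC' := hC.1.pop
      have := conf_applyAff ⟨hC', by simpa [Mem.write_ne] using hC.2⟩ hV' (by omega) hg (by omega)
      simp only [hV.gval_one, hV.gval_zero, one_mul, add_zero] at this
      simp only [Op.eval, hy]
      exact this
  | none =>
    have k1 := hS.top_kind.1 rfl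
    rw [Cmd.run_ite, if_neg (by simp [k1])]
    cases v with
    | none =>
      have k2 := hS.snd_kind.1 rfl
      rw [Cmd.run_ite, if_neg (by simp [k2]), Cmd.run_seq]
      exact ⟨_, _, _, (hS.run_emit (e := opcode) (n := f.num) (by simp [hf])
        (Or.inr ⟨f, rfl, rfl⟩)).pop, hV.emit_op⟩
    | some g =>
      obtain ⟨k2, k3⟩ := hS.snd_kind.2 g rfl
      rw [Cmd.run_ite, if_pos (by simp [k2]), Cmd.run_seq, Cmd.run_seq, Cmd.run_seq]
      obtain ⟨hV', hx, hg⟩ := hV.pop_snd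
      cases f with
      | add =>
        rw [Cmd.run_ite, if_pos (by simp [hf, Op.num])]
        have hC := hS.run_setABC (ea := .lit 1) (eb := .lit 1)
          (ec := .get 17 (.sub (.var 15) (.lit 1))) (a := 1)
          (b := 1) (c := g) rfl (fun _ => rfl) (fun _ _ => by simp [Mem.write_ne, k3])
        have hC' := hC.1.pop.top_to_var
        have := conf_applyAff ⟨hC', by simpa [Mem.write_ne] using hC.2⟩ hV' (by omega) (by omega) hg
        -- The constant was the left summand, while the affine map adds it on the right; addition is
        -- commutative in every semiring.
        simp only [hV.gval_one, one_mul, mul_one, add_comm (y _)] at this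
        simp only [Op.eval, hx]
        exact this
      | mul =>
        rw [Cmd.run_ite, if_neg (by simp [hf, Op.num])]
        have hC := hS.run_setABC (ea := .get 17 (.sub (.var 15) (.lit 1))) (eb := .lit 1)
          (ec := .lit 0) (a := g)
          (b := 1) (c := 0) (by simp [k3]) (fun _ => rfl) (fun _ _ => rfl)
        have hC' := hC.1.pop.top_to_var
        have := conf_applyAff ⟨hC', by simpa [Mem.write_ne] using hC.2⟩ hV' hg (by omega) (by omega)
        simp only [hV.gval_one, hV.gval_zero, mul_one, add_zero] at this
        simp only [Op.eval, hx]
        exact this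

theorem Conf.run_op {f : Op}
    (h : Conf κ χ M₀ o₀ gs₀ M (pc :: K) tp p fun xs => y xs :: x xs :: rest xs)
    (hpc : pc < o₀) (hi : InsAt M₀ pc (.op f)) :
    Conf κ χ M₀ o₀ gs₀ (vmStep.run M) ((pc + 1) :: K) tp p
      fun xs => f.eval (x xs) (y xs) :: rest xs := by
  obtain ⟨gs, out, V, hS, hV⟩ := h
  obtain ⟨M', e, hS, e21, hi'⟩ := hS.run_vmStep hpc
  have i0 : M' 10 pc = f.num := hi.congr hi'
  have hf : 5 ≤ f.num := by cases f <;> simp [Op.num]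
  rw [e, vmBody, Cmd.run_ite, if_neg (by simp [e21, i0]; omega), Cmd.run_ite,
    if_neg (by simp [e21, i0]; omega), Cmd.run_ite, if_neg (by simp [e21, i0]; omega), Cmd.run_ite,
    if_neg (by simp [e21, i0]; omega)]
  exact Conf.run_opStep ⟨gs, out, V, hS, hV⟩ (by rw [e21, i0])

theorem Conf.run_emitArg (h : Conf κ χ M₀ o₀ gs₀ M K tp p vs) (hp : p < ρ) :
    Conf κ χ M₀ o₀ gs₀ ((emit (.lit 1) ;; .inc 15 1 ;; .set 16 (.var 15) (.lit 1)).run M) K tp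
      (p + 1) fun xs => xs ⟨p, hp⟩ :: vs xs := by
  obtain ⟨gs, out, V, hS, hV⟩ := h
  exact ⟨_, _, _, (hS.run_emit (e := .lit 1) rfl (Or.inl ⟨rfl, rfl⟩)).run_pushVar, hV.push_param hp⟩

/-- The instruction `arg` reads the next symbol. -/
theorem St.run_fetch (h : St M₀ o₀ M gs out V (pc :: K) tp) (hpc : pc < o₀)
    (hi : InsAt M₀ pc .arg) :
    ∃ M', vmStep.run M = fetch.run M' ∧ St M₀ o₀ M' gs out V ((pc + 1) :: K) tp ∧
      (∀ i, M' 0 i = M₀ 0 i) ∧ M' 20 0 = tp ∧ M' 25 = M₀ 25 := by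
  obtain ⟨M', e, hS, e21, hi'⟩ := h.run_vmStep hpc
  have i0 : M' 10 pc = 1 := hi.congr hi'
  refine ⟨M', ?_, hS, fun i => by rw [hS.fr0], hS.tp, hS.fr25⟩
  rw [e, vmBody, Cmd.run_ite, if_neg (by simp [e21, i0]), Cmd.run_ite, if_pos (by simp [e21, i0])]

theorem Conf.run_param (h : Conf κ χ M₀ o₀ gs₀ M (pc :: K) tp p vs)
    (hpc : pc < o₀) (hi : InsAt M₀ pc .arg) (ht : M₀ 0 tp = 0) (hp : p < ρ) :
    Conf κ χ M₀ o₀ gs₀ (vmStep.run M) ((pc + 1) :: K) (tp + 2) (p + 1)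
      fun xs => xs ⟨p, hp⟩ :: vs xs := by
  obtain ⟨gs, out, V, hS, hV⟩ := h
  obtain ⟨M', e, hS, e0, e20, -⟩ := hS.run_fetch hpc hi
  rw [e, fetch, Cmd.run_ite, if_pos (by simp [e20, e0, ht]), Cmd.run_seq]
  exact ⟨_, _, _, ((hS.run_emit (e := .lit 1) rfl (Or.inl ⟨rfl, rfl⟩)).run_pushVar).run_next 2,
    hV.push_param hp⟩

/-- The leaves 0 and 1 have the codes 1 and 2 and are represented by the gates 0 and 1, so
subtracting one from the symbol gives the gate. The other leaves require a new gate. -/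
theorem Conf.run_leaf (h : Conf κ χ M₀ o₀ gs₀ M (pc :: K) tp p vs)
    (hpc : pc < o₀) (hi : InsAt M₀ pc .arg) (l : Leaf k) (ht : Seg (M₀ 0) tp l.code) :
    Conf κ χ M₀ o₀ gs₀ (vmStep.run M) ((pc + 1) :: K) (tp + l.code.length) p
      fun xs => l.eval κ χ :: vs xs := by
  obtain ⟨gs, out, V, hS, hV⟩ := h
  obtain ⟨M', e, hS, e0, e20, -⟩ := hS.run_fetch hpc hi
  rw [e, fetch]
  have h2 := hV.two_le
  have key : ∀ t a : ℕ, t = 3 ∨ t = 4 → l.code = [t, a] →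
      Conf κ χ M₀ o₀ gs₀ (fetch.run M') ((pc + 1) :: K) (tp + l.code.length) p
      fun xs => l.eval κ χ :: vs xs := by
    intro t a hta hl
    rw [hl] at ht
    obtain ⟨t0, t1, -⟩ := ht
    have h1 : t ≠ 0 := by omega
    have h2 : t - 2 ≠ 0 := by omega
    have h3 : t - 4 = 0 := by omega
    rw [fetch, Cmd.run_ite, if_neg (by simp [e20, e0, t0, h1]), Cmd.run_ite,
      if_neg (by simp [e20, e0, t0, h2]), Cmd.run_ite, if_pos (by simp [e20, e0, t0, h3]),
      Cmd.run_seq, Cmd.run_seq]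
    have s1 := hS.run_mkLeaf (et := token) (ea := tokenArg) hl (by simp [e20, e0, t0])
      (fun x => by simp [Mem.write_ne, e20, e0, t1])
    have s2 := (s1.run_pushCon (e := lastGate) (g := gs.length)
      (by simp [Mem.write_ne, s1.cnt])).run_next 2
    have ho : Ordered (.leaf l :: gs) := ⟨trivial, hV.ord⟩
    have v1 := hV.extend (List.suffix_cons (.leaf l) gs) ho
    have v2 := v1.push_con (g := gs.length) (by simp)
    rw [gval_cons_self] at v2
    rw [hl]
    exact ⟨_, _, _, s2, v2⟩
  cases l with
  | zero =>
    obtain ⟨t0, -⟩ := ht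
    rw [Cmd.run_ite, if_neg (by simp [e20, e0, t0]), Cmd.run_ite, if_pos (by simp [e20, e0, t0]),
      Cmd.run_seq]
    refine ⟨_, _, _, (hS.run_pushCon (g := 0) (by simp [Mem.write_ne, e20, e0, t0])).run_next 1, ?_⟩
    have := hV.push_con (g := 0) (by omega)
    rwa [hV.gval_zero] at this
  | one =>
    obtain ⟨t0, -⟩ := ht
    rw [Cmd.run_ite, if_neg (by simp [e20, e0, t0]), Cmd.run_ite, if_pos (by simp [e20, e0, t0]),
      Cmd.run_seq]
    refine ⟨_, _, _, (hS.run_pushCon (g := 1) (by simp [Mem.write_ne, e20, e0, t0])).run_next 1, ?_⟩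
    have := hV.push_con (g := 1) (by omega)
    rwa [hV.gval_one] at this
  | const j => exact key 3 j (Or.inl rfl) rfl
  | var v => exact key 4 v (Or.inr rfl) rfl

/-- The position of the instructions for an operation. -/
def Op.pos : Op → ℕ
  | add => 0
  | mul => 4

theorem Conf.run_push_op (h : Conf κ χ M₀ o₀ gs₀ M (pc :: K) tp p vs)
    (hpc : pc < o₀) (hi : InsAt M₀ pc .arg) (f : Op) (ht : M₀ 0 tp = f.num) :
    Conf κ χ M₀ o₀ gs₀ (vmStep.run M) (f.pos :: (pc + 1) :: K) (tp + 1) p vs := by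
  obtain ⟨gs, out, V, hS, hV⟩ := h
  obtain ⟨M', e, hS, e0, e20, -⟩ := hS.run_fetch hpc hi
  refine ⟨gs, out, V, ?_, hV⟩
  cases f with
  | add =>
    rw [e, fetch, Cmd.run_ite, if_neg (by simp [e20, e0, ht, Op.num]), Cmd.run_ite,
      if_neg (by simp [e20, e0, ht, Op.num]), Cmd.run_ite, if_neg (by simp [e20, e0, ht, Op.num]),
      Cmd.run_ite, if_pos (by simp [e20, e0, ht, Op.num]), Cmd.run_seq, Cmd.run_ite,
      if_pos (by simp [e20, e0, ht, Op.num])]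
    exact (hS.run_pushFrame rfl).run_next 1
  | mul =>
    rw [e, fetch, Cmd.run_ite, if_neg (by simp [e20, e0, ht, Op.num]), Cmd.run_ite,
      if_neg (by simp [e20, e0, ht, Op.num]), Cmd.run_ite, if_neg (by simp [e20, e0, ht, Op.num]),
      Cmd.run_ite, if_pos (by simp [e20, e0, ht, Op.num]), Cmd.run_seq, Cmd.run_ite,
      if_neg (by simp [e20, e0, ht, Op.num])]
    exact (hS.run_pushFrame rfl).run_next 1

theorem Conf.run_push_nt (h : Conf κ χ M₀ o₀ gs₀ M (pc :: K) tp p vs)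
    (hpc : pc < o₀) (hi : InsAt M₀ pc .arg) (A : ℕ) (ht : Seg (M₀ 0) tp [7, A]) :
    Conf κ χ M₀ o₀ gs₀ (vmStep.run M) (M₀ 25 A :: (pc + 1) :: K) (tp + 2) p vs := by
  obtain ⟨gs, out, V, hS, hV⟩ := h
  obtain ⟨M', e, hS, e0, e20, e25⟩ := hS.run_fetch hpc hi
  obtain ⟨t0, t1, -⟩ := ht
  refine ⟨gs, out, V, ?_, hV⟩
  rw [e, fetch, Cmd.run_ite, if_neg (by simp [e20, e0, t0]), Cmd.run_ite,
    if_neg (by simp [e20, e0, t0]), Cmd.run_ite, if_neg (by simp [e20, e0, t0]),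
    Cmd.run_ite, if_neg (by simp [e20, e0, t0]), Cmd.run_seq]
  exact (hS.run_pushFrame (by simp [Mem.write_ne, e20, e0, e25, t1])).run_next 2

end steps

end Arith

/-! ### Reading a whole tree -/

namespace Arith

open RAM

/-- The value of a tree, given the functions denoted by the nonterminals. -/
def Tree.teval {R : Type*} [Semiring R] {k : ℕ} (κ : Fin k → R) (χ : ℕ → R) {N : Type} {rk : N → ℕ}
    (Φ : (A : N) → (Fin (rk A) → R) → R) (ξ : ℕ → R) : Tree k rk → R
  | param i => ξ i
  | leaf a => a.eval κ χ
  | op f s t => f.eval (s.teval κ χ Φ ξ) (t.teval κ χ Φ ξ)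
  | nt A args => Φ A fun i => (args i).teval κ χ Φ ξ

/-- Extension of a finite sequence by zeros. -/
def extend {R : Type*} [Zero R] {ρ : ℕ} (xs : Fin ρ → R) (i : ℕ) : R :=
  if h : i < ρ then xs ⟨i, h⟩ else 0

/-- A list of instructions is stored at position `p`, followed by an end mark, before position
`o₀`. -/
structure Stored (M₀ : Mem) (o₀ n : ℕ) (p : ℕ) (w : List Ins) : Prop where
  str : StrAt M₀ p w
  fin : M₀ 10 (p + w.length) = 0
  lt : p + w.length < o₀
  ids : ∀ i ∈ w, i.Lt n

section run

variable {R : Type*} [Semiring R] {k : ℕ} {κ : Fin k → R} {χ : ℕ → R} {ρ : ℕ}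
  {gs₀ : List (PreGate k)} {M₀ : Mem} {o₀ : ℕ} {n : ℕ} {rk : Fin n → ℕ}
  {Φ : (A : Fin n) → (Fin (rk A) → R) → R} {B : ℕ}

/-- The machine reads the tree `t` correctly. -/
def Reads (κ : Fin k → R) (χ : ℕ → R) (ρ : ℕ) (gs₀ : List (PreGate k)) (M₀ : Mem) (o₀ : ℕ)
    (Φ : (A : Fin n) → (Fin (rk A) → R) → R) (B : ℕ) (t : Tree k rk) : Prop :=
  ∀ (pc : ℕ) (K : List ℕ) (tp p m : ℕ) (vs : (Fin ρ → R) → List R) (M : Mem), pc < o₀ →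
    InsAt M₀ pc .arg → Seg (M₀ 0) tp t.code → t.params = List.range' p m → p + m ≤ ρ →
    Conf κ χ M₀ o₀ gs₀ M (pc :: K) tp p vs →
    ∃ s ≤ t.code.length * B, Conf κ χ M₀ o₀ gs₀ (vmStep.run^[s] M) ((pc + 1) :: K)
      (tp + t.code.length) (p + m) fun xs => t.teval κ χ Φ (extend xs) :: vs xs

/-- The machine follows the abstract execution of w: at `arg` it reads the next argument tree, by
the hypothesis on ts, and otherwise makes one step. That the abstract execution succeeds excludes
empty queues and stacks. The parameters of consecutive argument trees form consecutive intervals, so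
each tree finds the parameters that come next; here the order of the parameters is used. -/
theorem Conf.run_string (w : List Ins) (ts : List (Tree k rk))
    (H : ∀ t ∈ ts, Reads κ χ ρ gs₀ M₀ o₀ Φ B t) (pc : ℕ) (K : List ℕ) (tp p m : ℕ)
    (st : List ((Fin ρ → R) → R)) (base : (Fin ρ → R) → List R) (z : (Fin ρ → R) → R) (M : Mem)
    (hw : Stored M₀ o₀ gs₀.length pc w) (ht : Seg (M₀ 0) tp (ts.map Tree.code).flatten)
    (hp : (ts.map Tree.params).flatten = List.range' p m) (hm : p + m ≤ ρ)
    (he : ∀ xs, exec (gval κ χ gs₀) w (ts.map fun t => t.teval κ χ Φ (extend xs))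
      (st.map fun f => f xs) = some ([], [z xs]))
    (h : Conf κ χ M₀ o₀ gs₀ M (pc :: K) tp p fun xs => (st.map fun f => f xs) ++ base xs) :
    ∃ s ≤ w.length + (ts.map Tree.code).flatten.length * B,
      Conf κ χ M₀ o₀ gs₀ (vmStep.run^[s] M) ((pc + w.length) :: K)
        (tp + (ts.map Tree.code).flatten.length) (p + m) fun xs => z xs :: base xs := by
  induction w generalizing ts pc tp p m st M with
  | nil =>
    simp only [exec, Option.some.injEq, Prod.mk.injEq] at he
    obtain rfl := List.map_eq_nil_iff.1 (he fun _ => 0).1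
    simp only [List.map_nil, List.flatten_nil] at hp
    obtain rfl : m = 0 := by simpa using congrArg List.length hp.symm
    refine ⟨0, by simp, ?_⟩
    simp only [(he _).2] at h
    simpa using h
  | cons i w ih =>
    obtain ⟨⟨hi, hs⟩, hfin, hlt, hids⟩ := hw
    simp only [List.length_cons] at hfin hlt ⊢
    have hw' : Stored M₀ o₀ gs₀.length (pc + 1) w :=
      ⟨hs, by rw [← hfin]; congr 1; omega, by omega, fun j hj => hids j (List.mem_cons_of_mem _ hj)⟩
    have hpc : pc < o₀ := by omega
    have hil := hids i List.mem_cons_self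
    have hpw : pc + 1 + w.length = pc + (w.length + 1) := by omega
    cases i with
    | arg =>
      cases ts with
      | nil => exact absurd (he fun _ => 0) (by simp [exec])
      | cons t ts =>
        simp only [List.map_cons, List.flatten_cons] at ht hp
        obtain ⟨m₁, hm₁, hp₁, hp₂⟩ := List.range'_eq_append_iff.1 hp.symm
        rw [mul_one] at hp₂
        obtain ⟨ht₁, ht₂⟩ := (seg_append _ _ _ _).1 ht
        obtain ⟨s₁, hs₁, h₁⟩ := H t List.mem_cons_self pc K tp p m₁ _ M hpc hi ht₁ hp₁ (by omega) h
        obtain ⟨s₂, hs₂, h₂⟩ := ih ts (fun t ht => H t (List.mem_cons_of_mem _ ht)) (pc + 1)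
          (tp + t.code.length) (p + m₁) (m - m₁)
          ((fun xs => t.teval κ χ Φ (extend xs)) :: st) (vmStep.run^[s₁] M) hw' ht₂ hp₂ (by omega)
          he h₁
        refine ⟨s₂ + s₁, ?_, ?_⟩
        · simp only [List.map_cons, List.flatten_cons, List.length_append, add_mul]
          omega
        · rw [Function.iterate_add_apply]
          simp only [List.map_cons, List.flatten_cons, List.length_append]
          rwa [hpw, add_assoc tp, add_assoc p, Nat.add_sub_cancel' hm₁] at h₂
    | aff a b c =>
      cases st with
      | nil => exact absurd (he fun _ => 0) (by cases ts <;> simp [exec])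
      | cons x st =>
        have h₁ := Conf.run_aff (x := x) (rest := fun xs => st.map (fun f => f xs) ++ base xs) h hpc
          hi hil
        obtain ⟨s₂, hs₂, h₂⟩ := ih ts H (pc + 1) tp p m
          ((fun xs => gval κ χ gs₀ a * x xs * gval κ χ gs₀ b + gval κ χ gs₀ c) :: st)
          (vmStep.run M) hw' ht hp hm he h₁
        refine ⟨s₂ + 1, by omega, ?_⟩
        rw [hpw] at h₂
        exact h₂
    | op f =>
      rcases st with _ | ⟨y, _ | ⟨x, st⟩⟩
      · exact absurd (he fun _ => 0) (by cases ts <;> simp [exec])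
      · exact absurd (he fun _ => 0) (by cases ts <;> simp [exec])
      · have h₁ := Conf.run_op (x := x) (y := y)
          (rest := fun xs => st.map (fun f => f xs) ++ base xs) h hpc hi
        obtain ⟨s₂, hs₂, h₂⟩ := ih ts H (pc + 1) tp p m
          ((fun xs => f.eval (x xs) (y xs)) :: st) _ hw' ht hp hm he h₁
        refine ⟨s₂ + 1, by omega, ?_⟩
        rw [hpw] at h₂
        exact h₂
    | con g =>
      have h₁ := Conf.run_con h hpc hi hil
      obtain ⟨s₂, hs₂, h₂⟩ := ih ts H (pc + 1) tp p m
        ((fun xs => gval κ χ gs₀ g) :: st) _ hw' ht hp hm he h₁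
      refine ⟨s₂ + 1, by omega, ?_⟩
      rw [hpw] at h₂
      exact h₂

/-- The instructions for the two operations and for the start of the machine are available. -/
structure Builtin (M₀ : Mem) (o₀ n : ℕ) : Prop where
  op : ∀ f : Op, Stored M₀ o₀ n f.pos [.arg, .arg, .op f]
  boot : Stored M₀ o₀ n 8 [.arg]

/-- The list of instructions at position `e` denotes the function `φ` with `r` arguments. -/
def DenoteAt (κ : Fin k → R) (χ : ℕ → R) (gs₀ : List (PreGate k)) (M₀ : Mem) (o₀ B e r : ℕ)
    (φ : (Fin r → R) → R) : Prop :=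
  ∃ w, Stored M₀ o₀ gs₀.length e w ∧ w.length + 2 ≤ B ∧ (r = 0 → ∃ g, w = [.con g]) ∧
    ∀ xs, exec (gval κ χ gs₀) w (List.ofFn xs) [] = some ([], [φ xs])

/-- A symbol for an operation or a nonterminal runs its skeleton with its subtrees as arguments,
which by induction are read correctly. The first symbol of a code pays B steps: its skeleton, the
step that pushes the frame and the step at the end mark. For an operation these are 3 + 2 = 5 steps.
-/
theorem reads (hb : Builtin M₀ o₀ gs₀.length) (hB : 5 ≤ B) 
    (hΦ : ∀ A : Fin n, DenoteAt κ χ gs₀ M₀ o₀ B (M₀ 25 A) (rk A) (Φ A))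
    (t : Tree k rk) : Reads κ χ ρ gs₀ M₀ o₀ Φ B t := by
  induction t with
  | param i =>
    intro pc K tp p m vs M hpc hi ht hp hm h
    obtain rfl : m = 1 := by simpa [Tree.params] using (congrArg List.length hp).symm
    obtain rfl : i = p := by simpa [Tree.params] using hp
    have hc : (Tree.param i : Tree k rk).code.length = 2 := rfl
    refine ⟨1, by rw [hc]; omega, ?_⟩
    have := h.run_param hpc hi ht.1 (by omega)
    rw [hc]
    have e : ∀ xs : Fin ρ → R, (Tree.param i : Tree k rk).teval κ χ Φ (extend xs) =
        xs ⟨i, by omega⟩ := fun xs => dif_pos (by omega)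
    simp only [e]
    exact this
  | leaf a =>
    intro pc K tp p m vs M hpc hi ht hp hm h
    obtain rfl : m = 0 := by simpa [Tree.params] using (congrArg List.length hp).symm
    have hc : 1 ≤ (Tree.leaf a : Tree k rk).code.length := by
      cases a <;> simp [Tree.code, Leaf.code]
    exact ⟨1, by nlinarith, h.run_leaf hpc hi a ht⟩
  | op f s t hs ht =>
    intro pc K tp p m vs M hpc hi hseg hp hm h
    have hf : f.code = [f.num] := by cases f <;> rfl
    have hcode : (Tree.op f s t).code = f.num :: (([s, t].map Tree.code).flatten) := by
      simp [Tree.code, hf]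
    rw [hcode] at hseg ⊢
    have h₁ := h.run_push_op hpc hi f hseg.1
    obtain ⟨s₂, hs₂, h₂⟩ := Conf.run_string (B := B) (Φ := Φ) [.arg, .arg, .op f] [s, t] (by simp [hs, ht])
      f.pos ((pc + 1) :: K) (tp + 1) p m [] vs
      (fun xs => (Tree.op f s t).teval κ χ Φ (extend xs)) (vmStep.run M) (hb.op f) hseg.2
      (by simpa [Tree.params] using hp) hm (fun xs => rfl) h₁
    have h₃ := h₂.run_end (hb.op f).lt (hb.op f).fin
    refine ⟨1 + (s₂ + 1), ?_, ?_⟩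
    · simp only [List.length_cons, List.length_nil] at hs₂ ⊢
      rw [add_mul]
      omega
    · rw [Function.iterate_add_apply, Function.iterate_add_apply]
      convert h₃ using 1
      · rfl
      · simp only [List.length_cons]
        omega
  | nt A args ih =>
    intro pc K tp p m vs M hpc hi hseg hp hm h
    have hcode : (Tree.nt A args).code = 7 :: (A : ℕ) :: (((List.ofFn args).map Tree.code).flatten) := by
      simp [Tree.code, List.map_ofFn, Function.comp_def]
    rw [hcode] at hseg ⊢
    obtain ⟨w, hw, hwB, -, hwe⟩ := hΦ A
    have h₁ := h.run_push_nt hpc hi A ⟨hseg.1, hseg.2.1, trivial⟩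
    obtain ⟨s₂, hs₂, h₂⟩ := Conf.run_string (B := B) (Φ := Φ) w (List.ofFn args)
      (by intro t ht; obtain ⟨i, rfl⟩ := (List.mem_ofFn' _ _).1 ht; exact ih i)
      (M₀ 25 A) ((pc + 1) :: K) (tp + 2) p m [] vs
      (fun xs => (Tree.nt A args).teval κ χ Φ (extend xs)) (vmStep.run M) hw hseg.2.2
      (by simpa [Tree.params, List.map_ofFn, Function.comp_def] using hp) hm
      (fun xs => by rw [List.map_ofFn]; exact hwe _) h₁
    have h₃ := h₂.run_end hw.lt hw.fin
    refine ⟨1 + (s₂ + 1), ?_, ?_⟩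
    · simp only [List.length_cons] at hs₂ ⊢
      rw [add_mul, add_mul]
      omega
    · rw [Function.iterate_add_apply, Function.iterate_add_apply]
      convert h₃ using 1
      · rfl
      · simp only [List.length_cons]
        omega

end run

end Arith

/-! ### The functions denoted by nonterminals -/

namespace Arith

open RAM

section values

variable {R : Type*} [Semiring R] {k : ℕ} {κ : Fin k → R} {χ : ℕ → R}

theorem Tree.teval_congr {N : Type} {rk : N → ℕ} {Φ Φ' : (A : N) → (Fin (rk A) → R) → R}
    {ξ ξ' : ℕ → R} (t : Tree k rk) (hξ : ∀ i ∈ t.params, ξ i = ξ' i)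
    (hΦ : ∀ A ∈ t.nonterminals, Φ A = Φ' A) : t.teval κ χ Φ ξ = t.teval κ χ Φ' ξ' := by
  induction t with
  | param i => exact hξ i (by simp [params])
  | leaf a => rfl
  | op f s t hs ht =>
    rw [teval, teval, hs (fun i hi => hξ i (by simp [params, hi])) (fun A hA => hΦ A (Or.inl hA)),
      ht (fun i hi => hξ i (by simp [params, hi])) (fun A hA => hΦ A (Or.inr hA))]
  | nt A args ih =>
    rw [teval, teval, hΦ A (Or.inl rfl)]
    congr 1
    funext i
    refine ih i (fun j hj => hξ j ?_) (fun B hB => hΦ B (Or.inr (Set.mem_iUnion.2 ⟨i, hB⟩)))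
    simp only [params, List.mem_flatten]
    exact ⟨_, List.mem_ofFn.2 ⟨i, rfl⟩, hj⟩

/-- Substituting trees for parameters becomes composition of functions. Only the nonterminals that
occur in t matter, so the irrelevant default in `TSLP.val` does no harm. -/
theorem Tree.eval_expand {N : Type} {rk : N → ℕ} {Φ : (A : N) → (Fin (rk A) → R) → R}
    {v : N → Formula k} (ξ : ℕ → R) (t : Tree k rk)
    (h : ∀ A ∈ t.nonterminals, ∀ ξ, (v A).eval κ χ ξ = Φ A fun i => ξ i) :
    (t.expand v).eval κ χ ξ = t.teval κ χ Φ ξ := by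
  induction t with
  | param i => rfl
  | leaf a => rfl
  | op f s t hs ht =>
    rw [expand, Formula.eval, teval, hs fun A hA => h A (Or.inl hA),
      ht fun A hA => h A (Or.inr hA)]
  | nt A args ih =>
    rw [expand, Formula.eval_subst, h A (Or.inl rfl), teval]
    congr 1
    funext i
    rw [dif_pos i.2]
    exact ih i fun B hB => h B (Or.inr (Set.mem_iUnion.2 ⟨i, hB⟩))

/-- The function denoted by a nonterminal. -/
noncomputable def TSLP.fn (κ : Fin k → R) (χ : ℕ → R) (G : TSLP k) (A : Fin G.n)
    (xs : Fin (G.rk A) → R) : R :=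
  (G.val A).eval κ χ (extend xs)

/-- By induction along the acyclic relation. No parameter beyond the rank occurs in a right-hand
side, so the value depends only on finitely many arguments, and extending these by zeros in
`TSLP.fn` loses nothing. -/
theorem TSLP.eval_val (G : TSLP k) (A : Fin G.n) (ξ : ℕ → R) :
    (G.val A).eval κ χ ξ = (G.rhs A).teval κ χ (G.fn κ χ) ξ := by
  induction A using G.acyclic.induction generalizing ξ with
  | _ A ih =>
    rw [TSLP.val_eq]
    refine Tree.eval_expand ξ _ fun B hB ξ => ?_
    rw [if_pos hB, ih B hB, TSLP.fn, ih B hB]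
    refine Tree.teval_congr _ (fun i hi => ?_) fun _ _ => rfl
    rw [G.valid, List.mem_range] at hi
    rw [extend, dif_pos hi]

theorem TSLP.fn_eq (G : TSLP k) {Φ : (A : Fin G.n) → (Fin (G.rk A) → R) → R} (A : Fin G.n)
    (hΦ : ∀ B ∈ (G.rhs A).nonterminals, Φ B = G.fn κ χ B) :
    (fun xs => (G.rhs A).teval κ χ Φ (extend xs)) = G.fn κ χ A := by
  funext xs
  rw [TSLP.fn, G.eval_val]
  exact Tree.teval_congr _ (fun _ _ => rfl) hΦ

theorem TSLP.eval_eq_fn (G : TSLP k) (xs : Fin (G.rk G.start) → R) :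
    G.fn κ χ G.start xs = G.eval κ χ := by
  rw [TSLP.fn, TSLP.eval]
  congr 1
  funext i
  rw [extend, dif_neg]
  simp [G.rk_start]

/-- Since the parameters have to be written down in a right-hand side, ranks are bounded by the
length of the input and not merely by its numerical entries. -/
theorem Tree.params_length_le {n : ℕ} {rk : Fin n → ℕ} (t : Tree k rk) :
    t.params.length ≤ t.code.length := by
  induction t with
  | param i => simp [params, code]
  | leaf a => simp [params]
  | op f s t hs ht => simp only [params, code, List.length_append]; omega
  | nt A args ih =>
    simp only [params, code, List.length_append, List.length_flatten, List.map_ofFn, List.sum_ofFn]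
    exact (Finset.sum_le_sum fun i _ => ih i).trans (by simp)

end values

end Arith

/-- Take the number of elements strictly below a in the transitive closure. It is less than n
because a is not below itself, and along r it increases because a is below b but not below a. -/
theorem WellFounded.exists_height {n : ℕ} {r : Fin n → Fin n → Prop} (h : WellFounded r) :
    ∃ f : Fin n → ℕ, (∀ a, f a < n) ∧ ∀ a b, r a b → f a < f b := by
  classical
  refine ⟨fun a => (Finset.univ.filter fun c => Relation.TransGen r c a).card, fun a => ?_,
    fun a b hab => ?_⟩
  · have h1 : (Finset.univ.filter fun c => Relation.TransGen r c a) ⊂ Finset.univ := by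
      refine Finset.filter_ssubset.2 ⟨a, Finset.mem_univ _, fun h' => ?_⟩
      exact h.transGen.irrefl.irrefl a h'
    simpa using Finset.card_lt_card h1
  · refine Finset.card_lt_card ((Finset.ssubset_iff_of_subset fun c hc => ?_).2 ⟨a, ?_, ?_⟩)
    · simp only [Finset.mem_filter, Finset.mem_univ, true_and] at hc ⊢
      exact hc.tail hab
    · simpa using Relation.TransGen.single hab
    · simpa using h.transGen.irrefl.irrefl a

/-! ### The driver of the translation: default skeletons and repeated rounds -/

namespace RAM

/-- Start the translation of a right-hand side. -/
def begin : Cmd := .asg 28 (.var 14) ;; .asg 15 (.lit 0) ;; .asg 18 (.lit 0)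

/-- Store the instructions for the nonterminal whose right-hand side has been translated. -/
def finish : Cmd :=
  .ite (.get 16 (.var 15)) .skip
    (.set 10 (.var 14) (.lit 3) ;; .set 13 (.var 14) (.get 17 (.var 15)) ;; .inc 14 1) ;;
  .set 10 (.var 14) (.lit 0) ;; .inc 14 1 ;; .set 25 (.var 26) (.var 28) ;; .inc 26 1

/-- Define the next nonterminal as the sum of its arguments. -/
def defaultStep : Cmd :=
  begin ;; pushCon (.lit 0) ;; .asg 27 (.lit 0) ;;
    .rep (.ite (.sub (.get 0 (.add (.var 26) (.lit 3))) (.var 27))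
      ((emit (.lit 1) ;; .inc 15 1 ;; .set 16 (.var 15) (.lit 1)) ;; .asg 21 (.lit 2) ;;
        opStep ;; .inc 27 1) .skip) ;;
    finish

/-- Translate the right-hand side of the next nonterminal. -/
def ruleStep : Cmd := begin ;; pushFrame (.lit 8) ;; .rep vmStep ;; finish

/-- Execute a command for all nonterminals. -/
def forAll (p : Cmd) : Cmd :=
  .asg 26 (.lit 0) ;; .rep (.ite (.sub (.get 0 (.lit 1)) (.var 26)) p .skip)

/-- Gate 0 is the constant 0 and gate 1 the constant 1. The skeletons of addition and multiplication
occupy the positions 0–2 and 4–6, and position 8 holds the single `arg` that starts the reading of a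
right-hand side. The cells 3, 7 and 9 are left at zero and serve as end marks; 10 is the first free
position. -/
def setup : Cmd :=
  .set 2 (.lit 3) (.lit 1) ;; .set 2 (.lit 4) (.lit 2) ;; .inc 6 4 ;; .inc 7 2 ;;
  .set 10 (.lit 0) (.lit 1) ;; .set 10 (.lit 1) (.lit 1) ;; .set 10 (.lit 2) (.lit 5) ;;
  .set 10 (.lit 4) (.lit 1) ;; .set 10 (.lit 5) (.lit 1) ;; .set 10 (.lit 6) (.lit 6) ;;
  .set 10 (.lit 8) (.lit 1) ;; .asg 14 (.lit 10)

/-- Translation of tree straight-line programs into circuits. -/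
def tslpToCircuit : Cmd :=
  setup ;; forAll defaultStep ;;
  .rep (.asg 20 (.add (.get 0 (.lit 1)) (.lit 3)) ;; forAll ruleStep) ;;
  .set 2 (.lit 1) (.var 7) ;;
  .set 2 (.lit 2) (.get 13 (.get 25 (.get 0 (.lit 2)))) ;;
  .set 2 (.lit 0) (.var 6)

/-- A loop with a test. -/
theorem run_rep_ite {e : Ex} {p : Cmd} {M : Mem} (I : ℕ → Mem → Prop) (m : ℕ) (h0 : I 0 M)
    (hm : m ≤ M 3 0) (hs : ∀ i < m, ∀ M, I i M → e.eval M ≠ 0 ∧ I (i + 1) (p.run M))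
    (hf : ∀ M, I m M → e.eval M = 0) : I m ((Cmd.rep (.ite e p .skip)).run M) := by
  have key := iterate_inv (Cmd.ite e p .skip).run (fun i M => I (min i m) M) (M 3 0) (a := M)
    (by simpa using h0) (fun i _ M h => ?_)
  · rw [Cmd.run_rep]
    simpa [hm] using key
  · rw [Cmd.run_ite]
    rcases lt_or_ge i m with hi | hi
    · rw [min_eq_left hi.le] at h
      obtain ⟨h1, h2⟩ := hs i hi M h
      rw [min_eq_left (show i + 1 ≤ m from hi), if_neg h1]
      exact h2
    · rw [min_eq_right hi] at h
      rw [min_eq_right (by omega), if_pos (hf M h), Cmd.run_skip]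
      exact h

end RAM

namespace Arith

open RAM

theorem Stored.mono {M M' : Mem} {o o' n n' p : ℕ} {w : List Ins} (h : Stored M o n p w)
    (hs : ∀ q < o, SameIns M M' q) (ho : o ≤ o') (hn : n ≤ n') : Stored M' o' n' p w := by
  have := h.lt
  exact ⟨h.str.congr fun q _ hq => hs q (by omega), by rw [← (hs _ h.lt).1, h.fin], by omega,
    fun i hi => (h.ids i hi).mono hn⟩

theorem Builtin.mono {M M' : Mem} {o o' n n' : ℕ} (h : Builtin M o n)
    (hs : ∀ q < o, SameIns M M' q) (ho : o ≤ o') (hn : n ≤ n') : Builtin M' o' n' :=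
  ⟨fun f => (h.op f).mono hs ho hn, h.boot.mono hs ho hn⟩

section driver

variable {R : Type*} [Semiring R] {k : ℕ} {κ : Fin k → R} {χ : ℕ → R}

theorem DenoteAt.mono {gs gs' : List (PreGate k)} {M M' : Mem} {o o' B e r : ℕ}
    {φ : (Fin r → R) → R} (h : DenoteAt κ χ gs M o B e r φ) (hs : ∀ q < o, SameIns M M' q)
    (ho : o ≤ o') (hg : gs <:+ gs') : DenoteAt κ χ gs' M' o' B e r φ := by
  obtain ⟨w, h1, h2, h3, h4⟩ := h
  refine ⟨w, h1.mono hs ho hg.length_le, h2, h3, fun xs => ?_⟩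
  rw [← h4 xs]
  exact exec_congr (fun i hi => gval_suffix κ χ hg hi) w h1.ids _ _

/-- The state of the memory between two right-hand sides. -/
structure Env (x : ℕ → ℕ) (N : ℕ) (M : Mem) (gs : List (PreGate k)) : Prop where
  inp : M 0 = x
  bound : M 3 0 = N
  base : [.leaf .one, .leaf .zero] <:+ gs
  ord : Ordered gs
  len : M 6 0 = 2 + (gcode gs).length
  code : Seg (M 2) 3 (gcode gs)
  cnt : M 7 0 = gs.length
  builtin : Builtin M (M 14 0) gs.length

theorem Env.of_arrays {x : ℕ → ℕ} {N : ℕ} {M M' : Mem} {gs : List (PreGate k)} (h : Env x N M gs)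
    (he : ∀ a ∈ [0, 2, 3, 6, 7, 10, 11, 12, 13, 14], M' a = M a) : Env x N M' gs := by
  simp only [List.mem_cons, List.not_mem_nil, or_false, forall_eq_or_imp, forall_eq] at he
  obtain ⟨e0, e2, e3, e6, e7, e10, e11, e12, e13, e14⟩ := he
  refine ⟨e0 ▸ h.inp, e3 ▸ h.bound, h.base, h.ord, e6 ▸ h.len, e2 ▸ h.code, e7 ▸ h.cnt, ?_⟩
  exact h.builtin.mono (fun q _ => by simp [SameIns, e10, e11, e12, e13]) (by rw [e14]) le_rfl

variable {x : ℕ → ℕ} {N : ℕ} {M M₀ : Mem} {gs gs₀ : List (PreGate k)} {o₀ tp p r A B : ℕ}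
  {K : List ℕ} {z : (Fin r → R) → R}

theorem Env.run_begin (h : Env x N M gs) :
    Conf (ρ := r) κ χ M (M 14 0) gs (begin.run M) [] (M 20 0) 0 fun _ => [] := by
  have e : begin.run M = ((M.write 28 0 (M 14 0)).write 15 0 0).write 18 0 0 := by
    simp [begin, Cmd.run_seq, Cmd.run_set]
  have hne : ∀ a, a ≠ 28 → a ≠ 15 → a ≠ 18 → begin.run M a = M a := fun a h1 h2 h3 => by
    rw [e, Mem.write_ne _ _ _ h3, Mem.write_ne _ _ _ h2, Mem.write_ne _ _ _ h1]
  refine ⟨gs, [], [], ⟨by simp [hne], by simp [hne], fun p _ => by simp [SameIns, hne],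
    by simpa [hne] using h.len, by simpa [hne] using h.code, by simpa [hne] using h.cnt, trivial,
    by simp [hne], by simp [e, Mem.write_self, Mem.write_ne], trivial,
    by simp [e, Mem.write_self], trivial, by simp [hne]⟩,
    ⟨h.base, List.suffix_refl _, h.ord, by simp, by simp, Or.inl rfl, by simp,
      fun xs => ⟨[], by simp [exec], .nil⟩⟩⟩

/-- The nonterminal `A` of rank `r` has been defined as `z`. -/
structure Defined (κ : Fin k → R) (χ : ℕ → R) (x : ℕ → ℕ) (N B : ℕ) (M₀ : Mem)
    (gs₀ : List (PreGate k)) (A tp : ℕ) (z : (Fin r → R) → R) (M : Mem) (gs : List (PreGate k)) :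
    Prop where
  env : Env x N M gs
  suf : gs₀ <:+ gs
  same : ∀ p < M₀ 14 0, SameIns M₀ M p
  le : M₀ 14 0 ≤ M 14 0
  den : DenoteAt κ χ gs M (M 14 0) B (M 25 A) r z
  entry : M 25 = Function.update (M₀ 25) A (M₀ 14 0)
  next : M 26 0 = A + 1
  pos : M 20 0 = tp

/-- If the remaining entry is a constant, an instruction `con` is appended. The potential bounds the
length by 4r + 1, and two more steps for pushing the frame and for the end mark give 4r + 3. For r =
0 the potential is zero, so nothing was emitted and the skeleton is a single `con`; for the start
nonterminal this gives the output gate. -/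
theorem Conf.run_finish (h : Conf κ χ M₀ (M₀ 14 0) gs₀ M K tp r fun xs => [z xs])
    (hE : Env x N M₀ gs₀) (h3 : M 3 0 = N) (h28 : M 28 0 = M₀ 14 0) (h26 : M 26 0 = A)
    (hB : 4 * r + 3 ≤ B) : ∃ gs, Defined κ χ x N B M₀ gs₀ A tp z (finish.run M) gs := by
  obtain ⟨gs, out, V, hS, hV⟩ := h
  obtain ⟨v, rfl⟩ : ∃ v, V = [v] := by
    obtain ⟨cs, -, h2⟩ := hV.sim fun _ => 0
    rcases V with _ | ⟨v, _ | ⟨v', V⟩⟩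
    · cases h2
    · exact ⟨v, rfl⟩
    · exfalso
      have := h2
      cases v with
      | none => obtain ⟨_, _, _, e1, -, h3⟩ := h2.inv_none; rw [← (List.cons.inj e1).2] at h3; cases h3
      | some g => obtain ⟨_, e1, h3⟩ := h2.inv_some; rw [← (List.cons.inj e1).2] at h3; cases h3
  obtain ⟨w, hw, hlen, hr0, hids, hex⟩ : ∃ w : List Ins,
      (((Cmd.ite (.get 16 (.var 15)) .skip (.set 10 (.var 14) (.lit 3) ;;
        .set 13 (.var 14) (.get 17 (.var 15)) ;; .inc 14 1)).run M 14 0 = M₀ 14 0 + w.length ∧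
        StrAt ((Cmd.ite (.get 16 (.var 15)) .skip (.set 10 (.var 14) (.lit 3) ;;
        .set 13 (.var 14) (.get 17 (.var 15)) ;; .inc 14 1)).run M) (M₀ 14 0) w ∧
        (∀ p < M₀ 14 0, SameIns M₀ ((Cmd.ite (.get 16 (.var 15)) .skip (.set 10 (.var 14) (.lit 3) ;;
        .set 13 (.var 14) (.get 17 (.var 15)) ;; .inc 14 1)).run M) p))) ∧
      w.length ≤ 4 * r + 1 ∧ (r = 0 → ∃ g, w = [.con g]) ∧ (∀ i ∈ w, i.Lt gs.length) ∧
      ∀ xs, exec (gval κ χ gs) w (List.ofFn xs) [] = some ([], [z xs]) := by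
    have hpot := hV.pot
    have ho := hS.o
    cases v with
    | none =>
      rw [Cmd.run_ite, if_neg (by simp [hS.top_kind.1 rfl]), Cmd.run_skip]
      refine ⟨out, ⟨ho, hS.str, hS.low⟩, by simp at hpot; omega, ?_, hV.idsOut, fun xs => ?_⟩
      · rintro rfl
        simp at hpot
      · obtain ⟨cs, h1, h2⟩ := hV.sim xs
        obtain ⟨_, _, _, e1, e2, h3⟩ := h2.inv_none
        obtain rfl := (List.cons.inj e1).2
        cases h3
        rw [h1, e2, (List.cons.inj e1).1, List.drop_eq_nil_of_le (by simp)]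
    | some g =>
      obtain ⟨k1, k2⟩ := hS.top_kind.2 g rfl
      rw [Cmd.run_ite, if_pos (by simp [k1])]
      have hlow : ∀ p < M 14 0, SameIns M ((Cmd.set 10 (.var 14) (.lit 3) ;;
          .set 13 (.var 14) (.get 17 (.var 15)) ;; .inc 14 1).run M) p := by
        intro p hp
        simp [SameIns, Cmd.run_seq, Cmd.run_set, Mem.write_self, Mem.write_ne,
          Function.update_of_ne hp.ne]
      refine ⟨out ++ [.con g], ⟨?_, ?_, fun p hp => ?_⟩, ?_, ?_, ?_, fun xs => ?_⟩
      · simp [Cmd.run_seq, Cmd.run_set, Mem.write_self, Mem.write_ne, ho, add_assoc]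
      · rw [strAt_append]
        refine ⟨hS.str.congr fun q _ hq => hlow q (by omega), ⟨?_, ?_⟩, trivial⟩
        · simp [Cmd.run_seq, Cmd.run_set, Mem.write_self, Mem.write_ne, ho]
        · simp [Cmd.run_seq, Cmd.run_set, Mem.write_self, Mem.write_ne, ← ho, k2]
      · obtain ⟨a1, a2, a3, a4⟩ := hS.low p hp
        obtain ⟨b1, b2, b3, b4⟩ := hlow p (by omega)
        exact ⟨a1.trans b1, a2.trans b2, a3.trans b3, a4.trans b4⟩
      · simp at hpot ⊢
        omega
      · rintro rfl
        simp at hpot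
        exact ⟨g, by simp [hpot]⟩
      · intro i hi
        rcases List.mem_append.1 hi with e | e
        · exact hV.idsOut i e
        · simp only [List.mem_cons, List.not_mem_nil, or_false] at e
          subst e
          exact hV.idsV g List.mem_cons_self
      · obtain ⟨cs, h1, h2⟩ := hV.sim xs
        obtain ⟨_, e1, h3⟩ := h2.inv_some
        obtain rfl := (List.cons.inj e1).2
        obtain rfl : cs = [] := by cases h3; rfl
        rw [exec_append, h1, List.drop_eq_nil_of_le (by simp)]
        simp [exec, (List.cons.inj e1).1]
  have hkeep : ∀ a, a ≠ 10 → a ≠ 13 → a ≠ 14 → (Cmd.ite (.get 16 (.var 15)) .skip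
      (.set 10 (.var 14) (.lit 3) ;; .set 13 (.var 14) (.get 17 (.var 15)) ;; .inc 14 1)).run M a =
      M a := fun a h1 h2 h3 => Cmd.run_of_keeps _ (by simp [Cmd.Keeps, h1.symm, h2.symm, h3.symm]) M
  rw [finish, Cmd.run_seq]
  generalize (Cmd.ite (.get 16 (.var 15)) .skip (.set 10 (.var 14) (.lit 3) ;;
        .set 13 (.var 14) (.get 17 (.var 15)) ;; .inc 14 1)).run M = M₁ at *
  obtain ⟨w1, w2, w3⟩ := hw
  set M₂ := (Cmd.set 10 (.var 14) (.lit 0) ;; .inc 14 1 ;; .set 25 (.var 26) (.var 28) ;;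
    .inc 26 1).run M₁ with hM₂
  have hk : ∀ a, a ≠ 10 → a ≠ 14 → a ≠ 25 → a ≠ 26 → M₂ a = M₁ a := fun a h1 h2 h3 h4 =>
    Cmd.run_of_keeps _ (by simp [Cmd.Keeps, h1.symm, h2.symm, h3.symm, h4.symm]) _
  have e10 : M₂ 10 = Function.update (M₁ 10) (M₁ 14 0) 0 := by
    simp [hM₂, Cmd.run_seq, Cmd.run_set, Mem.write_self, Mem.write_ne]
  have e14 : M₂ 14 0 = M₁ 14 0 + 1 := by
    simp [hM₂, Cmd.run_seq, Cmd.run_set, Mem.write_self, Mem.write_ne]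
  have e25 : M₂ 25 = Function.update (M₀ 25) A (M₀ 14 0) := by
    simp [hM₂, Cmd.run_seq, Cmd.run_set, Mem.write_self, Mem.write_ne, hkeep, h28, h26, hS.fr25]
  have e26 : M₂ 26 0 = A + 1 := by
    simp [hM₂, Cmd.run_seq, Cmd.run_set, Mem.write_self, Mem.write_ne, hkeep, h26]
  have hs : ∀ q < M₁ 14 0, SameIns M₁ M₂ q := fun q hq => by
    simp [SameIns, hk, e10, Function.update_of_ne hq.ne]
  have hs₀ : ∀ q < M₀ 14 0, SameIns M₀ M₂ q := fun q hq => by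
    obtain ⟨a1, a2, a3, a4⟩ := w3 q hq
    obtain ⟨b1, b2, b3, b4⟩ := hs q (by omega)
    exact ⟨a1.trans b1, a2.trans b2, a3.trans b3, a4.trans b4⟩
  refine ⟨gs, ⟨?_, ?_, hV.base.trans hV.suf, hV.ord, ?_, ?_, ?_, ?_⟩, hV.suf, hs₀,
    by omega, ⟨w, ⟨?_, ?_, ?_, hids⟩, by omega, hr0, hex⟩, e25, e26, ?_⟩
  · simpa [hk, hkeep, hS.fr0] using hE.inp
  · simpa [hk, hkeep] using h3
  · simpa [hk, hkeep] using hS.len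
  · simpa [hk, hkeep] using hS.code
  · simpa [hk, hkeep] using hS.cnt
  · exact hE.builtin.mono hs₀ (by omega) hV.suf.length_le
  · rw [e25, Function.update_self]
    exact w2.congr fun q _ hq => hs q (by omega)
  · rw [e25, Function.update_self, e10, ← w1, Function.update_self]
  · rw [e25, Function.update_self]
    omega
  · simpa [hk, hkeep] using hS.tp

end driver

end Arith

namespace Arith

open RAM

section driver

variable {R : Type*} [Semiring R] {k : ℕ} {κ : Fin k → R} {χ : ℕ → R}
  {x : ℕ → ℕ} {N : ℕ} {M M₀ : Mem} {gs gs₀ : List (PreGate k)} {o₀ tp p r A B : ℕ} {K : List ℕ}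

theorem Conf.of_arrays {ρ : ℕ} {vs : (Fin ρ → R) → List R} {M' : Mem}
    (h : Conf κ χ M₀ o₀ gs₀ M K tp p vs)
    (he : ∀ a ∈ [0, 2, 6, 7, 10, 11, 12, 13, 14, 15, 16, 17, 18, 19, 20, 25], M' a = M a) :
    Conf κ χ M₀ o₀ gs₀ M' K tp p vs := by
  obtain ⟨gs, out, V, hS, hV⟩ := h
  refine ⟨gs, out, V, hS.of_arrays (fun a ha => he a ?_) ?_ ?_ ?_, hV⟩
  · simp at ha ⊢; omega
  · rw [he 18 (by simp)]; exact hS.ksp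
  · rw [he 19 (by simp)]; exact hS.kst
  · rw [he 20 (by simp)]; exact hS.tp

theorem run_setup (h0 : M 0 = x) (h3 : M 3 0 = N) (h : ∀ a, a = 2 ∨ 5 ≤ a → M a = fun _ => 0) :
    Env x N (setup.run M) [(.leaf .one : PreGate k), .leaf .zero] := by
  have hk : ∀ a, a ≠ 2 → a ≠ 6 → a ≠ 7 → a ≠ 10 → a ≠ 14 → setup.run M a = M a :=
    fun a h1 h2 h3 h4 h5 => Cmd.run_of_keeps _
      (by simp [setup, Cmd.Keeps, h1.symm, h2.symm, h3.symm, h4.symm, h5.symm]) _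
  have e2 : setup.run M 2 = Function.update (Function.update (fun _ => 0) 3 1) 4 2 := by
    simp [setup, Cmd.run_seq, Cmd.run_set, Mem.write_self, Mem.write_ne, h 2]
  have e10 : setup.run M 10 = Function.update (Function.update (Function.update (Function.update
      (Function.update (Function.update (Function.update (fun _ => 0) 0 1) 1 1) 2 5) 4 1) 5 1) 6 6)
      8 1 := by
    simp [setup, Cmd.run_seq, Cmd.run_set, Mem.write_self, Mem.write_ne, h 10]
  have e14 : setup.run M 14 0 = 10 := by
    simp [setup, Cmd.run_seq, Cmd.run_set, Mem.write_self, Mem.write_ne]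
  refine ⟨by simp [hk, h0], by simp [hk, h3], List.suffix_refl _, ⟨trivial, trivial, trivial⟩, ?_, ?_,
    ?_, ?_, ?_⟩
  · simp [setup, Cmd.run_seq, Cmd.run_set, Mem.write_self, Mem.write_ne, h 6, gcode, PreGate.code,
      Leaf.code]
  · rw [e2]
    simp [gcode, PreGate.code, Leaf.code]
  · simp [setup, Cmd.run_seq, Cmd.run_set, Mem.write_self, Mem.write_ne, h 7]
  · intro f
    rw [e14]
    cases f with
    | add =>
      refine ⟨⟨?_, ?_, ?_, trivial⟩, ?_, by simp [Op.pos], by simp [Ins.Lt]⟩ <;>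
      simp [InsAt, Op.pos, e10, Op.num, Function.update]
    | mul =>
      refine ⟨⟨?_, ?_, ?_, trivial⟩, ?_, by simp [Op.pos], by simp [Ins.Lt]⟩ <;>
      simp [InsAt, Op.pos, e10, Op.num, Function.update]
  · rw [e14]
    refine ⟨⟨?_, trivial⟩, ?_, by simp, by simp [Ins.Lt]⟩ <;>
    simp [InsAt, e10, Function.update]

/-- A rule may be translated before the rules that it calls. For the machine to stay in step, each
nonterminal needs some skeleton that consumes the right number of arguments; what function it
denotes does not matter, and the sum of the arguments is a convenient one. -/
theorem Env.run_defaultStep (h : Env x N M gs) (h26 : M 26 0 = A) (hr : x (A + 3) = r) (hrN : r ≤ N)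
    (hB : 4 * r + 3 ≤ B) : ∃ (gs' : List (PreGate k)) (z : (Fin r → R) → R),
      Defined κ χ x N B M gs A (M 20 0) z (defaultStep.run M) gs' := by
  have h1 := h.run_begin (κ := κ) (χ := χ) (r := r)
  have h2 : Conf κ χ M (M 14 0) gs ((begin ;; pushCon (.lit 0)).run M) [] (M 20 0) 0
      fun _ : Fin r → R => [0] := by
    obtain ⟨gs, out, V, hS, hV⟩ := h1
    have := hV.push_con (g := 0) (by have := hV.two_le; omega)
    rw [hV.gval_zero] at this
    exact ⟨_, _, _, hS.run_pushCon rfl, this⟩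
  have k1 : ∀ a, a ≠ 28 → a ≠ 15 → a ≠ 16 → a ≠ 17 → a ≠ 18 → 
      (begin ;; pushCon (.lit 0)).run M a = M a := fun a h1 h2 h3 h4 h5 => Cmd.run_of_keeps _
      (by simp [begin, pushCon, Cmd.Keeps, h1.symm, h2.symm, h3.symm, h4.symm, h5.symm]) _
  have k28 : (begin ;; pushCon (.lit 0)).run M 28 0 = M 14 0 := by
    simp [begin, pushCon, Cmd.run_seq, Cmd.run_set, Mem.write_self, Mem.write_ne]
  change ∃ gs' z, Defined κ χ x N B M gs A (M 20 0) z (finish.run ((Cmd.rep (.ite _ _ _)).run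
    ((Cmd.asg 27 (.lit 0)).run ((begin ;; pushCon (.lit 0)).run M)))) gs'
  generalize (begin ;; pushCon (.lit 0)).run M = M₁ at *
  rw [Cmd.run_set]
  have key := run_rep_ite (M := M₁.write 27 0 0)
    (e := .sub (.get 0 (.add (.var 26) (.lit 3))) (.var 27))
    (p := (emit (.lit 1) ;; .inc 15 1 ;; .set 16 (.var 15) (.lit 1)) ;; .asg 21 (.lit 2) ;;
        opStep ;; .inc 27 1)
    (fun j M' => (∃ z : (Fin r → R) → R,
      Conf κ χ M (M 14 0) gs M' [] (M 20 0) j fun xs => [z xs]) ∧ M' 26 0 = A ∧ M' 27 0 = j ∧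
      M' 28 0 = M 14 0 ∧ M' 3 0 = N ∧ M' 0 = x) r ?_ ?_ ?_ ?_
  · obtain ⟨⟨z, hz⟩, e26, -, e28, e3, -⟩ := key
    obtain ⟨gs', h'⟩ := hz.run_finish h e3 e28 e26 hB
    exact ⟨gs', z, h'⟩
  · refine ⟨⟨fun _ => 0, h2.of_arrays ?_⟩, ?_, ?_, ?_, ?_, ?_⟩
    · simp [Mem.write_ne]
    · simp [Mem.write_ne, k1, h26]
    · simp [Mem.write_self]
    · simp [Mem.write_ne, k28]
    · simp [Mem.write_ne, k1, h.bound]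
    · simp [Mem.write_ne, k1, h.inp]
  · simp [Mem.write_ne, k1, h.bound, hrN]
  · rintro j hj M' ⟨⟨z, hz⟩, e26, e27, e28, e3, e0⟩
    refine ⟨by simp [e0, e26, hr, e27]; omega, ?_, ?_, ?_, ?_, ?_, ?_⟩
    · refine ⟨fun xs => z xs + xs ⟨j, hj⟩, ?_⟩
      have c1 := hz.run_emitArg hj
      rw [Cmd.run_seq, Cmd.run_seq, Cmd.run_seq]
      generalize (emit (.lit 1) ;; .inc 15 1 ;; .set 16 (.var 15) (.lit 1)).run M' = M'' at *
      have c2 : Conf κ χ M (M 14 0) gs (M''.write 21 0 2) [] (M 20 0) (j + 1)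
          fun xs => xs ⟨j, hj⟩ :: z xs :: (fun _ => []) xs := c1.of_arrays (by simp [Mem.write_ne])
      -- Position 2, to which cell `21` points, is the opcode in the built-in skeleton of addition.
      have c3 := c2.run_opStep (f := .add) (by
        obtain ⟨gs', out, V, hS, -⟩ := c2
        have hb := (h.builtin.op .add).lt
        rw [Mem.write_self, Function.update_self,
          ← (hS.low 2 (by simp only [Op.pos, List.length_cons, List.length_nil] at hb; omega)).1]
        exact (h.builtin.op .add).str.2.2.1)
      refine Conf.of_arrays c3 ?_
      simp [Cmd.run_set, Mem.write_ne]
    · rw [Cmd.run_of_keeps (x := 26) _ (by decide)]; exact e26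
    · rw [Cmd.run_seq, Cmd.run_seq, Cmd.run_seq, Cmd.run_set, Mem.write_self]
      simp only [Ex.eval, Function.update_self]
      rw [Cmd.run_of_keeps (x := 27) opStep (by decide), Cmd.run_of_keeps (x := 27) _ (by decide),
        Cmd.run_of_keeps (x := 27) _ (by decide), e27]
    · rw [Cmd.run_of_keeps (x := 28) _ (by decide)]; exact e28
    · rw [Cmd.run_of_keeps (x := 3) _ (by decide)]; exact e3
    · rw [Cmd.run_of_keeps (x := 0) _ (by decide)]; exact e0
  · rintro M' ⟨-, e26, e27, -, -, e0⟩
    simp [e0, e26, hr, e27]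

/-- The skeleton at position 8 consists of a single `arg`, so running it reads the whole right-hand
side. One further step meets its end mark and empties the stack of frames, which explains the bound
on N. -/
theorem Env.run_ruleStep {n : ℕ} {rk : Fin n → ℕ} {Φ : (A : Fin n) → (Fin (rk A) → R) → R}
    (h : Env x N M gs) (h26 : M 26 0 = A)
    (t : Tree k rk) (ht : Seg x (M 20 0) t.code) (hp : t.params = List.range r)
    (hB : 4 * r + 3 ≤ B) (hB' : 5 ≤ B) (hN : t.code.length * B + 1 ≤ N)
    (hΦ : ∀ A : Fin n, DenoteAt κ χ gs M (M 14 0) B (M 25 A) (rk A) (Φ A)) :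
    ∃ gs' : List (PreGate k), Defined κ χ x N B M gs A (M 20 0 + t.code.length)
      (fun xs : Fin r → R => t.teval κ χ Φ (extend xs)) (ruleStep.run M) gs' := by
  have h1 := h.run_begin (κ := κ) (χ := χ) (r := r)
  have h2 : Conf κ χ M (M 14 0) gs ((begin ;; pushFrame (.lit 8)).run M) [8] (M 20 0) 0
      fun _ : Fin r → R => [] := by
    obtain ⟨gs, out, V, hS, hV⟩ := h1
    exact ⟨_, _, _, hS.run_pushFrame rfl, hV⟩
  have hb := h.builtin.boot
  have k1 : ∀ a, a ≠ 28 → a ≠ 15 → a ≠ 18 → a ≠ 19 →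
      (begin ;; pushFrame (.lit 8)).run M a = M a := fun a h1 h2 h3 h4 => Cmd.run_of_keeps _
      (by simp [begin, pushFrame, Cmd.Keeps, h1.symm, h2.symm, h3.symm, h4.symm]) _
  have k28 : (begin ;; pushFrame (.lit 8)).run M 28 0 = M 14 0 := by
    simp [begin, pushFrame, Cmd.run_seq, Cmd.run_set, Mem.write_self, Mem.write_ne]
  change ∃ gs', Defined κ χ x N B M gs A _ _ (finish.run ((Cmd.rep vmStep).run
    ((begin ;; pushFrame (.lit 8)).run M))) gs'
  generalize (begin ;; pushFrame (.lit 8)).run M = M₁ at *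
  obtain ⟨s, hs, h3⟩ := reads h.builtin hB' hΦ t 8 [] (M 20 0) 0 r _ M₁
    (by have := hb.lt; omega) hb.str.1 (by rw [h.inp]; exact ht) (by rw [hp, List.range_eq_range'])
    (by omega) h2
  have h4 := h3.run_end (by have := hb.lt; simpa using this) (by simpa using hb.fin)
  -- With no frames left the step is the identity, so the superfluous rounds of the loop change
  -- nothing.
  have halt : ∀ j, vmStep.run^[j] (vmStep.run (vmStep.run^[s] M₁)) =
      vmStep.run (vmStep.run^[s] M₁) := by
    obtain ⟨_, _, _, hS, -⟩ := h4
    exact fun j => Function.iterate_fixed hS.run_vmStep_halt j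
  have e : (Cmd.rep vmStep).run M₁ = vmStep.run (vmStep.run^[s] M₁) := by
    rw [Cmd.run_rep, k1 3 (by decide) (by decide) (by decide) (by decide), h.bound, ← halt (N - (s + 1)),
      ← Function.iterate_succ_apply' vmStep.run s, ← Function.iterate_add_apply]
    congr 1
    omega
  rw [← e] at h4
  rw [zero_add] at h4
  refine h4.run_finish h ?_ ?_ ?_ hB
  · rw [Cmd.run_of_keeps (x := 3) _ (by decide), k1 3 (by decide) (by decide) (by decide) (by decide),
      h.bound]
  · rw [Cmd.run_of_keeps (x := 28) _ (by decide), k28]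
  · rw [Cmd.run_of_keeps (x := 26) _ (by decide),
      k1 26 (by decide) (by decide) (by decide) (by decide), h26]

end driver

end Arith

/-! ### Rounds over all rules -/

namespace Arith

open RAM

section driver

variable {R : Type*} [Semiring R] {k : ℕ} (κ : Fin k → R) (χ : ℕ → R)

theorem TSLP.layout (G : TSLP k) : ofList G.code 1 = G.n ∧ ofList G.code 2 = G.start ∧
    (∀ A : Fin G.n, ofList G.code (A + 3) = G.rk A) ∧
    Seg (ofList G.code) (G.n + 3) (List.ofFn fun A => (G.rhs A).code).flatten := by
  have hc : G.code = G.n :: (G.start : ℕ) :: (List.ofFn G.rk ++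
      (List.ofFn fun A => (G.rhs A).code).flatten) := by simp [TSLP.code]
  have h := seg_ofList G.code
  generalize ofList G.code = b at *
  rw [hc, seg_cons, seg_cons, seg_append, List.length_ofFn] at h
  obtain ⟨h1, h2, h3, h4⟩ := h
  refine ⟨h1, h2, fun A => ?_, ?_⟩
  · have := (seg_iff_getElem _ _ _).1 h3 A (by simp)
    rw [List.getElem_ofFn] at this
    rw [← this]
    congr 1
    omega
  · convert h4 using 1
    omega

theorem TSLP.length_le (G : TSLP k) : G.n ≤ G.code.length ∧
    (∀ A, (G.rhs A).code.length ≤ G.code.length) ∧ ∀ A, G.rk A ≤ G.code.length := by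
  have h : ∀ A, (G.rhs A).code.length ≤ G.code.length := by
    intro A
    have : (G.rhs A).code.length ≤ (List.ofFn fun A => (G.rhs A).code).flatten.length := by
      rw [List.length_flatten]
      exact List.single_le_sum (fun _ _ => Nat.zero_le _) _
        (List.mem_map.2 ⟨_, List.mem_ofFn.2 ⟨A, rfl⟩, rfl⟩)
    simp only [TSLP.code, List.length_append]
    omega
  refine ⟨by simp only [TSLP.code, List.length_append, List.length_ofFn]; omega, h, fun A => ?_⟩
  have := (G.rhs A).params_length_le
  rw [G.valid, List.length_range] at this
  exact this.trans (h A)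

theorem flatten_eq_take {α : Type*} (L : List (List α)) {i : ℕ} (hi : i < L.length) :
    L.flatten = (L.take i).flatten ++ (L[i] ++ (L.drop (i + 1)).flatten) := by
  conv_lhs => rw [← List.take_append_drop i L, List.drop_eq_getElem_cons hi]
  rw [List.flatten_append, List.flatten_cons]

variable {κ χ}

theorem Defined.mono {x : ℕ → ℕ} {N B A tp r : ℕ} {M₀ M : Mem} {gs₀ gs : List (PreGate k)}
    {z : (Fin r → R) → R} (h : Defined κ χ x N B M₀ gs₀ A tp z M gs) {A' r' : ℕ} (hA : A' ≠ A)
    {φ : (Fin r' → R) → R} (hφ : DenoteAt κ χ gs₀ M₀ (M₀ 14 0) B (M₀ 25 A') r' φ) :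
    DenoteAt κ χ gs M (M 14 0) B (M 25 A') r' φ := by
  rw [h.entry, Function.update_of_ne hA]
  exact hφ.mono h.same h.le h.suf

theorem run_forAll {M : Mem} {x : ℕ → ℕ} {p : Cmd} (I : ℕ → Mem → Prop)
    (h0 : I 0 (M.write 26 0 0)) (hM : x 1 ≤ M 3 0)
    (hI : ∀ i M, I i M → M 0 = x ∧ M 26 0 = i) (hs : ∀ i < x 1, ∀ M, I i M → I (i + 1) (p.run M)) :
    I (x 1) ((forAll p).run M) := by
  rw [forAll, Cmd.run_seq, Cmd.run_set]
  refine run_rep_ite I (x 1) h0 (by simpa [Mem.write_ne] using hM) (fun i hi M h => ⟨?_, hs i hi M h⟩)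
    fun M h => ?_
  · obtain ⟨e0, e26⟩ := hI i M h
    simp [e0, e26]
    omega
  · obtain ⟨e0, e26⟩ := hI _ M h
    simp [e0, e26]

/-- All nonterminals denote functions; those of height less than `l`, and the nonterminals less than
`i` of height `l`, denote the correct ones. -/
def Level (κ : Fin k → R) (χ : ℕ → R) (G : TSLP k) (h : Fin G.n → ℕ) (B : ℕ) (gs : List (PreGate k))
    (M : Mem) (l i : ℕ) : Prop :=
  ∀ A : Fin G.n, ∃ φ, DenoteAt κ χ gs M (M 14 0) B (M 25 A) (G.rk A) φ ∧
    (h A < l + (if (A : ℕ) < i then 1 else 0) → φ = G.fn κ χ A)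

variable (G : TSLP k) {h : Fin G.n → ℕ} {N B : ℕ} {M : Mem}

theorem run_forAll_defaultStep {gs : List (PreGate k)} (hE : Env (ofList G.code) N M gs)
    (hN : G.code.length ≤ N) (hB : 4 * G.code.length + 3 ≤ B) :
    ∃ gs' : List (PreGate k), Env (ofList G.code) N ((forAll defaultStep).run M) gs' ∧
      Level κ χ G h B gs' ((forAll defaultStep).run M) 0 0 := by
  obtain ⟨l1, l2, l3, l4⟩ := G.layout
  obtain ⟨m1, m2, m3⟩ := G.length_le
  have key := run_forAll (M := M) (x := ofList G.code) (p := defaultStep)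
    (fun i M => (∃ gs : List (PreGate k), Env (ofList G.code) N M gs ∧ ∀ A : Fin G.n, (A : ℕ) < i →
      ∃ φ, DenoteAt κ χ gs M (M 14 0) B (M 25 A) (G.rk A) φ) ∧ M 26 0 = i)
    ⟨⟨gs, hE.of_arrays (by simp [Mem.write_ne]), by simp⟩, by simp [Mem.write_self]⟩
    (by rw [l1, hE.bound]; omega) (fun i M hi => by obtain ⟨⟨gs, h1, -⟩, h2⟩ := hi; exact ⟨h1.inp, h2⟩)
    ?_
  · rw [l1] at key
    obtain ⟨⟨gs', h1, h2⟩, -⟩ := key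
    exact ⟨gs', h1, fun A => by
      obtain ⟨φ, hφ⟩ := h2 A A.2
      exact ⟨φ, hφ, fun h => by simp at h⟩⟩
  · rintro i hi M ⟨⟨gs, h1, h2⟩, h3⟩
    rw [l1] at hi
    have hr := m3 ⟨i, hi⟩
    obtain ⟨gs', z, hD⟩ := h1.run_defaultStep (κ := κ) (χ := χ) (B := B) h3 (l3 ⟨i, hi⟩) (by omega)
      (by omega)
    refine ⟨⟨gs', hD.env, fun A hA => ?_⟩, hD.next⟩
    rcases Nat.lt_succ_iff_lt_or_eq.1 hA with hA | hA
    · obtain ⟨φ, hφ⟩ := h2 A hA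
      exact ⟨φ, hD.mono (by omega) hφ⟩
    · obtain rfl : A = ⟨i, hi⟩ := Fin.ext hA
      exact ⟨z, hD.den⟩

/-- A rule of height at most l calls only nonterminals of height less than l. These are correct from
the preceding rounds and remain correct when they are translated again, so the new skeleton is
correct as well. Rules of greater height yield skeletons of the right rank, whatever they denote. -/
theorem run_forAll_ruleStep (hh : ∀ B A, B ∈ (G.rhs A).nonterminals → h B < h A)
    {gs : List (PreGate k)} (hE : Env (ofList G.code) N M gs)
    (hN : G.code.length * B + 1 ≤ N) (hB : 4 * G.code.length + 3 ≤ B) (hB' : 5 ≤ B) {l : ℕ}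
    (hL : Level κ χ G h B gs M l 0) (h20 : M 20 0 = G.n + 3) :
    ∃ gs' : List (PreGate k), Env (ofList G.code) N ((forAll ruleStep).run M) gs' ∧
      Level κ χ G h B gs' ((forAll ruleStep).run M) (l + 1) 0 := by
  obtain ⟨l1, l2, l3, l4⟩ := G.layout
  obtain ⟨m1, m2, m3⟩ := G.length_le
  set L := List.ofFn fun A => (G.rhs A).code with hLdef
  have hLl : L.length = G.n := by simp [hLdef]
  have key := run_forAll (M := M) (x := ofList G.code) (p := ruleStep)
    (fun i M => (∃ gs : List (PreGate k), Env (ofList G.code) N M gs ∧ Level κ χ G h B gs M l i) ∧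
      M 26 0 = i ∧ M 20 0 = G.n + 3 + (L.take i).flatten.length)
    ⟨⟨gs, hE.of_arrays (by simp [Mem.write_ne]), fun A => ?_⟩, by simp [Mem.write_self], ?_⟩
    (by rw [l1, hE.bound]; nlinarith)
    (fun i M hi => by obtain ⟨⟨gs, h1, -⟩, h2, -⟩ := hi; exact ⟨h1.inp, h2⟩) ?_
  · rw [l1] at key
    obtain ⟨⟨gs', h1, h2⟩, -⟩ := key
    exact ⟨gs', h1, fun A => by
      obtain ⟨φ, hφ, hφ'⟩ := h2 A
      exact ⟨φ, hφ, by simpa using hφ'⟩⟩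
  · obtain ⟨φ, hφ, hφ'⟩ := hL A
    refine ⟨φ, ?_, hφ'⟩
    rw [Mem.write_ne _ _ _ (by decide), Mem.write_ne _ _ _ (by decide)]
    exact hφ.mono (fun q _ => by simp [SameIns, Mem.write_ne]) le_rfl (List.suffix_refl _)
  · simp [Mem.write_ne, h20]
  · rintro i hi M ⟨⟨gs, h1, h2⟩, h3, h4⟩
    rw [l1] at hi
    have hr := m3 ⟨i, hi⟩
    have hc := m2 ⟨i, hi⟩
    have hLi : L[i]'(by omega) = (G.rhs ⟨i, hi⟩).code := by simp [hLdef]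
    choose Φ hΦ hΦ' using h2
    obtain ⟨gs', hD⟩ := h1.run_ruleStep (κ := κ) (χ := χ) (B := B) (r := G.rk ⟨i, hi⟩) h3
      (G.rhs ⟨i, hi⟩) (by
        rw [flatten_eq_take L (i := i) (by omega), seg_append, seg_append, hLi] at l4
        rw [h4]
        exact l4.2.1) (G.valid _) (by omega) hB' (by nlinarith) hΦ
    refine ⟨⟨gs', hD.env, fun A => ?_⟩, hD.next, ?_⟩
    · by_cases hA : (A : ℕ) = i
      · obtain rfl : A = ⟨i, hi⟩ := Fin.ext hA
        refine ⟨_, hD.den, fun hlt => G.fn_eq _ fun C hC => hΦ' C ?_⟩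
        have := hh _ _ hC
        simp at hlt
        omega
      · refine ⟨_, hD.mono hA (hΦ A), fun hlt => hΦ' A ?_⟩
        have : (A : ℕ) < i + 1 ↔ (A : ℕ) < i := by omega
        simpa only [this] using hlt
    · rw [hD.pos, h4, List.take_succ_eq_append_getElem (by omega), List.flatten_append, hLi]
      simp [add_assoc]

/-- The translation of tree straight-line programs into circuits is correct. -/
theorem run_tslpToCircuit (κ : Fin k → R) (χ : ℕ → R) (h0 : M 0 = ofList G.code)
    (h3 : (G.code.length + 3) ^ 3 ≤ M 3 0) (hz : ∀ a, a = 2 ∨ 5 ≤ a → M a = fun _ => 0) :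
    ∃ (gs : List (PreGate k)) (g : ℕ), Ordered gs ∧ g < gs.length ∧
      gval κ χ gs g = G.eval κ χ ∧
      Seg (tslpToCircuit.run M 2) 0 ([2 + (gcode gs).length, gs.length, g] ++ gcode gs) ∧
      tslpToCircuit.run M 6 0 = 2 + (gcode gs).length ∧ tslpToCircuit.run M 7 0 = gs.length := by
  obtain ⟨h, hlt, hh⟩ := G.acyclic.exists_height
  obtain ⟨l1, l2, l3, l4⟩ := G.layout
  obtain ⟨m1, m2, m3⟩ := G.length_le
  have hX : 3 ≤ G.code.length := by
    have := G.start.pos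
    simp only [TSLP.code, List.length_append, List.length_ofFn, List.length_cons, List.length_nil]
    omega
  obtain ⟨N, hN⟩ : ∃ N, M 3 0 = N := ⟨_, rfl⟩
  set X := G.code.length
  -- Reading one right-hand side takes at most X·B + 1 steps, with B = 4X + 3 because ranks are at
  -- most X. The third power in N is chosen to exceed this.
  have hN1 : X * (4 * X + 3) + 1 ≤ N := by rw [← hN]; nlinarith [sq_nonneg X]
  have hN2 : X ≤ N := by nlinarith
  have e1 := run_setup (k := k) h0 hN hz
  obtain ⟨gs₁, e2, e3⟩ := run_forAll_defaultStep (κ := κ) (χ := χ) (h := h) (B := 4 * X + 3) G e1 hN2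
    le_rfl
  rw [tslpToCircuit, Cmd.run_seq, Cmd.run_seq, Cmd.run_seq, Cmd.run_rep]
  generalize (forAll defaultStep).run (setup.run M) = M₁ at *
  have key := iterate_inv (Cmd.asg 20 (.add (.get 0 (.lit 1)) (.lit 3)) ;; forAll ruleStep).run
    (fun l M => ∃ gs : List (PreGate k), Env (ofList G.code) N M gs ∧
      Level κ χ G h (4 * X + 3) gs M l 0) (M₁ 3 0) (a := M₁) ⟨gs₁, e2, e3⟩ ?_
  · obtain ⟨gs, f1, f2⟩ := key
    rw [e2.bound] at f1 f2 ⊢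
    generalize (Cmd.asg 20 (.add (.get 0 (.lit 1)) (.lit 3)) ;; forAll ruleStep).run^[N] M₁ = M₂ at *
    obtain ⟨φ, ⟨w, w1, w2, w3, w4⟩, hφ⟩ := f2 G.start
    obtain ⟨g, rfl⟩ := w3 G.rk_start
    -- All heights are less than the number of nonterminals, which is at most N; hence N rounds make
    -- every nonterminal correct.
    have hφ' := hφ (by have := hlt G.start; simp; omega)
    have hg : g < gs.length := w1.ids _ List.mem_cons_self
    have hv : M₂ 13 (M₂ 25 G.start) = g := w1.str.1.2
    refine ⟨gs, g, f1.ord, hg, ?_, ?_, ?_, ?_⟩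
    · have := w4 fun _ => 0
      rw [hφ', G.eval_eq_fn] at this
      simp only [exec, Option.some.injEq, Prod.mk.injEq, List.cons.injEq] at this
      exact this.2.1
    · have e : (Cmd.set 2 (.lit 1) (.var 7) ;; .set 2 (.lit 2) (.get 13 (.get 25 (.get 0 (.lit 2)))) ;;
          .set 2 (.lit 0) (.var 6)).run M₂ 2 = Function.update (Function.update (Function.update
          (M₂ 2) 1 gs.length) 2 g) 0 (2 + (gcode gs).length) := by
        simp [Cmd.run_seq, Cmd.run_set, Mem.write_self, Mem.write_ne, f1.cnt, f1.inp, l2, hv, f1.len]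
      rw [e]
      refine ⟨by simp, by simp, by simp, ?_⟩
      refine Seg.update (Seg.update (Seg.update f1.code (by omega)) (by omega)) (by omega)
    · simp [Cmd.run_seq, Cmd.run_set, Mem.write_ne, f1.len]
    · simp [Cmd.run_seq, Cmd.run_set, Mem.write_ne, f1.cnt]
  · rintro l - M' ⟨gs, f1, f2⟩
    rw [Cmd.run_seq, Cmd.run_set]
    refine run_forAll_ruleStep G hh (f1.of_arrays ?_) hN1 le_rfl (by omega) (l := l) (fun A => ?_) ?_
    · simp [Mem.write_ne]
    · obtain ⟨φ, hφ, hφ'⟩ := f2 A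
      refine ⟨φ, ?_, hφ'⟩
      rw [Mem.write_ne _ _ _ (by decide), Mem.write_ne _ _ _ (by decide)]
      exact hφ.mono (fun q _ => by simp [SameIns, Mem.write_ne]) le_rfl (List.suffix_refl _)
    · simp [Mem.write_self, f1.inp, l1]

end driver

end Arith

/-! ### From ordered lists of gates to circuits -/

namespace Arith

open RAM

section circuits

variable {k : ℕ} {gs : List (PreGate k)}

theorem Ordered.lt (h : Ordered gs) {i : ℕ} (hi : i < gs.reverse.length) :
    (gs.reverse[i]).Lt i := by
  induction gs with
  | nil => simp at hi
  | cons g gs ih =>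
    simp only [List.reverse_cons, List.length_append, List.length_singleton] at hi ⊢
    rcases Nat.lt_succ_iff_lt_or_eq.1 hi with h' | h'
    · rw [List.getElem_append_left h']
      exact ih h.2 h'
    · rw [List.length_reverse] at h'
      subst h'
      rw [show (gs.reverse ++ [g])[gs.length]'(by simp) = g by simp]
      exact h.1

theorem gcode_eq (gs : List (PreGate k)) : gcode gs = (gs.reverse.map PreGate.code).flatten := by
  induction gs with
  | nil => rfl
  | cons g gs ih => simp [gcode, ih]

theorem gval_eq {R : Type*} [Semiring R] (κ : Fin k → R) (χ : ℕ → R) (h : Ordered gs) {i : ℕ}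
    (hi : i < gs.reverse.length) : gval κ χ gs i = (gs.reverse[i]).eval κ χ (gval κ χ gs) := by
  induction gs with
  | nil => simp at hi
  | cons g gs ih =>
    have hc : ∀ (g' : PreGate k) (n : ℕ), n ≤ gs.length → g'.Lt n →
        g'.eval κ χ (gval κ χ (g :: gs)) = g'.eval κ χ (gval κ χ gs) := by
      intro g' n hn hg'
      cases g' with
      | leaf a => rfl
      | op f i j =>
        rw [PreGate.eval, PreGate.eval, gval_cons_of_lt κ χ g gs (hg'.1.trans_le hn),
          gval_cons_of_lt κ χ g gs (hg'.2.trans_le hn)]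
    simp only [List.reverse_cons, List.length_append, List.length_singleton] at hi ⊢
    rcases Nat.lt_succ_iff_lt_or_eq.1 hi with h' | h'
    · have h'' : i < gs.length := by simpa using h'
      rw [List.getElem_append_left h', gval_cons_of_lt κ χ g gs h'', ih h.2 h',
        hc _ i h''.le (h.2.lt h')]
    · rw [List.length_reverse] at h'
      subst h'
      rw [show (gs.reverse ++ [g])[gs.length]'(by simp) = g by simp, gval_cons_self,
        hc g _ le_rfl h.1]

def PreGate.toGate (n : ℕ) : (g : PreGate k) → g.Lt n → Gate k n
  | leaf a, _ => .leaf a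
  | op f i j, h => .op f ⟨i, h.1⟩ ⟨j, h.2⟩

theorem PreGate.Lt.mono {m n : ℕ} {g : PreGate k} (h : g.Lt m) (hmn : m ≤ n) : g.Lt n := by
  cases g with
  | leaf a => trivial
  | op f i j => exact ⟨h.1.trans_le hmn, h.2.trans_le hmn⟩

/-- Inputs have smaller numbers, so the graph is acyclic. The circuit is chosen before the semiring
and works for all of them. -/
theorem Ordered.exists_circuit (h : Ordered gs) {g : ℕ} (hg : g < gs.length) :
    ∃ C : Circuit k, C.code = [gs.length, g] ++ gcode gs ∧
      ∀ {R : Type*} [Semiring R] (κ : Fin k → R) (χ : ℕ → R), C.eval κ χ = gval κ χ gs g := by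
  have hlt : ∀ i : Fin gs.length, (gs.reverse[i]'(by simp)).Lt gs.length := fun i =>
    (h.lt (by simp)).mono i.2.le
  let gate : Fin gs.length → Gate k gs.length := fun i =>
    (gs.reverse[i]'(by simp)).toGate gs.length (hlt i)
  have hin : ∀ i j, j ∈ (gate i).inputs → j < i := by
    intro i j hj
    have h1 := h.lt (i := i) (by simp)
    change j ∈ (PreGate.toGate gs.length _ (hlt i)).inputs at hj
    have h2 := hlt i
    revert hj
    generalize hlt i = h3
    change (gs.reverse[i]'(by simp)).Lt i at h1
    revert h3 h1
    generalize gs.reverse[i]'(by simp) = y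
    intro h3 h1 hj
    cases y with
    | leaf a => exact hj.elim
    | op f a b =>
      rcases hj with rfl | rfl
      · exact h1.1
      · exact h1.2
  let C : Circuit k := ⟨gs.length, gate, ⟨g, hg⟩,
    Subrelation.wf (fun {j i} hj => hin i j hj) (measure fun i : Fin gs.length => (i : ℕ)).wf⟩
  refine ⟨C, ?_, fun {R} _ κ χ => ?_⟩
  · rw [gcode_eq]
    change [gs.length, g] ++ (List.ofFn fun i => (gate i).code).flatten = _
    congr 2
    apply List.ext_getElem
    · simp
    · intro i h1 h2
      rw [List.getElem_ofFn, List.getElem_map]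
      have : ∀ (y : PreGate k) (hy : y.Lt gs.length), (y.toGate _ hy).code = y.code := by
        intro y hy
        cases y <;> rfl
      exact this _ _
  · have key : ∀ i : Fin gs.length, C.val κ χ i = gval κ χ gs i := by
      intro i
      induction i using C.acyclic.induction with
      | _ i ih =>
        rw [Circuit.val_eq, gval_eq κ χ h (by simp)]
        have : ∀ (y : PreGate k) (hy : y.Lt gs.length),
            (∀ j ∈ (y.toGate _ hy).inputs, C.val κ χ j = gval κ χ gs j) →
            Circuit.evalGate κ χ (y.toGate _ hy) (fun j _ => C.val κ χ j) =
              y.eval κ χ (gval κ χ gs) := by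
          intro y hy hv
          cases y with
          | leaf a => rfl
          | op f a b =>
            exact congrArg₂ f.eval (hv ⟨a, hy.1⟩ (Or.inl rfl)) (hv ⟨b, hy.2⟩ (Or.inr rfl))
        exact this _ _ ih
    exact key ⟨g, hg⟩

end circuits

/-- Although the circuit is obtained for given κ and χ, its code is the output of a fixed program on
`G.code`. This makes the chosen circuits a function computable in polynomial time. -/
theorem TSLP.exists_circuit {R : Type*} [Semiring R] {k : ℕ} (κ : Fin k → R) (χ : ℕ → R)
    (G : TSLP k) : ∃ C : Circuit k, C.eval κ χ = G.eval κ χ ∧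
      toList (tslpToCircuit.run (RAM.start 3 3 G.code []) 2) = C.code ∧
      tslpToCircuit.run (RAM.start 3 3 G.code []) 2 0 ≤
        tslpToCircuit.run (RAM.start 3 3 G.code []) 6 0 := by
  obtain ⟨gs, g, h1, h2, h3, h4, h5, -⟩ := run_tslpToCircuit G (M := RAM.start 3 3 G.code []) κ χ
    (by simp [RAM.start, Mem.write, init]) (by simp [RAM.start, Mem.write])
    (by
      rintro a (rfl | ha)
      · simp [RAM.start, Mem.write_ne, init]
      · obtain ⟨b, rfl⟩ : ∃ b, a = b + 2 := ⟨a - 2, by omega⟩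
        rw [RAM.start, Mem.write_ne _ _ _ (by omega)]
        rfl)
  obtain ⟨C, hC, hC'⟩ := h1.exists_circuit h2
  obtain ⟨h40, h41⟩ := h4
  refine ⟨C, (hC' κ χ).trans h3, ?_, by rw [h5, h40]⟩
  rw [hC]
  exact toList_of_seg (by rw [h40]; simp; omega) h41

theorem ncZeroTSLP_reduces {S : Type*} [Semiring S] {k : ℕ} (c : Fin k → S) :
    (ncZeroTSLP c).Reduces (ncPIT c) := by
  choose f hf using fun G : TSLP k => G.exists_circuit
    (fun j => (MonoidAlgebra.single 1 (c j) : MonoidAlgebra S (FreeMonoid ℕ)))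
    fun v => MonoidAlgebra.single (FreeMonoid.of v) 1
  exact ⟨f, polyTime_of_run 3 3 6 tslpToCircuit (by decide) (by decide) (by decide) (by decide)
    fun G => (hf G).2, fun G => Iff.of_eq (congrArg (· = 0) (hf G).1.symm)⟩

theorem zeroTSLP_reduces {S : Type*} [CommSemiring S] {k : ℕ} (c : Fin k → S) :
    (zeroTSLP c).Reduces (PIT c) := by
  choose f hf using fun G : TSLP k => G.exists_circuit
    (fun j => (MvPolynomial.C (c j) : MvPolynomial ℕ S)) MvPolynomial.X
  exact ⟨f, polyTime_of_run 3 3 6 tslpToCircuit (by decide) (by decide) (by decide) (by decide)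
    fun G => (hf G).2, fun G => Iff.of_eq (congrArg (· = 0) (hf G).1.symm)⟩

end Arith

namespace RAM

/-! ### Nested loops -/

/-- The expression `c * e`. -/
def Ex.times : ℕ → Ex → Ex
  | 0, _ => .lit 0
  | c + 1, e => .add (times c e) e

@[simp] theorem Ex.eval_times (c : ℕ) (e : Ex) (M : Mem) : (times c e).eval M = c * e.eval M := by
  induction c with
  | zero => simp [times]
  | succ c ih => simp [times, ih, add_mul]

theorem Ex.avoids_times (c x : ℕ) (e : Ex) (h : e.Avoids x) : (times c e).Avoids x := by
  induction c with
  | zero => rfl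
  | succ c ih => simp [times, Ex.Avoids, ih, h]

/-- A loop of nesting depth `e`. -/
def Cmd.loop : ℕ → Cmd → Cmd
  | 0, p => p
  | e + 1, p => .rep (loop e p)

theorem Cmd.keeps_loop (e x : ℕ) (p : Cmd) : (loop e p).Keeps x = p.Keeps x := by
  induction e with
  | zero => rfl
  | succ e ih => exact ih

theorem Cmd.wf_loop (e : ℕ) (p : Cmd) : (loop e p).WF = p.WF := by
  induction e with
  | zero => rfl
  | succ e ih => exact ih

/-- Nesting yields any power of N as a number of rounds, which is needed where the number N of a
single loop is too small. -/
theorem Cmd.run_loop (e : ℕ) {p : Cmd} (hp : p.Keeps 3) (M : Mem) :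
    (loop e p).run M = p.run^[M 3 0 ^ e] M := by
  induction e generalizing M with
  | zero => rfl
  | succ e ih =>
    have h3 : ∀ (j : ℕ), p.run^[j] M 3 = M 3 := by
      intro j
      induction j with
      | zero => rfl
      | succ j ih => rw [Function.iterate_succ_apply', Cmd.run_of_keeps p hp, ih]
    have key : ∀ j, (loop e p).run^[j] M = p.run^[M 3 0 ^ e * j] M := by
      intro j
      induction j with
      | zero => rfl
      | succ j hj =>
        rw [Function.iterate_succ_apply', hj, ih, h3, ← Function.iterate_add_apply, Nat.mul_succ,
          add_comm]
    rw [loop, run_rep, key, pow_succ]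

/-- A nested loop with a test. -/
theorem run_loop_ite {e : ℕ} {x : Ex} {p : Cmd} {M : Mem} (I : ℕ → Mem → Prop) (m : ℕ)
    (hp : p.Keeps 3) (h0 : I 0 M) (hm : m ≤ M 3 0 ^ e)
    (hs : ∀ i < m, ∀ M, I i M → x.eval M ≠ 0 ∧ I (i + 1) (p.run M))
    (hf : ∀ M, I m M → x.eval M = 0) : I m ((Cmd.loop e (.ite x p .skip)).run M) := by
  have key := iterate_inv (Cmd.ite x p .skip).run (fun i M => I (min i m) M) (M 3 0 ^ e) (a := M)
    (by simpa using h0) (fun i _ M h => ?_)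
  · rw [Cmd.run_loop e (by simpa [Cmd.Keeps] using hp)]
    simpa [hm] using key
  · rw [Cmd.run_ite]
    rcases lt_or_ge i m with hi | hi
    · rw [min_eq_left hi.le] at h
      obtain ⟨h1, h2⟩ := hs i hi M h
      rw [min_eq_left (show i + 1 ≤ m from hi), if_neg h1]
      exact h2
    · rw [min_eq_right hi] at h
      rw [min_eq_right (by omega), if_pos (hf M h), Cmd.run_skip]
      exact h

/-! ### Determinism -/

/-- Acceptance asserts the existence of an accepting run. As runs are unique, a run that does not
answer 1 excludes acceptance. -/
theorem Exec.unique {p : Prog} {M M₁ M₂ : Mem} {t₁ t₂ : ℕ} (h₁ : Exec p M t₁ M₁)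
    (h₂ : Exec p M t₂ M₂) : M₁ = M₂ := by
  induction h₁ generalizing t₂ M₂ with
  | skip M => cases h₂; rfl
  | set a i e M => cases h₂; rfl
  | seq _ _ ih₁ ih₂ =>
    cases h₂ with
    | seq a b =>
      obtain rfl := ih₁ a
      exact ih₂ b
  | iteTrue h _ ih =>
    cases h₂ with
    | iteTrue _ a => exact ih a
    | iteFalse h' _ => exact absurd h' h
  | iteFalse h _ ih =>
    cases h₂ with
    | iteTrue h' _ => exact absurd h h'
    | iteFalse _ a => exact ih a
  | loopDone h =>
    cases h₂ with
    | loopDone _ => rfl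
    | loopStep h' _ _ => exact absurd h h'
  | loopStep h _ _ ih₁ ih₂ =>
    cases h₂ with
    | loopDone h' => exact absurd h' h
    | loopStep _ a b =>
      obtain rfl := ih₁ a
      exact ih₂ b

/-! ### Parameters and the modulus -/

/-- Compute the parameters `L`, `r`, `ℓ`, `t`, and initialize the modulus and the position in the
sequence of random bits. -/
def paramCmd (e C q b t m : ℕ) : Cmd :=
  .asg 30 (.add (.var 7) (.lit 2)) ;; .asg 31 (.lit 1) ;;
  .loop e (.ite (.sub (.times C (.var 30)) (.var 31)) (.asg 31 (.times q (.var 31))) .skip) ;;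
  .asg 32 (.add (.times 2 (.var 30)) (.lit b)) ;; .asg 33 (.times t (.var 32)) ;;
  .asg 34 (.lit m) ;; .asg 36 (.lit 1)

theorem run_paramCmd (e C q b t m : ℕ) (M : Mem) (hC : 1 ≤ C) (hq : 2 ≤ q)
    (he : C * (M 7 0 + 2) ≤ M 3 0 ^ e) :
    ∃ M' : Mem, (paramCmd e C q b t m).run M = M' ∧ M' 30 0 = M 7 0 + 2 ∧
      (∃ j, M' 31 0 = q ^ j) ∧ C * (M 7 0 + 2) ≤ M' 31 0 ∧ M' 31 0 ≤ q * (C * (M 7 0 + 2)) ∧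
      M' 32 0 = 2 * (M 7 0 + 2) + b ∧ M' 33 0 = t * M' 32 0 ∧ M' 34 0 = m ∧ M' 36 0 = 1 ∧
      ∀ a, a ≠ 30 → a ≠ 31 → a ≠ 32 → a ≠ 33 → a ≠ 34 → a ≠ 36 → M' a = M a := by
  refine ⟨_, rfl, ?_⟩
  rw [paramCmd, Cmd.run_seq, Cmd.run_seq, Cmd.run_seq, Cmd.run_set, Cmd.run_set,
    Cmd.run_loop _ (by simp [Cmd.Keeps])]
  set M₁ := (M.write 30 ((Ex.lit 0).eval M) (((Ex.var 7).add (.lit 2)).eval M)).write 31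
    ((Ex.lit 0).eval _) ((Ex.lit 1).eval _) with hM₁
  have e30 : M₁ 30 0 = M 7 0 + 2 := by simp [hM₁, Mem.write_ne, Mem.write_self]
  have e3 : M₁ 3 0 = M 3 0 := by simp [hM₁, Mem.write_ne]
  -- Starting from 1, the power of q increases by at least one in each round in which it is below
  -- C·L, which gives the minimum in the invariant; so N^e ≥ C·L rounds suffice. The last
  -- multiplication overshoots by less than a factor q.
  have key := iterate_inv (Cmd.ite (.sub (.times C (.var 30)) (.var 31)) (.asg 31 (.times q (.var 31)))
    .skip).run (fun i M' => (∃ j, M' 31 0 = q ^ j) ∧ min (C * (M 7 0 + 2)) (i + 1) ≤ M' 31 0 ∧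
      M' 31 0 ≤ q * (C * (M 7 0 + 2)) ∧ ∀ a, a ≠ 31 → M' a = M₁ a) (M 3 0 ^ e) (a := M₁) ?_ ?_
  · rw [e3]
    generalize (Cmd.run _)^[_] _ = M₂ at *
    obtain ⟨h1, h2, h3, h4⟩ := key
    rw [min_eq_left (by omega)] at h2
    simp only [Cmd.run_seq, Cmd.run_set]
    refine ⟨?_, ?_, ?_, ?_, ?_, ?_, ?_, ?_, ?_⟩
    · simp [Mem.write_ne, h4, e30]
    · simpa [Mem.write_ne] using h1
    · simpa [Mem.write_ne] using h2
    · simpa [Mem.write_ne] using h3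
    · simp [Mem.write_ne, Mem.write_self, h4, e30]
    · simp [Mem.write_ne, Mem.write_self]
    · simp [Mem.write_ne, Mem.write_self]
    · simp [Mem.write_self]
    · intro a h30 h31 h32 h33 h34 h36
      rw [Mem.write_ne _ _ _ h36, Mem.write_ne _ _ _ h34, Mem.write_ne _ _ _ h33,
        Mem.write_ne _ _ _ h32, h4 a h31, hM₁, Mem.write_ne _ _ _ h31, Mem.write_ne _ _ _ h30]
  · have : M₁ 31 0 = 1 := by simp [hM₁, Mem.write_self]
    have hCL : 1 ≤ C * (M 7 0 + 2) := by nlinarith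
    refine ⟨⟨0, by simp [this]⟩, by rw [this]; omega, by rw [this]; nlinarith, fun _ _ => rfl⟩
  · rintro i - M' ⟨⟨j, h1⟩, h2, h3, h4⟩
    rw [Cmd.run_ite]
    split_ifs with h
    · simp only [Ex.eval, Ex.eval_times, h4 30 (by decide), e30] at h
      rw [Cmd.run_skip]
      exact ⟨⟨j, h1⟩, by omega, h3, h4⟩
    · simp only [Ex.eval, Ex.eval_times, h4 30 (by decide), e30] at h
      rw [Cmd.run_set]
      simp only [Mem.write_self, Ex.eval, Ex.eval_times, Function.update_self]
      refine ⟨⟨j + 1, by rw [h1, pow_succ, mul_comm]⟩, ?_, ?_, ?_⟩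
      · nlinarith [min_le_right (C * (M 7 0 + 2)) (i + 1 + 1), min_le_left (C * (M 7 0 + 2)) (i + 1),
          Nat.min_le_right (C * (M 7 0 + 2)) (i + 1), show i + 1 ≤ M' 31 0 by omega]
      · exact Nat.mul_le_mul_left q (by omega)
      · intro a ha
        rw [Mem.write_ne _ _ _ ha, h4 a ha]

/-- The number with the binary digits `f 0, …, f (n - 1)`, the most significant digit first. -/
def horner (f : ℕ → ℕ) : ℕ → ℕ
  | 0 => 0
  | n + 1 => 2 * horner f n + f n

/-- Multiply the modulus by random numbers. -/
def modulusCmd (e : ℕ) : Cmd :=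
  .asg 37 (.lit 0) ;;
  .loop e (.ite (.sub (.var 33) (.var 37))
    (.asg 38 (.lit 0) ;; .asg 35 (.lit 0) ;;
      .loop e (.ite (.sub (.var 32) (.var 38))
        (.ite (.get 1 (.var 36)) (.asg 35 (.add (.add (.var 35) (.var 35)) (.var 34)))
            (.asg 35 (.add (.var 35) (.var 35))) ;;
          .inc 36 1 ;; .inc 38 1) .skip) ;;
      .asg 34 (.add (.var 35) (.var 34)) ;; .inc 37 1) .skip)

/-- Multiplying the modulus by a random number has to be done by doubling and adding: cell `35`
accumulates the old modulus times the digits read so far. The old modulus is added once more at the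
end, so the factors range over 1, …, 2^ℓ and the modulus never becomes zero. -/
theorem run_modulusCmd (e : ℕ) (M : Mem) (hℓ : M 32 0 ≤ M 3 0 ^ e) (ht : M 33 0 ≤ M 3 0 ^ e)
    (hb : ∀ i, M 1 (M 36 0 + i) ≤ 1) :
    ∃ M' : Mem, (modulusCmd e).run M = M' ∧ M' 36 0 = M 36 0 + M 33 0 * M 32 0 ∧
      M' 34 0 = M 34 0 * ∏ i ∈ Finset.range (M 33 0),
        (horner (fun l => M 1 (M 36 0 + (i * M 32 0 + l))) (M 32 0) + 1) ∧
      ∀ a, a ≠ 34 → a ≠ 35 → a ≠ 36 → a ≠ 37 → a ≠ 38 → M' a = M a := by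
  refine ⟨_, rfl, ?_⟩
  rw [modulusCmd, Cmd.run_seq, Cmd.run_set]
  have key := run_loop_ite (M := M.write 37 0 0) (e := e)
    (x := .sub (.var 33) (.var 37))
    (p := .asg 38 (.lit 0) ;; .asg 35 (.lit 0) ;;
      .loop e (.ite (.sub (.var 32) (.var 38))
        (.ite (.get 1 (.var 36)) (.asg 35 (.add (.add (.var 35) (.var 35)) (.var 34)))
            (.asg 35 (.add (.var 35) (.var 35))) ;;
          .inc 36 1 ;; .inc 38 1) .skip) ;;
      .asg 34 (.add (.var 35) (.var 34)) ;; .inc 37 1)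
    (fun i M' => M' 37 0 = i ∧ M' 36 0 = M 36 0 + i * M 32 0 ∧
      M' 34 0 = M 34 0 * ∏ i ∈ Finset.range i,
        (horner (fun l => M 1 (M 36 0 + (i * M 32 0 + l))) (M 32 0) + 1) ∧
      ∀ a, a ≠ 34 → a ≠ 35 → a ≠ 36 → a ≠ 37 → a ≠ 38 → M' a = M a) (M 33 0)
    (by simp [Cmd.Keeps, Cmd.keeps_loop]) ?_ (by simpa [Mem.write_ne] using ht) ?_ ?_
  · exact key.2
  · refine ⟨by simp [Mem.write_self], by simp [Mem.write_ne], by simp [Mem.write_ne],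
      fun a _ _ _ h _ => by rw [Mem.write_ne _ _ _ h]⟩
  · rintro i hi M' ⟨h37, h36, h34, hk⟩
    refine ⟨by simp [hk, h37]; omega, ?_⟩
    rw [Cmd.run_seq, Cmd.run_seq, Cmd.run_seq, Cmd.run_set, Cmd.run_set]
    set M₁ := (M'.write 38 ((Ex.lit 0).eval M') ((Ex.lit 0).eval M')).write 35
      ((Ex.lit 0).eval _) ((Ex.lit 0).eval _) with hM₁
    have hk₁ : ∀ a, a ≠ 35 → a ≠ 38 → M₁ a = M' a := fun a h1 h2 => by
      rw [hM₁, Mem.write_ne _ _ _ h1, Mem.write_ne _ _ _ h2]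
    have key := run_loop_ite (M := M₁) (e := e)
      (x := .sub (.var 32) (.var 38))
      (p := .ite (.get 1 (.var 36)) (.asg 35 (.add (.add (.var 35) (.var 35)) (.var 34)))
            (.asg 35 (.add (.var 35) (.var 35))) ;; .inc 36 1 ;; .inc 38 1)
      (fun l M'' => M'' 38 0 = l ∧ M'' 36 0 = M' 36 0 + l ∧
        M'' 35 0 = horner (fun l => M 1 (M 36 0 + (i * M 32 0 + l))) l * M' 34 0 ∧
        ∀ a, a ≠ 35 → a ≠ 36 → a ≠ 38 → M'' a = M' a) (M 32 0)
      (by simp [Cmd.Keeps]) ?_ (by simpa [hk₁, hk] using hℓ) ?_ ?_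
    · generalize (Cmd.loop e _).run M₁ = M₂ at *
      obtain ⟨g38, g36, g35, gk⟩ := key
      simp only [Cmd.run_seq, Cmd.run_set]
      refine ⟨?_, ?_, ?_, ?_⟩
      · simp [Mem.write_self, Mem.write_ne, gk, h37]
      · simp [Mem.write_ne, g36, h36, add_mul, add_assoc]
      · simp only [Mem.write_ne, Mem.write_self, Ex.eval, Function.update_self, ne_eq,
          Nat.reduceEqDiff, not_false_eq_true]
        rw [g35, gk 34 (by decide) (by decide) (by decide), h34, Finset.prod_range_succ]
        ring
      · intro a a1 a2 a3 a4 a5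
        rw [Mem.write_ne _ _ _ a4, Mem.write_ne _ _ _ a1, gk a a2 a3 a5, hk a a1 a2 a3 a4 a5]
    · refine ⟨by simp [hM₁, Mem.write_ne, Mem.write_self], by simp [hk₁],
        by simp [hM₁, Mem.write_self, horner], fun a h1 _ h3 => hk₁ a h1 h3⟩
    · rintro l hl M'' ⟨g38, g36, g35, gk⟩
      refine ⟨by simp [g38, gk, hk]; omega, ?_⟩
      have hbit : (Ex.get 1 (.var 36)).eval M'' = M 1 (M 36 0 + (i * M 32 0 + l)) := by
        simp [gk, hk, g36, h36, add_assoc]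
      have hb' := hb (i * M 32 0 + l)
      have e34 : M'' 34 0 = M' 34 0 := by rw [gk 34 (by decide) (by decide) (by decide)]
      rw [Cmd.run_seq, Cmd.run_ite, hbit]
      split_ifs with h0
      · simp only [Cmd.run_seq, Cmd.run_set]
        refine ⟨by simp [Mem.write_self, Mem.write_ne, g38],
          by simp [Mem.write_self, Mem.write_ne, g36, add_assoc], ?_, ?_⟩
        · simp only [Mem.write_ne, Mem.write_self, Ex.eval, Function.update_self, ne_eq,
            Nat.reduceEqDiff, not_false_eq_true, horner, h0, g35]
          ring
        · intro a a1 a2 a3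
          rw [Mem.write_ne _ _ _ a3, Mem.write_ne _ _ _ a2, Mem.write_ne _ _ _ a1, gk a a1 a2 a3]
      · simp only [Cmd.run_seq, Cmd.run_set]
        refine ⟨by simp [Mem.write_self, Mem.write_ne, g38],
          by simp [Mem.write_self, Mem.write_ne, g36, add_assoc], ?_, ?_⟩
        · simp only [Mem.write_ne, Mem.write_self, Ex.eval, Function.update_self, ne_eq,
            Nat.reduceEqDiff, not_false_eq_true, horner, g35, e34,
            show M 1 (M 36 0 + (i * M 32 0 + l)) = 1 by omega]
          ring
        · intro a a1 a2 a3
          rw [Mem.write_ne _ _ _ a3, Mem.write_ne _ _ _ a2, Mem.write_ne _ _ _ a1, gk a a1 a2 a3]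
    · rintro M'' ⟨g38, g36, g35, gk⟩
      simp [g38, gk, hk]
  · rintro M' ⟨h37, h36, h34, hk⟩
    simp [h37, hk]

/-! ### The table of constants -/

/-- Store the numbers `u j - v j` modulo the modulus. -/
def constCmd (u v : ℕ → ℕ) (l : List ℕ) : Cmd :=
  l.foldr (fun j c => .set 40 (.lit j) (.add (.lit (u j)) (.mulmod (.lit (v j))
    (.sub (.var 34) (.lit 1)) (.sub (.var 34) (.lit 1)))) ;; c) .skip

/-- Memory holds natural numbers only. Modulo the modulus, multiplication by the modulus minus one
is negation, so the stored number represents u j - v j. The predecessor also appears as the third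
operand since `mulmod` reduces modulo its successor. -/
theorem run_constCmd (u v : ℕ → ℕ) (l : List ℕ) (M : Mem) :
    (∀ j ∈ l, (constCmd u v l).run M 40 j =
      u j + v j * (M 34 0 - 1) % (M 34 0 - 1 + 1)) ∧
    ∀ a, a ≠ 40 → (constCmd u v l).run M a = M a := by
  have key : ∀ M : Mem, (∀ j, (constCmd u v l).run M 40 j =
      if j ∈ l then u j + v j * (M 34 0 - 1) % (M 34 0 - 1 + 1) else M 40 j) ∧
      ∀ a, a ≠ 40 → (constCmd u v l).run M a = M a := by
    induction l with
    | nil => exact fun M => ⟨by simp [constCmd, Cmd.run_skip], fun a _ => rfl⟩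
    | cons i l ih =>
      intro M
      rw [constCmd, List.foldr_cons, ← constCmd, Cmd.run_seq, Cmd.run_set]
      obtain ⟨h1, h2⟩ := ih (M.write 40 ((Ex.lit i).eval M) (((Ex.lit (u i)).add ((Ex.lit (v i)).mulmod
        ((Ex.var 34).sub (.lit 1)) ((Ex.var 34).sub (.lit 1)))).eval M))
      refine ⟨fun j => ?_, fun a ha => by rw [h2 a ha, Mem.write_ne _ _ _ ha]⟩
      rw [h1]
      by_cases hj : j ∈ l
      · simp [hj, Mem.write_ne]
      · by_cases hji : j = i
        · subst hji
          simp [hj, Mem.write_self]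
        · simp [hj, hji, Mem.write_self]
  exact ⟨fun j hj => by rw [(key M).1 j, if_pos hj], (key M).2⟩

end RAM

namespace RAM

/-! ### Evaluation of circuits in group rings -/

/-- Add two vectors. -/
def addVec (e : ℕ) : Cmd :=
  .asg 47 (.lit 0) ;;
  .loop e (.ite (.sub (.var 31) (.var 47))
    (.set 41 (.add (.var 43) (.var 47))
      (.add (.get 41 (.add (.var 51) (.var 47))) (.get 41 (.add (.var 52) (.var 47)))) ;;
      .inc 47 1) .skip)

/-- Multiply two vectors (cyclic convolution). -/
def mulVec (e : ℕ) : Cmd :=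
  .asg 47 (.lit 0) ;;
  .loop e (.ite (.sub (.var 31) (.var 47))
    (.asg 48 (.lit 0) ;;
      .loop e (.ite (.sub (.var 31) (.var 48))
        (.asg 53 (.add (.var 43) (.mulmod (.add (.var 47) (.var 48)) (.lit 1)
            (.sub (.var 31) (.lit 1)))) ;;
          .set 41 (.var 53) (.add (.get 41 (.var 53))
            (.mulmod (.get 41 (.add (.var 51) (.var 47))) (.get 41 (.add (.var 52) (.var 48)))
              (.sub (.var 34) (.lit 1)))) ;;
          .inc 48 1) .skip) ;;
      .inc 47 1) .skip)

/-- Read a random point. -/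
def readVec (e : ℕ) : Cmd :=
  .asg 47 (.lit 0) ;;
  .loop e (.ite (.sub (.var 30) (.var 47))
    (.set 41 (.add (.var 43) (.var 47)) (.get 1 (.add (.var 51) (.var 47))) ;; .inc 47 1) .skip)

/-- The code of the next gate. -/
abbrev gateCode (i : ℕ) : Ex := .get 2 (.add (.var 45) (.lit i))

/-- Evaluate the next gate. -/
def evalGateCmd (e : ℕ) : Cmd :=
  .ite (.sub (gateCode 0) (.lit 4))
    (.asg 51 (.get 42 (gateCode 1)) ;; .asg 52 (.get 42 (gateCode 2)) ;;
      .ite (.sub (gateCode 0) (.lit 5)) (mulVec e) (addVec e) ;; .inc 45 3)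
    (.ite (.sub (gateCode 0) (.lit 3))
      (.ite (.get 46 (gateCode 1)) .skip (.set 46 (gateCode 1) (.var 36)) ;;
        .asg 51 (.get 46 (gateCode 1)) ;; readVec e ;; .inc 45 2)
      (.ite (.sub (gateCode 0) (.lit 2))
        (.set 41 (.var 43) (.get 40 (gateCode 1)) ;; .inc 45 2)
        (.ite (.sub (gateCode 0) (.lit 1)) (.set 41 (.var 43) (.lit 1)) .skip ;; .inc 45 1))) ;;
  .set 42 (.var 44) (.var 43) ;; .asg 43 (.add (.var 43) (.var 31)) ;; .inc 44 1 ;;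
  .asg 36 (.add (.var 36) (.var 30))

section vectors

variable {A : Type*} [CommRing A] {ξ : A} {r : ℕ}

/-- The element of a ring that is represented by a vector. -/
def vec (ξ : A) (r : ℕ) (f : ℕ → ℕ) (b : ℕ) : A :=
  ∑ u ∈ Finset.range r, (f (b + u) : A) * ξ ^ u

theorem vec_congr {f g : ℕ → ℕ} {b : ℕ} (h : ∀ u < r, f (b + u) = g (b + u)) :
    vec ξ r f b = vec ξ r g b :=
  Finset.sum_congr rfl fun u hu => by rw [h u (Finset.mem_range.1 hu)]

theorem vec_update {f : ℕ → ℕ} {b u : ℕ} (hu : u < r) (v : ℕ) :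
    vec ξ r (Function.update f (b + u) v) b = vec ξ r f b + ((v : A) - f (b + u)) * ξ ^ u := by
  have h : ∀ w ∈ Finset.range r, (Function.update f (b + u) v (b + w) : A) * ξ ^ w =
      (f (b + w) : A) * ξ ^ w + if w = u then ((v : A) - f (b + u)) * ξ ^ u else 0 := by
    intro w _
    by_cases hw : w = u
    · subst hw
      simp
      ring
    · rw [Function.update_of_ne (by omega), if_neg hw, add_zero]
  rw [vec, Finset.sum_congr rfl h, Finset.sum_add_distrib, Finset.sum_ite_eq',
    if_pos (Finset.mem_range.2 hu), vec]

theorem vec_zero {f : ℕ → ℕ} {b : ℕ} (h : ∀ u < r, f (b + u) = 0) : vec ξ r f b = 0 :=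
  Finset.sum_eq_zero fun u hu => by rw [h u (Finset.mem_range.1 hu)]; simp

variable {e m b x y : ℕ} {M : Mem}

theorem run_addVec (hr : r ≤ M 3 0 ^ e) (h31 : M 31 0 = r) (h43 : M 43 0 = b) (h51 : M 51 0 = x)
    (h52 : M 52 0 = y) (hx : x + r ≤ b) (hy : y + r ≤ b) :
    vec ξ r ((addVec e).run M 41) b = vec ξ r (M 41) x + vec ξ r (M 41) y ∧
      (∀ p, p < b ∨ b + r ≤ p → (addVec e).run M 41 p = M 41 p) ∧
      ∀ a, a ≠ 41 → a ≠ 47 → (addVec e).run M a = M a := by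
  rw [addVec, Cmd.run_seq, Cmd.run_set]
  have key := run_loop_ite (M := M.write 47 0 0) (e := e) (x := .sub (.var 31) (.var 47))
    (p := .set 41 (.add (.var 43) (.var 47))
      (.add (.get 41 (.add (.var 51) (.var 47))) (.get 41 (.add (.var 52) (.var 47)))) ;;
      .inc 47 1)
    (fun i M' => M' 47 0 = i ∧ (∀ u < i, M' 41 (b + u) = M 41 (x + u) + M 41 (y + u)) ∧
      (∀ p, p < b ∨ b + i ≤ p → M' 41 p = M 41 p) ∧ ∀ a, a ≠ 41 → a ≠ 47 → M' a = M a) r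
    (by simp [Cmd.Keeps]) ?_ (by simpa [Mem.write_ne] using hr) ?_ ?_
  · simp only [Ex.eval]
    generalize (Cmd.loop e _).run _ = M₂ at *
    obtain ⟨-, h1, h2, h3⟩ := key
    refine ⟨?_, h2, h3⟩
    rw [vec, vec, vec, ← Finset.sum_add_distrib]
    refine Finset.sum_congr rfl fun u hu => ?_
    rw [h1 u (Finset.mem_range.1 hu)]
    push_cast
    ring
  · exact ⟨by simp [Mem.write_self], by simp, fun p _ => by simp [Mem.write_ne],
      fun a _ h => by rw [Mem.write_ne _ _ _ h]⟩
  · rintro i hi M' ⟨h1, h2, h3, h4⟩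
    have hx' : M' 41 (x + i) = M 41 (x + i) := h3 _ (by omega)
    have hy' : M' 41 (y + i) = M 41 (y + i) := h3 _ (by omega)
    have e41 : (Cmd.set 41 (.add (.var 43) (.var 47))
      (.add (.get 41 (.add (.var 51) (.var 47))) (.get 41 (.add (.var 52) (.var 47)))) ;;
      .inc 47 1).run M' 41 = Function.update (M' 41) (b + i) (M 41 (x + i) + M 41 (y + i)) := by
      simp [Cmd.run_seq, Cmd.run_set, Mem.write_ne, Mem.write_self, h4, h43, h51, h52, h1, hx', hy']
    refine ⟨by simp [h4, h31, h1]; omega, ?_, ?_, ?_, ?_⟩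
    · simp [Cmd.run_seq, Cmd.run_set, Mem.write_ne, Mem.write_self, h1]
    · intro u hu
      rw [e41]
      by_cases hui : u = i
      · rw [hui, Function.update_self]
      · rw [Function.update_of_ne (by omega), h2 u (by omega)]
    · intro p hp
      rw [e41, Function.update_of_ne (by omega), h3 p (by omega)]
    · intro a a1 a2
      rw [Cmd.run_seq, Cmd.run_set, Cmd.run_set, Mem.write_ne _ _ _ a2, Mem.write_ne _ _ _ a1, h4 a a1 a2]
  · rintro M' ⟨h1, -, -, h4⟩
    simp [h4, h31, h1]

theorem run_readVec {L : ℕ} (hL : L ≤ M 3 0 ^ e) (hLr : L ≤ r) (h30 : M 30 0 = L)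
    (h43 : M 43 0 = b) (h51 : M 51 0 = x) (h0 : ∀ p, b ≤ p → M 41 p = 0) :
    vec ξ r ((readVec e).run M 41) b = ∑ l ∈ Finset.range L, (M 1 (x + l) : A) * ξ ^ l ∧
      (∀ p, p < b ∨ b + r ≤ p → (readVec e).run M 41 p = M 41 p) ∧
      ∀ a, a ≠ 41 → a ≠ 47 → (readVec e).run M a = M a := by
  rw [readVec, Cmd.run_seq, Cmd.run_set]
  have key := run_loop_ite (M := M.write 47 0 0) (e := e) (x := .sub (.var 30) (.var 47))
    (p := .set 41 (.add (.var 43) (.var 47)) (.get 1 (.add (.var 51) (.var 47))) ;; .inc 47 1)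
    (fun i M' => M' 47 0 = i ∧ (∀ u < i, M' 41 (b + u) = M 1 (x + u)) ∧
      (∀ p, p < b ∨ b + i ≤ p → M' 41 p = M 41 p) ∧ ∀ a, a ≠ 41 → a ≠ 47 → M' a = M a) L
    (by simp [Cmd.Keeps]) ?_ (by simpa [Mem.write_ne] using hL) ?_ ?_
  · simp only [Ex.eval]
    generalize (Cmd.loop e _).run _ = M₂ at *
    obtain ⟨-, h1, h2, h3⟩ := key
    refine ⟨?_, fun p hp => h2 p (by omega), h3⟩
    rw [vec, ← Finset.sum_subset (Finset.range_subset_range.2 hLr)]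
    · refine Finset.sum_congr rfl fun u hu => ?_
      rw [h1 u (Finset.mem_range.1 hu)]
    · intro u _ hu
      rw [Finset.mem_range, not_lt] at hu
      rw [h2 _ (by omega), h0 _ (by omega)]
      simp
  · exact ⟨by simp [Mem.write_self], by simp, fun p _ => by simp [Mem.write_ne],
      fun a _ h => by rw [Mem.write_ne _ _ _ h]⟩
  · rintro i hi M' ⟨h1, h2, h3, h4⟩
    have e41 : (Cmd.set 41 (.add (.var 43) (.var 47)) (.get 1 (.add (.var 51) (.var 47))) ;;
      .inc 47 1).run M' 41 = Function.update (M' 41) (b + i) (M 1 (x + i)) := by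
      simp [Cmd.run_seq, Cmd.run_set, Mem.write_ne, Mem.write_self, h4, h43, h51, h1]
    refine ⟨by simp [h4, h30, h1]; omega, ?_, ?_, ?_, ?_⟩
    · simp [Cmd.run_seq, Cmd.run_set, Mem.write_ne, Mem.write_self, h1]
    · intro u hu
      rw [e41]
      by_cases hui : u = i
      · rw [hui, Function.update_self]
      · rw [Function.update_of_ne (by omega), h2 u (by omega)]
    · intro p hp
      rw [e41, Function.update_of_ne (by omega), h3 p (by omega)]
    · intro a a1 a2
      rw [Cmd.run_seq, Cmd.run_set, Cmd.run_set, Mem.write_ne _ _ _ a2, Mem.write_ne _ _ _ a1, h4 a a1 a2]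
  · rintro M' ⟨h1, -, -, h4⟩
    simp [h4, h30, h1]

theorem cast_mod_eq {m : ℕ} (hm : (m : A) = 0) (a : ℕ) : ((a % m : ℕ) : A) = a := by
  conv_rhs => rw [← Nat.mod_add_div a m]
  simp [hm]

/-- Because ξ^r = 1, exponents may be added modulo r, so the product of two vectors is again a
vector of length r. Entries are mere representatives modulo m: each single product is reduced, but
sums are not, which is harmless in a ring where m is zero. -/
theorem run_mulVec (hξ : ξ ^ r = 1) (hm : (m : A) = 0) (h1m : 1 ≤ m) (hr : r ≤ M 3 0 ^ e)
    (h34 : M 34 0 = m) (h31 : M 31 0 = r) (h43 : M 43 0 = b) (h51 : M 51 0 = x)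
    (h52 : M 52 0 = y) (hx : x + r ≤ b) (hy : y + r ≤ b) (h0 : ∀ p, b ≤ p → M 41 p = 0) :
    vec ξ r ((mulVec e).run M 41) b = vec ξ r (M 41) x * vec ξ r (M 41) y ∧
      (∀ p, p < b ∨ b + r ≤ p → (mulVec e).run M 41 p = M 41 p) ∧
      ∀ a, a ≠ 41 → a ≠ 47 → a ≠ 48 → a ≠ 53 → (mulVec e).run M a = M a := by
  rw [mulVec, Cmd.run_seq, Cmd.run_set]
  have key := run_loop_ite (M := M.write 47 0 0) (e := e) (x := .sub (.var 31) (.var 47))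
    (p := .asg 48 (.lit 0) ;;
      .loop e (.ite (.sub (.var 31) (.var 48))
        (.asg 53 (.add (.var 43) (.mulmod (.add (.var 47) (.var 48)) (.lit 1)
            (.sub (.var 31) (.lit 1)))) ;;
          .set 41 (.var 53) (.add (.get 41 (.var 53))
            (.mulmod (.get 41 (.add (.var 51) (.var 47))) (.get 41 (.add (.var 52) (.var 48)))
              (.sub (.var 34) (.lit 1)))) ;;
          .inc 48 1) .skip) ;;
      .inc 47 1)
    (fun i M' => M' 47 0 = i ∧ vec ξ r (M' 41) b =
        (∑ u ∈ Finset.range i, (M 41 (x + u) : A) * ξ ^ u) * vec ξ r (M 41) y ∧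
      (∀ p, p < b ∨ b + r ≤ p → M' 41 p = M 41 p) ∧
      ∀ a, a ≠ 41 → a ≠ 47 → a ≠ 48 → a ≠ 53 → M' a = M a) r
    (by simp [Cmd.Keeps, Cmd.keeps_loop]) ?_ (by simpa [Mem.write_ne] using hr) ?_ ?_
  · exact key.2
  · refine ⟨by simp [Mem.write_self], ?_, fun p _ => by simp [Mem.write_ne],
      fun a _ h _ _ => by rw [Mem.write_ne _ _ _ h]⟩
    rw [vec_zero fun u _ => by rw [Mem.write_ne _ _ _ (by decide), h0 _ (by omega)]]
    simp
  · rintro i hi M' ⟨h1, h2, h3, h4⟩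
    refine ⟨by simp [h4, h31, h1]; omega, ?_⟩
    rw [Cmd.run_seq, Cmd.run_set, Cmd.run_seq]
    have key := run_loop_ite (M := M'.write 48 0 0) (e := e) (x := .sub (.var 31) (.var 48))
      (p := .asg 53 (.add (.var 43) (.mulmod (.add (.var 47) (.var 48)) (.lit 1)
            (.sub (.var 31) (.lit 1)))) ;;
          .set 41 (.var 53) (.add (.get 41 (.var 53))
            (.mulmod (.get 41 (.add (.var 51) (.var 47))) (.get 41 (.add (.var 52) (.var 48)))
              (.sub (.var 34) (.lit 1)))) ;;
          .inc 48 1)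
      (fun j M'' => M'' 48 0 = j ∧ vec ξ r (M'' 41) b = vec ξ r (M' 41) b +
          (M 41 (x + i) : A) * ξ ^ i * ∑ w ∈ Finset.range j, (M 41 (y + w) : A) * ξ ^ w ∧
        (∀ p, p < b ∨ b + r ≤ p → M'' 41 p = M 41 p) ∧
        ∀ a, a ≠ 41 → a ≠ 48 → a ≠ 53 → M'' a = M' a) r
      (by simp [Cmd.Keeps]) ?_ (by simpa [Mem.write_ne, h4] using hr) ?_ ?_
    · simp only [Ex.eval]
      generalize (Cmd.loop e _).run _ = M₂ at *
      obtain ⟨-, g2, g3, g4⟩ := key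
      rw [Cmd.run_set]
      refine ⟨?_, ?_, ?_, ?_⟩
      · simp [Mem.write_self, g4, h1]
      · rw [Mem.write_ne _ _ _ (by decide), g2, h2, Finset.sum_range_succ, add_mul, vec]
      · intro p hp
        rw [Mem.write_ne _ _ _ (by decide), g3 p hp]
      · intro a a1 a2 a3 a4
        rw [Mem.write_ne _ _ _ a2, g4 a a1 a3 a4, h4 a a1 a2 a3 a4]
    · refine ⟨by simp [Mem.write_self], by simp [Mem.write_ne], fun p hp => by
        rw [Mem.write_ne _ _ _ (by decide), h3 p hp], fun a _ h _ => by rw [Mem.write_ne _ _ _ h]⟩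
    · rintro j hj M'' ⟨g1, g2, g3, g4⟩
      refine ⟨by simp [g4, h4, h31, g1]; omega, ?_⟩
      have hx' : M'' 41 (x + i) = M 41 (x + i) := g3 _ (by omega)
      have hy' : M'' 41 (y + j) = M 41 (y + j) := g3 _ (by omega)
      have hr1 : r - 1 + 1 = r := by omega
      have hm1 : m - 1 + 1 = m := by omega
      have hmod : (i + j) % r < r := Nat.mod_lt _ (by omega)
      have e41 : (Cmd.asg 53 (.add (.var 43) (.mulmod (.add (.var 47) (.var 48)) (.lit 1)
            (.sub (.var 31) (.lit 1)))) ;;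
          .set 41 (.var 53) (.add (.get 41 (.var 53))
            (.mulmod (.get 41 (.add (.var 51) (.var 47))) (.get 41 (.add (.var 52) (.var 48)))
              (.sub (.var 34) (.lit 1)))) ;;
          .inc 48 1).run M'' 41 = Function.update (M'' 41) (b + (i + j) % r)
            (M'' 41 (b + (i + j) % r) + M 41 (x + i) * M 41 (y + j) % m) := by
        simp [Cmd.run_seq, Cmd.run_set, Mem.write_ne, Mem.write_self, g4, h4, h43, h51, h52, h1, g1,
          h31, h34, hx', hy', hr1, hm1]
      refine ⟨?_, ?_, ?_, ?_⟩
      · simp [Cmd.run_seq, Cmd.run_set, Mem.write_ne, Mem.write_self, g1]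
      · have hpow : ξ ^ ((i + j) % r) = ξ ^ i * ξ ^ j := by
          rw [← pow_add]
          conv_rhs => rw [← Nat.mod_add_div (i + j) r, pow_add, pow_mul, hξ, one_pow, mul_one]
        rw [e41, vec_update hmod, g2, Finset.sum_range_succ, hpow]
        push_cast [cast_mod_eq hm]
        ring
      · intro p hp
        rw [e41, Function.update_of_ne (by omega), g3 p hp]
      · intro a a1 a2 a3
        rw [Cmd.run_seq, Cmd.run_seq, Cmd.run_set, Cmd.run_set, Cmd.run_set, Mem.write_ne _ _ _ a2,
          Mem.write_ne _ _ _ a1, Mem.write_ne _ _ _ a3, g4 a a1 a2 a3]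
    · rintro M'' ⟨g1, -, -, g4⟩
      simp [g4, h4, h31, g1]
  · rintro M' ⟨h1, -, -, h4⟩
    simp [h4, h31, h1]

end vectors

end RAM

/-! ### Evaluating one gate in the group ring -/

namespace Arith

open RAM

/-- The number of the first gate with variable `v`. -/
def firstVar {k : ℕ} : List (PreGate k) → ℕ → Option ℕ
  | [], _ => none
  | .leaf (.var w) :: gs, v => (firstVar gs v).or (if w = v then some gs.length else none)
  | _ :: gs, v => firstVar gs v

/-- The state of the memory after the evaluation of the gates `gs`. -/
structure EvalInv {A : Type*} [CommRing A] {k : ℕ} (κ : Fin k → A) (χ : ℕ → A) (ξ : A)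
    (r L p₀ : ℕ) (M₁ : Mem) (gs : List (PreGate k)) (M : Mem) : Prop where
  keep : ∀ a, a ≠ 36 → a ∉ Finset.Icc 41 53 → M a = M₁ a
  bas : M 43 0 = gs.length * r
  num : M 44 0 = gs.length
  ptr : M 45 0 = 3 + (gcode gs).length
  off : M 36 0 = p₀ + gs.length * L
  addr : ∀ j < gs.length, M 42 j = j * r
  zero : ∀ p, gs.length * r ≤ p → M 41 p = 0
  vars : ∀ v, M 46 v = (firstVar gs v).elim 0 fun j => p₀ + j * L
  val : ∀ j < gs.length, vec ξ r (M 41) (j * r) = gval κ χ gs j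

section

variable {A : Type*} [CommRing A] {k : ℕ} {κ : Fin k → A} {χ : ℕ → A} {ξ : A}
  {r L p₀ e m : ℕ} {M₁ M M₂ : Mem} {gs : List (PreGate k)} {g : PreGate k}

/-- Common end of all cases. Gate j owns the cells from j·r on and the block of L random bits from
p₀ + j·L on; a block is skipped even when the gate does not read it. -/
theorem EvalInv.next (h : EvalInv κ χ ξ r L p₀ M₁ gs M) (h31 : M₁ 31 0 = r) (h30 : M₁ 30 0 = L)
    (hk : ∀ a, a ≠ 41 → a ≠ 45 → a ≠ 46 → a ≠ 47 → a ≠ 48 → a ≠ 51 → a ≠ 52 → a ≠ 53 → M₂ a = M a)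
    (h45 : M₂ 45 0 = M 45 0 + g.code.length)
    (h46 : ∀ v, M₂ 46 v = (firstVar (g :: gs) v).elim 0 fun j => p₀ + j * L)
    (hv : vec ξ r (M₂ 41) (gs.length * r) = g.eval κ χ (gval κ χ gs))
    (h41 : ∀ p, p < gs.length * r ∨ gs.length * r + r ≤ p → M₂ 41 p = M 41 p) :
    EvalInv κ χ ξ r L p₀ M₁ (g :: gs) ((Cmd.set 42 (.var 44) (.var 43) ;;
      .asg 43 (.add (.var 43) (.var 31)) ;; .inc 44 1 ;; .asg 36 (.add (.var 36) (.var 30))).run M₂) := by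
  have e43 : M₂ 43 0 = gs.length * r := by rw [hk, h.bas] <;> decide
  have e44 : M₂ 44 0 = gs.length := by rw [hk, h.num] <;> decide
  have e36 : M₂ 36 0 = p₀ + gs.length * L := by rw [hk, h.off] <;> decide
  have e31 : M₂ 31 0 = r := by rw [hk, h.keep, h31] <;> decide
  have e30 : M₂ 30 0 = L := by rw [hk, h.keep, h30] <;> decide
  simp only [Cmd.run_seq, Cmd.run_set]
  refine ⟨?_, ?_, ?_, ?_, ?_, ?_, ?_, ?_, ?_⟩
  · intro a h1 h2
    have h3 : ∀ b ∈ Finset.Icc 41 53, a ≠ b := fun b hb hab => h2 (hab ▸ hb)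
    rw [Mem.write_ne _ _ _ h1, Mem.write_ne _ _ _ (h3 44 (by decide)),
      Mem.write_ne _ _ _ (h3 43 (by decide)), Mem.write_ne _ _ _ (h3 42 (by decide)),
      hk a (h3 _ (by decide)) (h3 _ (by decide)) (h3 _ (by decide)) (h3 _ (by decide))
        (h3 _ (by decide)) (h3 _ (by decide)) (h3 _ (by decide)) (h3 _ (by decide)), h.keep a h1 h2]
  · simp [Mem.write_ne, Mem.write_self, e43, e31, add_mul]
  · simp [Mem.write_ne, Mem.write_self, e44]
  · simp [Mem.write_ne, h45, h.ptr, gcode, add_assoc]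
  · simp [Mem.write_ne, Mem.write_self, e36, e30, add_mul, add_assoc]
  · intro j hj
    simp only [Mem.write_ne, Mem.write_self, ne_eq, Nat.reduceEqDiff, not_false_eq_true, Ex.eval, e44,
      e43]
    by_cases hj' : j = gs.length
    · rw [hj', Function.update_self]
    · rw [Function.update_of_ne hj', hk _ (by decide) (by decide) (by decide) (by decide) (by decide)
        (by decide) (by decide) (by decide), h.addr j (by simp at hj; omega)]
  · intro p hp
    simp only [List.length_cons, add_mul, one_mul] at hp
    simp only [Mem.write_ne, ne_eq, Nat.reduceEqDiff, not_false_eq_true]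
    rw [h41 p (Or.inr hp), h.zero p (by omega)]
  · intro v
    simp only [Mem.write_ne, ne_eq, Nat.reduceEqDiff, not_false_eq_true]
    exact h46 v
  · intro j hj
    simp only [Mem.write_ne, ne_eq, Nat.reduceEqDiff, not_false_eq_true]
    by_cases hj' : j = gs.length
    · rw [hj', hv, gval_cons_self]
    · have hj'' : j < gs.length := by simp at hj; omega
      rw [gval_cons_of_lt _ _ _ _ hj'', ← h.val j hj'']
      refine vec_congr fun u hu => h41 _ (Or.inl ?_)
      nlinarith

theorem EvalInv.step (h : EvalInv κ χ ξ r L p₀ M₁ gs M) (h31 : M₁ 31 0 = r) (h30 : M₁ 30 0 = L)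
    (hξ : ξ ^ r = 1) (h34 : M₁ 34 0 = m) (hm : (m : A) = 0) (h1m : 1 ≤ m) (hr : r ≤ M₁ 3 0 ^ e)
    (hr1 : 1 ≤ r) (hLr : L ≤ r) (hp₀ : 1 ≤ p₀) (hκ : ∀ j : Fin k, (M₁ 40 j : A) = κ j)
    (hχ : ∀ v j, firstVar (g :: gs) v = some j →
      χ v = ∑ l ∈ Finset.range L, (M₁ 1 (p₀ + j * L + l) : A) * ξ ^ l)
    (hlt : g.Lt gs.length) (hseg : Seg (M₁ 2) 3 (gcode (g :: gs))) :
    EvalInv κ χ ξ r L p₀ M₁ (g :: gs) ((evalGateCmd e).run M) := by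
  have hseg' : Seg (M₁ 2) (3 + (gcode gs).length) g.code := ((seg_append _ _ _ _).1 hseg).2
  have k2 : M 2 = M₁ 2 := h.keep 2 (by decide) (by decide)
  have hk : ∀ i, (gateCode i).eval M = M₁ 2 (3 + (gcode gs).length + i) := by
    intro i
    simp [k2, h.ptr]
  have e3 : M 3 0 = M₁ 3 0 := by rw [h.keep 3 (by decide) (by decide)]
  have e31 : M 31 0 = r := by rw [h.keep 31 (by decide) (by decide), h31]
  have e30 : M 30 0 = L := by rw [h.keep 30 (by decide) (by decide), h30]
  have e34 : M 34 0 = m := by rw [h.keep 34 (by decide) (by decide), h34]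
  have vconst : ∀ v : ℕ, vec ξ r (Function.update (M 41) (gs.length * r) v) (gs.length * r) = v := by
    intro v
    have := vec_update (A := A) (ξ := ξ) (f := M 41) (b := gs.length * r) (u := 0) hr1 v
    rw [add_zero] at this
    rw [this, vec_zero fun u _ => h.zero _ (by omega), h.zero _ le_rfl]
    simp
  have hupd : ∀ (v p : ℕ), p < gs.length * r ∨ gs.length * r + r ≤ p →
      Function.update (M 41) (gs.length * r) v p = M 41 p := fun v p hp => by
    rw [Function.update_of_ne (by omega)]
  rw [evalGateCmd, Cmd.run_seq]
  have fin := fun M₂ => h.next (M₂ := M₂) (g := g) h31 h30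
  generalize Cmd.seq (Cmd.set 42 (.var 44) (.var 43)) _ = T at fin ⊢
  cases g with
  | leaf a =>
    cases a with
    | zero =>
      obtain ⟨t0, -⟩ := hseg'
      rw [Cmd.run_ite, if_pos (by simp [k2, h.ptr, t0]), Cmd.run_ite,
        if_pos (by simp [k2, h.ptr, t0]), Cmd.run_ite, if_pos (by simp [k2, h.ptr, t0]), Cmd.run_seq,
        Cmd.run_ite, if_pos (by simp [k2, h.ptr, t0]), Cmd.run_skip, Cmd.run_set]
      refine fin _ (fun a _ h2 _ _ _ _ _ _ => by rw [Mem.write_ne _ _ _ h2]) ?_ ?_ ?_ ?_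
      · simp [Mem.write_self, PreGate.code, Leaf.code]
      · simpa [Mem.write_ne, firstVar] using h.vars
      · rw [Mem.write_ne _ _ _ (by decide), vec_zero fun u _ => h.zero _ (by omega)]
        rfl
      · simp [Mem.write_ne]
    | one =>
      obtain ⟨t0, -⟩ := hseg'
      rw [Cmd.run_ite, if_pos (by simp [k2, h.ptr, t0]), Cmd.run_ite,
        if_pos (by simp [k2, h.ptr, t0]), Cmd.run_ite, if_pos (by simp [k2, h.ptr, t0]), Cmd.run_seq,
        Cmd.run_ite, if_neg (by simp [k2, h.ptr, t0]), Cmd.run_set, Cmd.run_set]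
      refine fin _ (fun a h1 h2 _ _ _ _ _ _ => by
        rw [Mem.write_ne _ _ _ h2, Mem.write_ne _ _ _ h1]) ?_ ?_ ?_ ?_
      · simp [Mem.write_self, Mem.write_ne, PreGate.code, Leaf.code]
      · simpa [Mem.write_ne, firstVar] using h.vars
      · rw [Mem.write_ne _ _ _ (by decide), Mem.write_self]
        simp only [Ex.eval, h.bas]
        rw [vconst]
        simp [PreGate.eval, Leaf.eval]
      · rw [Mem.write_ne _ _ _ (by decide), Mem.write_self]
        simp only [Ex.eval, h.bas]
        exact hupd _
    | const j =>
      obtain ⟨t0, t1, -⟩ := hseg'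
      rw [Cmd.run_ite, if_pos (by simp [k2, h.ptr, t0]), Cmd.run_ite,
        if_pos (by simp [k2, h.ptr, t0]), Cmd.run_ite, if_neg (by simp [k2, h.ptr, t0]), Cmd.run_seq,
        Cmd.run_set, Cmd.run_set]
      refine fin _ (fun a h1 h2 _ _ _ _ _ _ => by
        rw [Mem.write_ne _ _ _ h2, Mem.write_ne _ _ _ h1]) ?_ ?_ ?_ ?_
      · simp [Mem.write_self, Mem.write_ne, PreGate.code, Leaf.code]
      · simpa [Mem.write_ne, firstVar] using h.vars
      · rw [Mem.write_ne _ _ _ (by decide), Mem.write_self]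
        have : (Ex.get 40 (gateCode 1)).eval M = M₁ 40 j := by
          rw [Ex.eval, hk, t1, h.keep 40 (by decide) (by decide)]
        rw [this]
        simp only [Ex.eval, h.bas]
        rw [vconst, hκ]
        rfl
      · rw [Mem.write_ne _ _ _ (by decide), Mem.write_self]
        simp only [Ex.eval, h.bas]
        exact hupd _
    | var v =>
      obtain ⟨t0, t1, -⟩ := hseg'
      rw [Cmd.run_ite, if_pos (by simp [k2, h.ptr, t0]), Cmd.run_ite,
        if_neg (by simp [k2, h.ptr, t0]), Cmd.run_seq, Cmd.run_seq, Cmd.run_seq]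
      have hv1 : (gateCode 1).eval M = v := by rw [hk, t1]
      set M' := (Cmd.ite (.get 46 (gateCode 1)) .skip (.set 46 (gateCode 1) (.var 36))).run M with hM'
      obtain ⟨j, hj⟩ : ∃ j, firstVar (.leaf (.var v) :: gs) v = some j := by
        rw [firstVar]
        cases firstVar gs v <;> simp
      have hk' : ∀ a, a ≠ 46 → M' a = M a := fun a ha =>
        Cmd.run_of_keeps _ (by simp [Cmd.Keeps, ha.symm]) M
      have h46 : ∀ w, M' 46 w = (firstVar (.leaf (.var v) :: gs) w).elim 0 fun j => p₀ + j * L := by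
        intro w
        have hw := h.vars w
        have hw' := h.vars v
        rw [hM', Cmd.run_ite, firstVar]
        have hc : (Ex.get 46 (gateCode 1)).eval M = M 46 v := by rw [Ex.eval, hv1]
        rw [hc]
        split_ifs with h1 h2 h3
        · subst h2
          rw [Cmd.run_set, hv1, Mem.write_self, Function.update_self]
          -- A stored zero means that the variable has not been met; since p₀ ≥ 1, no block starts
          -- at zero, and the two situations cannot be confused.
          cases hf : firstVar gs v with
          | none => simp [h.off]
          | some i =>
            rw [hf] at hw'
            simp at hw'
            omega
        · rw [Cmd.run_set, hv1, Mem.write_self, Function.update_of_ne (Ne.symm h2), hw]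
          simp
        · subst h3
          rw [Cmd.run_skip]
          cases hf : firstVar gs v with
          | none =>
            rw [hf] at hw'
            exact absurd hw' h1
          | some i => rw [hw, hf]; rfl
        · rw [Cmd.run_skip, hw]
          simp
      have hv2 : (Ex.get 46 (gateCode 1)).eval M' = p₀ + j * L := by
        have : (gateCode 1).eval M' = v := by
          rw [← hv1]
          simp [hk']
        rw [Ex.eval, this, h46, hj]
        rfl
      rw [Cmd.run_set, Cmd.run_set, hv2]
      set M'' := M'.write 51 ((Ex.lit 0).eval M') (p₀ + j * L) with hM''
      have hk'' : ∀ a, a ≠ 46 → a ≠ 51 → M'' a = M a := fun a h1 h2 => by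
        rw [hM'', Mem.write_ne _ _ _ h2, hk' a h1]
      have e41'' : M'' 41 = M 41 := hk'' 41 (by decide) (by decide)
      obtain ⟨r1, r2, r3⟩ := run_readVec (ξ := ξ) (r := r) (e := e) (M := M'') (L := L)
        (b := gs.length * r) (x := p₀ + j * L)
        (by rw [hk'' 3 (by decide) (by decide), e3]; omega) hLr
        (by rw [hk'' 30 (by decide) (by decide), e30])
        (by rw [hk'' 43 (by decide) (by decide), h.bas]) (by simp [hM'', Mem.write_self])
        (by rw [e41'']; exact h.zero)
      refine fin _ ?_ ?_ ?_ ?_ ?_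
      · intro a h1 h2 h3 h4 h5 h6 h7 h8
        rw [Mem.write_ne _ _ _ h2, r3 a h1 h4, hk'' a h3 h6]
      · simp [Mem.write_self, r3, hk'', PreGate.code, Leaf.code]
      · intro w
        rw [Mem.write_ne _ _ _ (by decide), r3 46 (by decide) (by decide), hM'',
          Mem.write_ne _ _ _ (by decide), h46]
      · rw [Mem.write_ne _ _ _ (by decide), r1]
        change _ = χ v
        rw [hχ v j hj, hk'' 1 (by decide) (by decide), h.keep 1 (by decide) (by decide)]
      · intro p hp
        rw [Mem.write_ne _ _ _ (by decide), r2 p hp, e41'']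
  | op f x y =>
    have hc : (PreGate.op f x y : PreGate k).code = [f.num, x, y] := by cases f <;> rfl
    have hc3 : (PreGate.op f x y : PreGate k).code.length = 3 := by rw [hc]; rfl
    rw [hc] at hseg'
    obtain ⟨t0, t1, t2, -⟩ := hseg'
    have hf : 5 ≤ f.num := by cases f <;> simp [Op.num]
    rw [Cmd.run_ite, if_neg (by simp [k2, h.ptr, t0]; omega), Cmd.run_seq, Cmd.run_seq, Cmd.run_seq,
      Cmd.run_set, Cmd.run_set, Cmd.run_set]
    have hx : (Ex.get 42 (gateCode 1)).eval M = x * r := by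
      rw [Ex.eval, hk, t1, h.addr x hlt.1]
    have hy : (Ex.get 42 (gateCode 2)).eval (M.write 51 0 (x * r)) = y * r := by
      have : (gateCode 2).eval (M.write 51 0 (x * r)) = (gateCode 2).eval M := by
        simp [Mem.write_ne]
      rw [Ex.eval, this, hk, t2, Mem.write_ne _ _ _ (by decide), h.addr y hlt.2]
    simp only [hx, Ex.eval.eq_1] at hy ⊢
    rw [hy]
    set M'' := (M.write 51 0 (x * r)).write 52 0 (y * r) with hM''
    have hk'' : ∀ a, a ≠ 51 → a ≠ 52 → M'' a = M a := fun a h1 h2 => by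
      rw [hM'', Mem.write_ne _ _ _ h2, Mem.write_ne _ _ _ h1]
    have e41'' : M'' 41 = M 41 := hk'' 41 (by decide) (by decide)
    have g3 : r ≤ M'' 3 0 ^ e := by rw [hk'' 3 (by decide) (by decide), e3]; exact hr
    have g31 : M'' 31 0 = r := by rw [hk'' 31 (by decide) (by decide), e31]
    have g34 : M'' 34 0 = m := by rw [hk'' 34 (by decide) (by decide), e34]
    have g43 : M'' 43 0 = gs.length * r := by rw [hk'' 43 (by decide) (by decide), h.bas]
    have g51 : M'' 51 0 = x * r := by simp [hM'', Mem.write_self, Mem.write_ne]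
    have g52 : M'' 52 0 = y * r := by simp [hM'', Mem.write_self]
    have hxb : x * r + r ≤ gs.length * r := by linarith [Nat.mul_le_mul_right r hlt.1, Nat.succ_mul x r]
    have hyb : y * r + r ≤ gs.length * r := by linarith [Nat.mul_le_mul_right r hlt.2, Nat.succ_mul y r]
    have g0 : ∀ p, gs.length * r ≤ p → M'' 41 p = 0 := by rw [e41'']; exact h.zero
    have ht : (gateCode 0).eval M'' = f.num := by
      have : (gateCode 0).eval M'' = (gateCode 0).eval M := by simp [hk'']
      rw [this, hk, add_zero, t0]
    have hvars : ∀ v, M 46 v = (firstVar (.op f x y :: gs) v).elim 0 fun j => p₀ + j * L := h.vars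
    cases f with
    | add =>
      rw [Cmd.run_ite, if_pos (by rw [Ex.eval, ht]; rfl)]
      obtain ⟨r1, r2, r3⟩ := run_addVec (ξ := ξ) (e := e) g3 g31 g43 g51 g52 hxb hyb
      refine fin _ ?_ ?_ ?_ ?_ ?_
      · intro a h1 h2 h3 h4 h5 h6 h7 h8
        rw [Mem.write_ne _ _ _ h2, r3 a h1 h4, hk'' a h6 h7]
      · simp [Mem.write_self, r3, hk'', hc3]
      · intro w
        rw [Mem.write_ne _ _ _ (by decide), r3 46 (by decide) (by decide),
          hk'' 46 (by decide) (by decide), hvars]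
      · rw [Mem.write_ne _ _ _ (by decide), r1, e41'', h.val x hlt.1, h.val y hlt.2]
        rfl
      · intro p hp
        rw [Mem.write_ne _ _ _ (by decide), r2 p hp, e41'']
    | mul =>
      rw [Cmd.run_ite, if_neg (by rw [Ex.eval, ht]; simp [Op.num])]
      obtain ⟨r1, r2, r3⟩ := run_mulVec (e := e) hξ hm h1m g3 g34 g31 g43 g51 g52 hxb hyb g0
      refine fin _ ?_ ?_ ?_ ?_ ?_
      · intro a h1 h2 h3 h4 h5 h6 h7 h8
        rw [Mem.write_ne _ _ _ h2, r3 a h1 h4 h5 h8, hk'' a h6 h7]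
      · simp [Mem.write_self, r3, hk'', hc3]
      · intro w
        rw [Mem.write_ne _ _ _ (by decide), r3 46 (by decide) (by decide) (by decide) (by decide),
          hk'' 46 (by decide) (by decide), hvars]
      · rw [Mem.write_ne _ _ _ (by decide), r1, e41'', h.val x hlt.1, h.val y hlt.2]
        rfl
      · intro p hp
        rw [Mem.write_ne _ _ _ (by decide), r2 p hp, e41'']

end

end Arith

/-! ### Evaluating all gates and testing the output -/

namespace Arith

open RAM

section

variable {k : ℕ} {gs gs' : List (PreGate k)}

theorem firstVar_of_suffix (h : gs' <:+ gs) {v j : ℕ} (hj : firstVar gs' v = some j) :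
    firstVar gs v = some j := by
  obtain ⟨l, rfl⟩ := h
  induction l with
  | nil => exact hj
  | cons g l ih =>
    rw [List.cons_append]
    cases g with
    | leaf a =>
      cases a with
      | var w => rw [firstVar, ih]; rfl
      | _ => exact ih
    | op f i j => exact ih

theorem firstVar_lt {v j : ℕ} (h : firstVar gs v = some j) : j < gs.length := by
  induction gs with
  | nil => cases h
  | cons g gs ih =>
    have ih' : firstVar gs v = some j → j < (g :: gs).length := fun h => (ih h).trans (by simp)
    cases g with
    | leaf a =>
      cases a with
      | var w =>
        rw [firstVar, Option.or_eq_some_iff] at h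
        rcases h with h | ⟨-, h⟩
        · exact ih' h
        · split_ifs at h
          simp only [Option.some.injEq] at h
          simp [h]
      | _ => exact ih' h
    | op f i j => exact ih' h

theorem Ordered.of_suffix (h : gs' <:+ gs) (hg : Ordered gs) : Ordered gs' := by
  obtain ⟨l, rfl⟩ := h
  induction l with
  | nil => exact hg
  | cons g l ih => exact ih hg.2

theorem seg_gcode_of_suffix {f : ℕ → ℕ} {p : ℕ} (h : gs' <:+ gs) (hg : Seg f p (gcode gs)) :
    Seg f p (gcode gs') := by
  obtain ⟨l, rfl⟩ := h
  induction l with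
  | nil => exact hg
  | cons g l ih =>
    rw [List.cons_append, gcode, seg_append] at hg
    exact ih hg.1

theorem exists_cons_suffix {α : Type*} {l l' : List α} (h : l' <:+ l) (hl : l'.length < l.length) :
    ∃ a, a :: l' <:+ l := by
  obtain ⟨t, rfl⟩ := h
  rcases List.eq_nil_or_concat t with rfl | ⟨s, a, rfl⟩
  · simp at hl
  · exact ⟨a, s, by simp⟩

end

/-- Evaluate all gates. -/
def gatesCmd (e : ℕ) : Cmd :=
  .asg 45 (.lit 3) ;; .loop e (.ite (.sub (.var 7) (.var 44)) (evalGateCmd e) .skip)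

/-- Test if the output gate has the value zero. -/
def answerCmd (e : ℕ) : Cmd :=
  .asg 50 (.lit 1) ;; .asg 43 (.get 42 (.get 2 (.lit 2))) ;; .asg 47 (.lit 0) ;;
  .loop e (.ite (.sub (.var 31) (.var 47))
    (.ite (.mulmod (.get 41 (.add (.var 43) (.var 47))) (.lit 1) (.sub (.var 34) (.lit 1)))
        (.asg 50 (.lit 0)) .skip ;; .inc 47 1) .skip) ;;
  .asg 2 (.var 50)

theorem run_gatesCmd {A : Type*} [CommRing A] {k : ℕ} {κ : Fin k → A} {χ : ℕ → A} {ξ : A}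
    {r L p₀ e m : ℕ} {M : Mem} {gs : List (PreGate k)} (h31 : M 31 0 = r) (h30 : M 30 0 = L)
    (h36 : M 36 0 = p₀) (hξ : ξ ^ r = 1) (h34 : M 34 0 = m) (hm : (m : A) = 0) (h1m : 1 ≤ m)
    (hr : r ≤ M 3 0 ^ e) (hr1 : 1 ≤ r) (hLr : L ≤ r) (hp₀ : 1 ≤ p₀)
    (hκ : ∀ j : Fin k, (M 40 j : A) = κ j)
    (hχ : ∀ v j, firstVar gs v = some j →
      χ v = ∑ l ∈ Finset.range L, (M 1 (p₀ + j * L + l) : A) * ξ ^ l)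
    (ho : Ordered gs) (hseg : Seg (M 2) 3 (gcode gs)) (h7 : M 7 0 = gs.length)
    (hlen : gs.length ≤ M 3 0 ^ e) (hz : ∀ a ∈ Finset.Icc 41 53, M a = fun _ => 0) :
    EvalInv κ χ ξ r L p₀ M gs ((gatesCmd e).run M) := by
  rw [gatesCmd, Cmd.run_seq, Cmd.run_set]
  have key := run_loop_ite (M := M.write 45 0 3) (e := e) (x := .sub (.var 7) (.var 44))
    (p := evalGateCmd e)
    (fun i M' => ∃ gs', gs' <:+ gs ∧ gs'.length = i ∧ EvalInv κ χ ξ r L p₀ M gs' M') gs.length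
    (by simp [Cmd.Keeps, Cmd.keeps_loop, evalGateCmd, addVec, mulVec, readVec]) ?_
    (by simpa [Mem.write_ne] using hlen) ?_ ?_
  · obtain ⟨gs', h1, h2, h3⟩ := key
    obtain rfl := h1.eq_of_length h2
    exact h3
  · refine ⟨[], List.nil_suffix, rfl, ?_⟩
    refine ⟨?_, ?_, ?_, ?_, ?_, ?_, ?_, ?_, ?_⟩
    · intro a _ h2
      rw [Mem.write_ne _ _ _ fun h => h2 (by rw [h]; decide)]
    · simp [Mem.write_ne, hz 43 (by decide)]
    · simp [Mem.write_ne, hz 44 (by decide)]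
    · simp [Mem.write_self, gcode]
    · simp [Mem.write_ne, h36]
    · simp
    · simp [Mem.write_ne, hz 41 (by decide)]
    · simp [Mem.write_ne, hz 46 (by decide), firstVar]
    · simp
  · rintro i hi M' ⟨gs', h1, h2, h3⟩
    refine ⟨by simp [h3.keep, h7, h3.num, h2]; omega, ?_⟩
    obtain ⟨g, hg⟩ := exists_cons_suffix h1 (h2 ▸ hi)
    exact ⟨g :: gs', hg, by simp [h2], h3.step h31 h30 hξ h34 hm h1m hr hr1 hLr hp₀ hκ
      (fun v j hj => hχ v j (firstVar_of_suffix hg hj)) (ho.of_suffix hg).1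
      (seg_gcode_of_suffix hg hseg)⟩
  · rintro M' ⟨gs', h1, h2, h3⟩
    simp [h3.keep, h7, h3.num, h2]

theorem run_answerCmd {e r m g b : ℕ} {M : Mem} (h31 : M 31 0 = r) (h34 : M 34 0 = m)
    (hr : r ≤ M 3 0 ^ e) (h1m : 1 ≤ m) (h2 : M 2 2 = g) (h42 : M 42 g = b) :
    (answerCmd e).run M 2 0 = if ∀ u < r, m ∣ M 41 (b + u) then 1 else 0 := by
  rw [answerCmd, Cmd.run_seq, Cmd.run_seq, Cmd.run_seq, Cmd.run_seq, Cmd.run_set, Cmd.run_set,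
    Cmd.run_set, Cmd.run_set]
  set M₁ := Mem.write (Mem.write (Mem.write M 50 _ _) 43 _ _) 47 _ _ with hM₁
  have hk : ∀ a, a ≠ 50 → a ≠ 43 → a ≠ 47 → M₁ a = M a := fun a h1 h2 h3 => by
    rw [hM₁, Mem.write_ne _ _ _ h3, Mem.write_ne _ _ _ h2, Mem.write_ne _ _ _ h1]
  have hm1 : m - 1 + 1 = m := by omega
  have key := run_loop_ite (M := M₁) (e := e) (x := .sub (.var 31) (.var 47))
    (p := .ite (.mulmod (.get 41 (.add (.var 43) (.var 47))) (.lit 1) (.sub (.var 34) (.lit 1)))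
        (.asg 50 (.lit 0)) .skip ;; .inc 47 1)
    (fun i M' => M' 47 0 = i ∧ M' 50 0 = (if ∀ u < i, m ∣ M 41 (b + u) then 1 else 0) ∧
      ∀ a, a ≠ 47 → a ≠ 50 → M' a = M₁ a) r
    (by simp [Cmd.Keeps]) ?_ (by rw [hk 3 (by decide) (by decide) (by decide)]; exact hr) ?_ ?_
  · simp [Mem.write_self, key.2.1]
  · refine ⟨by simp [hM₁, Mem.write_self], by simp [hM₁, Mem.write_self, Mem.write_ne],
      fun _ _ _ => rfl⟩
  · rintro i hi M' ⟨i1, i2, i3⟩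
    have e43 : M' 43 0 = b := by
      rw [i3 43 (by decide) (by decide)]
      simp [hM₁, Mem.write_ne, Mem.write_self, h2, h42]
    have ht : (Ex.mulmod (.get 41 (.add (.var 43) (.var 47))) (.lit 1)
        (.sub (.var 34) (.lit 1))).eval M' = M 41 (b + i) % m := by
      simp [e43, i1, i3, hk, h34, hm1]
    refine ⟨by simp [i3, hk, h31, i1]; omega, ?_⟩
    rw [Cmd.run_seq, Cmd.run_ite, ht]
    have hstep : (∀ u < i + 1, m ∣ M 41 (b + u)) ↔ (∀ u < i, m ∣ M 41 (b + u)) ∧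
        M 41 (b + i) % m = 0 := by
      rw [← Nat.dvd_iff_mod_eq_zero]
      exact ⟨fun h => ⟨fun u hu => h u (by omega), h i (by omega)⟩, fun h u hu => by
        rcases Nat.lt_succ_iff_lt_or_eq.1 hu with hu | rfl
        exacts [h.1 u hu, h.2]⟩
    split_ifs with h1 h2 h2
    · rw [Cmd.run_skip, Cmd.run_set]
      refine ⟨by simp [Mem.write_self, i1], ?_, fun a a1 a2 => by rw [Mem.write_ne _ _ _ a1, i3 a a1 a2]⟩
      rw [Mem.write_ne _ _ _ (by decide), i2, if_pos (hstep.1 h2).1]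
    · rw [Cmd.run_skip, Cmd.run_set]
      refine ⟨by simp [Mem.write_self, i1], ?_, fun a a1 a2 => by rw [Mem.write_ne _ _ _ a1, i3 a a1 a2]⟩
      rw [Mem.write_ne _ _ _ (by decide), i2, if_neg fun h => h2 (hstep.2 ⟨h, h1⟩)]
    · exact absurd (hstep.1 h2).2 h1
    · rw [Cmd.run_set, Cmd.run_set]
      refine ⟨by simp [Mem.write_self, Mem.write_ne, i1], by simp [Mem.write_self, Mem.write_ne],
        fun a a1 a2 => by rw [Mem.write_ne _ _ _ a1, Mem.write_ne _ _ _ a2, i3 a a1 a2]⟩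
  · rintro M' ⟨i1, i2, i3⟩
    simp [i3, hk, h31, i1]

end Arith

namespace RAM

/-! ### Programs that do not read an array -/

theorem Ex.eval_congr_of_avoids {x : ℕ} {M M' : Mem} (h : ∀ a, a ≠ x → M a = M' a) (e : Ex)
    (he : e.Avoids x) : e.eval M = e.eval M' := by
  induction e with
  | lit n => rfl
  | get a e ih =>
    simp only [Avoids, Bool.and_eq_true, bne_iff_ne] at he
    rw [eval, eval, ih he.2, h a he.1]
  | add e₁ e₂ h₁ h₂ | sub e₁ e₂ h₁ h₂ =>
    simp only [Avoids, Bool.and_eq_true] at he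
    rw [eval, eval, h₁ he.1, h₂ he.2]
  | mulmod e₁ e₂ m h₁ h₂ h₃ =>
    simp only [Avoids, Bool.and_eq_true] at he
    rw [eval, eval, h₁ he.1.1, h₂ he.1.2, h₃ he.2]

/-- The program does not read the array with name `x`. -/
def Cmd.Avoids (x : ℕ) : Cmd → Bool
  | skip => true
  | set _ i e => i.Avoids x && e.Avoids x
  | seq p q => p.Avoids x && q.Avoids x
  | ite e p q => e.Avoids x && p.Avoids x && q.Avoids x
  | rep p => x != 3 && p.Avoids x

theorem Cmd.avoids_loop (e x : ℕ) (p : Cmd) (hx : x ≠ 3) (h : p.Avoids x) :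
    (loop e p).Avoids x := by
  induction e with
  | zero => exact h
  | succ e ih => simp [loop, Avoids, hx, ih]

/-- Applied to the array of random bits: the circuit and the order r are the same for all random
bits, so that probabilities refer to a fixed polynomial. -/
theorem Cmd.run_congr_of_avoids {x : ℕ} (c : Cmd) (hc : c.Avoids x) {M M' : Mem}
    (h : ∀ a, a ≠ x → M a = M' a) : ∀ a, a ≠ x → c.run M a = c.run M' a := by
  induction c generalizing M M' with
  | skip => exact h
  | set b i e =>
    simp only [Avoids, Bool.and_eq_true] at hc
    intro a ha
    rw [run, run, Ex.eval_congr_of_avoids h i hc.1, Ex.eval_congr_of_avoids h e hc.2]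
    by_cases hab : a = b
    · subst hab
      simp [Mem.write_self, h a ha]
    · rw [Mem.write_ne _ _ _ hab, Mem.write_ne _ _ _ hab, h a ha]
  | seq p q hp hq =>
    simp only [Avoids, Bool.and_eq_true] at hc
    exact hq hc.2 (hp hc.1 h)
  | ite e p q hp hq =>
    simp only [Avoids, Bool.and_eq_true] at hc
    rw [run, run, Ex.eval_congr_of_avoids h e hc.1.1]
    split_ifs
    · exact hq hc.2 h
    · exact hp hc.1.2 h
  | rep p hp =>
    simp only [Avoids, Bool.and_eq_true, bne_iff_ne] at hc
    rw [run, run, h 3 (Ne.symm hc.1)]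
    generalize M' 3 0 = n
    induction n with
    | zero => exact h
    | succ n ih =>
      rw [Function.iterate_succ_apply', Function.iterate_succ_apply']
      exact hp hc.2 ih

/-- Supplies a nesting depth e for which N^e exceeds all the loop bounds that the test requires. A
coefficient c is absorbed by c ≤ 2^c ≤ N^c, hence the assumption 2 ≤ N. -/
theorem exists_eval_le_pow (p : Polynomial ℕ) : ∃ e : ℕ, ∀ N, 2 ≤ N → p.eval N ≤ N ^ e := by
  induction p using Polynomial.induction_on' with
  | add p q hp hq =>
    obtain ⟨a, ha⟩ := hp
    obtain ⟨b, hb⟩ := hq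
    refine ⟨a + b + 1, fun N hN => ?_⟩
    rw [Polynomial.eval_add]
    have h1 : N ^ a ≤ N ^ (a + b) := Nat.pow_le_pow_right (by omega) (by omega)
    have h2 : N ^ b ≤ N ^ (a + b) := Nat.pow_le_pow_right (by omega) (by omega)
    have h3 : N ^ (a + b) * 2 ≤ N ^ (a + b + 1) := by
      rw [pow_succ]
      exact Nat.mul_le_mul_left _ hN
    have := ha N hN
    have := hb N hN
    omega
  | monomial n c =>
    refine ⟨c + n, fun N hN => ?_⟩
    rw [Polynomial.eval_monomial, pow_add]
    refine Nat.mul_le_mul_right _ ?_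
    exact (Nat.lt_two_pow_self.le).trans (Nat.pow_le_pow_left hN c)

end RAM

namespace Arith

open RAM

/-! ### Ring homomorphisms -/

section map

variable {R S : Type*} [Semiring R] [Semiring S] (f : R →+* S) {k : ℕ} (κ : Fin k → R) (χ : ℕ → R)

theorem map_leaf_eval (a : Leaf k) : f (a.eval κ χ) = a.eval (f ∘ κ) (f ∘ χ) := by
  cases a <;> simp [Leaf.eval]

theorem map_op_eval (o : Op) (a b : R) : f (o.eval a b) = o.eval (f a) (f b) := by
  cases o <;> simp [Op.eval]

theorem map_formula_eval (ξ : ℕ → R) (t : Formula k) :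
    f (t.eval κ χ ξ) = t.eval (f ∘ κ) (f ∘ χ) (f ∘ ξ) := by
  induction t with
  | param i => rfl
  | leaf a => exact map_leaf_eval f κ χ a
  | op o s t hs ht => rw [Formula.eval, map_op_eval, hs, ht, Formula.eval]

theorem map_tslp_eval (G : TSLP k) : f (G.eval κ χ) = G.eval (f ∘ κ) (f ∘ χ) := by
  rw [TSLP.eval, map_formula_eval, TSLP.eval]
  congr 1
  funext i
  simp

theorem map_gval (gs : List (PreGate k)) (i : ℕ) :
    f (gval κ χ gs i) = gval (f ∘ κ) (f ∘ χ) gs i := by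
  induction gs generalizing i with
  | nil => simp [gval]
  | cons g gs ih =>
    rw [gval, gval]
    split_ifs
    · cases g with
      | leaf a => exact map_leaf_eval f κ χ a
      | op o i j => rw [PreGate.eval, map_op_eval, ih, ih, PreGate.eval]
    · exact ih i

end map

/-- The polynomial semiring over ℕ in all constants and variables is universal, so an identity there
specializes to every commutative semiring. This matters for the randomized test, where the ring
depends on the random modulus but the list of gates must not. -/
theorem gval_eq_of_universal {k : ℕ} {gs : List (PreGate k)} {i : ℕ} {G : TSLP k}
    (h : gval (fun j => (MvPolynomial.X (Sum.inl j) : MvPolynomial (Fin k ⊕ ℕ) ℕ))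
      (fun v => MvPolynomial.X (Sum.inr v)) gs i =
        G.eval (fun j => MvPolynomial.X (Sum.inl j)) fun v => MvPolynomial.X (Sum.inr v))
    {R : Type*} [CommSemiring R] (κ : Fin k → R) (χ : ℕ → R) : gval κ χ gs i = G.eval κ χ := by
  have := congrArg (MvPolynomial.eval₂Hom (Nat.castRingHom R) (Sum.elim κ χ)) h
  rw [map_gval, map_tslp_eval] at this
  convert this using 2 <;> first | rfl | (funext; simp)

/-! ### The group ring of a cyclic group -/

section groupRing

variable {R : Type*} [CommRing R] {r : ℕ}

/-- The generator of the cyclic group. -/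
noncomputable def rootOfUnity (R : Type*) [CommRing R] (r : ℕ) : AddMonoidAlgebra R (ZMod r) :=
  AddMonoidAlgebra.single 1 1

theorem rootOfUnity_pow (u : ℕ) : rootOfUnity R r ^ u = AddMonoidAlgebra.single (u : ZMod r) 1 := by
  rw [rootOfUnity, AddMonoidAlgebra.single_pow]
  simp

theorem rootOfUnity_pow_self : rootOfUnity R r ^ r = 1 := by
  rw [rootOfUnity_pow, ZMod.natCast_self]
  rfl

theorem coeff_vec (f : ℕ → ℕ) (b : ℕ) {w : ℕ} (hw : w < r) :
    (vec (rootOfUnity R r) r f b).coeff w = (f (b + w) : R) := by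
  have h : ∀ u ∈ Finset.range r,
      (((f (b + u) : AddMonoidAlgebra R (ZMod r)) * rootOfUnity R r ^ u).coeff w : R) =
        if u = w then (f (b + u) : R) else 0 := by
    intro u hu
    rw [rootOfUnity_pow, AddMonoidAlgebra.natCast_def, AddMonoidAlgebra.single_mul_single, zero_add,
      mul_one, AddMonoidAlgebra.coeff_single, Finsupp.single_apply]
    congr 1
    rw [ZMod.natCast_eq_natCast_iff, Nat.ModEq, Nat.mod_eq_of_lt (Finset.mem_range.1 hu),
      Nat.mod_eq_of_lt hw]
  rw [vec, AddMonoidAlgebra.coeff_sum, Finsupp.finsetSum_apply, Finset.sum_congr rfl h,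
    Finset.sum_ite_eq', if_pos (Finset.mem_range.2 hw)]

/-- The powers ξ^u with u < r form a basis of the group ring, so the inspection of the entries
decides exactly whether the value is zero. -/
theorem vec_eq_zero_iff {m : ℕ} (f : ℕ → ℕ) (b : ℕ) :
    vec (rootOfUnity (ZMod m) r) r f b = 0 ↔ ∀ u < r, m ∣ f (b + u) := by
  constructor
  · intro h u hu
    rw [← ZMod.natCast_eq_zero_iff, ← coeff_vec f b hu, h]
    rfl
  · intro h
    exact Finset.sum_eq_zero fun u hu => by
      rw [AddMonoidAlgebra.natCast_def,
        (ZMod.natCast_eq_zero_iff _ _).2 (h u (Finset.mem_range.1 hu))]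
      simp

end groupRing

end Arith

/-! ### The complete zero test -/

namespace Arith

open RAM

/-- The zero test for tree straight-line programs. -/
def zeroTestCmd (k e C q b t m : ℕ) (u v : ℕ → ℕ) : Cmd :=
  (tslpToCircuit ;; paramCmd e C q b t m) ;; modulusCmd e ;; constCmd u v (List.range k) ;;
    gatesCmd e ;; answerCmd e

theorem wf_zeroTestCmd (k e C q b t m : ℕ) (u v : ℕ → ℕ) : (zeroTestCmd k e C q b t m u v).WF := by
  have h1 : tslpToCircuit.WF := by decide
  have h2 : (paramCmd e C q b t m).WF := by
    simp [paramCmd, Cmd.WF, Cmd.wf_loop, Ex.Avoids, Ex.avoids_times]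
  have h3 : (modulusCmd e).WF := by simp [modulusCmd, Cmd.WF, Cmd.wf_loop, Ex.Avoids]
  have h4 : (gatesCmd e).WF := by
    simp [gatesCmd, evalGateCmd, mulVec, addVec, readVec, Cmd.WF, Cmd.wf_loop, Ex.Avoids]
  have h5 : (answerCmd e).WF := by simp [answerCmd, Cmd.WF, Cmd.wf_loop, Ex.Avoids]
  have h6 : ∀ l, (constCmd u v l).WF := fun l => by
    induction l with
    | nil => rfl
    | cons a l ih =>
      rw [constCmd, List.foldr_cons, ← constCmd]
      simp [Cmd.WF, Ex.Avoids, ih]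
  simp [zeroTestCmd, Cmd.WF, h1, h2, h3, h4, h5, h6]

/-- The random modulus. -/
def modulus (m T ℓ : ℕ) (β : ℕ → ℕ) : ℕ :=
  m * ∏ i ∈ Finset.range T, (horner (fun l => β (i * ℓ + l)) ℓ + 1)

/-- The random point. -/
def point {A : Type*} [CommRing A] (ξ : A) {k : ℕ} (gs : List (PreGate k)) (L s : ℕ) (β : ℕ → ℕ)
    (v : ℕ) : A :=
  (firstVar gs v).elim 0 fun j => ∑ l ∈ Finset.range L, (β (s + (j * L + l)) : A) * ξ ^ l

theorem modulus_pos {m T ℓ : ℕ} {β : ℕ → ℕ} (hm : 1 ≤ m) : 1 ≤ modulus m T ℓ β :=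
  Nat.mul_pos hm (Finset.prod_pos fun _ _ => Nat.succ_pos _)

/-- The first t·ℓ·ℓ random bits determine the modulus, and the following blocks of length L
determine the point. These ranges are disjoint, so the modulus and the point are independent. -/
theorem run_zeroTestCmd {k e C q b t m L ℓ r g : ℕ} {u v : ℕ → ℕ} {M : Mem}
    {gs : List (PreGate k)} (hC : 1 ≤ C) (hq : 2 ≤ q) (hm : 1 ≤ m) (ho : Ordered gs)
    (hg : g < gs.length)
    (hseg : Seg (tslpToCircuit.run M 2) 0 ([2 + (gcode gs).length, gs.length, g] ++ gcode gs))
    (h7 : tslpToCircuit.run M 7 0 = gs.length) (hL : L = gs.length + 2) (hℓ : ℓ = 2 * L + b)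
    (hz : ∀ a, a = 2 ∨ 5 ≤ a → M a = fun _ => 0)
    (hr : r = (tslpToCircuit ;; paramCmd e C q b t m).run M 31 0)
    (hβ : ∀ i, M 1 (1 + i) ≤ 1) (e1 : q * (C * L) ≤ M 3 0 ^ e) (e2 : t * ℓ ≤ M 3 0 ^ e)
    (e3 : ℓ ≤ M 3 0 ^ e) :
    (∃ j, r = q ^ j) ∧ C * L ≤ r ∧
    let μ := modulus m (t * ℓ) ℓ fun i => M 1 (1 + i)
    ((zeroTestCmd k e C q b t m u v).run M 2 0 = 1 ↔
      gval (fun j : Fin k => (u j - v j : AddMonoidAlgebra (ZMod μ) (ZMod r)))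
        (point (rootOfUnity (ZMod μ) r) gs L (t * ℓ * ℓ) fun i => M 1 (1 + i)) gs g = 0) := by
  have hk : ∀ a ∈ insert 1 (insert 3 (Finset.Icc 30 53)), tslpToCircuit.Keeps a := by decide
  set M₁ := tslpToCircuit.run M with hM₁
  have k1 : ∀ a ∈ insert 1 (insert 3 (Finset.Icc 30 53)), M₁ a = M a := fun a ha =>
    Cmd.run_of_keeps _ (hk a ha) M
  have k3 : M₁ 3 = M 3 := k1 3 (by decide)
  have hCL : C * L ≤ q * (C * L) := Nat.le_mul_of_pos_left _ (by omega)
  have hLL : L ≤ C * L := Nat.le_mul_of_pos_left _ hC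
  obtain ⟨M₂, hM₂, p30, ⟨j, p31⟩, p31', p31'', p32, p33, p34, p36, pk⟩ :=
    run_paramCmd e C q b t m M₁ hC hq (by rw [h7, ← hL, k3]; omega)
  rw [h7, ← hL] at p30 p31' p31'' p32
  rw [Cmd.run_seq, ← hM₁, hM₂] at hr
  have hr' : M₂ 31 0 = r := hr.symm
  rw [← hℓ] at p32
  rw [p32] at p33
  rw [hr'] at p31 p31' p31''
  have k2 : ∀ a ∈ insert 1 (insert 3 (Finset.Icc 37 53)), M₂ a = M a := fun a ha => by
    have h : ∀ a ∈ insert 1 (insert 3 (Finset.Icc 37 53)), a ≠ 30 ∧ a ≠ 31 ∧ a ≠ 32 ∧ a ≠ 33 ∧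
      a ≠ 34 ∧ a ≠ 36 ∧ a ∈ insert 1 (insert 3 (Finset.Icc 30 53)) := by decide
    obtain ⟨h1, h2, h3, h4, h5, h6, h7⟩ := h a ha
    rw [pk a h1 h2 h3 h4 h5 h6, k1 a h7]
  have k2_1 : M₂ 1 = M 1 := k2 1 (by decide)
  have k2_3 : M₂ 3 = M 3 := k2 3 (by decide)
  obtain ⟨M₃, hM₃, q36, q34, qk⟩ := run_modulusCmd e M₂ (by rw [p32, k2_3]; exact e3)
    (by rw [p33, k2_3]; exact e2) (by rw [k2_1, p36]; exact hβ)
  rw [p36, p33, p32] at q36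
  have q34' : M₃ 34 0 = modulus m (t * ℓ) ℓ fun i => M 1 (1 + i) := by
    rw [q34, p34, p33, p32, p36, k2_1]
    rfl
  refine ⟨⟨j, p31⟩, p31', ?_⟩
  intro μ
  have hμ : 1 ≤ μ := modulus_pos hm
  obtain ⟨c1, ck⟩ := run_constCmd u v (List.range k) M₃
  set M₄ := (constCmd u v (List.range k)).run M₃ with hM₄
  have k4 : ∀ a, a ≠ 34 → a ≠ 35 → a ≠ 36 → a ≠ 37 → a ≠ 38 → a ≠ 40 → M₄ a = M₂ a :=
    fun a h1 h2 h3 h4 h5 h6 => by rw [ck a h6, qk a h1 h2 h3 h4 h5]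
  have k42 : ∀ a ∈ insert 1 (insert 3 (Finset.Icc 41 53)), M₄ a = M a := fun a ha => by
    have h : ∀ a ∈ insert 1 (insert 3 (Finset.Icc 41 53)), a ≠ 34 ∧ a ≠ 35 ∧ a ≠ 36 ∧ a ≠ 37 ∧
      a ≠ 38 ∧ a ≠ 40 ∧ a ∈ insert 1 (insert 3 (Finset.Icc 37 53)) := by decide
    obtain ⟨h1, h2, h3, h4, h5, h6, h7⟩ := h a ha
    rw [k4 a h1 h2 h3 h4 h5 h6, k2 a h7]
  have m2 : M₄ 2 = M₁ 2 := by
    rw [k4 2 (by decide) (by decide) (by decide) (by decide) (by decide) (by decide),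
      pk 2 (by decide) (by decide) (by decide) (by decide) (by decide) (by decide)]
  have m3 : M₄ 3 = M 3 := k42 3 (by decide)
  have m1 : M₄ 1 = M 1 := k42 1 (by decide)
  have m7 : M₄ 7 0 = gs.length := by
    rw [k4 7 (by decide) (by decide) (by decide) (by decide) (by decide) (by decide),
      pk 7 (by decide) (by decide) (by decide) (by decide) (by decide) (by decide), h7]
  have m31 : M₄ 31 0 = r := by
    rw [k4 31 (by decide) (by decide) (by decide) (by decide) (by decide) (by decide), hr']
  have m30 : M₄ 30 0 = L := by
    rw [k4 30 (by decide) (by decide) (by decide) (by decide) (by decide) (by decide), p30]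
  have m34 : M₄ 34 0 = μ := by rw [ck 34 (by decide), q34']
  have m36 : M₄ 36 0 = 1 + t * ℓ * ℓ := by rw [ck 36 (by decide), q36]
  have hμ0 : ((μ : ℕ) : AddMonoidAlgebra (ZMod μ) (ZMod r)) = 0 := by
    rw [AddMonoidAlgebra.natCast_def, ZMod.natCast_self]
    simp
  have hr1 : r ≤ M₄ 3 0 ^ e := by rw [m3]; omega
  have hseg₄ : Seg (M₄ 2) 3 (gcode gs) := by
    rw [m2]
    exact ((seg_append _ _ _ _).1 hseg).2
  have m22 : M₄ 2 2 = g := by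
    rw [m2]
    exact hseg.2.2.1
  have E := run_gatesCmd (A := AddMonoidAlgebra (ZMod μ) (ZMod r)) (e := e)
    (κ := fun j : Fin k => (u j - v j : AddMonoidAlgebra (ZMod μ) (ZMod r)))
    (χ := point (rootOfUnity (ZMod μ) r) gs L (t * ℓ * ℓ) fun i => M 1 (1 + i)) m31 m30 m36
    rootOfUnity_pow_self m34 hμ0 hμ hr1 (by omega) (by omega) (by omega) (fun j => by
      rw [c1 j (by simp), q34', Nat.cast_add, show _ - 1 + 1 = μ from Nat.sub_add_cancel hμ,
        cast_mod_eq hμ0, Nat.cast_mul, Nat.cast_sub (show 1 ≤ modulus _ _ _ _ from hμ), hμ0]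
      simp [sub_eq_add_neg]) (fun v j hj => by
      rw [point, hj]
      simp [m1, add_assoc]) ho hseg₄ m7 (by rw [m3]; omega) (fun a ha => by
      have h : ∀ a ∈ Finset.Icc 41 53, 5 ≤ a ∧ a ∈ insert 1 (insert 3 (Finset.Icc 41 53)) := by decide
      rw [k42 a (h a ha).2, hz a (Or.inr (h a ha).1)])
  set M₅ := (gatesCmd e).run M₄ with hM₅
  have A := run_answerCmd (M := M₅) (e := e) (r := r) (m := μ) (g := g) (b := g * r)
    (by rw [E.keep 31 (by decide) (by decide), m31])
    (by rw [E.keep 34 (by decide) (by decide), m34])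
    (by rw [E.keep 3 (by decide) (by decide)]; exact hr1) hμ
    (by rw [E.keep 2 (by decide) (by decide), m22]) (E.addr g hg)
  have hrun : (zeroTestCmd k e C q b t m u v).run M = (answerCmd e).run M₅ := by
    rw [zeroTestCmd, Cmd.run_seq, Cmd.run_seq, Cmd.run_seq, Cmd.run_seq, Cmd.run_seq, ← hM₁, hM₂, hM₃,
      ← hM₄, ← hM₅]
  rw [hrun, A, ← E.val g hg, vec_eq_zero_iff]
  simp
end Arith

namespace Arith

open RAM

/-- The random bits as a function; missing bits are zero. -/
def bitFun {n : ℕ} (ρ : Fin n → Bool) (i : ℕ) : ℕ := if h : i < n then (ρ ⟨i, h⟩).toNat else 0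

theorem bitFun_le_one {n : ℕ} (ρ : Fin n → Bool) (i : ℕ) : bitFun ρ i ≤ 1 := by
  rw [bitFun]
  split_ifs
  · exact Bool.toNat_le _
  · exact zero_le_one

theorem ofList_bits {n : ℕ} (ρ : Fin n → Bool) (i : ℕ) : ofList (bits ρ) (1 + i) = bitFun ρ i := by
  rw [add_comm, ofList, bitFun, bits]
  split_ifs with h
  · rw [List.getD_eq_getElem _ _ (by simpa using h)]
    simp
  · rw [List.getD_eq_default _ _ (by simpa using h)]

/-- The order of the quantifiers matters: gates, order of the group, L and ℓ depend on G alone, and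
only the modulus and the point depend on the random bits ρ. Both coRP results are instances that
differ in the parameters. -/
theorem exists_zeroTest (k C q b t m : ℕ) (u v : ℕ → ℕ) (hC : 1 ≤ C) (hq : 2 ≤ q) (hm : 1 ≤ m) :
    ∃ (p : Prog) (Q l : Polynomial ℕ), ∀ G : TSLP k,
      ∃ (gs : List (PreGate k)) (g r j L ℓ : ℕ), g < gs.length ∧
      (∀ {R : Type} [CommSemiring R] (κ : Fin k → R) (χ : ℕ → R), gval κ χ gs g = G.eval κ χ) ∧
      L = gs.length + 2 ∧ ℓ = 2 * L + b ∧ r = q ^ j ∧ C * L ≤ r ∧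
      t * ℓ * ℓ + gs.length * L ≤ l.eval (bitSize G.code) ∧
      ∀ ρ : Fin (l.eval (bitSize G.code)) → Bool,
        (∃ (t : ℕ) (M : Mem), Exec p (init G.code (bits ρ)) t M ∧ t ≤ Q.eval (bitSize G.code)) ∧
        let μ := modulus m (t * ℓ) ℓ (bitFun ρ)
        (Accepts p G.code ρ ↔
          gval (fun j : Fin k => (u j - v j : AddMonoidAlgebra (ZMod μ) (ZMod r)))
            (point (rootOfUnity (ZMod μ) r) gs L (t * ℓ * ℓ) (bitFun ρ)) gs g = 0) := by
  obtain ⟨γ, hγ⟩ := tslpToCircuit.run_counts_le (x := 7) (by decide) (by decide)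
  -- The number of gates is at most γ(N); the polynomial majorizes q·C·L, the number t·ℓ of random
  -- factors, and ℓ.
  obtain ⟨e, he⟩ := exists_eval_le_pow
    (.C (q * C) * (γ + 2) + .C (t + 1) * (2 * (γ + 2) + .C b))
  have he' : ∀ N, 2 ≤ N → ∀ n ≤ γ.eval N, q * (C * (n + 2)) ≤ N ^ e ∧
      t * (2 * (n + 2) + b) ≤ N ^ e ∧ 2 * (n + 2) + b ≤ N ^ e := by
    intro N hN n hn
    have := he N hN
    simp only [Polynomial.eval_add, Polynomial.eval_mul, Polynomial.eval_C, Polynomial.eval_ofNat]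
      at this
    have h1 : q * C * (n + 2) ≤ q * C * (γ.eval N + 2) := Nat.mul_le_mul_left _ (by omega)
    have h2 : t * (2 * (n + 2) + b) ≤ t * (2 * (γ.eval N + 2) + b) :=
      Nat.mul_le_mul_left _ (by omega)
    rw [add_mul, one_mul] at this
    rw [← mul_assoc]
    omega
  -- An upper bound for the number t·ℓ·ℓ + n·L of random bits in use, where n ≤ γ(N) is the number
  -- of gates.
  set P : Polynomial ℕ := .C t * (2 * (γ + 2) + .C b) * (2 * (γ + 2) + .C b) + γ * (γ + 2) with hP
  set l : Polynomial ℕ := P.comp ((.X + 3) ^ 3) with hl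
  obtain ⟨Q, hQ⟩ := exec_program 3 3 _ (wf_zeroTestCmd k e C q b t m u v) l
  refine ⟨program 3 3 (zeroTestCmd k e C q b t m u v), Q, l, fun G => ?_⟩
  have s3 : ∀ r, start 3 3 G.code r 3 0 = (G.code.length + 3) ^ 3 := fun r => by
    simp [start, Mem.write_self]
  have s7 : ∀ r, start 3 3 G.code r 7 0 = 0 := fun r => by simp [start, Mem.write_ne, init]
  have sz : ∀ r a, a = 2 ∨ 5 ≤ a → start 3 3 G.code r a = fun _ => 0 := fun r a ha => by
    obtain ⟨a, rfl⟩ := Nat.exists_eq_add_of_le' (show 2 ≤ a by omega)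
    rw [start, Mem.write_ne _ _ _ (by omega)]
    rfl
  have s1 : ∀ r, start 3 3 G.code r 1 = ofList r := fun r => by
    rw [start, Mem.write_ne _ _ _ (by decide)]
    rfl
  have hN : 2 ≤ (G.code.length + 3) ^ 3 :=
    calc 2 ≤ 3 ^ 3 := by norm_num
      _ ≤ _ := Nat.pow_le_pow_left (by omega) 3
  obtain ⟨gs, g, ho, hg, hv, hseg, -, h7⟩ := run_tslpToCircuit
    (M := start 3 3 G.code []) (G := G)
    (fun j => (MvPolynomial.X (Sum.inl j) : MvPolynomial (Fin k ⊕ ℕ) ℕ))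
    (fun v => MvPolynomial.X (Sum.inr v)) (by
      rw [start, Mem.write_ne _ _ _ (by decide)]; rfl) (s3 _).ge (sz _)
  have hlen : gs.length ≤ γ.eval ((G.code.length + 3) ^ 3) := by
    have := hγ (start 3 3 G.code [])
    rwa [h7, s7, zero_add, s3] at this
  obtain ⟨e1, e2, e3⟩ := he' _ hN _ hlen
  have htest := fun (r : List ℕ) (hseg) (h7) (hr) (hβ) =>
    run_zeroTestCmd (M := start 3 3 G.code r) (u := u) (v := v) (e := e) (C := C) (q := q) (b := b)
      (t := t) (m := m) hC hq hm ho hg hseg h7 rfl rfl (sz r) (hr : (tslpToCircuit ;;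
        paramCmd e C q b t m).run (start 3 3 G.code []) 31 0 = _) hβ (by rw [s3]; exact e1)
      (by rw [s3]; exact e2) (by rw [s3]; exact e3)
  obtain ⟨⟨j, hj⟩, hCL, -⟩ := htest [] hseg h7 rfl (by
    intro i
    rw [s1, add_comm]
    simp [ofList])
  refine ⟨gs, g, _, j, _, _, hg, fun κ χ => gval_eq_of_universal hv κ χ, rfl, rfl, hj, hCL, ?_, ?_⟩
  · have hx := (Polynomial.eval_nat_mono γ) (show (G.code.length + 3) ^ 3 ≤ (bitSize G.code + 3) ^ 3
      from Nat.pow_le_pow_left (Nat.add_le_add_right (length_le_bitSize _) _) 3)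
    simp only [hl, hP, Polynomial.eval_comp, Polynomial.eval_add, Polynomial.eval_mul,
      Polynomial.eval_C, Polynomial.eval_ofNat, Polynomial.eval_pow, Polynomial.eval_X]
    dsimp only at hx
    gcongr <;> omega
  · intro ρ
    have hagree : ∀ a, a ≠ 1 → start 3 3 G.code [] a = start 3 3 G.code (bits ρ) a := by
      intro a ha
      by_cases h3 : a = 3
      · subst h3
        rw [start, start, Mem.write_self, Mem.write_self]
        rfl
      · rw [start, start, Mem.write_ne _ _ _ h3, Mem.write_ne _ _ _ h3]
        rcases a with _ | _ | a
        · rfl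
        · exact absurd rfl ha
        · rfl
    have hc := Cmd.run_congr_of_avoids tslpToCircuit (by decide) hagree
    have hp := Cmd.run_congr_of_avoids (tslpToCircuit ;; paramCmd e C q b t m) (x := 1) (by
      have h1 : tslpToCircuit.Avoids 1 := by decide
      simp [Cmd.Avoids, h1, paramCmd, Cmd.avoids_loop, Ex.avoids_times]) hagree
    obtain ⟨-, -, H⟩ := htest (bits ρ) (by rw [← hc 2 (by decide)]; exact hseg)
      (by rw [← hc 7 (by decide)]; exact h7) (by rw [hp 31 (by decide)]) (fun i => by
        rw [s1, ofList_bits]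
        exact bitFun_le_one ρ i)
    have hf : (fun i => start 3 3 G.code (bits ρ) 1 (1 + i)) = bitFun ρ := by
      funext i
      rw [s1, ofList_bits]
    rw [hf] at H
    obtain ⟨T, M, hE, hM, -, hT⟩ := hQ G.code (bits ρ) (by simp [bits]) (by
      simp only [bits, List.mem_ofFn]
      rintro y ⟨i, rfl⟩
      exact Bool.toNat_le _)
    refine ⟨⟨T, M, hE, hT⟩, ?_⟩
    intro μ
    refine Iff.trans ?_ H
    rw [← hM 2 (by decide)]
    constructor
    · rintro ⟨T', M', hE', h⟩
      rwa [hE.unique hE']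
    · exact fun h => ⟨T, M, hE, h⟩

end Arith

namespace Arith

/-! ### Probabilities -/

/-- Conditioning: if the probability is at most 1/4 for every fixed choice of the bits outside the
image of e, it is at most 1/4 altogether. The injection F writes s into the positions given by e and
remembers the bits that were there. -/
theorem four_mul_card_le {I : Type*} [Fintype I] {l : ℕ} {e : I → Fin l} (he : e.Injective)
    (Q : (Fin l → Bool) → Prop)
    (h : ∀ ρ, 4 * Nat.card {s : I → Bool // Q (Function.extend e s ρ)} ≤ 2 ^ Fintype.card I) :
    4 * Nat.card {ρ // Q ρ} ≤ 2 ^ l := by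
  classical
  have hext : ∀ (ρ : Fin l → Bool) (s : I → Bool),
      Function.extend e (ρ ∘ e) (Function.extend e s ρ) = ρ := by
    intro ρ s
    funext i
    by_cases hi : ∃ a, e a = i
    · obtain ⟨a, rfl⟩ := hi
      rw [he.extend_apply]
      rfl
    · rw [Function.extend_apply' _ _ _ hi, Function.extend_apply' _ _ _ hi]
  let F : {ρ // Q ρ} × (I → Bool) → Σ ρ, {s : I → Bool // Q (Function.extend e s ρ)} :=
    fun x => ⟨Function.extend e x.2 x.1, x.1.1 ∘ e, by rw [hext]; exact x.1.2⟩
  have hF : F.Injective := by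
    rintro ⟨⟨ρ, h1⟩, s⟩ ⟨⟨ρ', h2⟩, s'⟩ hx
    have hx1 : Function.extend e s ρ = Function.extend e s' ρ' := congrArg Sigma.fst hx
    have hx2 : ρ ∘ e = ρ' ∘ e :=
      congrArg (fun y : Σ ρ, {s : I → Bool // Q (Function.extend e s ρ)} => y.2.1) hx
    have h3 : ρ = ρ' := by rw [← hext ρ s, ← hext ρ' s', hx1, hx2]
    have h4 : s = s' := by
      funext a
      have := congrFun hx1 (e a)
      rwa [he.extend_apply, he.extend_apply] at this
    subst h3 h4
    rfl
  have h1 := Nat.card_le_card_of_injective F hF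
  rw [Nat.card_prod, Nat.card_sigma] at h1
  have h2 : Nat.card (I → Bool) = 2 ^ Fintype.card I := by simp [Nat.card_eq_fintype_card]
  rw [h2] at h1
  have h3 := Finset.sum_le_card_nsmul Finset.univ
    (fun ρ => 4 * Nat.card {s : I → Bool // Q (Function.extend e s ρ)}) _ fun ρ _ => h ρ
  rw [← Finset.mul_sum, Finset.card_univ] at h3
  simp only [Fintype.card_pi, Fintype.card_bool, Finset.prod_const, Finset.card_univ,
    Fintype.card_fin, smul_eq_mul] at h3
  have h4 : 0 < 2 ^ Fintype.card I := by positivity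
  refine Nat.le_of_mul_le_mul_right ?_ h4
  calc _ ≤ 4 * _ := by rw [mul_assoc]; exact Nat.mul_le_mul_left 4 h1
    _ ≤ _ := h3

/-- This is (1 - 1/s)^s ≤ 1/e ≤ 1/2: a ratio D/M of at most 1 - 1/s is halved by the s-th power. -/
theorem two_mul_pow_le {D M s : ℕ} (hs : 1 ≤ s) (h : D * s ≤ M * (s - 1)) :
    2 * D ^ s ≤ M ^ s := by
  have hs' : (0 : ℝ) < s := by exact_mod_cast hs
  have h1 : (D : ℝ) ≤ M * (1 - 1 / s) := by
    have : (D : ℝ) * s ≤ M * (s - 1) := by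
      have := (Nat.cast_le (α := ℝ)).2 h
      rwa [Nat.cast_mul, Nat.cast_mul, Nat.cast_sub hs, Nat.cast_one] at this
    rw [← mul_le_mul_iff_left₀ hs']
    calc _ ≤ _ := this
      _ = _ := by field_simp
  have h2 : (1 - 1 / s : ℝ) ^ s ≤ 1 / 2 := by
    calc (1 - 1 / s : ℝ) ^ s ≤ Real.exp (-1) := Real.one_sub_div_pow_le_exp_neg (by exact_mod_cast hs)
      _ = 1 / Real.exp 1 := by rw [Real.exp_neg, one_div]
      _ ≤ 1 / 2 := one_div_le_one_div_of_le two_pos (by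
        have := Real.add_one_le_exp 1
        linarith)
  have h3 : (D : ℝ) ^ s ≤ M ^ s * (1 / 2) := by
    calc (D : ℝ) ^ s ≤ (M * (1 - 1 / s)) ^ s := pow_le_pow_left₀ (Nat.cast_nonneg _) h1 _
      _ = M ^ s * (1 - 1 / s) ^ s := mul_pow _ _ _
      _ ≤ _ := mul_le_mul_of_nonneg_left h2 (by positivity)
  have h4 : (2 : ℝ) * (D : ℝ) ^ s ≤ M ^ s := by linarith
  exact_mod_cast h4

/-! ### Number theory -/

/-- By Fermat q divides p^(q-1) - 1, so lifting the exponent gives v_q(p^((q-1)d) - 1) =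
v_q((p^(q-1) - 1)·d). Hence q^j divides a positive number less than p^(q-1)·d. In other words, the
order of p modulo q^j grows linearly in q^j, for fixed p and q. -/
theorem lt_of_pow_dvd {p q j d : ℕ} (hp : p.Prime) (hq : q.Prime) (hq2 : q ≠ 2) (hpq : p ≠ q)
    (hd : 1 ≤ d) (h : q ^ j ∣ p ^ d - 1) : q ^ j < p ^ (q - 1) * d := by
  have := Fact.mk hq
  have hcop : ¬ q ∣ p := fun h => hpq ((Nat.prime_dvd_prime_iff_eq hq hp).1 h).symm
  have hx1 : 1 < p ^ (q - 1) := Nat.one_lt_pow (by have := hq.two_le; omega) hp.one_lt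
  have hx : q ∣ p ^ (q - 1) - 1 := by
    have h1 : p ^ (q - 1) ≡ 1 [MOD q] := by
      rw [← Nat.totient_prime hq]
      exact Nat.ModEq.pow_totient ((Nat.coprime_primes hp hq).2 hpq)
    exact (Nat.modEq_iff_dvd' hx1.le).1 h1.symm
  have hxd : q ^ j ∣ (p ^ (q - 1)) ^ d - 1 ^ d := by
    rw [← pow_mul, mul_comm, pow_mul, one_pow]
    exact h.trans (by simpa using Nat.sub_dvd_pow_sub_pow (p ^ d) 1 (q - 1))
  have hne : (p ^ (q - 1)) ^ d - 1 ^ d ≠ 0 := by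
    have := Nat.one_lt_pow (show d ≠ 0 by omega) hx1
    simp
    omega
  have hv := padicValNat.pow_sub_pow (p := q) (hq.odd_of_ne_two hq2) hx1 hx
    (fun h => hcop (hq.dvd_of_dvd_pow h)) (show d ≠ 0 by omega)
  have h1 := (padicValNat_dvd_iff_le hne).1 hxd
  rw [hv, ← padicValNat.mul (by omega) (by omega)] at h1
  have h2 : q ^ j ∣ (p ^ (q - 1) - 1) * d :=
    (padicValNat_dvd_iff_le (Nat.mul_ne_zero (by omega) (by omega))).2 h1
  have h3 := Nat.le_of_dvd (Nat.mul_pos (by omega) (by omega)) h2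
  refine h3.trans_lt ?_
  exact Nat.mul_lt_mul_of_pos_right (by omega) (by omega)

/-- Two equal sums would make ζ a root of a polynomial of degree less than L with coefficients in
{0, 1, -1}, not all zero in any characteristic. Then ζ lies in a field with p^d elements for some d
< L, so its order q^j divides p^d - 1, and `lt_of_pow_dvd` contradicts the size of q^j. -/
theorem injective_sum_pow {p q j L : ℕ} [Fact p.Prime] (hq : q.Prime) (hq2 : q ≠ 2) (hpq : p ≠ q)
    {K : Type*} [Field K] [Algebra (ZMod p) K] {ζ : K} (hζ : IsPrimitiveRoot ζ (q ^ j))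
    (hL : p ^ (q - 1) * L ≤ q ^ j) :
    Function.Injective fun s : Fin L → Bool => ∑ l, ((s l).toNat : K) * ζ ^ (l : ℕ) := by
  intro s s' hs
  by_contra hne
  obtain ⟨l₀, hl₀⟩ := Function.ne_iff.1 hne
  set f : Polynomial (ZMod p) :=
    ∑ l : Fin L, Polynomial.monomial (l : ℕ) (((s l).toNat : ZMod p) - (s' l).toNat) with hf
  have hcoeff : f.coeff l₀ = ((s l₀).toNat : ZMod p) - (s' l₀).toNat := by
    rw [hf, Polynomial.finsetSum_coeff, Finset.sum_eq_single l₀]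
    · simp
    · intro l _ hl
      rw [Polynomial.coeff_monomial, if_neg fun h => hl (Fin.ext h)]
    · simp
  have hf0 : f ≠ 0 := by
    intro h
    rw [h, Polynomial.coeff_zero] at hcoeff
    cases h1 : s l₀ <;> cases h2 : s' l₀ <;> simp [h1, h2] at hl₀ hcoeff
  have hdeg : f.degree < L := by
    rw [hf]
    refine (Polynomial.degree_sum_le _ _).trans_lt ?_
    rw [Finset.sup_lt_iff (by exact WithBot.bot_lt_coe L)]
    intro l _
    exact (Polynomial.degree_monomial_le _ _).trans_lt (by exact_mod_cast l.2)
  have hroot : Polynomial.aeval ζ f = 0 := by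
    rw [hf, map_sum]
    have : ∀ l : Fin L, Polynomial.aeval ζ (Polynomial.monomial (l : ℕ)
        (((s l).toNat : ZMod p) - (s' l).toNat)) =
        ((s l).toNat : K) * ζ ^ (l : ℕ) - ((s' l).toNat : K) * ζ ^ (l : ℕ) := by
      intro l
      rw [Polynomial.aeval_monomial]
      simp [sub_mul]
    rw [Finset.sum_congr rfl fun l _ => this l, Finset.sum_sub_distrib]
    exact sub_eq_zero.2 hs
  have hint : IsIntegral (ZMod p) ζ := isAlgebraic_iff_isIntegral.1 ⟨f, hf0, hroot⟩
  set d := (minpoly (ZMod p) ζ).natDegree with hd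
  have hd1 : 1 ≤ d := minpoly.natDegree_pos hint
  have hdL : d < L := by
    have h1 := minpoly.degree_le_of_ne_zero (ZMod p) ζ hf0 hroot
    have h2 := h1.trans_lt hdeg
    rwa [Polynomial.degree_eq_natDegree (minpoly.ne_zero hint), Nat.cast_lt] at h2
  have hfin : FiniteDimensional (ZMod p) (IntermediateField.adjoin (ZMod p) {ζ}) :=
    IntermediateField.adjoin.finiteDimensional hint
  have hpow : ζ ^ p ^ d = ζ := by
    have : Finite (IntermediateField.adjoin (ZMod p) {ζ}) :=
      Module.finite_of_finite (ZMod p)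
    have := Fintype.ofFinite (IntermediateField.adjoin (ZMod p) {ζ})
    have h1 := FiniteField.pow_card (IntermediateField.AdjoinSimple.gen (ZMod p) ζ)
    rw [Module.card_eq_pow_finrank (K := ZMod p), ZMod.card,
      IntermediateField.adjoin.finrank hint, ← hd] at h1
    simpa using congrArg (algebraMap _ K) h1
  have hp := (Fact.out : p.Prime)
  have hζ0 : ζ ≠ 0 := hζ.ne_zero (pow_pos hq.pos j).ne'
  have hpow' : ζ ^ (p ^ d - 1) = 1 := by
    refine mul_right_cancel₀ hζ0 ?_
    rw [← pow_succ, Nat.sub_add_cancel (Nat.one_le_pow _ _ hp.pos), hpow, one_mul]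
  have := lt_of_pow_dvd hp hq hq2 hpq hd1 (hζ.dvd_of_pow_eq_one _ hpow')
  have h2 : p ^ (q - 1) * d ≤ p ^ (q - 1) * L := Nat.mul_le_mul_left _ hdL.le
  omega

/-- A nonzero number has many nondivisors. -/
theorem card_divisors_mul_le {d E ℓ : ℕ} (hd : d ≠ 0) (hdE : d < 2 ^ E) (hℓ : 1 ≤ ℓ)
    (hE : 2 * (E + ℓ + 1) ≤ 2 ^ ℓ) :
    ((Finset.Icc 1 (2 ^ ℓ)).filter (· ∣ d)).card * (2 * ℓ) ≤ 2 ^ ℓ * (2 * ℓ - 1) := by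
  set M := 2 ^ ℓ with hM
  set W := (Finset.Icc 1 M).filter fun m => ¬ m ∣ d with hW
  -- Each m ≤ M divides d or is one of the nondivisors collected in W, so the least common multiple,
  -- which is at least 2^M / (M + 1), divides d times their product. Since d < 2^E and each factor
  -- is at most 2^ℓ, W cannot be small.
  have hdvd : Nat.lcmUpto M ∣ d * ∏ m ∈ W, m := by
    refine Finset.lcm_dvd fun m hm => ?_
    by_cases h : m ∣ d
    · exact h.mul_right _
    · exact (Finset.dvd_prod_of_mem _ (Finset.mem_filter.2 ⟨hm, h⟩)).mul_left _
  have hprod : ∏ m ∈ W, m ≤ M ^ W.card :=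
    Finset.prod_le_pow_card _ _ _ fun m hm => (Finset.mem_Icc.1 (Finset.mem_filter.1 hm).1).2
  have hpos : 0 < ∏ m ∈ W, m :=
    Finset.prod_pos fun m hm => (Finset.mem_Icc.1 (Finset.mem_filter.1 hm).1).1
  have h1 := Nat.le_of_dvd (Nat.mul_pos (Nat.pos_of_ne_zero hd) hpos) hdvd
  have h2 : 2 ^ M ≤ (M + 1) * Nat.lcmUpto M := Chebyshev.two_pow_le_mul_lcmUpto M
  have h3 : M + 1 ≤ 2 ^ (ℓ + 1) := by
    rw [pow_succ]
    have : 1 ≤ M := Nat.one_le_two_pow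
    omega
  have h4 : (2 : ℕ) ^ M < 2 ^ (ℓ + 1 + E + ℓ * W.card) := by
    calc 2 ^ M ≤ (M + 1) * Nat.lcmUpto M := h2
      _ ≤ 2 ^ (ℓ + 1) * (d * ∏ m ∈ W, m) := Nat.mul_le_mul h3 h1
      _ < 2 ^ (ℓ + 1) * (2 ^ E * ∏ m ∈ W, m) := by
        refine Nat.mul_lt_mul_of_pos_left (Nat.mul_lt_mul_of_pos_right hdE hpos) (by positivity)
      _ ≤ 2 ^ (ℓ + 1) * (2 ^ E * M ^ W.card) := by gcongr
      _ = _ := by rw [hM, ← pow_mul]; ring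
  have h5 := (Nat.pow_lt_pow_iff_right (by norm_num)).1 h4
  have h6 := Finset.card_filter_add_card_filter_not (s := Finset.Icc 1 M) (· ∣ d)
  rw [← hW, Nat.card_Icc, Nat.add_sub_cancel] at h6
  have h7 : M ≤ 2 * ℓ * W.card := by
    have : 2 * ℓ * W.card = 2 * (ℓ * W.card) := mul_assoc _ _ _
    omega
  obtain ⟨s, hs⟩ : ∃ s, 2 * ℓ = s + 1 := ⟨2 * ℓ - 1, by omega⟩
  rw [hs] at h7 ⊢
  rw [Nat.add_sub_cancel]
  nlinarith

end Arith

namespace Arith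

/-! ### The integer polynomial of a circuit -/

section

variable {k : ℕ}

theorem firstVar_injective {gs : List (PreGate k)} {v w j : ℕ} (hv : firstVar gs v = some j)
    (hw : firstVar gs w = some j) : v = w := by
  induction gs with
  | nil => cases hv
  | cons g gs ih =>
    cases g with
    | leaf a =>
      cases a with
      | var x =>
        rw [firstVar, Option.or_eq_some_iff] at hv hw
        rcases hv with hv | ⟨-, hv⟩ <;> rcases hw with hw | ⟨-, hw⟩
        · exact ih hv hw
        · have := firstVar_lt hv
          split_ifs at hw
          simp only [Option.some.injEq] at hw
          omega
        · have := firstVar_lt hw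
          split_ifs at hv
          simp only [Option.some.injEq] at hv
          omega
        · split_ifs at hv hw with h1 h2
          exact h1.symm.trans h2
      | _ => exact ih hv hw
    | op f a b => exact ih hv hw

theorem gval_congr {R : Type*} [Semiring R] (κ : Fin k → R) {χ χ' : ℕ → R}
    {gs : List (PreGate k)} (h : ∀ v j, firstVar gs v = some j → χ v = χ' v) (i : ℕ) :
    gval κ χ gs i = gval κ χ' gs i := by
  induction gs generalizing i with
  | nil => rfl
  | cons g gs ih =>
    have ih' := fun i => ih (fun v j hj => h v j (firstVar_of_suffix (List.suffix_cons g gs) hj)) i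
    rw [gval, gval]
    split_ifs
    · cases g with
      | leaf a =>
        cases a with
        | var v =>
          obtain ⟨j, hj⟩ : ∃ j, firstVar (.leaf (.var v) :: gs) v = some j := by
            rw [firstVar]
            cases firstVar gs v <;> simp
          exact h v j hj
        | _ => rfl
      | op f a b => rw [PreGate.eval, PreGate.eval, ih', ih']
    · exact ih' i

/-- The polynomial with integer coefficients that is computed by a gate. Its variables are the
gates. -/
noncomputable def intPoly (κ : Fin k → ℤ) (gs : List (PreGate k)) (g : ℕ) :
    MvPolynomial (Fin gs.length) ℤ :=
  gval (fun j => MvPolynomial.C (κ j)) (fun v => (firstVar gs v).elim 0 fun j =>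
    if h : j < gs.length then MvPolynomial.X ⟨j, h⟩ else 0) gs g

variable (κ : Fin k → ℤ) (gs : List (PreGate k)) (g : ℕ)

theorem eval₂_intPoly {A : Type*} [CommRing A] (y : ℕ → A) :
    MvPolynomial.eval₂Hom (Int.castRingHom A) (fun j : Fin gs.length => y j) (intPoly κ gs g) =
      gval (fun j => (κ j : A)) (fun v => (firstVar gs v).elim 0 y) gs g := by
  rw [intPoly, map_gval]
  congr 1
  · funext j
    exact MvPolynomial.eval₂_C _ _ _
  · funext v
    cases h : firstVar gs v with
    | none => simp [h]
    | some j => simp [h, firstVar_lt h]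

/-- Replacing variables by numbers of gates loses nothing, as different variables have different
first gates: substituting for each gate the variable that it introduces recovers the original
polynomial. The new polynomial has finitely many variables and integer coefficients, whatever the
ring R. -/
theorem map_intPoly_ne_zero {R : Type*} [CommRing R] {c : Fin k → R} (hc : ∀ j, (κ j : R) = c j)
    (h : gval (fun j => MvPolynomial.C (c j)) MvPolynomial.X gs g ≠ (0 : MvPolynomial ℕ R)) :
    MvPolynomial.map (Int.castRingHom R) (intPoly κ gs g) ≠ 0 := by
  classical
  intro h0
  refine h ?_
  set w : ℕ → ℕ := fun j => if h : ∃ v, firstVar gs v = some j then h.choose else 0 with hw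
  have h1 := congrArg (MvPolynomial.eval₂Hom (MvPolynomial.C : R →+* MvPolynomial ℕ R)
    fun j : Fin gs.length => MvPolynomial.X (w j)) h0
  rw [map_zero, MvPolynomial.coe_eval₂Hom, MvPolynomial.eval₂_map,
    show MvPolynomial.C.comp (Int.castRingHom R) = Int.castRingHom (MvPolynomial ℕ R) from
      RingHom.ext_int _ _, ← MvPolynomial.coe_eval₂Hom,
    eval₂_intPoly κ gs g fun j => MvPolynomial.X (w j)] at h1
  rw [← h1]
  have h2 : ∀ j, ((κ j : ℤ) : MvPolynomial ℕ R) = MvPolynomial.C (c j) := fun j => by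
    rw [← hc, map_intCast]
  simp only [h2]
  refine gval_congr _ (fun v j hj => ?_) g
  rw [hj, Option.elim_some, hw]
  have hex : ∃ v, firstVar gs v = some j := ⟨v, hj⟩
  simp only [hex, ↓reduceDIte]
  rw [firstVar_injective hj hex.choose_spec]

/-- Each gate at most doubles the degree. -/
theorem totalDegree_gval_le {σ R : Type*} [CommSemiring R] {κ : Fin k → MvPolynomial σ R}
    {χ : ℕ → MvPolynomial σ R} (hκ : ∀ j, (κ j).totalDegree ≤ 1) (hχ : ∀ v, (χ v).totalDegree ≤ 1)
    (gs : List (PreGate k)) (i : ℕ) : (gval κ χ gs i).totalDegree ≤ 2 ^ gs.length := by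
  induction gs generalizing i with
  | nil => simp [gval]
  | cons g gs ih =>
    have h1 : 1 ≤ 2 ^ gs.length := Nat.one_le_two_pow
    rw [gval, List.length_cons, pow_succ]
    split_ifs
    · cases g with
      | leaf a =>
        cases a with
        | zero => simp [PreGate.eval, Leaf.eval]
        | one => simp [PreGate.eval, Leaf.eval]
        | const j => exact (hκ j).trans (by omega)
        | var v => exact (hχ v).trans (by omega)
      | op f a b =>
        have ha := ih a
        have hb := ih b
        cases f with
        | add =>
          refine (MvPolynomial.totalDegree_add _ _).trans ?_
          omega
        | mul =>
          refine (MvPolynomial.totalDegree_mul _ _).trans ?_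
          omega
    · exact (ih i).trans (by omega)

theorem totalDegree_intPoly_le : (intPoly κ gs g).totalDegree ≤ 2 ^ gs.length := by
  refine totalDegree_gval_le (fun j => by
    rw [MvPolynomial.totalDegree_C]
    exact zero_le_one) (fun v => ?_) gs g
  cases firstVar gs v with
  | none => simp
  | some j =>
    simp only [Option.elim_some]
    split_ifs <;> simp

end

/-! ### Primitive polynomials -/

/-- The number c is the content, the greatest common divisor of the coefficients. If a prime p
divided all coefficients of the quotient, then c·p would divide c. -/
theorem exists_eq_C_mul {σ : Type*} {P : MvPolynomial σ ℤ} (hP : P ≠ 0) :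
    ∃ (c : ℤ) (P₀ : MvPolynomial σ ℤ), c ≠ 0 ∧ P = MvPolynomial.C c * P₀ ∧
      P₀.totalDegree ≤ P.totalDegree ∧
      ∀ p : ℕ, p.Prime → MvPolynomial.map (Int.castRingHom (ZMod p)) P₀ ≠ 0 := by
  classical
  set c := P.support.gcd P.coeff with hc
  have hdvd : ∀ d, c ∣ P.coeff d := by
    intro d
    by_cases hd : d ∈ P.support
    · exact Finset.gcd_dvd hd
    · rw [MvPolynomial.notMem_support_iff.1 hd]
      exact dvd_zero _
  obtain ⟨P₀, hP₀⟩ := (MvPolynomial.C_dvd_iff_dvd_coeff c P).2 hdvd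
  have hc0 : c ≠ 0 := by
    rintro h
    rw [h, map_zero, zero_mul] at hP₀
    exact hP hP₀
  refine ⟨c, P₀, hc0, hP₀, ?_, fun p hp h => ?_⟩
  · refine Finset.sup_mono fun d hd => ?_
    rw [MvPolynomial.mem_support_iff] at hd ⊢
    rw [hP₀, MvPolynomial.coeff_C_mul]
    exact mul_ne_zero hc0 hd
  · have h1 : ∀ d, (p : ℤ) ∣ P₀.coeff d := by
      intro d
      have := congrArg (MvPolynomial.coeff d) h
      rw [MvPolynomial.coeff_map, MvPolynomial.coeff_zero] at this
      exact (ZMod.intCast_zmod_eq_zero_iff_dvd _ _).1 this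
    have h2 : c * p ∣ c := by
      conv_rhs => rw [hc]
      refine Finset.dvd_gcd fun d _ => ?_
      rw [hP₀, MvPolynomial.coeff_C_mul]
      exact mul_dvd_mul_left c (h1 d)
    have h3 : (p : ℤ) ∣ 1 := by
      rw [← mul_dvd_mul_iff_left hc0, mul_one]
      exact h2
    exact hp.one_lt.ne' (by exact_mod_cast Int.eq_one_of_dvd_one (by positivity) h3)

/-! ### The size of coefficients -/

section norm

variable {r : ℕ} [NeZero r]

/-- The sum of the absolute values of the coefficients. -/
def coeffNorm (x : AddMonoidAlgebra ℤ (ZMod r)) : ℤ := ∑ w, |x.coeff w|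

theorem coeffNorm_single (w : ZMod r) (a : ℤ) : coeffNorm (AddMonoidAlgebra.single w a) = |a| := by
  rw [coeffNorm, Finset.sum_eq_single w]
  · simp
  · intro w' _ h
    simp [h.symm]
  · simp

theorem coeffNorm_zero : coeffNorm (0 : AddMonoidAlgebra ℤ (ZMod r)) = 0 := by simp [coeffNorm]

theorem coeffNorm_intCast (a : ℤ) : coeffNorm (a : AddMonoidAlgebra ℤ (ZMod r)) = |a| := by
  rw [AddMonoidAlgebra.intCast_def, coeffNorm_single]
  rfl

theorem coeffNorm_nonneg (x : AddMonoidAlgebra ℤ (ZMod r)) : 0 ≤ coeffNorm x :=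
  Finset.sum_nonneg fun _ _ => abs_nonneg _

theorem abs_coeff_le_coeffNorm (x : AddMonoidAlgebra ℤ (ZMod r)) (w : ZMod r) :
    |x.coeff w| ≤ coeffNorm x :=
  Finset.single_le_sum (f := fun w => |x.coeff w|) (fun _ _ => abs_nonneg _) (Finset.mem_univ w)

theorem coeffNorm_add_le (x y : AddMonoidAlgebra ℤ (ZMod r)) :
    coeffNorm (x + y) ≤ coeffNorm x + coeffNorm y := by
  rw [coeffNorm, coeffNorm, coeffNorm, ← Finset.sum_add_distrib]
  exact Finset.sum_le_sum fun w _ => abs_add_le _ _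

theorem coeffNorm_sum_le {ι : Type*} (s : Finset ι) (f : ι → AddMonoidAlgebra ℤ (ZMod r)) :
    coeffNorm (∑ i ∈ s, f i) ≤ ∑ i ∈ s, coeffNorm (f i) := by
  classical
  induction s using Finset.induction_on with
  | empty => simp [coeffNorm_zero]
  | insert a s ha ih =>
    rw [Finset.sum_insert ha, Finset.sum_insert ha]
    exact (coeffNorm_add_le _ _).trans (add_le_add_right ih _)

theorem coeffNorm_mul_le (x y : AddMonoidAlgebra ℤ (ZMod r)) :
    coeffNorm (x * y) ≤ coeffNorm x * coeffNorm y := by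
  have h : ∀ g, (x * y).coeff g = ∑ a, x.coeff a * y.coeff (-a + g) := fun g => by
    rw [AddMonoidAlgebra.coeff_mul_apply_left, Finsupp.sum_fintype _ _ (by simp)]
  calc coeffNorm (x * y) = ∑ g, |∑ a, x.coeff a * y.coeff (-a + g)| :=
        Finset.sum_congr rfl fun g _ => by rw [h]
    _ ≤ ∑ g, ∑ a, |x.coeff a| * |y.coeff (-a + g)| := Finset.sum_le_sum fun g _ =>
        (Finset.abs_sum_le_sum_abs _ _).trans (Finset.sum_le_sum fun a _ => (abs_mul _ _).le)
    _ = ∑ a, |x.coeff a| * ∑ g, |y.coeff (-a + g)| := by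
        rw [Finset.sum_comm]
        exact Finset.sum_congr rfl fun a _ => (Finset.mul_sum _ _ _).symm
    _ = coeffNorm x * coeffNorm y := by
        rw [coeffNorm, Finset.sum_mul]
        refine Finset.sum_congr rfl fun a _ => ?_
        congr 1
        exact Fintype.sum_equiv (Equiv.addLeft (-a)) _ _ fun g => rfl

/-- The norm is subadditive and submultiplicative, so a gate at most squares the bound B: a sum
gives 2B, which is at most B² because T ≥ 2. -/
theorem coeffNorm_gval_le {k : ℕ} {κ : Fin k → AddMonoidAlgebra ℤ (ZMod r)}
    {χ : ℕ → AddMonoidAlgebra ℤ (ZMod r)} {T : ℤ} (hT : 2 ≤ T) (hκ : ∀ j, coeffNorm (κ j) ≤ T)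
    (hχ : ∀ v, coeffNorm (χ v) ≤ T) (gs : List (PreGate k)) (i : ℕ) :
    coeffNorm (gval κ χ gs i) ≤ T ^ 2 ^ gs.length := by
  induction gs generalizing i with
  | nil => simp [gval, coeffNorm_zero]; omega
  | cons g gs ih =>
    have h1 : T ≤ T ^ 2 ^ gs.length := le_self_pow₀ (by omega) (by positivity)
    set B := T ^ 2 ^ gs.length with hB
    have hBB : T ^ 2 ^ (g :: gs).length = B * B := by
      rw [List.length_cons, pow_succ, pow_mul, ← hB, sq]
    have h2 : B ≤ B * B := by nlinarith
    rw [hBB, gval]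
    split_ifs
    · cases g with
      | leaf a =>
        cases a with
        | zero => simp only [PreGate.eval, Leaf.eval, coeffNorm_zero]; nlinarith
        | one =>
          have : coeffNorm (1 : AddMonoidAlgebra ℤ (ZMod r)) = 1 := by
            have := coeffNorm_intCast (r := r) 1
            simpa using this
          simp only [PreGate.eval, Leaf.eval, this]
          nlinarith
        | const j => exact ((hκ j).trans h1).trans h2
        | var v => exact ((hχ v).trans h1).trans h2
      | op f a b =>
        have ha := ih a
        have hb := ih b
        cases f with
        | add =>
          refine (coeffNorm_add_le _ _).trans ?_
          nlinarith
        | mul =>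
          exact (coeffNorm_mul_le _ _).trans (mul_le_mul ha hb (coeffNorm_nonneg _) (by omega))
    · exact (ih i).trans h2

end norm

end Arith

namespace Arith

/-! ### Random points -/

/-- The value of variable `j` at the random point. -/
def pointVal {A : Type*} [CommRing A] (ξ : A) (L s : ℕ) (β : ℕ → ℕ) (j : ℕ) : A :=
  ∑ l ∈ Finset.range L, (β (s + (j * L + l)) : A) * ξ ^ l

/-- The value of an integer polynomial at the random point. -/
noncomputable def evalPoint {A : Type*} [CommRing A] (ξ : A) (L s : ℕ) (β : ℕ → ℕ) {n : ℕ}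
    (P : MvPolynomial (Fin n) ℤ) : A :=
  MvPolynomial.eval₂Hom (Int.castRingHom A) (fun j : Fin n => pointVal ξ L s β j) P

theorem map_pointVal {A A' : Type*} [CommRing A] [CommRing A'] (f : A →+* A') (ξ : A) (L s : ℕ)
    (β : ℕ → ℕ) (j : ℕ) : f (pointVal ξ L s β j) = pointVal (f ξ) L s β j := by
  simp [pointVal]

theorem map_evalPoint {A A' : Type*} [CommRing A] [CommRing A'] (f : A →+* A') (ξ : A) (L s : ℕ)
    (β : ℕ → ℕ) {n : ℕ} (P : MvPolynomial (Fin n) ℤ) :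
    f (evalPoint ξ L s β P) = evalPoint (f ξ) L s β P := by
  rw [evalPoint, MvPolynomial.coe_eval₂Hom, MvPolynomial.hom_eval₂,
    show f.comp (Int.castRingHom A) = Int.castRingHom A' from RingHom.ext_int _ _, evalPoint,
    MvPolynomial.coe_eval₂Hom]
  simp only [map_pointVal]

theorem gval_point {A : Type*} [CommRing A] (ξ : A) {k : ℕ} (κ : Fin k → ℤ)
    (gs : List (PreGate k)) (g L s : ℕ) (β : ℕ → ℕ) :
    gval (fun j => (κ j : A)) (point ξ gs L s β) gs g = evalPoint ξ L s β (intPoly κ gs g) :=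
  (eval₂_intPoly κ gs g (pointVal ξ L s β)).symm

theorem bitFun_extend {I : Type*} {l : ℕ} {e : I → Fin l} (he : e.Injective) (s : I → Bool)
    (ρ : Fin l → Bool) (a : I) : bitFun (Function.extend e s ρ) (e a) = (s a).toNat := by
  rw [bitFun, dif_pos (e a).2, Fin.eta, he.extend_apply]

theorem bitFun_extend_of_ne {I : Type*} {l : ℕ} {e : I → Fin l} (s : I → Bool)
    (ρ : Fin l → Bool) {i : ℕ} (hi : ∀ a, (e a : ℕ) ≠ i) :
    bitFun (Function.extend e s ρ) i = bitFun ρ i := by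
  rw [bitFun, bitFun]
  split_ifs with h
  · rw [Function.extend_apply']
    rintro ⟨a, ha⟩
    exact hi a (by rw [ha])
  · rfl

theorem block_lt {s n L l j x : ℕ} (h : s + n * L ≤ l) (hj : j < n) (hx : x < L) :
    s + (j * L + x) < l := by
  have : (j + 1) * L ≤ n * L := Nat.mul_le_mul_right _ hj
  rw [add_mul] at this
  omega

/-- The positions of `n` blocks of length `L`. -/
def blocks {s n L l : ℕ} (h : s + n * L ≤ l) (a : Fin n × Fin L) : Fin l :=
  ⟨s + (a.1 * L + a.2), block_lt h a.1.2 a.2.2⟩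

theorem blocks_injective {s n L l : ℕ} (h : s + n * L ≤ l) : (blocks h).Injective := by
  rintro ⟨j, x⟩ ⟨j', x'⟩ hx
  have h1 : s + ((j : ℕ) * L + x) = s + (j' * L + x') := congrArg Fin.val hx
  have h2 : (j : ℕ) * L + x = j' * L + x' := by omega
  have hL : 0 < L := by have := x.2; omega
  have h3 : ((j : ℕ) * L + x) / L = j := by
    rw [mul_comm, Nat.mul_add_div hL, Nat.div_eq_of_lt x.2, add_zero]
  have h4 : ((j' : ℕ) * L + x') / L = j' := by
    rw [mul_comm, Nat.mul_add_div hL, Nat.div_eq_of_lt x'.2, add_zero]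
  have h5 : j = j' := Fin.ext (by rw [← h3, ← h4, h2])
  subst h5
  have h6 : x = x' := Fin.ext (by omega)
  rw [h6]

/-- With the bits outside the blocks fixed, the coordinates of the point are independent and uniform
in a set of 2^L elements, by injectivity. Schwartz–Zippel bounds the probability of a zero by 2^n /
2^L, and L = n + 2 makes this 1/4. -/
theorem card_evalPoint_eq_zero_le {K : Type*} [Field K] {ζ : K} {L n s l : ℕ}
    (hinj : Function.Injective fun s : Fin L → Bool => ∑ x, ((s x).toNat : K) * ζ ^ (x : ℕ))
    (hL : L = n + 2) (hl : s + n * L ≤ l) {P : MvPolynomial (Fin n) ℤ}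
    (hP : MvPolynomial.map (Int.castRingHom K) P ≠ 0) (hdeg : P.totalDegree ≤ 2 ^ n) :
    4 * Nat.card {ρ : Fin l → Bool // evalPoint ζ L s (bitFun ρ) P = 0} ≤ 2 ^ l := by
  classical
  refine four_mul_card_le (blocks_injective hl) _ fun ρ => ?_
  set φ := fun s : Fin L → Bool => ∑ x, ((s x).toNat : K) * ζ ^ (x : ℕ) with hφ
  set S := Finset.univ.image φ with hS
  have hScard : S.card = 2 ^ L := by
    rw [hS, Finset.card_image_of_injective _ hinj]
    simp
  set P' := MvPolynomial.map (Int.castRingHom K) P with hP'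
  have heval : ∀ a : Fin n × Fin L → Bool,
      evalPoint ζ L s (bitFun (Function.extend (blocks hl) a ρ)) P =
        MvPolynomial.eval (fun j => φ fun x => a (j, x)) P' := by
    intro a
    rw [hP', MvPolynomial.eval_map, evalPoint, MvPolynomial.coe_eval₂Hom]
    congr 1
    funext j
    rw [pointVal, Finset.sum_range]
    refine Finset.sum_congr rfl fun x _ => ?_
    rw [show s + ((j : ℕ) * L + x) = (blocks hl (j, x) : ℕ) from rfl,
      bitFun_extend (blocks_injective hl)]
  have hdeg' : P'.totalDegree ≤ 2 ^ n := (Finset.sup_mono (MvPolynomial.support_map_subset _ _)).trans hdeg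
  have hsz := MvPolynomial.schwartz_zippel_totalDegree hP S
  set F := (Fintype.piFinset fun _ : Fin n => S).filter fun f => MvPolynomial.eval f P' = 0 with hF
  have h1 : Nat.card {a // evalPoint ζ L s (bitFun (Function.extend (blocks hl) a ρ)) P = 0} ≤
      F.card := by
    rw [← Fintype.card_coe F, ← Nat.card_eq_fintype_card]
    refine Nat.card_le_card_of_injective (fun a => ⟨fun j => φ fun x => a.1 (j, x), ?_⟩) ?_
    · rw [hF, Finset.mem_filter, Fintype.mem_piFinset]
      exact ⟨fun j => Finset.mem_image_of_mem _ (Finset.mem_univ _), by rw [← heval]; exact a.2⟩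
    · rintro ⟨a, _⟩ ⟨a', _⟩ h
      refine Subtype.ext (funext fun ⟨j, x⟩ => ?_)
      exact congrFun (hinj (congrFun (congrArg Subtype.val h) j)) x
  have h2 : 4 * F.card ≤ 2 ^ (n * L) := by
    have hc : (0 : ℚ≥0) < (S.card : ℚ≥0) ^ n := by rw [hScard]; positivity
    have h3 : (F.card : ℚ≥0) / (S.card : ℚ≥0) ^ n ≤ 1 / 4 := by
      refine hsz.trans ?_
      rw [hScard, hL, div_le_iff₀ (by positivity)]
      have : ((P'.totalDegree : ℕ) : ℚ≥0) ≤ 2 ^ n := by exact_mod_cast hdeg'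
      refine this.trans (le_of_eq ?_)
      push_cast
      rw [pow_add]
      ring
    rw [div_le_iff₀ hc, hScard] at h3
    have h4 : (4 * F.card : ℚ≥0) ≤ 2 ^ (n * L) := by
      calc (4 * F.card : ℚ≥0) ≤ 4 * (1 / 4 * ((2 ^ L : ℕ) : ℚ≥0) ^ n) :=
            mul_le_mul_of_nonneg_left h3 (by norm_num)
        _ = 2 ^ (n * L) := by
          push_cast
          rw [← pow_mul, mul_comm L n]
          ring
    exact_mod_cast h4
  rw [Fintype.card_prod, Fintype.card_fin, Fintype.card_fin]
  exact (Nat.mul_le_mul_left 4 h1).trans h2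

/-- There is a ring homomorphism from the integral group ring to an algebraic closure of the field
with p elements that sends the generator to a primitive q^j-th root of unity; this root exists
because p ≠ q. If p divides all coefficients of the value, the image of the value is zero, so the
polynomial vanishes at the image of the random point. -/
theorem card_forall_dvd_le {p q j L n s l : ℕ} (hp : p.Prime) (hq : q.Prime) (hq2 : q ≠ 2)
    (hpq : p ≠ q) (hL : L = n + 2) (hr : p ^ (q - 1) * L ≤ q ^ j) (hl : s + n * L ≤ l)
    {P : MvPolynomial (Fin n) ℤ} (hP : MvPolynomial.map (Int.castRingHom (ZMod p)) P ≠ 0)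
    (hdeg : P.totalDegree ≤ 2 ^ n) :
    4 * Nat.card {ρ : Fin l → Bool //
      ∀ w, (p : ℤ) ∣ (evalPoint (rootOfUnity ℤ (q ^ j)) L s (bitFun ρ) P).coeff w} ≤ 2 ^ l := by
  have := Fact.mk hp
  set K := AlgebraicClosure (ZMod p)
  have hrK : NeZero ((q ^ j : ℕ) : K) := ⟨by
    rw [Ne, CharP.cast_eq_zero_iff K p]
    exact fun h => hpq ((Nat.prime_dvd_prime_iff_eq hp hq).1 (hp.dvd_of_dvd_pow h))⟩
  obtain ⟨ζ, hζ⟩ := HasEnoughRootsOfUnity.exists_primitiveRoot K (q ^ j)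
  have hr0 : NeZero (q ^ j) := ⟨(pow_pos hq.pos j).ne'⟩
  have hPK : MvPolynomial.map (Int.castRingHom K) P ≠ 0 := by
    rw [show Int.castRingHom K = (algebraMap (ZMod p) K).comp (Int.castRingHom (ZMod p)) from
      RingHom.ext_int _ _, ← MvPolynomial.map_map]
    exact fun h => hP (MvPolynomial.map_injective _ (algebraMap (ZMod p) K).injective
      (h.trans (map_zero _).symm))
  refine le_trans (Nat.mul_le_mul_left 4 (Nat.card_le_card_of_injective (Subtype.map id ?_)
    (Subtype.map_injective _ Function.injective_id)))
    (card_evalPoint_eq_zero_le (injective_sum_pow hq hq2 hpq hζ hr) hL hl hPK hdeg)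
  intro ρ hρ
  set f := (AddMonoidAlgebra.lift ℤ K (ZMod (q ^ j)) (AddChar.zmodChar (q ^ j)
    hζ.pow_eq_one).toMonoidHom : AddMonoidAlgebra ℤ (ZMod (q ^ j)) →+* K) with hf
  have hroot : f (rootOfUnity ℤ (q ^ j)) = ζ := by
    have h1 := AddChar.zmodChar_apply' hζ.pow_eq_one 1
    rw [hf, rootOfUnity]
    simpa using h1
  have hx : f (evalPoint (rootOfUnity ℤ (q ^ j)) L s (bitFun ρ) P) = 0 := by
    generalize evalPoint (rootOfUnity ℤ (q ^ j)) L s (bitFun ρ) P = x at hρ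
    change AddMonoidAlgebra.lift ℤ K (ZMod (q ^ j)) _ x = 0
    rw [AddMonoidAlgebra.lift_apply]
    refine Finset.sum_eq_zero fun w _ => ?_
    obtain ⟨y, hy⟩ := hρ w
    simp only [hy, zsmul_eq_mul]
    push_cast
    rw [CharP.cast_eq_zero K p]
    simp
  rw [map_evalPoint, hroot] at hx
  exact hx

/-! ### Random moduli -/

theorem horner_congr {f f' : ℕ → ℕ} {n : ℕ} (h : ∀ i < n, f i = f' i) :
    RAM.horner f n = RAM.horner f' n := by
  induction n with
  | zero => rfl
  | succ n ih => rw [RAM.horner, RAM.horner, ih fun i hi => h i (by omega), h n (by omega)]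

theorem horner_lt {f : ℕ → ℕ} (hf : ∀ i, f i ≤ 1) (n : ℕ) : RAM.horner f n < 2 ^ n := by
  induction n with
  | zero => simp [RAM.horner]
  | succ n ih =>
    rw [RAM.horner, pow_succ]
    have := hf n
    omega

theorem horner_injective {f f' : ℕ → ℕ} (hf : ∀ i, f i ≤ 1) (hf' : ∀ i, f' i ≤ 1) {n : ℕ}
    (h : RAM.horner f n = RAM.horner f' n) : ∀ i < n, f i = f' i := by
  induction n with
  | zero => simp
  | succ n ih =>
    rw [RAM.horner, RAM.horner] at h
    have h1 := hf n
    have h2 := hf' n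
    intro i hi
    rcases Nat.lt_succ_iff_lt_or_eq.1 hi with hi | rfl
    · exact ih (by omega) i hi
    · omega

/-- If the product divides d, then each of the 4ℓ independent factors does. One factor divides d
with probability at most 1 - 1/(2ℓ); 2ℓ of them reduce the probability to 1/2 and 4ℓ of them to 1/4.
-/
theorem card_modulus_dvd_le {d : ℤ} {E ℓ l : ℕ} (hd : d ≠ 0) (hdE : d.natAbs < 2 ^ E) (hℓ : 1 ≤ ℓ)
    (hE : 2 * (E + ℓ + 1) ≤ 2 ^ ℓ) (hl : 0 + 4 * ℓ * ℓ ≤ l) (ρ : Fin l → Bool) :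
    4 * Nat.card {s : Fin (4 * ℓ) × Fin ℓ → Bool //
      (modulus 1 (4 * ℓ) ℓ (bitFun (Function.extend (blocks hl) s ρ)) : ℤ) ∣ d} ≤
        2 ^ Fintype.card (Fin (4 * ℓ) × Fin ℓ) := by
  classical
  set D := (Finset.Icc 1 (2 ^ ℓ)).filter (· ∣ d.natAbs) with hD
  have h1 : Nat.card {s : Fin (4 * ℓ) × Fin ℓ → Bool //
      (modulus 1 (4 * ℓ) ℓ (bitFun (Function.extend (blocks hl) s ρ)) : ℤ) ∣ d} ≤
        Nat.card (Fin (4 * ℓ) → D) := by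
    refine Nat.card_le_card_of_injective
      (fun s i => ⟨RAM.horner (bitFun fun x => s.1 (i, x)) ℓ + 1, ?_⟩) ?_
    · rw [hD, Finset.mem_filter, Finset.mem_Icc]
      refine ⟨⟨by omega, horner_lt (bitFun_le_one _) ℓ⟩, ?_⟩
      refine dvd_trans ?_ (Int.natCast_dvd.1 s.2)
      rw [modulus, one_mul]
      refine dvd_trans (dvd_of_eq ?_) (Finset.dvd_prod_of_mem _ (Finset.mem_range.2 i.2))
      congr 1
      refine horner_congr fun x hx => ?_
      have := bitFun_extend (blocks_injective hl) s.1 ρ (i, ⟨x, hx⟩)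
      rw [show (blocks hl (i, ⟨x, hx⟩) : ℕ) = 0 + (i * ℓ + x) from rfl, zero_add] at this
      rw [this, bitFun, dif_pos hx]
    · rintro ⟨a, _⟩ ⟨a', _⟩ h
      refine Subtype.ext (funext fun ⟨i, x⟩ => ?_)
      have h2 := congrArg Subtype.val (congrFun h i)
      have h3 := horner_injective (bitFun_le_one _) (bitFun_le_one _) (Nat.succ_injective h2) x x.2
      rw [bitFun, bitFun, dif_pos x.2, dif_pos x.2] at h3
      change a (i, x) = a' (i, x)
      dsimp only at h3
      cases h4 : a (i, x) <;> cases h5 : a' (i, x) <;> simp [h4, h5] at h3 ⊢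
  have h2 : Nat.card (Fin (4 * ℓ) → D) = (D.card ^ (2 * ℓ)) ^ 2 := by
    rw [Nat.card_eq_fintype_card]
    simp only [Fintype.card_pi, Fintype.card_coe, Finset.prod_const, Finset.card_univ,
      Fintype.card_fin]
    rw [← pow_mul]
    congr 1
    ring
  have h3 := two_mul_pow_le (by omega)
    (card_divisors_mul_le (Int.natAbs_ne_zero.2 hd) hdE hℓ hE)
  rw [← hD] at h3
  rw [Fintype.card_prod, Fintype.card_fin, Fintype.card_fin]
  calc _ ≤ 4 * (D.card ^ (2 * ℓ)) ^ 2 := Nat.mul_le_mul_left 4 (h1.trans h2.le)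
    _ = (2 * D.card ^ (2 * ℓ)) ^ 2 := by ring
    _ ≤ ((2 ^ ℓ) ^ (2 * ℓ)) ^ 2 := Nat.pow_le_pow_left h3 2
    _ = _ := by
      rw [← pow_mul, ← pow_mul]
      congr 1
      ring

end Arith

namespace Arith

open RAM

/-! ### Zero testing in coRP -/

theorem gval_eq_zero_iff {μ r k L s : ℕ} {u v : ℕ → ℕ} {κ : Fin k → ℤ}
    (hκ : ∀ j : Fin k, κ j = u j - v j) (gs : List (PreGate k)) (g : ℕ) (β : ℕ → ℕ) :
    gval (fun j : Fin k => (u j - v j : AddMonoidAlgebra (ZMod μ) (ZMod r)))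
      (point (rootOfUnity (ZMod μ) r) gs L s β) gs g = 0 ↔
    ∀ w, (μ : ℤ) ∣ (evalPoint (rootOfUnity ℤ r) L s β (intPoly κ gs g)).coeff w := by
  have h1 : (fun j : Fin k => (u j - v j : AddMonoidAlgebra (ZMod μ) (ZMod r))) =
      fun j => ((κ j : ℤ) : AddMonoidAlgebra (ZMod μ) (ZMod r)) := by
    funext j
    rw [hκ]
    push_cast
    rfl
  set f := AddMonoidAlgebra.mapRingHom (ZMod r) (Int.castRingHom (ZMod μ)) with hf
  have h2 : f (rootOfUnity ℤ r) = rootOfUnity (ZMod μ) r := by simp [hf, rootOfUnity]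
  rw [h1, gval_point, ← h2, ← map_evalPoint]
  generalize evalPoint (rootOfUnity ℤ r) L s β (intPoly κ gs g) = x
  rw [← AddMonoidAlgebra.coeff_eq_zero, DFunLike.ext_iff]
  refine forall_congr' fun w => ?_
  rw [hf, AddMonoidAlgebra.coeff_mapRingHom, ← ZMod.intCast_zmod_eq_zero_iff_dvd]
  rfl

/-- Evaluation factors through the polynomial ring over R. This is why the test never errs on a zero
polynomial, and it requires a ring homomorphism ψ from R: none is missing for ℤ, but for ℤ/nℤ the
modulus has to divide n. -/
theorem gval_eq_zero_of_poly_eq_zero {R A : Type} [CommRing R] [CommRing A] (ψ : R →+* A) {k : ℕ}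
    {c : Fin k → R} {κ : Fin k → A} (hκ : ∀ j, κ j = ψ (c j)) (χ : ℕ → A) {G : TSLP k}
    (hG : G.poly c = 0) {gs : List (PreGate k)} {g : ℕ} (h : gval κ χ gs g = G.eval κ χ) :
    gval κ χ gs g = 0 := by
  have h1 := congrArg (MvPolynomial.eval₂Hom ψ χ) hG
  rw [TSLP.poly, map_tslp_eval, map_zero] at h1
  rw [h, ← h1]
  congr 1
  · funext j
    rw [hκ]
    exact (MvPolynomial.eval₂_C _ _ _).symm
  · funext v
    exact (MvPolynomial.eval₂_X _ _ _).symm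

/-- Any prime divisor p of n / gcd(n, c) will do: this quotient is not 1, and it is coprime to c /
gcd(n, c). -/
theorem exists_prime_dvd_of_not_dvd {n : ℕ} (hn : n ≠ 0) {c : ℤ} (hc : ¬ (n : ℤ) ∣ c) :
    ∃ p : ℕ, p.Prime ∧ p ≤ n ∧ ∀ x : ℤ, (n : ℤ) ∣ c * x → (p : ℤ) ∣ x := by
  set d := Int.gcd n c with hd
  have hd0 : 0 < d := Int.gcd_pos_of_ne_zero_left _ (by exact_mod_cast hn)
  obtain ⟨a, ha⟩ : (d : ℤ) ∣ n := Int.gcd_dvd_left _ _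
  obtain ⟨b, hb⟩ : (d : ℤ) ∣ c := Int.gcd_dvd_right _ _
  have hd0' : (d : ℤ) ≠ 0 := by exact_mod_cast hd0.ne'
  have hab : IsCoprime a b := by
    rw [Int.isCoprime_iff_gcd_eq_one]
    have h1 : d * Int.gcd a b = d := by
      conv_rhs => rw [hd, ha, hb, Int.gcd_mul_left]
      simp
    exact Nat.eq_of_mul_eq_mul_left hd0 (by rw [h1, mul_one])
  have ha1 : a.natAbs ≠ 1 := by
    intro h
    refine hc ?_
    rw [← Int.natAbs_dvd, ha, Int.natAbs_mul, h, hb]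
    simp
  obtain ⟨p, hp, hpa⟩ := Nat.exists_prime_and_dvd ha1
  have hpa' : (p : ℤ) ∣ a := Int.natCast_dvd.2 hpa
  refine ⟨p, hp, Nat.le_of_dvd (Nat.pos_of_ne_zero hn) ?_, fun x hx => ?_⟩
  · exact Int.natCast_dvd_natCast.1 (hpa'.trans ⟨d, by rw [ha, mul_comm]⟩)
  · rw [ha, hb, mul_assoc, mul_dvd_mul_iff_left hd0'] at hx
    exact hpa'.trans (hab.dvd_of_dvd_mul_left hx)

theorem evalPoint_C_mul {r n L s : ℕ} (β : ℕ → ℕ) (c : ℤ) (P : MvPolynomial (Fin n) ℤ)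
    (w : ZMod r) : (evalPoint (rootOfUnity ℤ r) L s β (MvPolynomial.C c * P)).coeff w =
      c * (evalPoint (rootOfUnity ℤ r) L s β P).coeff w := by
  have h1 : evalPoint (rootOfUnity ℤ r) L s β (MvPolynomial.C c * P) =
      c • evalPoint (rootOfUnity ℤ r) L s β P := by
    rw [evalPoint, map_mul, MvPolynomial.coe_eval₂Hom, MvPolynomial.eval₂_C, zsmul_eq_mul]
    rfl
  rw [h1, AddMonoidAlgebra.coeff_smul, Finsupp.smul_apply, smul_eq_mul]

theorem card_subtype_le {l : ℕ} {P Q : (Fin l → Bool) → Prop} (h : ∀ ρ, P ρ → Q ρ) :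
    Nat.card {ρ // P ρ} ≤ Nat.card {ρ // Q ρ} :=
  Nat.card_le_card_of_injective (Subtype.map id h) (Subtype.map_injective _ Function.injective_id)

theorem card_or_le {l : ℕ} (P Q : (Fin l → Bool) → Prop) :
    Nat.card {ρ // P ρ ∨ Q ρ} ≤ Nat.card {ρ // P ρ} + Nat.card {ρ // Q ρ} := by
  classical
  rw [Nat.card_eq_fintype_card, Nat.card_eq_fintype_card, Nat.card_eq_fintype_card]
  exact Fintype.card_subtype_or _ _

/-- With P = d·P₀ and P nonzero modulo n, the number n does not divide d. Acceptance then forces a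
prime p' dividing n to divide the value of the primitive polynomial P₀, which is nonzero modulo p',
and this happens with probability at most 1/4. -/
theorem zeroTSLP_inCoRP_zmod (n : ℕ) (hn : 2 ≤ n) (k : ℕ) (c : Fin k → ZMod n) :
    (zeroTSLP c).InCoRP := by
  -- The prime p' will be known only after the input has been given, but it is at most n. So a prime
  -- q > n is odd and differs from it, and C = n^(q-1) is at least p'^(q-1). With t = 0 no random
  -- factors occur and the modulus is n itself.
  obtain ⟨q, hqn, hq⟩ := Nat.exists_infinite_primes (n + 1)
  have := NeZero.mk (show n ≠ 0 by omega)
  obtain ⟨u, hu⟩ : ∃ u : ℕ → ℕ, ∀ j : Fin k, u j = (c j).val :=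
    ⟨fun j => if h : j < k then (c ⟨j, h⟩).val else 0, fun j => by simp⟩
  obtain ⟨v, hv⟩ : ∃ v : ℕ → ℕ, ∀ j, v j = 0 := ⟨fun _ => 0, fun _ => rfl⟩
  obtain ⟨p, Q, l, H⟩ := exists_zeroTest k (n ^ (q - 1)) q 0 0 n u v
    (Nat.one_le_pow _ _ (by omega)) hq.two_le (by omega)
  refine ⟨p, Q, l, fun G => ?_⟩
  obtain ⟨gs, g, r, j, L, ℓ, hg, hgv, hL, hℓ, rfl, hCL, hl, H⟩ := H G
  have hκ : ∀ j : Fin k, ((c j).val : ℤ) = u j - v j := fun j => by simp [hu, hv]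
  have hμ : ∀ β, modulus n (0 * ℓ) ℓ β = n := fun β => by rw [zero_mul]; simp [modulus]
  dsimp only [zeroTSLP]
  refine ⟨fun ρ => (H ρ).1, fun hG ρ => ?_, fun hG => ?_⟩
  · refine (H ρ).2.2 ?_
    refine gval_eq_zero_of_poly_eq_zero
      ((algebraMap (ZMod (modulus n (0 * ℓ) ℓ (bitFun ρ))) _).comp
        (ZMod.castHom (hμ _).dvd (ZMod (modulus n (0 * ℓ) ℓ (bitFun ρ))))) (fun j => ?_) _ hG
      (hgv _ _)
    conv_rhs => rw [← ZMod.natCast_zmod_val (c j), map_natCast]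
    simp [hu, hv]
  · have hP : MvPolynomial.map (Int.castRingHom (ZMod n)) (intPoly (fun j => ((c j).val : ℤ)) gs g) ≠ 0 := by
      refine map_intPoly_ne_zero _ gs g (c := c) (fun j => by simp) ?_
      rw [hgv]
      exact hG
    obtain ⟨d, P, hd, hP', hdeg, hprim⟩ := exists_eq_C_mul
      (P := intPoly (fun j => ((c j).val : ℤ)) gs g) (fun h => hP (by rw [h, map_zero]))
    have hnd : ¬ (n : ℤ) ∣ d := by
      intro h
      refine hP ?_
      rw [hP', map_mul, MvPolynomial.map_C, eq_intCast, (ZMod.intCast_zmod_eq_zero_iff_dvd _ _).2 h]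
      simp
    obtain ⟨p', hp', hpn, hdvd⟩ := exists_prime_dvd_of_not_dvd (by omega) hnd
    have h1 := card_forall_dvd_le (s := 0 * ℓ * ℓ) (l := l.eval (bitSize G.code)) (j := j) hp' hq
      (by omega) (by omega) hL
      ((Nat.mul_le_mul_right _ (Nat.pow_le_pow_left hpn _)).trans hCL) hl (hprim p' hp')
      (hdeg.trans (totalDegree_intPoly_le _ _ _))
    have h2 : ∀ ρ : Fin (l.eval (bitSize G.code)) → Bool, Accepts p G.code ρ →
        ∀ w, (p' : ℤ) ∣ (evalPoint (rootOfUnity ℤ (q ^ j)) L (0 * ℓ * ℓ) (bitFun ρ) P).coeff w := by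
      intro ρ hρ
      have h2 := (gval_eq_zero_iff hκ gs g _).1 ((H ρ).2.1 hρ)
      rw [hμ, hP'] at h2
      exact fun w => hdvd _ (by rw [← evalPoint_C_mul]; exact h2 w)
    have h3 := (Nat.mul_le_mul_left 4 (card_subtype_le h2)).trans h1
    omega

theorem coeffNorm_point_le {r : ℕ} [NeZero r] {k : ℕ} (gs : List (PreGate k)) (L s : ℕ)
    {β : ℕ → ℕ} (hβ : ∀ i, β i ≤ 1) (v : ℕ) :
    coeffNorm (point (rootOfUnity ℤ r) gs L s β v) ≤ L := by
  rw [point]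
  cases firstVar gs v with
  | none => simp [coeffNorm_zero]
  | some j =>
    simp only [Option.elim_some]
    refine (coeffNorm_sum_le _ _).trans ?_
    calc _ ≤ ∑ _l ∈ Finset.range L, (1 : ℤ) := Finset.sum_le_sum fun l _ => ?_
      _ = L := by simp
    rw [rootOfUnity_pow, AddMonoidAlgebra.natCast_def, AddMonoidAlgebra.single_mul_single, mul_one,
      coeffNorm_single]
    have := hβ (s + (j * L + l))
    simp only [Nat.abs_cast]
    exact_mod_cast this

/-- There are two sources of error, each of probability at most 1/4: the value in the integral group
ring may be zero, or it may be nonzero but divisible by the random modulus. -/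
theorem zeroTSLP_inCoRP_int (k : ℕ) (c : Fin k → ℤ) : (zeroTSLP c).InCoRP := by
  classical
  set K := ∑ j, (c j).natAbs with hK
  obtain ⟨u, hu⟩ : ∃ u : ℕ → ℕ, ∀ j : Fin k, u j = (c j).toNat :=
    ⟨fun j => if h : j < k then (c ⟨j, h⟩).toNat else 0, fun j => by simp⟩
  obtain ⟨v, hv⟩ : ∃ v : ℕ → ℕ, ∀ j : Fin k, v j = (-c j).toNat :=
    ⟨fun j => if h : j < k then (-c ⟨j, h⟩).toNat else 0, fun j => by simp⟩
  -- The order of the group is a power of q = 3 and the auxiliary prime is 2, so C = 2^(3-1) = 4.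
  -- There are 4ℓ random factors, with initial modulus 1, and K + 2 in ℓ = 2L + K + 2 allows for the
  -- size of the constants.
  obtain ⟨p, Q, l, H⟩ := exists_zeroTest k 4 3 (K + 2) 4 1 u v (by norm_num) (by norm_num) le_rfl
  refine ⟨p, Q, l, fun G => ?_⟩
  obtain ⟨gs, g, r, j, L, ℓ, hg, hgv, hL, hℓ, rfl, hCL, hl, H⟩ := H G
  have hκ : ∀ j : Fin k, c j = u j - v j := fun j => by rw [hu, hv, Int.toNat_sub_toNat_neg]
  dsimp only [zeroTSLP]
  refine ⟨fun ρ => (H ρ).1, fun hG ρ => ?_, fun hG => ?_⟩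
  · refine (H ρ).2.2 ?_
    refine gval_eq_zero_of_poly_eq_zero (Int.castRingHom _) (fun j => ?_) _ hG (hgv _ _)
    rw [eq_intCast, hκ]
    push_cast
    rfl
  · have hP : intPoly c gs g ≠ 0 := by
      have h1 := map_intPoly_ne_zero c gs g (c := c) (fun j => rfl) (by
        rw [hgv]
        exact hG)
      exact fun h => h1 (by rw [h, map_zero])
    obtain ⟨d, P, hd, hP', hdeg, hprim⟩ := exists_eq_C_mul hP
    have hl0 : 0 + 4 * ℓ * ℓ ≤ l.eval (bitSize G.code) := by omega
    have hA := card_forall_dvd_le (s := 4 * ℓ * ℓ) (l := l.eval (bitSize G.code)) (j := j)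
      Nat.prime_two Nat.prime_three (by norm_num) (by norm_num) hL hCL hl
      (hprim 2 Nat.prime_two) (hdeg.trans (totalDegree_intPoly_le _ _ _))
    have hB := four_mul_card_le (blocks_injective hl0)
      (fun ρ => evalPoint (rootOfUnity ℤ (3 ^ j)) L (4 * ℓ * ℓ) (bitFun ρ) (intPoly c gs g) ≠ 0 ∧
        ∀ w, ((modulus 1 (4 * ℓ) ℓ (bitFun ρ) : ℕ) : ℤ) ∣
          (evalPoint (rootOfUnity ℤ (3 ^ j)) L (4 * ℓ * ℓ) (bitFun ρ) (intPoly c gs g)).coeff w)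
      (fun ρ => by
        -- The point depends only on bits behind those of the modulus, so choosing the latter anew
        -- leaves the integral value unchanged.
        have hindep : ∀ s : Fin (4 * ℓ) × Fin ℓ → Bool,
            evalPoint (rootOfUnity ℤ (3 ^ j)) L (4 * ℓ * ℓ)
              (bitFun (Function.extend (blocks hl0) s ρ)) (intPoly c gs g) =
            evalPoint (rootOfUnity ℤ (3 ^ j)) L (4 * ℓ * ℓ) (bitFun ρ) (intPoly c gs g) := by
          intro s
          rw [evalPoint, evalPoint]
          congr 2
          funext i
          rw [pointVal, pointVal]
          refine Finset.sum_congr rfl fun x _ => ?_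
          rw [bitFun_extend_of_ne]
          intro a ha
          have h1 : 0 + ((a.1 : ℕ) * ℓ + a.2) < 4 * ℓ * ℓ := block_lt (by omega) a.1.2 a.2.2
          have h2 : (blocks hl0 a : ℕ) = 0 + ((a.1 : ℕ) * ℓ + a.2) := rfl
          omega
        simp only [hindep]
        by_cases h0 : evalPoint (rootOfUnity ℤ (3 ^ j)) L (4 * ℓ * ℓ) (bitFun ρ) (intPoly c gs g) = 0
        · simp [h0]
        · obtain ⟨w, hw⟩ : ∃ w, (evalPoint (rootOfUnity ℤ (3 ^ j)) L (4 * ℓ * ℓ) (bitFun ρ)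
              (intPoly c gs g)).coeff w ≠ 0 := by
            by_contra! hcon
            exact h0 (AddMonoidAlgebra.ext (DFunLike.ext _ _ hcon))
          have : NeZero (3 ^ j) := ⟨by positivity⟩
          -- T bounds the norms of the constants and of the coordinates of the point. Therefore all
          -- coefficients of the value are at most T^(2^n) in absolute value, which is less than
          -- 2^E, as T < 2^T.
          set T := L + K + 2 with hT
          set E := T * 2 ^ gs.length with hE
          have hx := (abs_coeff_le_coeffNorm _ w).trans ((gval_point (rootOfUnity ℤ (3 ^ j)) c gs g L
            (4 * ℓ * ℓ) (bitFun ρ)) ▸ coeffNorm_gval_le (T := (T : ℤ)) (by omega) (fun i => by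
              rw [coeffNorm_intCast, Int.abs_eq_natAbs]
              have h1 : (c i).natAbs ≤ K :=
                Finset.single_le_sum (f := fun j => (c j).natAbs) (fun _ _ => Nat.zero_le _)
                  (Finset.mem_univ i)
              omega) (fun v => (coeffNorm_point_le gs L _ (bitFun_le_one ρ) v).trans (by omega)) gs g)
          have hwE : (((evalPoint (rootOfUnity ℤ (3 ^ j)) L (4 * ℓ * ℓ) (bitFun ρ)
              (intPoly c gs g)).coeff w).natAbs) < 2 ^ E := by
            rw [Int.abs_eq_natAbs] at hx
            refine lt_of_le_of_lt (b := T ^ 2 ^ gs.length) (by exact_mod_cast hx) ?_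
            rw [hE, pow_mul]
            exact Nat.pow_lt_pow_left Nat.lt_two_pow_self (by positivity)
          -- Here T ≤ 2^(L+K+1) and n = L - 2 give E ≤ 2^(2L+K-1), and ℓ exceeds this exponent by 3.
          have hEℓ : 2 * (E + ℓ + 1) ≤ 2 ^ ℓ := by
            have h1 : T ≤ 2 ^ (L + K + 1) := by
              have : L + K + 1 < 2 ^ (L + K + 1) := Nat.lt_two_pow_self
              omega
            have h2 : E ≤ 2 ^ (2 * L + K - 1) := by
              calc E ≤ 2 ^ (L + K + 1) * 2 ^ gs.length := Nat.mul_le_mul_right _ h1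
                _ = 2 ^ (2 * L + K - 1) := by
                  rw [← pow_add]
                  congr 1
                  omega
            obtain ⟨y, hy⟩ : ∃ y, 2 * L + K = y + 1 := ⟨2 * L + K - 1, by omega⟩
            have h3 : y < 2 ^ y := Nat.lt_two_pow_self
            rw [hy, Nat.add_sub_cancel] at h2
            rw [show ℓ = y + 1 + 2 by omega, pow_add, pow_succ]
            omega
          refine (Nat.mul_le_mul_left 4 (Nat.card_le_card_of_injective
            (Subtype.map id fun s hs => hs.2 w)
            (Subtype.map_injective _ Function.injective_id))).trans
            (card_modulus_dvd_le hw hwE (by omega) hEℓ hl0 ρ))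
    -- If the value of the integer polynomial is zero, so is that of P₀, since d ≠ 0; then 2 divides
    -- all its coefficients, an event already bounded by `hA`. Otherwise acceptance means that the
    -- modulus divides a nonzero value, which `hB` bounds.
    have hacc : ∀ ρ : Fin (l.eval (bitSize G.code)) → Bool, Accepts p G.code ρ →
        (∀ w, ((2 : ℕ) : ℤ) ∣ (evalPoint (rootOfUnity ℤ (3 ^ j)) L (4 * ℓ * ℓ) (bitFun ρ)
          P).coeff w) ∨ (evalPoint (rootOfUnity ℤ (3 ^ j)) L (4 * ℓ * ℓ) (bitFun ρ)
            (intPoly c gs g) ≠ 0 ∧ ∀ w, ((modulus 1 (4 * ℓ) ℓ (bitFun ρ) : ℕ) : ℤ) ∣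
          (evalPoint (rootOfUnity ℤ (3 ^ j)) L (4 * ℓ * ℓ) (bitFun ρ)
            (intPoly c gs g)).coeff w) := by
      intro ρ hρ
      have h2 := (gval_eq_zero_iff hκ gs g _).1 ((H ρ).2.1 hρ)
      by_cases h0 : evalPoint (rootOfUnity ℤ (3 ^ j)) L (4 * ℓ * ℓ) (bitFun ρ) (intPoly c gs g) = 0
      · refine Or.inl fun w => ?_
        have h3 := evalPoint_C_mul (r := 3 ^ j) (L := L) (s := 4 * ℓ * ℓ) (bitFun ρ) d P w
        rw [← hP', h0] at h3
        rcases mul_eq_zero.1 (h3.symm.trans rfl) with h | h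
        · exact absurd h hd
        · rw [h]
          exact dvd_zero _
      · exact Or.inr ⟨h0, h2⟩
    have hor := (card_subtype_le hacc).trans (card_or_le _ _)
    omega

end Arith

theorem mainTheorem10 :
    (∀ (S : Type*) [Semiring S] (k : ℕ) (c : Fin k → S),
      (Arith.ncZeroTSLP c).Equivalent (Arith.ncPIT c)) ∧
    (∀ (S : Type*) [CommSemiring S] (k : ℕ) (c : Fin k → S),
      (Arith.zeroTSLP c).Equivalent (Arith.PIT c)) ∧
    (∀ (k : ℕ) (c : Fin k → ℤ), (Arith.zeroTSLP c).InCoRP) ∧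
    (∀ (n : ℕ), 2 ≤ n → ∀ (k : ℕ) (c : Fin k → ZMod n), (Arith.zeroTSLP c).InCoRP) := by
  refine ⟨fun S _ k c => ⟨Arith.ncZeroTSLP_reduces c, Arith.ncPIT_reduces c⟩,
    fun S _ k c => ⟨Arith.zeroTSLP_reduces c, Arith.PIT_reduces c⟩,
    Arith.zeroTSLP_inCoRP_int, Arith.zeroTSLP_inCoRP_zmod⟩
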